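/- Identify the vertices of the vertex-centred Kreweras lattice with the points $a+b\,e^{2\pi i/3}\in\mathbb{C}$, $a,b\in\mathbb{Z}$, where from each vertex $z$ there are directed edges to $z+1$, $z+e^{2\pi i/3}$ and $z+e^{4\pi i/3}$. Let $w_0,w_1,w_2$ be the three vertices from which there is an edge pointing to the origin $0$ (in any order). Walks follow directed edges and never visit $0$. The winding angle of a walk is the total anticlockwise angle by which the direction of a point moving continuously along the walk, seen from $0$, turns. Let $$\tilde E(t,s)=\sum_{n\ge 0}t^n\sum_{k\in\mathbb{Z}}p_{n,k}\,s^k,$$ where $p_{n,k}$ is the number of walks of length $n$ that start at $w_0$, end at one of $w_0,w_1,w_2$ and have winding angle $\frac{2\pi k}{3}$ (for each $n$, only finitely many $p_{n,k}$ are nonzero). Let $\alpha\in(0,\pi)\setminus\left\{\frac{2\pi}{3}\right\}$ and $s=e^{i\alpha}$. Then the coefficients $v_n=[t^n]\tilde E(t,s)$ satisfy $$v_n\sim-\frac{3^{5-\frac{3\alpha}{\pi}}\,e^{\alpha i}\,\alpha}{2\pi\,(1+e^{\alpha i}+e^{2\alpha i})\,\Gamma\!\left(-\frac{3\alpha}{2\pi}\right)}\,n^{-\frac{3\alpha}{2\pi}-1}\,3^{n}$$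 as $n\to\infty$ through the multiples of $3$, and $v_n=0$ whenever $3\nmid n$. -/

import Mathlib

namespace KrewerasWinding

/-- The three steps of the Kreweras lattice, in the coordinates `(a, b)` of the point
`a + b e^{2πi/3}` of the plane: they are `1`, `e^{2πi/3}` and `e^{4πi/3} = -1 - e^{2πi/3}`. -/
def steps : Finset (ℤ × ℤ) := {(1, 0), (0, 1), (-1, -1)}

/-- The point of the plane represented by the lattice vertex `(a, b)`, that is,
`a + b e^{2πi/3}`. -/
noncomputable def toPlane (v : ℤ × ℤ) : ℂ :=
  v.1 + v.2 * Complex.exp (2 * Real.pi * Complex.I / 3)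

/-- The vertices from which there is an edge pointing to the origin. -/
def nearOrigin : Set (ℤ × ℤ) := {v | ∃ d ∈ steps, v + d = 0}

/-- `w` lists the successive vertices of a walk of length `n` on the vertex-centred Kreweras
lattice; such a walk never visits the origin. -/
def IsWalk {n : ℕ} (w : Fin (n + 1) → ℤ × ℤ) : Prop :=
  (∀ i : Fin n, w i.succ - w i.castSucc ∈ steps) ∧ ∀ i : Fin (n + 1), w i ≠ 0

/-- The winding angle around the origin: the sum over the edges of the walk of the anticlockwise
angle swept. An edge is a straight segment that avoids the origin, so this angle lies
in `(-π, π)` and is the principal argument of the quotient of its endpoints. -/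
noncomputable def windingAngle {n : ℕ} (w : Fin (n + 1) → ℤ × ℤ) : ℝ :=
  ∑ i : Fin n, Complex.arg (toPlane (w i.succ) / toPlane (w i.castSucc))

/-- The walks of length `n` that start at `w₀` and end at one of the vertices from which there is
an edge pointing to the origin. -/
def walks (w₀ : ℤ × ℤ) (n : ℕ) : Set (Fin (n + 1) → ℤ × ℤ) :=
  {w | IsWalk w ∧ w 0 = w₀ ∧ w (Fin.last n) ∈ nearOrigin}

/-- The number of these walks with winding angle `2πk/3`. -/
noncomputable def walkCount (w₀ : ℤ × ℤ) (n : ℕ) (k : ℤ) : ℕ :=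
  {w ∈ walks w₀ n | windingAngle w = 2 * Real.pi * k / 3}.ncard

/-- The generating function, a power series in `t`, at a fixed complex value of `s`: a walk of
length `n` and winding angle `2πk/3` contributes `t ^ n * s ^ k`. -/
noncomputable def genFun (w₀ : ℤ × ℤ) (s : ℂ) : PowerSeries ℂ :=
  PowerSeries.mk fun n => ∑ᶠ k : ℤ, (walkCount w₀ n k : ℂ) * s ^ k

/-- There are finitely many walks of each length, so `walkCount` is a true count. -/
theorem walks_finite (w₀ : ℤ × ℤ) (n : ℕ) : (walks w₀ n).Finite := by
  have hfin : (Set.univ.pi fun _ : Fin n => (steps : Set (ℤ × ℤ))).Finite :=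
    Set.Finite.pi fun _ => steps.finite_toSet
  refine hfin.of_injOn (f := fun w i => w i.succ - w i.castSucc) ?_ ?_
  · intro w hw i _
    exact hw.1.1 i
  · intro w hw w' hw' h
    funext i
    induction i using Fin.induction with
    | zero => rw [hw.2.1, hw'.2.1]
    | succ i ih =>
      have h1 := congrFun h i
      simp only [ih] at h1
      exact sub_left_injective h1

/-- Finitely many `k` occur, so that the sum over `k` in `genFun` is a finite sum. -/
theorem walkCount_support_finite (w₀ : ℤ × ℤ) (n : ℕ) :
    (Function.support (walkCount w₀ n)).Finite := by
  have h := ((walks_finite w₀ n).image windingAngle).preimage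
    (f := fun k : ℤ => 2 * Real.pi * k / 3) (by
      intro a _ b _ hab
      have hpi := Real.pi_ne_zero
      field_simp at hab
      exact_mod_cast hab)
  refine h.subset ?_
  intro k hk
  obtain ⟨w, hw, hwk⟩ := Set.nonempty_of_ncard_ne_zero (Function.mem_support.1 hk)
  exact ⟨w, hw, hwk⟩

end KrewerasWinding

/-!
The rotations `rot` by `2π/3` cut the plane into three sectors, and every vertex is a rotation of
exactly one vertex of the sector `a ≥ 1`, `b ≥ 0`. If the walks ending at a rotation of a vertex `(a, b)`
of this sector are counted together, each with the power of `s` that records how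
often it crosses from one sector to the next, then the last step of a walk gives a linear recursion
in the sector, whose coefficients on the two sides carry `s` and `s⁻¹` (`coef`, `coef_succ`). The
coefficient of `tⁿ` to be estimated is the value at `(1, 1)` (`coeff_genFun`), and it vanishes for
`3 ∤ n` because a step changes `a + b` by `1` modulo `3` (`coef_eq_zero`). For small `t` the recursion
has only one solution of geometric growth (`hasSum_coef`), so any such solution will do.

A solution is a contour integral. Let `ξ = κ (℘ - ℘(τ))` for the lattice `ℤ + 3τℤ`. The three
functions `ξ(z)`, `ξ(z + τ)`, `ξ(z - τ)` have constant product, normalised to `1` by the choice of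
`κ`, and by Liouville's theorem the sum of the products of two of them is a constant too, called
`1/t` (`dfun_prod`, `dfun_pairs`). So `ξ(z)ᵃ ξ(z + τ)ᵇ` satisfies the recursion inside the sector.
The integral of `f(z) ξ(z)ᵃ ξ(z + τ)ᵇ` over the difference of two horizontal periods satisfies the
conditions at the sides as well, and the initial condition, if `f` has period `1` and
`f(z) - s⁻¹ f(z + τ) = -ξ(z - τ)` (`Uniformizes`, `sol_recursion`). Such an `f` is a Laurent series in
`e^{2πiz}` (`laurent_shift`). The value at `(1, 1)` only involves `f(0)`, and the outcome is a
parametrization by `τ`: with `p = e^{2πiτ}` and Lambert series `eis3`, `eis4` of weights `3` and `4`,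

  `t³ = eis3⁴ / eis4³`,  `∑ₘ v₃ₘ t³ᵐ = s/(1 + s + s²) · eis4/eis3² · (sig s - sig e^{2πi/3})`

(`exists_hasSum_coef`). This is proved for `Im τ` large, that is, for small `t`.

The asymptotic behaviour is governed by the other cusp, at which `1/t³ = 27`. By Cauchy's formula in
the variable `gam = 1/t³`, the coefficients are integrals over a horizontal period in the upper half
plane (`coef_eq_mean`). The height is arbitrary because `eis3` has no zeros, and at the height `√3/6`
the map `τ ↦ -1/(3τ)` exchanges the end points of the period from `-1/2 + √3/6 i` to
`1/2 + √3/6 i` (`mean_eq_neg_integral`). In the variable `σ = -1/(3τ)` the sums `eis3` and `eis4` are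
series in `q = e^{2πiσ}` (`gam_transform`, `quotient_transform`), whereas `sig s`, for `s = e^{2πia}`,
becomes the series `psi`, which contains the non-integral powers `q^{3(n + a)}` (`sig_transform`).
This law comes from the lattice sum `∑ₖ ∑ⱼ e^{2πika} / (kτ + j)²`, summed in the other order and
evaluated row by row through Poisson summation.

Finally the segment is replaced by the two half lines `Re σ = ±1/2` above its end points. On these
`q = -x` takes the same real values, and everything cancels except the difference of the values of
`psi`, which is of the order `x^{3a}` as `x → 0` (`integral_integrand_eq`,
`exists_norm_psiJump_sub_le`). Hence the coefficients are integrals over `0 < x < e^{-π/√3} < 1/6` of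
an amplitude of the order `x^{3a}` against the powers of `cgam(-x)`, a function that takes the value
`27` at `0` and has absolute value at most `27 e^{-3x}` in between (`norm_cgam_le`). Watson's lemma
(`tendsto_laplace`) gives the order `27ᵐ m^{-3a - 1}`, with a constant that the reflection formula for
the Gamma function turns into the stated one (`tendsto_coef`).
-/

namespace KrewerasWinding

open Complex Filter Topology

/-! ### Winding angles and the last step of a walk -/

/-- Rotation of the lattice by `2π/3` around the origin. -/
def rot (v : ℤ × ℤ) : ℤ × ℤ := (-v.2, v.1 - v.2)

theorem rot_rot_rot (v : ℤ × ℤ) : rot (rot (rot v)) = v := by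
  ext
  · simp [rot]
  · simp only [rot]; ring

theorem rot_sub (v w : ℤ × ℤ) : rot (v - w) = rot v - rot w := by
  ext <;> simp [rot] <;> ring

theorem rot_eq_zero {v : ℤ × ℤ} : rot v = 0 ↔ v = 0 := by
  simp only [rot, Prod.ext_iff, Prod.fst_zero, Prod.snd_zero]; omega

theorem exp_two_pi_div_three :
    exp (2 * Real.pi * I / 3) = -1 / 2 + (Real.sqrt 3 / 2 : ℝ) * I := by
  have h : (2 * Real.pi * I / 3 : ℂ) = ((Real.pi - Real.pi / 3 : ℝ) : ℂ) * I := by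
    push_cast; ring
  rw [h, exp_mul_I, ← ofReal_cos, ← ofReal_sin, Real.cos_pi_sub, Real.sin_pi_sub,
    Real.cos_pi_div_three, Real.sin_pi_div_three]
  push_cast; ring

theorem exp_two_pi_div_three_sq : exp (2 * Real.pi * I / 3) ^ 2 =
    -1 - exp (2 * Real.pi * I / 3) := by
  rw [exp_two_pi_div_three]
  have h3 : ((Real.sqrt 3 : ℝ) : ℂ) ^ 2 = 3 := by
    rw [← ofReal_pow, Real.sq_sqrt (by norm_num)]; norm_num
  push_cast
  linear_combination (1 / 4 : ℂ) * I ^ 2 * h3 + (3 / 4) * I_sq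

theorem toPlane_rot (v : ℤ × ℤ) :
    toPlane (rot v) = exp (2 * Real.pi * I / 3) * toPlane v := by
  simp only [toPlane, rot]
  push_cast
  linear_combination -(v.2 : ℂ) * exp_two_pi_div_three_sq

theorem toPlane_re (v : ℤ × ℤ) : (toPlane v).re = v.1 - v.2 / 2 := by
  simp [toPlane, exp_two_pi_div_three]; ring

theorem toPlane_im (v : ℤ × ℤ) : (toPlane v).im = v.2 * (Real.sqrt 3 / 2) := by
  simp [toPlane, exp_two_pi_div_three]

theorem toPlane_ne_zero {v : ℤ × ℤ} (hv : v ≠ 0) : toPlane v ≠ 0 := by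
  intro h
  have h1 := toPlane_im v
  have h2 := toPlane_re v
  rw [h] at h1 h2
  have h3 : Real.sqrt 3 ≠ 0 := by positivity
  have h4 : (v.2 : ℝ) = 0 := by
    simp only [zero_im] at h1
    rcases mul_eq_zero.1 h1.symm with h | h
    · exact h
    · exact absurd h (by positivity)
  have h5 : (v.1 : ℝ) = 0 := by simp only [zero_re, h4] at h2; linarith
  exact hv (Prod.ext (by exact_mod_cast h5) (by exact_mod_cast h4))

/-- The argument of the quotient of two points with prescribed (lifted) polar angles. -/
theorem arg_div_of_polar {x y : ℂ} {r r' θ θ' : ℝ} (hr : 0 < r) (hr' : 0 < r')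
    (hx : x = r * exp (θ * I)) (hy : y = r' * exp (θ' * I))
    (h : θ - θ' ∈ Set.Ioc (-Real.pi) Real.pi) : arg (x / y) = θ - θ' := by
  have : x / y = ((r / r' : ℝ) : ℂ) * exp (((θ - θ' : ℝ) : ℂ) * I) := by
    rw [hx, hy]; push_cast
    rw [sub_mul, exp_sub]
    field_simp
  rw [this, arg_real_mul _ (by positivity), exp_mul_I]
  exact arg_cos_add_sin_mul_I h

theorem toPlane_polar (v : ℤ × ℤ) :
    toPlane v = (‖toPlane v‖ : ℝ) * exp ((arg (toPlane v) : ℝ) * I) :=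
  (norm_mul_exp_arg_mul_I _).symm

/-- The vertices of the fundamental sector have polar angle in `[0, 2π/3)`. -/
theorem arg_sector {v : ℤ × ℤ} (ha : 1 ≤ v.1) (hb : 0 ≤ v.2) :
    arg (toPlane v) ∈ Set.Ico 0 (2 * Real.pi / 3) := by
  have him : 0 ≤ (toPlane v).im := by
    rw [toPlane_im]
    have : (0 : ℝ) ≤ v.2 := by exact_mod_cast hb
    positivity
  have h0 : 0 ≤ arg (toPlane v) := arg_nonneg_iff.2 him
  refine ⟨h0, ?_⟩
  by_contra hcon
  push Not at hcon
  -- rotating by `-2π/3` would give a point in the closed upper half plane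
  have hne : v ≠ 0 := by rintro rfl; simp at ha
  have hpi := Real.pi_pos
  have hle := arg_le_pi (toPlane v)
  have hp := toPlane_polar v
  set r := ‖toPlane v‖
  have hr : 0 < r := norm_pos_iff.2 (toPlane_ne_zero hne)
  have h1 : toPlane (rot (rot v)) = r * exp (((arg (toPlane v) - 2 * Real.pi / 3 : ℝ) : ℂ) * I) :=
      by
    rw [toPlane_rot, toPlane_rot]
    conv_lhs => rw [hp]
    have : exp (((arg (toPlane v) - 2 * Real.pi / 3 : ℝ) : ℂ) * I) =
        exp (2 * Real.pi * I / 3) * exp (2 * Real.pi * I / 3) * exp (arg (toPlane v) * I) := by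
      rw [← exp_add, ← exp_add, exp_eq_exp_iff_exists_int]
      refine ⟨-1, ?_⟩
      push_cast; ring
    rw [this]; ring
  have h2 : (toPlane (rot (rot v))).im = r * Real.sin (arg (toPlane v) - 2 * Real.pi / 3) := by
    rw [h1, im_ofReal_mul, exp_ofReal_mul_I_im]
  have h3 : 0 ≤ Real.sin (arg (toPlane v) - 2 * Real.pi / 3) :=
    Real.sin_nonneg_of_nonneg_of_le_pi (by linarith) (by linarith)
  rw [toPlane_im] at h2
  have h4 : ((rot (rot v)).2 : ℝ) < 0 := by
    have : (rot (rot v)).2 < 0 := by simp [rot]; omega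
    exact_mod_cast this
  have h5 : 0 < Real.sqrt 3 := by positivity
  nlinarith [mul_nonneg hr.le h3, mul_pos h5 (neg_pos.2 h4)]

/-- All walks of length `n` from `w₀`. -/
noncomputable def allWalks (w₀ : ℤ × ℤ) (n : ℕ) : Finset (Fin (n + 1) → ℤ × ℤ) :=
  Set.Finite.toFinset (s := {w | IsWalk w ∧ w 0 = w₀}) (by
    have hfin : (Set.univ.pi fun _ : Fin n => (steps : Set (ℤ × ℤ))).Finite :=
      Set.Finite.pi fun _ => steps.finite_toSet
    refine hfin.of_injOn (f := fun w i => w i.succ - w i.castSucc) ?_ ?_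
    · intro w hw i _
      exact hw.1.1 i
    · intro w hw w' hw' h
      funext i
      induction i using Fin.induction with
      | zero => rw [hw.2, hw'.2]
      | succ i ih =>
        have h1 := congrFun h i
        simp only [ih] at h1
        exact sub_left_injective h1)

theorem mem_allWalks {w₀ : ℤ × ℤ} {n : ℕ} {w : Fin (n + 1) → ℤ × ℤ} :
    w ∈ allWalks w₀ n ↔ IsWalk w ∧ w 0 = w₀ := by
  simp [allWalks]

theorem isWalk_snoc {n : ℕ} {w : Fin (n + 1) → ℤ × ℤ} {z : ℤ × ℤ} :
    IsWalk (Fin.snoc w z : Fin (n + 2) → ℤ × ℤ) ↔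
      IsWalk w ∧ z - w (Fin.last n) ∈ steps ∧ z ≠ 0 := by
  unfold IsWalk
  rw [Fin.forall_fin_succ', Fin.forall_fin_succ' (P := fun i : Fin (n + 2) => _ ≠ _)]
  have h1 : ∀ i : Fin n, (Fin.snoc w z : Fin (n + 2) → ℤ × ℤ) i.castSucc.succ = w i.succ := by
    intro i
    rw [← Fin.castSucc_succ]
    exact Fin.snoc_castSucc (α := fun _ => ℤ × ℤ) z w i.succ
  have h2 : ∀ i : Fin (n + 1), (Fin.snoc w z : Fin (n + 2) → ℤ × ℤ) i.castSucc = w i := fun i =>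
    Fin.snoc_castSucc (α := fun _ => ℤ × ℤ) z w i
  have h3 : (Fin.snoc w z : Fin (n + 2) → ℤ × ℤ) (Fin.last (n + 1)) = z :=
    Fin.snoc_last (α := fun _ => ℤ × ℤ) z w
  simp only [h1, h2, h3, Fin.succ_last]
  tauto

theorem windingAngle_snoc {n : ℕ} (w : Fin (n + 1) → ℤ × ℤ) (z : ℤ × ℤ) :
    windingAngle (Fin.snoc w z : Fin (n + 2) → ℤ × ℤ) =
      windingAngle w + arg (toPlane z / toPlane (w (Fin.last n))) := by
  unfold windingAngle
  rw [Fin.sum_univ_castSucc]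
  have h1 : ∀ i : Fin n, (Fin.snoc w z : Fin (n + 2) → ℤ × ℤ) i.castSucc.succ = w i.succ := by
    intro i
    rw [← Fin.castSucc_succ]
    exact Fin.snoc_castSucc (α := fun _ => ℤ × ℤ) z w i.succ
  have h2 : ∀ i : Fin (n + 1), (Fin.snoc w z : Fin (n + 2) → ℤ × ℤ) i.castSucc = w i := fun i =>
    Fin.snoc_castSucc (α := fun _ => ℤ × ℤ) z w i
  have h3 : (Fin.snoc w z : Fin (n + 2) → ℤ × ℤ) (Fin.last (n + 1)) = z :=
    Fin.snoc_last (α := fun _ => ℤ × ℤ) z w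
  simp only [h1, h2, h3, Fin.succ_last]

/-- A walk of length `n + 1` is a walk of length `n` followed by a step that avoids the origin. -/
theorem sum_allWalks_succ (w₀ : ℤ × ℤ) (n : ℕ) (F : (Fin (n + 2) → ℤ × ℤ) → ℂ) :
    ∑ w ∈ allWalks w₀ (n + 1), F w = ∑ d ∈ steps, ∑ w ∈ allWalks w₀ n,
      if w (Fin.last n) + d ≠ 0 then F (Fin.snoc w (w (Fin.last n) + d)) else 0 := by
  rw [Finset.sum_sigma', ← Finset.sum_filter]
  symm
  refine Finset.sum_bij' (fun x _ => (Fin.snoc x.2 (x.2 (Fin.last n) + x.1) : Fin (n + 2) → ℤ × ℤ))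
    (fun w _ => ⟨w (Fin.last (n + 1)) - w (Fin.last n).castSucc, Fin.init w⟩) ?_ ?_ ?_ ?_ ?_
  · rintro ⟨d, w⟩ h
    simp only [Finset.mem_filter, Finset.mem_sigma, mem_allWalks] at h
    rw [mem_allWalks, isWalk_snoc]
    refine ⟨⟨h.1.2.1, by simpa using h.1.1, h.2⟩, ?_⟩
    have := Fin.snoc_castSucc (α := fun _ => ℤ × ℤ) (w (Fin.last n) + d) w 0
    rw [← h.1.2.2, ← this]; rfl
  · intro w h
    rw [mem_allWalks] at h
    have hw : w = (Fin.snoc (Fin.init w) (w (Fin.last (n + 1))) : Fin (n + 2) → ℤ × ℤ) :=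
      (Fin.snoc_init_self (α := fun _ => ℤ × ℤ) w).symm
    have h' := h.1
    rw [hw, isWalk_snoc] at h'
    simp only [Finset.mem_filter, Finset.mem_sigma, mem_allWalks]
    refine ⟨⟨h'.2.1, h'.1, h.2⟩, ?_⟩
    have : Fin.init w (Fin.last n) + (w (Fin.last (n + 1)) - w (Fin.last n).castSucc) =
      w (Fin.last (n + 1)) := by
      simp [Fin.init]
    rw [this]; exact h'.2.2
  · rintro ⟨d, w⟩ h
    have h3 : (Fin.snoc w (w (Fin.last n) + d) : Fin (n + 2) → ℤ × ℤ) (Fin.last (n + 1)) = _ :=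
      Fin.snoc_last (α := fun _ => ℤ × ℤ) _ w
    have h2 : (Fin.snoc w (w (Fin.last n) + d) : Fin (n + 2) → ℤ × ℤ) (Fin.last n).castSucc = _ :=
      Fin.snoc_castSucc (α := fun _ => ℤ × ℤ) _ w (Fin.last n)
    simp [h3, h2, Fin.init_snoc]
  · intro w h
    have hw : w = (Fin.snoc (Fin.init w) (w (Fin.last (n + 1))) : Fin (n + 2) → ℤ × ℤ) :=
      (Fin.snoc_init_self (α := fun _ => ℤ × ℤ) w).symm
    conv_rhs => rw [hw]
    simp [Fin.init]
  · intro x _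
    rfl

/-- The walks of length `n` from `w₀` to `z`, counted with the weight `e ^ (iβθ)`, where `θ` is
the winding angle. -/
noncomputable def weight (w₀ : ℤ × ℤ) (β : ℝ) (n : ℕ) (z : ℤ × ℤ) : ℂ :=
  ∑ w ∈ allWalks w₀ n, if w (Fin.last n) = z then exp ((β * windingAngle w : ℝ) * I) else 0

theorem weight_zero_right (w₀ : ℤ × ℤ) (β : ℝ) (n : ℕ) : weight w₀ β n 0 = 0 := by
  refine Finset.sum_eq_zero fun w hw => if_neg ?_
  exact (mem_allWalks.1 hw).1.2 _

theorem weight_zero_left {w₀ : ℤ × ℤ} (h : w₀ ≠ 0) (β : ℝ) (z : ℤ × ℤ) :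
    weight w₀ β 0 z = if z = w₀ then 1 else 0 := by
  have : allWalks w₀ 0 = {fun _ => w₀} := by
    ext w
    rw [mem_allWalks, Finset.mem_singleton]
    constructor
    · rintro ⟨-, h⟩
      funext i
      have hi : i = 0 := Fin.ext (by omega)
      rw [hi, h]
    · rintro rfl
      exact ⟨⟨fun i => i.elim0, fun _ => h⟩, rfl⟩
  rw [weight, this, Finset.sum_singleton]
  simp [windingAngle, eq_comm]

/-- The recursion of the weights over the last step. -/
theorem weight_succ (w₀ : ℤ × ℤ) (β : ℝ) (n : ℕ) {z : ℤ × ℤ} (hz : z ≠ 0) :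
    weight w₀ β (n + 1) z = ∑ d ∈ steps,
      weight w₀ β n (z - d) * exp ((β * arg (toPlane z / toPlane (z - d)) : ℝ) * I) := by
  unfold weight
  rw [sum_allWalks_succ]
  refine Finset.sum_congr rfl fun d _ => ?_
  rw [Finset.sum_mul]
  refine Finset.sum_congr rfl fun w _ => ?_
  have h3 : (Fin.snoc w (w (Fin.last n) + d) : Fin (n + 2) → ℤ × ℤ) (Fin.last (n + 1)) = _ :=
    Fin.snoc_last (α := fun _ => ℤ × ℤ) _ w
  rw [h3, windingAngle_snoc]
  by_cases h : w (Fin.last n) = z - d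
  · have h' : w (Fin.last n) + d = z := by rw [h]; simp
    rw [if_pos (by rw [h']; exact hz), if_pos h', if_pos h, h', h, ← exp_add]
    congr 1; push_cast; ring
  · have h' : ¬ w (Fin.last n) + d = z := fun h' => h (by rw [← h']; simp)
    rw [if_neg h', if_neg h]; simp

/-- `weight`, summed over the three rotations of the endpoint. -/
noncomputable def symWeight (w₀ : ℤ × ℤ) (β : ℝ) (n : ℕ) (z : ℤ × ℤ) : ℂ :=
  weight w₀ β n z + weight w₀ β n (rot z) + weight w₀ β n (rot (rot z))

theorem symWeight_rot (w₀ : ℤ × ℤ) (β : ℝ) (n : ℕ) (z : ℤ × ℤ) :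
    symWeight w₀ β n (rot z) = symWeight w₀ β n z := by
  simp only [symWeight, rot_rot_rot]; ring

theorem sum_steps (F : ℤ × ℤ → ℂ) : ∑ d ∈ steps, F d = F (1, 0) + F (0, 1) + F (-1, -1) := by
  simp [steps, add_assoc]

/-- The recursion over the last step is compatible with rotations, since these permute the three
steps and preserve the angles swept. -/
theorem symWeight_succ (w₀ : ℤ × ℤ) (β : ℝ) (n : ℕ) {z : ℤ × ℤ} (hz : z ≠ 0) :
    symWeight w₀ β (n + 1) z = ∑ d ∈ steps,
      symWeight w₀ β n (z - d) * exp ((β * arg (toPlane z / toPlane (z - d)) : ℝ) * I) := by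
  have key : ∀ u d : ℤ × ℤ, toPlane (rot u) / toPlane (rot d) = toPlane u / toPlane d := by
    intro u d
    rw [toPlane_rot, toPlane_rot, mul_div_mul_left _ _ (exp_ne_zero _)]
  have h1 : rot (z - (1, 0)) = rot z - (0, 1) := by rw [rot_sub]; rfl
  have h2 : rot (z - (0, 1)) = rot z - (-1, -1) := by rw [rot_sub]; rfl
  have h3 : rot (z - (-1, -1)) = rot z - (1, 0) := by rw [rot_sub]; rfl
  have h4 : rot (rot z - (1, 0)) = rot (rot z) - (0, 1) := by rw [rot_sub]; rfl
  have h5 : rot (rot z - (0, 1)) = rot (rot z) - (-1, -1) := by rw [rot_sub]; rfl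
  have h6 : rot (rot z - (-1, -1)) = rot (rot z) - (1, 0) := by rw [rot_sub]; rfl
  have hz1 : rot z ≠ 0 := by rwa [Ne, rot_eq_zero]
  have hz2 : rot (rot z) ≠ 0 := by rwa [Ne, rot_eq_zero]
  simp only [symWeight, weight_succ _ _ _ hz, weight_succ _ _ _ hz1, weight_succ _ _ _ hz2,
    sum_steps]
  have k1 := key z (z - (1, 0))
  have k2 := key z (z - (0, 1))
  have k3 := key z (z - (-1, -1))
  have k4 := key (rot z) (rot z - (1, 0))
  have k5 := key (rot z) (rot z - (0, 1))
  have k6 := key (rot z) (rot z - (-1, -1))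
  rw [h1] at k1; rw [h2] at k2; rw [h3] at k3; rw [h4] at k4; rw [h5] at k5; rw [h6] at k6
  rw [h1, h2, h3, h4, h5, h6, k4, k5, k6, k1, k2, k3]
  ring

/-! ### Coefficients in a fundamental sector -/

section

theorem mem_nearOrigin {v : ℤ × ℤ} :
    v ∈ nearOrigin ↔ v = (1, 1) ∨ v = rot (1, 1) ∨ v = rot (rot (1, 1)) := by
  obtain ⟨x, y⟩ := v
  have h : (x, y) ∈ nearOrigin ↔ ∃ d ∈ steps, (x, y) + d = 0 := Iff.rfl
  have h2 : rot (1, 1) = (-1, 0) := rfl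
  have h3 : rot (-1, 0) = (0, -1) := rfl
  rw [h, h2, h3]
  simp only [steps, Finset.mem_insert, Finset.mem_singleton, exists_eq_or_imp, exists_eq_left,
    Prod.mk_add_mk, Prod.mk_eq_zero, Prod.mk.injEq]
  omega

/-- The generating-function coefficients of walks that end at a rotation of the vertex `z` of the
fundamental sector: the weight `e ^ (iβθ)` is normalised by the polar angles of `z` and of the
starting point, so that it is the power of `s = e ^ (2πiβ/3)` counting crossings of sectors. -/
noncomputable def coef (w₀ : ℤ × ℤ) (β : ℝ) (n : ℕ) (a b : ℤ) : ℂ :=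
  symWeight w₀ β n (a, b) *
    exp ((-β * (arg (toPlane (a, b)) - arg (toPlane (1, 1))) : ℝ) * I)

section coef
variable {w₀ : ℤ × ℤ} {β : ℝ}

theorem nearOrigin_ne_zero (h : w₀ ∈ nearOrigin) : w₀ ≠ 0 := by
  rintro rfl
  obtain ⟨d, hd, h⟩ := h
  rw [zero_add] at h
  subst h
  revert hd
  decide

theorem coef_zero (h : w₀ ∈ nearOrigin) {a b : ℤ} (ha : 1 ≤ a) (hb : 0 ≤ b) :
    coef w₀ β 0 a b = if a = 1 ∧ b = 1 then 1 else 0 := by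
  have h0 := nearOrigin_ne_zero h
  unfold coef symWeight
  rw [weight_zero_left h0, weight_zero_left h0, weight_zero_left h0]
  have h2 : rot (1, 1) = (-1, 0) := rfl
  have h3 : rot (-1, 0) = (0, -1) := rfl
  rw [mem_nearOrigin, h2, h3] at h
  have e1 : ((a, b) : ℤ × ℤ) = w₀ ↔ a = 1 ∧ b = 1 ∧ w₀ = (1, 1) := by
    rcases h with rfl | rfl | rfl <;> simp <;> omega
  have e2 : rot (a, b) = w₀ ↔ a = 1 ∧ b = 1 ∧ w₀ = (-1, 0) := by
    rcases h with rfl | rfl | rfl <;> simp [rot] <;> omega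
  have e3 : rot (rot (a, b)) = w₀ ↔ a = 1 ∧ b = 1 ∧ w₀ = (0, -1) := by
    rcases h with rfl | rfl | rfl <;> simp [rot] <;> omega
  simp only [e1, e2, e3]
  by_cases hab : a = 1 ∧ b = 1
  · obtain ⟨rfl, rfl⟩ := hab
    rcases h with rfl | rfl | rfl <;> simp
  · rw [if_neg (by tauto), if_neg (by tauto), if_neg (by tauto), if_neg hab]; simp

/-- The transfer of weights along an edge between two vertices, from the vertex `rot^i u` to the
vertex `z`, where the lifted polar angle of the former is that of `u` plus `δ`. -/
theorem coef_step_aux {n : ℕ} {z z' u : ℤ × ℤ} {δ : ℝ} (hz : 1 ≤ z.1 ∧ 0 ≤ z.2)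
    (hu : 1 ≤ u.1 ∧ 0 ≤ u.2)
    (hz' : toPlane z' = exp (δ * I) * toPlane u)
    (hs : symWeight w₀ β n z' = symWeight w₀ β n u)
    (hδ : arg (toPlane z) - (arg (toPlane u) + δ) ∈ Set.Ioc (-Real.pi) Real.pi) :
    symWeight w₀ β n z' * exp ((β * arg (toPlane z / toPlane z') : ℝ) * I) *
      exp ((-β * (arg (toPlane z) - arg (toPlane (1, 1))) : ℝ) * I) =
    exp ((-β * δ : ℝ) * I) * coef w₀ β n u.1 u.2 := by
  have hz0 : z ≠ 0 := by rintro rfl; simp at hz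
  have hu0 : u ≠ 0 := by rintro rfl; simp at hu
  have : arg (toPlane z / toPlane z') = arg (toPlane z) - (arg (toPlane u) + δ) := by
    refine arg_div_of_polar (norm_pos_iff.2 (toPlane_ne_zero hz0))
      (norm_pos_iff.2 (toPlane_ne_zero hu0)) (toPlane_polar z) ?_ hδ
    rw [hz']
    conv_lhs => rw [toPlane_polar u]
    push_cast
    rw [add_mul, exp_add]; ring
  rw [this, hs, coef, mul_assoc, ← exp_add, mul_left_comm, ← exp_add]
  congr 2
  push_cast; ring

/-- A step inside the fundamental sector leaves the normalised weight unchanged. -/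
theorem coef_step_inner {n : ℕ} {z z' : ℤ × ℤ} (hz : 1 ≤ z.1 ∧ 0 ≤ z.2)
    (hz' : 1 ≤ z'.1 ∧ 0 ≤ z'.2) :
    symWeight w₀ β n z' * exp ((β * arg (toPlane z / toPlane z') : ℝ) * I) *
      exp ((-β * (arg (toPlane z) - arg (toPlane (1, 1))) : ℝ) * I) =
    coef w₀ β n z'.1 z'.2 := by
  have h1 := arg_sector hz.1 hz.2
  have h2 := arg_sector hz'.1 hz'.2
  have hpi := Real.pi_pos
  rw [coef_step_aux (δ := 0) hz hz' (by simp) rfl ⟨by linarith [h1.1, h2.2], by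
    linarith [h1.2, h2.1]⟩]
  simp

theorem arg_toPlane_axis {a : ℤ} (ha : 1 ≤ a) : arg (toPlane (a, 0)) = 0 := by
  have : toPlane (a, 0) = ((a : ℝ) : ℂ) := by simp [toPlane]
  rw [this, arg_ofReal_of_nonneg]
  exact_mod_cast (by omega : 0 ≤ a)

variable {α : ℝ}

/-- The recursion over the last step of a walk, inside the fundamental sector and across its two
sides. -/
theorem coef_succ (hβ : β * (2 * Real.pi / 3) = α) (n : ℕ) {a b : ℤ} (ha : 1 ≤ a) (hb : 0 ≤ b) :
    coef w₀ β (n + 1) a b = coef w₀ β n (a + 1) (b + 1) +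
      (if 2 ≤ a then coef w₀ β n (a - 1) b
        else if 1 ≤ b then exp (-(α * I)) * coef w₀ β n b 0 else 0) +
      (if 1 ≤ b then coef w₀ β n a (b - 1) else exp (α * I) * coef w₀ β n 1 (a + 1)) := by
  have hz0 : ((a, b) : ℤ × ℤ) ≠ 0 := by
    intro h; rw [Prod.ext_iff] at h; simp at h; omega
  have hpi := Real.pi_pos
  have hz : (1 : ℤ) ≤ ((a, b) : ℤ × ℤ).1 ∧ (0 : ℤ) ≤ ((a, b) : ℤ × ℤ).2 := ⟨ha, hb⟩
  have hargz := arg_sector hz.1 hz.2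
  rw [coef, symWeight_succ _ _ _ hz0, sum_steps, add_mul, add_mul]
  have e1 : ((a, b) : ℤ × ℤ) - (-1, -1) = (a + 1, b + 1) := by ext <;> simp
  have e2 : ((a, b) : ℤ × ℤ) - (1, 0) = (a - 1, b) := by ext <;> simp
  have e3 : ((a, b) : ℤ × ℤ) - (0, 1) = (a, b - 1) := by ext <;> simp
  rw [e1, e2, e3, coef_step_inner (z' := (a + 1, b + 1)) hz ⟨by simp; omega, by simp; omega⟩]
  rw [add_comm, ← add_assoc]
  congr 1
  · congr 1
    split_ifs with h1 h2
    · exact coef_step_inner (z' := (a - 1, b)) hz ⟨by simp; omega, by simp; omega⟩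
    · have ha1 : a = 1 := by omega
      subst ha1
      have hr : ((1 - 1, b) : ℤ × ℤ) = rot (b, 0) := by ext <;> simp [rot]
      have hax := arg_toPlane_axis h2
      rw [hr, coef_step_aux (u := (b, 0)) (δ := 2 * Real.pi / 3) hz ⟨h2, le_rfl⟩
        (by rw [toPlane_rot]; congr 2; push_cast; ring) (symWeight_rot _ _ _ _)
        (by rw [hax]; constructor <;> linarith [hargz.1, hargz.2])]
      rw [neg_mul, hβ]
      congr 2; push_cast; ring
    · have : ((a - 1, b) : ℤ × ℤ) = 0 := by ext <;> simp <;> omega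
      rw [this]
      have h0 : rot 0 = 0 := rot_eq_zero.2 rfl
      simp [symWeight, h0, weight_zero_right]
  · split_ifs with h1
    · exact coef_step_inner (z' := (a, b - 1)) hz ⟨by simp; omega, by simp; omega⟩
    · have hb0 : b = 0 := by omega
      subst hb0
      have hr : ((1, a + 1) : ℤ × ℤ) = rot (a, 0 - 1) := by ext <;> simp [rot]
      have hax := arg_toPlane_axis ha
      have hu := arg_sector (v := (1, a + 1)) (by simp) (by simp; omega)
      have hz' : toPlane (a, 0 - 1) = exp ((-(2 * Real.pi / 3) : ℝ) * I) * toPlane (1, a + 1) := by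
        rw [hr, toPlane_rot, ← mul_assoc, ← exp_add]
        rw [show (((-(2 * Real.pi / 3) : ℝ) : ℂ) * I + 2 * Real.pi * I / 3) = 0 by
          push_cast; ring]
        simp
      rw [coef_step_aux (u := (1, a + 1)) (δ := -(2 * Real.pi / 3)) hz ⟨by simp, by simp; omega⟩
        hz' (by rw [hr, symWeight_rot])
        (by rw [hax]; constructor <;> linarith [hu.1, hu.2])]
      rw [neg_mul_neg, hβ]

/-- There are at most three choices for each step. -/
theorem norm_coef_le (h : w₀ ∈ nearOrigin) (hβ : β * (2 * Real.pi / 3) = α) (n : ℕ) :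
    ∀ {a b : ℤ}, 1 ≤ a → 0 ≤ b → ‖coef w₀ β n a b‖ ≤ 3 ^ n := by
  induction n with
  | zero =>
    intro a b ha hb
    rw [coef_zero h ha hb]
    split_ifs <;> simp
  | succ n ih =>
    intro a b ha hb
    rw [coef_succ hβ n ha hb]
    have hn1 : ‖exp (-(α * I))‖ = 1 := by
      rw [← neg_mul, ← ofReal_neg]; exact norm_exp_ofReal_mul_I _
    have hn2 : ‖exp (α * I)‖ = 1 := norm_exp_ofReal_mul_I _
    have h1 := ih (a := a + 1) (b := b + 1) (by omega) (by omega)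
    have h2 : ‖(if 2 ≤ a then coef w₀ β n (a - 1) b
        else if 1 ≤ b then exp (-(α * I)) * coef w₀ β n b 0 else 0)‖ ≤ 3 ^ n := by
      split_ifs with h3 h4
      · exact ih (by omega) hb
      · rw [norm_mul, hn1, one_mul]; exact ih h4 le_rfl
      · simp
    have h3 : ‖(if 1 ≤ b then coef w₀ β n a (b - 1)
        else exp (α * I) * coef w₀ β n 1 (a + 1))‖ ≤ 3 ^ n := by
      split_ifs with h3
      · exact ih ha (by omega)
      · rw [norm_mul, hn2, one_mul]; exact ih le_rfl (by omega)
    refine (norm_add₃_le).trans ?_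
    rw [pow_succ]; linarith

/-- Each step increases `a + b` by `1` modulo `3`. -/
theorem coef_eq_zero (h : w₀ ∈ nearOrigin) (hβ : β * (2 * Real.pi / 3) = α) (n : ℕ) :
    ∀ {a b : ℤ}, 1 ≤ a → 0 ≤ b → ¬ (3 : ℤ) ∣ a + b - 2 - n → coef w₀ β n a b = 0 := by
  induction n with
  | zero =>
    intro a b ha hb hd
    rw [coef_zero h ha hb, if_neg]
    rintro ⟨rfl, rfl⟩
    exact hd (by norm_num)
  | succ n ih =>
    intro a b ha hb hd
    push_cast at hd
    rw [coef_succ hβ n ha hb, ih (by omega) (by omega) (by omega), zero_add]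
    split_ifs
    · rw [ih (by omega) (by omega) (by omega), ih (by omega) (by omega) (by omega), zero_add]
    · rw [ih (by omega) (by omega) (by omega), ih (by omega) (by omega) (by omega)]; simp
    · rw [ih (by omega) (by omega) (by omega), ih (by omega) (by omega) (by omega)]; simp
    · rw [ih (by omega) (by omega) (by omega)]; simp

end coef

theorem fin_prod_telescope {n : ℕ} (f : Fin (n + 1) → ℂ) (hf : ∀ i, f i ≠ 0) :
    ∏ i : Fin n, f i.succ / f i.castSucc = f (Fin.last n) / f 0 := by
  induction n with
  | zero => simp [div_self (hf 0)]
  | succ n ih =>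
    rw [Fin.prod_univ_castSucc]
    have := ih (fun i => f i.castSucc) fun i => hf _
    simp only [Fin.succ_castSucc, Fin.succ_last, Fin.castSucc_zero] at this ⊢
    rw [this]
    have h1 := hf (Fin.last n).castSucc
    have h2 := hf 0
    field_simp

/-- Winding angles add up to the rotation of the direction as seen from the origin. -/
theorem exp_windingAngle {n : ℕ} {w : Fin (n + 1) → ℤ × ℤ} (hw : IsWalk w) :
    exp ((windingAngle w : ℝ) * I) =
      (toPlane (w (Fin.last n)) / ‖toPlane (w (Fin.last n))‖) /
        (toPlane (w 0) / ‖toPlane (w 0)‖) := by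
  have hne : ∀ i, toPlane (w i) ≠ 0 := fun i => toPlane_ne_zero (hw.2 i)
  have hunit : ∀ i, toPlane (w i) / ‖toPlane (w i)‖ ≠ 0 := fun i =>
    div_ne_zero (hne i) (by simpa using hne i)
  unfold windingAngle
  push_cast
  rw [Finset.sum_mul, exp_sum]
  have hstep : ∀ i : Fin n, exp (arg (toPlane (w i.succ) / toPlane (w i.castSucc)) * I) =
      (toPlane (w i.succ) / ‖toPlane (w i.succ)‖) /
        (toPlane (w i.castSucc) / ‖toPlane (w i.castSucc)‖) := by
    intro i
    have := norm_mul_exp_arg_mul_I (toPlane (w i.succ) / toPlane (w i.castSucc))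
    have h1 := hne i.succ
    have h2 := hne i.castSucc
    have h3 : (‖toPlane (w i.succ)‖ : ℂ) ≠ 0 := by simpa using h1
    have h4 : (‖toPlane (w i.castSucc)‖ : ℂ) ≠ 0 := by simpa using h2
    rw [norm_div] at this
    push_cast at this
    field_simp at this ⊢
    linear_combination this
  rw [Finset.prod_congr rfl fun i _ => hstep i]
  exact fin_prod_telescope (fun i => toPlane (w i) / ‖toPlane (w i)‖) hunit

theorem toPlane_one_one_cube : toPlane (1, 1) ^ 3 = -1 := by
  have h := exp_two_pi_div_three_sq
  simp only [toPlane]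
  set ω := exp (2 * Real.pi * I / 3)
  push_cast
  linear_combination (ω + 2) * h

/-- The directions of the three neighbours differ by multiples of `2π/3`. -/
theorem cube_of_mem_nearOrigin {v : ℤ × ℤ} (hv : v ∈ nearOrigin) :
    (toPlane v / ‖toPlane v‖) ^ 3 = -1 := by
  have hω : exp (2 * Real.pi * I / 3) ^ 3 = 1 := by
    have h := exp_two_pi_div_three_sq
    set ω := exp (2 * Real.pi * I / 3)
    linear_combination (ω - 1) * h
  have h3 : toPlane v ^ 3 = -1 := by
    rcases mem_nearOrigin.1 hv with rfl | rfl | rfl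
    · exact toPlane_one_one_cube
    · rw [toPlane_rot, mul_pow, hω, toPlane_one_one_cube]; simp
    · rw [toPlane_rot, toPlane_rot, mul_pow, mul_pow, hω, toPlane_one_one_cube]; simp
  have hn : ‖toPlane v‖ = 1 := by
    have := congrArg norm h3
    rw [norm_pow] at this
    simpa [pow_eq_one_iff_of_nonneg] using this
  rw [hn, ofReal_one, div_one, h3]

/-- A walk between two neighbours of the origin has winding angle a multiple of `2π/3`. -/
theorem exists_windingAngle {w₀ : ℤ × ℤ} (h₀ : w₀ ∈ nearOrigin) {n : ℕ}
    {w : Fin (n + 1) → ℤ × ℤ} (hw : w ∈ walks w₀ n) :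
    ∃ k : ℤ, windingAngle w = 2 * Real.pi * k / 3 := by
  obtain ⟨hw, hw0, hl⟩ := hw
  have h := exp_windingAngle hw
  have h3 : exp ((windingAngle w : ℝ) * I) ^ 3 = 1 := by
    rw [h, div_pow, cube_of_mem_nearOrigin hl, hw0, cube_of_mem_nearOrigin h₀]; norm_num
  rw [← exp_nat_mul, exp_eq_one_iff] at h3
  obtain ⟨k, hk⟩ := h3
  refine ⟨k, ?_⟩
  have : (3 * windingAngle w : ℂ) = k * (2 * Real.pi) := by
    have hI := I_ne_zero
    apply mul_right_cancel₀ hI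
    push_cast at hk
    linear_combination hk
  have : 3 * windingAngle w = k * (2 * Real.pi) := by exact_mod_cast this
  linarith

/-- The coefficients of the generating function in terms of the weights. -/
theorem coeff_genFun {w₀ : ℤ × ℤ} (h₀ : w₀ ∈ nearOrigin) {α β : ℝ}
    (hβ : β * (2 * Real.pi / 3) = α) (n : ℕ) :
    PowerSeries.coeff n (genFun w₀ (exp (α * I))) = coef w₀ β n 1 1 := by
  classical
  have hpi := Real.pi_ne_zero
  choose! k hk using fun w (hw : w ∈ walks w₀ n) => exists_windingAngle h₀ hw
  have hinj : ∀ a b : ℤ, 2 * Real.pi * a / 3 = 2 * Real.pi * b / 3 → a = b := by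
    intro a b hab
    field_simp at hab
    exact_mod_cast hab
  set A := (walks_finite w₀ n).toFinset with hA
  have hmem : ∀ {w}, w ∈ A ↔ w ∈ walks w₀ n := by intro w; simp [hA]
  have hcount : ∀ j : ℤ, walkCount w₀ n j = (A.filter fun w => k w = j).card := by
    intro j
    rw [walkCount, ← Set.ncard_coe_finset]
    congr 1
    ext w
    simp only [Finset.coe_filter, hmem]
    constructor
    · rintro ⟨h1, h2⟩
      exact ⟨h1, hinj _ _ (by rw [← hk w h1, h2])⟩
    · rintro ⟨h1, h2⟩
      exact ⟨h1, by rw [hk w h1, h2]⟩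
  have h1 : PowerSeries.coeff n (genFun w₀ (exp (α * I))) =
      ∑ w ∈ A, exp ((β * windingAngle w : ℝ) * I) := by
    rw [genFun, PowerSeries.coeff_mk, finsum_eq_sum_of_support_subset (s := A.image k)]
    · have : ∀ w ∈ A, exp ((β * windingAngle w : ℝ) * I) = exp (α * I) ^ k w := by
        intro w hw
        rw [← exp_int_mul, hk w (hmem.1 hw), ← hβ]
        congr 1; push_cast; ring
      rw [Finset.sum_congr rfl this, Finset.sum_comp (fun j : ℤ => exp (α * I) ^ j) k]
      refine Finset.sum_congr rfl fun j _ => ?_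
      rw [hcount, nsmul_eq_mul]
    · intro j hj
      rw [Function.mem_support, hcount] at hj
      have hne : (A.filter fun w => k w = j).Nonempty := by
        rw [← Finset.card_ne_zero]
        intro h0
        rw [h0] at hj; simp at hj
      obtain ⟨w, hw⟩ := hne
      rw [Finset.mem_filter] at hw
      simp only [Finset.coe_image, Set.mem_image, Finset.mem_coe]
      exact ⟨w, hw⟩
  have hsub : A = (allWalks w₀ n).filter fun w => w (Fin.last n) ∈ nearOrigin := by
    ext w
    rw [hmem, Finset.mem_filter, mem_allWalks]
    exact ⟨fun h => ⟨⟨h.1, h.2.1⟩, h.2.2⟩, fun h => ⟨h.1.1, h.1.2, h.2⟩⟩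
  rw [h1, hsub, Finset.sum_filter, coef, sub_self, mul_zero]
  simp only [ofReal_zero, zero_mul, exp_zero, mul_one, symWeight, weight]
  rw [← Finset.sum_add_distrib, ← Finset.sum_add_distrib]
  refine Finset.sum_congr rfl fun w _ => ?_
  have h2 : rot (1, 1) = (-1, 0) := rfl
  have h3 : rot (-1, 0) = (0, -1) := rfl
  simp only [mem_nearOrigin, h2, h3]
  by_cases c1 : w (Fin.last n) = (1, 1)
  · simp [c1]
  · by_cases c2 : w (Fin.last n) = (-1, 0)
    · simp [c2]
    · simp [c1, c2]

end

/-! ### Uniqueness for the recursion -/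

/-- The sum over the possible last steps of a walk, read off from the fundamental sector. -/
noncomputable def lastStep (s : ℂ) (J : ℤ → ℤ → ℂ) (a b : ℤ) : ℂ :=
  J (a + 1) (b + 1) + (if 2 ≤ a then J (a - 1) b else if 1 ≤ b then s⁻¹ * J b 0 else 0) +
    (if 1 ≤ b then J a (b - 1) else s * J 1 (a + 1))

theorem lastStep_sub (s : ℂ) (J G : ℤ → ℤ → ℂ) (a b : ℤ) :
    lastStep s (fun a b => J a b - G a b) a b = lastStep s J a b - lastStep s G a b := by
  unfold lastStep
  split_ifs <;> ring

/-- On families of growth `R ^ (a + b)` the recursion is a bounded operator, hence a contraction after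
multiplication by a small `t`. -/
theorem norm_lastStep_le {s : ℂ} (hs : ‖s‖ = 1) {J : ℤ → ℤ → ℂ} {K R : ℝ} (hR : 1 ≤ R)
    (hK : 0 ≤ K) (hJ : ∀ a b : ℤ, 1 ≤ a → 0 ≤ b → ‖J a b‖ ≤ K * R ^ (a + b))
    {a b : ℤ} (ha : 1 ≤ a) (hb : 0 ≤ b) :
    ‖lastStep s J a b‖ ≤ 3 * R ^ 2 * (K * R ^ (a + b)) := by
  have hR0 : (0 : ℝ) < R := by linarith
  have key : ∀ {x : ℂ} {c : ℤ}, c ≤ a + b + 2 → ‖x‖ ≤ K * R ^ c →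
      ‖x‖ ≤ R ^ 2 * (K * R ^ (a + b)) := by
    intro x c hc hx
    refine hx.trans ?_
    have : R ^ c ≤ R ^ (a + b + 2) := zpow_le_zpow_right₀ hR hc
    calc K * R ^ c ≤ K * R ^ (a + b + 2) := by gcongr
      _ = _ := by rw [zpow_add₀ hR0.ne']; norm_cast; ring
  have h0 : 0 ≤ R ^ 2 * (K * R ^ (a + b)) := by positivity
  have h1 : ‖J (a + 1) (b + 1)‖ ≤ R ^ 2 * (K * R ^ (a + b)) :=
    key (by omega) (hJ (a + 1) (b + 1) (by omega) (by omega))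
  have h2 : ‖(if 2 ≤ a then J (a - 1) b else if 1 ≤ b then s⁻¹ * J b 0 else 0)‖ ≤
      R ^ 2 * (K * R ^ (a + b)) := by
    split_ifs with h1 h2
    · exact key (by omega) (hJ (a - 1) b (by omega) hb)
    · rw [norm_mul, norm_inv, hs, inv_one, one_mul]
      exact key (by omega) (hJ b 0 h2 le_rfl)
    · simpa using h0
  have h3 : ‖(if 1 ≤ b then J a (b - 1) else s * J 1 (a + 1))‖ ≤ R ^ 2 * (K * R ^ (a + b)) := by
    split_ifs with h1
    · exact key (by omega) (hJ a (b - 1) ha (by omega))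
    · rw [norm_mul, hs, one_mul]
      exact key (by omega) (hJ 1 (a + 1) le_rfl (by omega))
  refine (norm_add₃_le).trans ?_
  linarith

/-- The generating functions are characterised, for a small value of `t`, by the linear system
expressing the recursion over the last step, among the families of at most geometric growth. -/
theorem hasSum_coef {w₀ : ℤ × ℤ} (h₀ : w₀ ∈ nearOrigin) {α β : ℝ}
    (hβ : β * (2 * Real.pi / 3) = α) {t : ℂ} {K R : ℝ} (hR : 1 ≤ R) (hK : 0 ≤ K)
    (ht : 3 * R ^ 2 * ‖t‖ < 1) {J : ℤ → ℤ → ℂ}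
    (hJ : ∀ a b : ℤ, 1 ≤ a → 0 ≤ b → ‖J a b‖ ≤ K * R ^ (a + b))
    (hrec : ∀ a b : ℤ, 1 ≤ a → 0 ≤ b → J a b =
      (if a = 1 ∧ b = 1 then 1 else 0) + t * lastStep (exp (α * I)) J a b)
    {a b : ℤ} (ha : 1 ≤ a) (hb : 0 ≤ b) :
    HasSum (fun n => coef w₀ β n a b * t ^ n) (J a b) := by
  set s := exp (α * I) with hs_def
  have hs : ‖s‖ = 1 := norm_exp_ofReal_mul_I _
  have hs' : exp (-(α * I)) = s⁻¹ := by rw [exp_neg]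
  have hR0 : (0 : ℝ) < R := by linarith
  have ht3 : 3 * ‖t‖ < 1 := by
    have : 1 ≤ R ^ 2 := one_le_pow₀ hR
    nlinarith [norm_nonneg t]
  have hsum : ∀ a b : ℤ, 1 ≤ a → 0 ≤ b → Summable fun n => coef w₀ β n a b * t ^ n := by
    intro a b ha hb
    refine Summable.of_norm_bounded (g := fun n => (3 * ‖t‖) ^ n)
      (summable_geometric_of_lt_one (by positivity) ht3) fun n => ?_
    rw [norm_mul, norm_pow, mul_pow]
    gcongr
    exact norm_coef_le h₀ hβ n ha hb
  set G : ℤ → ℤ → ℂ := fun a b => ∑' n, coef w₀ β n a b * t ^ n with hG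
  have hGb : ∀ a b : ℤ, 1 ≤ a → 0 ≤ b → ‖G a b‖ ≤ (1 - 3 * ‖t‖)⁻¹ := by
    intro a b ha hb
    rw [← tsum_geometric_of_lt_one (by positivity) ht3]
    refine tsum_of_norm_bounded
      (summable_geometric_of_lt_one (by positivity) ht3).hasSum fun n => ?_
    rw [norm_mul, norm_pow, mul_pow]
    gcongr
    exact norm_coef_le h₀ hβ n ha hb
  have hGrec : ∀ a b : ℤ, 1 ≤ a → 0 ≤ b → G a b =
      (if a = 1 ∧ b = 1 then 1 else 0) + t * lastStep s G a b := by
    intro a b ha hb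
    have h1 : G a b = coef w₀ β 0 a b * t ^ 0 + ∑' n, coef w₀ β (n + 1) a b * t ^ (n + 1) :=
      (hsum a b ha hb).tsum_eq_zero_add
    rw [h1, coef_zero h₀ ha hb, pow_zero, mul_one]
    congr 1
    refine HasSum.tsum_eq ?_
    have hg : ∀ a b : ℤ, 1 ≤ a → 0 ≤ b → HasSum (fun n => coef w₀ β n a b * t ^ n) (G a b) :=
      fun a b ha hb => (hsum a b ha hb).hasSum
    have e1 := hg (a + 1) (b + 1) (by omega) (by omega)
    have e2 : HasSum (fun n => (if 2 ≤ a then coef w₀ β n (a - 1) b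
        else if 1 ≤ b then s⁻¹ * coef w₀ β n b 0 else 0) * t ^ n)
        (if 2 ≤ a then G (a - 1) b else if 1 ≤ b then s⁻¹ * G b 0 else 0) := by
      split_ifs with h1 h2
      · exact hg (a - 1) b (by omega) hb
      · simpa only [mul_assoc] using (hg b 0 h2 le_rfl).mul_left s⁻¹
      · simp
    have e3 : HasSum (fun n => (if 1 ≤ b then coef w₀ β n a (b - 1)
        else s * coef w₀ β n 1 (a + 1)) * t ^ n)
        (if 1 ≤ b then G a (b - 1) else s * G 1 (a + 1)) := by
      split_ifs with h1
      · exact hg a (b - 1) ha (by omega)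
      · simpa only [mul_assoc] using (hg 1 (a + 1) le_rfl (by omega)).mul_left s
    refine (((e1.add e2).add e3).mul_left t).congr_fun fun n => ?_
    rw [coef_succ hβ n ha hb, hs']
    ring
  set K' := K + (1 - 3 * ‖t‖)⁻¹ with hK'
  have hpos : 0 < (1 - 3 * ‖t‖)⁻¹ := inv_pos.2 (by linarith)
  have hind : ∀ N : ℕ, ∀ a b : ℤ, 1 ≤ a → 0 ≤ b →
      ‖J a b - G a b‖ ≤ (3 * R ^ 2 * ‖t‖) ^ N * K' * R ^ (a + b) := by
    intro N
    induction N with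
    | zero =>
      intro a b ha hb
      refine (norm_sub_le _ _).trans ?_
      have h1 : (1 : ℝ) ≤ R ^ (a + b) := one_le_zpow₀ hR (by omega)
      have := hJ a b ha hb
      have := hGb a b ha hb
      rw [pow_zero, one_mul, hK', add_mul]
      nlinarith
    | succ N ih =>
      intro a b ha hb
      have : J a b - G a b = t * lastStep s (fun a b => J a b - G a b) a b := by
        rw [lastStep_sub, hrec a b ha hb, hGrec a b ha hb]; ring
      rw [this, norm_mul]
      have := norm_lastStep_le hs hR (by positivity) ih ha hb
      refine (mul_le_mul_of_nonneg_left this (norm_nonneg t)).trans (le_of_eq ?_)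
      rw [pow_succ]; ring
  have hzero : J a b - G a b = 0 := by
    rw [← norm_le_zero_iff]
    have hlim : Filter.Tendsto (fun N : ℕ => (3 * R ^ 2 * ‖t‖) ^ N * K' * R ^ (a + b))
        Filter.atTop (nhds 0) := by
      have := tendsto_pow_atTop_nhds_zero_of_lt_one (r := 3 * R ^ 2 * ‖t‖) (by positivity) ht
      simpa using (this.mul_const K').mul_const (R ^ (a + b))
    exact ge_of_tendsto' hlim fun N => hind N a b ha hb
  rw [sub_eq_zero.1 hzero]
  exact (hsum a b ha hb).hasSum

/-! ### An elliptic function with a double pole and its translates by a third of a period -/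

section

/-- **Liouville's theorem** for elliptic functions: a function with a lattice of periods that is
differentiable off the lattice and has a limit at `0` is constant. -/
theorem eq_of_periodic_of_tendsto (L : PeriodPair) {φ : ℂ → ℂ} {c : ℂ}
    (hd : ∀ z ∉ L.lattice, DifferentiableAt ℂ φ z)
    (hp : ∀ z, ∀ l ∈ L.lattice, φ (z + l) = φ z)
    (hc : Tendsto φ (𝓝[≠] 0) (𝓝 c)) {z : ℂ} (hz : z ∉ L.lattice) : φ z = c := by
  classical
  set ψ : ℂ → ℂ := fun z => if z ∈ L.lattice then c else φ z with hψ
  have hψp : ∀ z l, l ∈ L.lattice → ψ (z + l) = ψ z := by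
    intro z l hl
    have : z + l ∈ L.lattice ↔ z ∈ L.lattice :=
      ⟨fun h => by simpa using L.lattice.sub_mem h hl, fun h => L.lattice.add_mem h hl⟩
    simp only [hψ, this, hp z l hl]
  have hev : ∀ z ∉ L.lattice, DifferentiableAt ℂ ψ z := by
    intro z hz
    refine (hd z hz).congr_of_eventuallyEq ?_
    filter_upwards [L.isClosed_lattice.isOpen_compl.mem_nhds hz] with w hw
    exact if_neg hw
  have h0 : DifferentiableAt ℂ ψ 0 := by
    refine (analyticAt_of_differentiable_on_punctured_nhds_of_continuousAt ?_ ?_).differentiableAt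
    · filter_upwards [self_mem_nhdsWithin, mem_nhdsWithin_of_mem_nhds
        (L.compl_lattice_sdiff_singleton_mem_nhds 0)] with w hw hw'
      exact hev w (by simp_all)
    · rw [continuousAt_iff_punctured_nhds]
      have : ψ 0 = c := if_pos L.lattice.zero_mem
      rw [this]
      refine hc.congr' ?_
      filter_upwards [self_mem_nhdsWithin, mem_nhdsWithin_of_mem_nhds
        (L.compl_lattice_sdiff_singleton_mem_nhds 0)] with w hw hw'
      exact (if_neg (by simp_all)).symm
  have hdiff : Differentiable ℂ ψ := by
    intro w
    by_cases hw : w ∈ L.lattice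
    · have h1 : ψ = fun z => ψ (z - w) := by
        funext z
        rw [sub_eq_add_neg, hψp _ _ (L.lattice.neg_mem hw)]
      rw [h1]
      have h2 : DifferentiableAt ℂ ψ (w - w) := by rwa [sub_self]
      exact DifferentiableAt.comp (f := fun z => z - w) w h2 (by fun_prop)
    · exact hev w hw
  have hb := (IsZLattice.isCompact_range_of_periodic L.lattice _ hdiff.continuous
    fun z w hw => hψp z w hw).isBounded
  have := hdiff.apply_eq_apply_of_bounded hb z 0
  simpa only [hψ, if_neg hz, if_pos L.lattice.zero_mem] using this

/-- The pair of periods `1, c`. -/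
noncomputable def unitPair (c : ℂ) (hc : 0 < c.im) : PeriodPair where
  ω₁ := 1
  ω₂ := c
  indep := by
    rw [LinearIndependent.pair_iff]
    intro x y h
    have h1 := congrArg im h
    have h2 := congrArg re h
    simp only [real_smul, mul_one, add_im, ofReal_im, re_ofReal_mul, im_ofReal_mul, zero_im, add_re,
      ofReal_re, zero_re, zero_add] at h1 h2
    have hy : y = 0 := by
      rcases mul_eq_zero.1 h1 with h | h
      · exact h
      · exact absurd h hc.ne'
    refine ⟨?_, hy⟩
    rw [hy] at h2; simpa using h2

theorem mem_unitPair {c : ℂ} {hc : 0 < c.im} {z : ℂ} :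
    z ∈ (unitPair c hc).lattice ↔ ∃ m n : ℤ, m + n * c = z := by
  rw [PeriodPair.mem_lattice]
  simp [unitPair]

theorem three_mul_im_pos {τ : ℂ} (hτ : 0 < τ.im) : 0 < (3 * τ).im := by
  have : (3 * τ).im = 3 * τ.im := by simp
  rw [this]; positivity

/-- The lattice `ℤ + 3τℤ`. -/
noncomputable abbrev L3 (τ : ℂ) (hτ : 0 < τ.im) : PeriodPair :=
  unitPair (3 * τ) (three_mul_im_pos hτ)

theorem im_of_mem_L3 {τ : ℂ} {hτ : 0 < τ.im} {z : ℂ} (hz : z ∈ (L3 τ hτ).lattice) :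
    ∃ n : ℤ, z.im = 3 * n * τ.im := by
  obtain ⟨m, n, rfl⟩ := mem_unitPair.1 hz
  exact ⟨n, by simp; ring⟩

variable {τ : ℂ} {hτ : 0 < τ.im}

theorem one_mem_L3 : (1 : ℂ) ∈ (L3 τ hτ).lattice := mem_unitPair.2 ⟨1, 0, by simp⟩

theorem three_mul_mem_L3 : 3 * τ ∈ (L3 τ hτ).lattice := mem_unitPair.2 ⟨0, 1, by simp⟩

theorem notMem_L3_of_im {z : ℂ} {k : ℤ} (h1 : 3 * k * τ.im < z.im)
    (h2 : z.im < 3 * (k + 1) * τ.im) : z ∉ (L3 τ hτ).lattice := by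
  intro hz
  obtain ⟨n, hn⟩ := im_of_mem_L3 hz
  rw [hn] at h1 h2
  have h1' : (k : ℝ) < n := by
    by_contra hcon
    push Not at hcon
    nlinarith
  have h2' : (n : ℝ) < k + 1 := by
    by_contra hcon
    push Not at hcon
    nlinarith
  have : k < n := by exact_mod_cast h1'
  have : n < k + 1 := by exact_mod_cast h2'
  omega

theorem tau_notMem : τ ∉ (L3 τ hτ).lattice :=
  notMem_L3_of_im (k := 0) (by simpa using hτ) (by norm_num; linarith)

/-- The elliptic function with a double pole at `0` and zeros at the `3`-torsion points `±τ`. -/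
noncomputable def dfun (τ : ℂ) (hτ : 0 < τ.im) (z : ℂ) : ℂ :=
  (L3 τ hτ).weierstrassP z - (L3 τ hτ).weierstrassP τ

theorem dfun_neg (z : ℂ) : dfun τ hτ (-z) = dfun τ hτ z := by
  simp [dfun, PeriodPair.weierstrassP_neg]

theorem dfun_add_mem {z l : ℂ} (hl : l ∈ (L3 τ hτ).lattice) :
    dfun τ hτ (z + l) = dfun τ hτ z := by
  unfold dfun
  rw [(L3 τ hτ).weierstrassP_add_coe z ⟨l, hl⟩]

theorem dfun_add_one (z : ℂ) : dfun τ hτ (z + 1) = dfun τ hτ z := dfun_add_mem one_mem_L3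

theorem dfun_add_three (z : ℂ) : dfun τ hτ (z + 3 * τ) = dfun τ hτ z :=
    dfun_add_mem three_mul_mem_L3

theorem dfun_tau : dfun τ hτ τ = 0 := sub_self _

theorem differentiableAt_dfun {z : ℂ} (hz : z ∉ (L3 τ hτ).lattice) :
    DifferentiableAt ℂ (dfun τ hτ) z :=
  (((L3 τ hτ).differentiableOn_weierstrassP z hz).differentiableAt
    ((L3 τ hτ).isClosed_lattice.isOpen_compl.mem_nhds hz)).sub_const _

/-- The sum of `(l - τ)⁻³` over the lattice `ℤ + 3τℤ`. -/
noncomputable abbrev s3 (τ : ℂ) (hτ : 0 < τ.im) : ℂ := (L3 τ hτ).sumInvPow τ 3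

/-- The sum of `(l - τ)⁻⁴` over the lattice `ℤ + 3τℤ`. -/
noncomputable abbrev s4 (τ : ℂ) (hτ : 0 < τ.im) : ℂ := (L3 τ hτ).sumInvPow τ 4

/-- The Taylor expansion of `dfun` at its zero `τ`. -/
theorem dfun_taylor : (fun w => dfun τ hτ (τ + w) - (2 * s3 τ hτ * w + 3 * s4 τ hτ * w ^ 2))
    =O[𝓝 0] fun w => ‖w‖ ^ 3 := by
  have h := ((L3 τ hτ).hasFPowerSeriesAt_weierstrassPExcept τ).isBigO_sub_partialSum_pow 3
  rw [(L3 τ hτ).weierstrassPExcept_of_notMem τ tau_notMem] at h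
  refine h.congr_left fun w => ?_
  simp only [FormalMultilinearSeries.partialSum, Finset.sum_range_succ, Finset.sum_range_zero,
    FormalMultilinearSeries.ofScalars_apply_eq, dfun, smul_eq_mul]
  norm_num
  ring

theorem hasDerivAt_dfun_tau : HasDerivAt (dfun τ hτ) (2 * s3 τ hτ) τ := by
  rw [hasDerivAt_iff_isLittleO_nhds_zero]
  have h1 : (fun w : ℂ => ‖w‖ ^ 3) =o[𝓝 0] fun w => w := by
    simpa using (Asymptotics.isLittleO_norm_pow_id (E' := ℂ) (by norm_num : 1 < 3))
  have h2 := (dfun_taylor (τ := τ) (hτ := hτ)).trans_isLittleO h1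
  have h3 : (fun w : ℂ => 3 * s4 τ hτ * w ^ 2) =o[𝓝 0] fun w => w :=
    (Asymptotics.isLittleO_pow_id (by norm_num : 1 < 2)).const_mul_left _
  refine (h2.add h3).congr_left fun w => ?_
  rw [dfun_tau, smul_eq_mul]; ring

/-- The double pole of `dfun` at `0` has leading coefficient `1`. -/
theorem sq_mul_dfun_tendsto : Tendsto (fun w => w ^ 2 * dfun τ hτ w) (𝓝[≠] 0) (𝓝 1) := by
  have h := ((L3 τ hτ).analyticAt_weierstrassPExcept 0).continuousAt
  have h1 : Tendsto (fun w => 1 + w ^ 2 * ((L3 τ hτ).weierstrassPExcept 0 w -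
      (L3 τ hτ).weierstrassP τ)) (𝓝 0) (𝓝 1) := by
    have : ContinuousAt (fun w => 1 + w ^ 2 * ((L3 τ hτ).weierstrassPExcept 0 w -
      (L3 τ hτ).weierstrassP τ)) 0 := by fun_prop
    have h2 := this.tendsto
    simpa using h2
  refine (h1.mono_left nhdsWithin_le_nhds).congr' ?_
  filter_upwards [self_mem_nhdsWithin] with w hw
  have hw0 : w ≠ 0 := hw
  have := (L3 τ hτ).weierstrassPExcept_add 0 w
  simp only [ZeroMemClass.coe_zero, sub_zero, ne_eq, OfNat.ofNat_ne_zero, not_false_eq_true,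
    zero_pow, div_zero] at this
  rw [dfun, ← this]
  field_simp
  ring

theorem notMem_of_notMem_unitPair {z : ℂ} (hz : z ∉ (unitPair τ hτ).lattice) (k : ℤ) :
    z + k * τ ∉ (L3 τ hτ).lattice := by
  intro h
  obtain ⟨m, n, h⟩ := mem_unitPair.1 h
  refine hz (mem_unitPair.2 ⟨m, 3 * n - k, ?_⟩)
  push_cast
  linear_combination h

theorem dfun_sub_tau (z : ℂ) : dfun τ hτ (z - τ) = dfun τ hτ (z + 2 * τ) := by
  rw [← dfun_add_three (z - τ)]; congr 1; ring

/-- A function built symmetrically from the three translates of `dfun` has the period `τ`. -/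
theorem periodic_of_triple {G : ℂ → ℂ → ℂ → ℂ} (hG : ∀ a b c, G a b c = G b c a) (z l : ℂ)
    (hl : l ∈ (unitPair τ hτ).lattice) :
    G (dfun τ hτ (z + l)) (dfun τ hτ (z + l + τ)) (dfun τ hτ (z + l - τ)) =
      G (dfun τ hτ z) (dfun τ hτ (z + τ)) (dfun τ hτ (z - τ)) := by
  set φ : ℂ → ℂ := fun z => G (dfun τ hτ z) (dfun τ hτ (z + τ)) (dfun τ hτ (z - τ)) with hφ
  have h1 : Function.Periodic φ 1 := by
    intro z
    simp only [hφ]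
    rw [show z + 1 + τ = z + τ + 1 by ring, show z + 1 - τ = z - τ + 1 by ring]
    simp only [dfun_add_one]
  have h2 : Function.Periodic φ τ := by
    intro z
    simp only [hφ]
    rw [hG (dfun τ hτ z), dfun_sub_tau z, show z + τ + τ = z + 2 * τ by ring,
      show z + τ - τ = z by ring]
  obtain ⟨m, n, rfl⟩ := mem_unitPair.1 hl
  have := (h1.int_mul m).add_period (h2.int_mul n) z
  simpa using this

/-- The three translates are differentiable off the lattice `ℤ + τℤ`. -/
theorem differentiableAt_triple {z : ℂ} (hz : z ∉ (unitPair τ hτ).lattice) :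
    DifferentiableAt ℂ (dfun τ hτ) z ∧ DifferentiableAt ℂ (fun z => dfun τ hτ (z + τ)) z ∧
      DifferentiableAt ℂ (fun z => dfun τ hτ (z - τ)) z := by
  refine ⟨differentiableAt_dfun (by simpa using notMem_of_notMem_unitPair hz 0), ?_, ?_⟩
  · have h : DifferentiableAt ℂ (dfun τ hτ) (z + τ) :=
      differentiableAt_dfun (by simpa using notMem_of_notMem_unitPair hz 1)
    exact DifferentiableAt.comp (f := fun z => z + τ) z h (by fun_prop)
  · have h : DifferentiableAt ℂ (dfun τ hτ) (z - τ) :=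
      differentiableAt_dfun (by simpa [sub_eq_add_neg] using notMem_of_notMem_unitPair hz (-1))
    exact DifferentiableAt.comp (f := fun z => z - τ) z h (by fun_prop)

theorem dfun_sub_tau_eq (w : ℂ) : dfun τ hτ (w - τ) = dfun τ hτ (τ + -w) := by
  rw [← dfun_neg]; congr 1; ring

theorem dfun_tau_add_div_tendsto :
    Tendsto (fun w => w⁻¹ * dfun τ hτ (τ + w)) (𝓝[≠] 0) (𝓝 (2 * s3 τ hτ)) := by
  have := hasDerivAt_iff_tendsto_slope_zero.1 (hasDerivAt_dfun_tau (τ := τ) (hτ := hτ))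
  simpa [dfun_tau] using this

theorem neg_tendsto_punctured : Tendsto (fun w : ℂ => -w) (𝓝[≠] 0) (𝓝[≠] 0) := by
  refine tendsto_nhdsWithin_iff.2 ⟨?_, ?_⟩
  · have : Tendsto (fun w : ℂ => -w) (𝓝 0) (𝓝 (-0)) := tendsto_id.neg
    rw [neg_zero] at this
    exact this.mono_left nhdsWithin_le_nhds
  · filter_upwards [self_mem_nhdsWithin] with w hw
    simpa using hw

/-- The product of the three translates is constant. -/
theorem dfun_prod {z : ℂ} (hz : z ∉ (unitPair τ hτ).lattice) :
    dfun τ hτ z * dfun τ hτ (z + τ) * dfun τ hτ (z - τ) = -4 * s3 τ hτ ^ 2 := by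
  refine eq_of_periodic_of_tendsto (unitPair τ hτ)
    (φ := fun z => dfun τ hτ z * dfun τ hτ (z + τ) * dfun τ hτ (z - τ)) ?_ ?_ ?_ hz
  · intro z hz
    obtain ⟨h1, h2, h3⟩ := differentiableAt_triple hz
    exact (h1.mul h2).mul h3
  · intro z l hl
    exact periodic_of_triple (G := fun a b c => a * b * c) (fun a b c => by ring) z l hl
  · have h1 := dfun_tau_add_div_tendsto (τ := τ) (hτ := hτ)
    have h2 := h1.comp neg_tendsto_punctured
    have h3 := ((sq_mul_dfun_tendsto (τ := τ) (hτ := hτ)).mul h1).mul h2.neg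
    have e : (1 : ℂ) * (2 * s3 τ hτ) * -(2 * s3 τ hτ) = -4 * s3 τ hτ ^ 2 := by ring
    rw [e] at h3
    refine h3.congr' ?_
    filter_upwards [self_mem_nhdsWithin] with w hw
    have hw0 : w ≠ 0 := hw
    simp only [Function.comp, dfun_sub_tau_eq, add_comm w τ]
    field_simp

/-- The sum of the products of pairs of translates is constant. -/
theorem dfun_pairs {z : ℂ} (hz : z ∉ (unitPair τ hτ).lattice) :
    dfun τ hτ z * dfun τ hτ (z + τ) + dfun τ hτ (z + τ) * dfun τ hτ (z - τ) +
      dfun τ hτ (z - τ) * dfun τ hτ z = 6 * s4 τ hτ := by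
  refine eq_of_periodic_of_tendsto (unitPair τ hτ)
    (φ := fun z => dfun τ hτ z * dfun τ hτ (z + τ) + dfun τ hτ (z + τ) * dfun τ hτ (z - τ) +
      dfun τ hτ (z - τ) * dfun τ hτ z) ?_ ?_ ?_ hz
  · intro z hz
    obtain ⟨h1, h2, h3⟩ := differentiableAt_triple hz
    exact ((h1.mul h2).add (h2.mul h3)).add (h3.mul h1)
  · intro z l hl
    exact periodic_of_triple (G := fun a b c => a * b + b * c + c * a) (fun a b c => by ring) z l hl
  · have h1 := dfun_tau_add_div_tendsto (τ := τ) (hτ := hτ)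
    have h2 := h1.comp neg_tendsto_punctured
    have hid : Tendsto (fun w : ℂ => w) (𝓝[≠] 0) (𝓝 0) := tendsto_id.mono_left nhdsWithin_le_nhds
    have h3 : Tendsto (fun w => dfun τ hτ (τ + w) * dfun τ hτ (τ + -w)) (𝓝[≠] 0) (𝓝 0) := by
      have := (((h1.mul h2).mul (hid.pow 2)).neg)
      simp only [ne_eq, OfNat.ofNat_ne_zero, not_false_eq_true, zero_pow, mul_zero,
        neg_zero] at this
      refine this.congr' ?_
      filter_upwards [self_mem_nhdsWithin] with w hw
      have hw0 : w ≠ 0 := hw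
      simp only [Function.comp]
      field_simp
    have h4 : Tendsto (fun w => (w ^ 2)⁻¹ * (dfun τ hτ (τ + w) + dfun τ hτ (τ + -w))) (𝓝[≠] 0)
        (𝓝 (6 * s4 τ hτ)) := by
      have t1 := dfun_taylor (τ := τ) (hτ := hτ)
      have t2 := t1.comp_tendsto (k := fun w : ℂ => -w) (l' := 𝓝 0)
        (by simpa using (tendsto_id (α := ℂ) (x := 𝓝 0)).neg)
      have t3 : (fun w => dfun τ hτ (τ + w) + dfun τ hτ (τ + -w) - 6 * s4 τ hτ * w ^ 2)
          =O[𝓝 0] fun w => ‖w‖ ^ 3 := by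
        refine (t1.add (t2.congr_right (g₂ := fun w => ‖w‖ ^ 3) fun w => by simp)).congr_left
          fun w => ?_
        simp only [Function.comp]; ring
      have t4 : (fun w : ℂ => ‖w‖ ^ 3) =o[𝓝 0] fun w => w ^ 2 := by
        have := (Asymptotics.isLittleO_norm_pow_norm_pow (E' := ℂ) (by norm_num : 2 < 3))
        exact this.trans_isBigO (Asymptotics.isBigO_of_le _ fun w => by simp)
      have t5 := (t3.trans_isLittleO t4).tendsto_div_nhds_zero.mono_left
        (nhdsWithin_le_nhds (s := {0}ᶜ))
      have t6 := t5.add_const (6 * s4 τ hτ)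
      rw [zero_add] at t6
      refine t6.congr' ?_
      filter_upwards [self_mem_nhdsWithin] with w hw
      have hw0 : w ≠ 0 := hw
      field_simp
      ring
    have h5 := ((sq_mul_dfun_tendsto (τ := τ) (hτ := hτ)).mul h4).add h3
    rw [one_mul, add_zero] at h5
    refine h5.congr' ?_
    filter_upwards [self_mem_nhdsWithin] with w hw
    have hw0 : w ≠ 0 := hw
    simp only [dfun_sub_tau_eq, add_comm w τ]
    field_simp
    ring

end

/-! ### Fourier expansions and Lambert series -/

section

variable {τ : ℂ} {hτ : 0 < τ.im}

theorem analyticOnNhd_dfun : AnalyticOnNhd ℂ (dfun τ hτ) ((L3 τ hτ).lattice : Set ℂ)ᶜ :=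
  fun z hz => ((L3 τ hτ).analyticOnNhd_weierstrassP z hz).sub analyticAt_const

theorem countable_unitPair {c : ℂ} {hc : 0 < c.im} :
    ((unitPair c hc).lattice : Set ℂ).Countable := by
  refine (Set.countable_range fun x : ℤ × ℤ => (x.1 + x.2 * c : ℂ)).mono ?_
  intro z hz
  obtain ⟨m, n, h⟩ := mem_unitPair.1 hz
  exact ⟨(m, n), h⟩

theorem dfun_ne_zero_eventually : ∀ᶠ w in 𝓝[≠] 0, dfun τ hτ w ≠ 0 := by
  have := (sq_mul_dfun_tendsto (τ := τ) (hτ := hτ)).eventually_ne one_ne_zero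
  filter_upwards [this] with w hw h
  rw [h, mul_zero] at hw
  exact hw rfl

/-- The zero of `dfun` at `τ` is simple: otherwise the constant product of its translates would
vanish, and `dfun` would vanish identically. -/
theorem s3_ne_zero : s3 τ hτ ≠ 0 := by
  intro h
  have hprod : ∀ᶠ w in 𝓝[≠] (0 : ℂ), dfun τ hτ (τ + w) * dfun τ hτ (τ + -w) = 0 := by
    filter_upwards [self_mem_nhdsWithin, mem_nhdsWithin_of_mem_nhds
      ((unitPair τ hτ).compl_lattice_sdiff_singleton_mem_nhds 0),
      dfun_ne_zero_eventually (τ := τ) (hτ := hτ)] with w hw hw' hne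
    have := dfun_prod (τ := τ) (hτ := hτ) (z := w) (by simp_all)
    rw [h, dfun_sub_tau_eq, add_comm w τ] at this
    simpa [mul_assoc, hne] using this
  have hfreq : ∃ᶠ w in 𝓝[≠] (0 : ℂ), dfun τ hτ (τ + w) = 0 := by
    have h1 : ∃ᶠ w in 𝓝[≠] (0 : ℂ), dfun τ hτ (τ + w) = 0 ∨ dfun τ hτ (τ + -w) = 0 :=
      (hprod.mono fun w hw => mul_eq_zero.1 hw).frequently
    rcases frequently_or_distrib.1 h1 with h2 | h2
    · exact h2
    · intro hcon
      exact h2 (neg_tendsto_punctured.eventually hcon)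
  have htr : Tendsto (fun w : ℂ => τ + w) (𝓝[≠] 0) (𝓝[≠] τ) := by
    refine tendsto_nhdsWithin_iff.2 ⟨?_, ?_⟩
    · have : Tendsto (fun w : ℂ => τ + w) (𝓝 0) (𝓝 (τ + 0)) := tendsto_id.const_add τ
      rw [add_zero] at this
      exact this.mono_left nhdsWithin_le_nhds
    · filter_upwards [self_mem_nhdsWithin] with w hw
      simpa using hw
  have hfreq' : ∃ᶠ w in 𝓝[≠] τ, dfun τ hτ w = 0 := htr.frequently hfreq
  have hconn : IsPreconnected ((L3 τ hτ).lattice : Set ℂ)ᶜ :=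
    (countable_unitPair.isConnected_compl_of_one_lt_rank (by simp)).isPreconnected
  have hz := analyticOnNhd_dfun.eqOn_zero_of_preconnected_of_frequently_eq_zero hconn
    (tau_notMem (τ := τ) (hτ := hτ)) hfreq'
  have h0 : ∀ᶠ w in 𝓝[≠] (0 : ℂ), dfun τ hτ w = 0 := by
    filter_upwards [self_mem_nhdsWithin, mem_nhdsWithin_of_mem_nhds
      ((L3 τ hτ).compl_lattice_sdiff_singleton_mem_nhds 0)] with w hw hw'
    exact hz (by simp_all)
  obtain ⟨w, h1, h2⟩ := (h0.and dfun_ne_zero_eventually).exists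
  exact h2 h1

/-- `e z = exp (2πiz)`. -/
noncomputable def e (z : ℂ) : ℂ := exp (2 * Real.pi * I * z)

theorem e_add (z w : ℂ) : e (z + w) = e z * e w := by
  rw [e, e, e, ← exp_add, mul_add]

theorem e_neg (z : ℂ) : e (-z) = (e z)⁻¹ := by
  rw [e, e, ← exp_neg]; congr 1; ring

theorem e_ne_zero (z : ℂ) : e z ≠ 0 := exp_ne_zero _

theorem e_nat_mul (n : ℕ) (z : ℂ) : e (n * z) = e z ^ n := by
  rw [e, e, ← exp_nat_mul]; congr 1; ring

theorem e_int (n : ℤ) : e n = 1 := by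
  rw [e, mul_comm]; exact exp_int_mul_two_pi_mul_I n

theorem e_one : e 1 = 1 := by simpa using e_int 1

theorem e_add_one (z : ℂ) : e (z + 1) = e z := by rw [e_add, e_one, mul_one]

theorem norm_e (z : ℂ) : ‖e z‖ = Real.exp (-(2 * Real.pi * z.im)) := by
  rw [e, norm_exp]; congr 1; simp

theorem norm_e_lt_one {z : ℂ} (hz : 0 < z.im) : ‖e z‖ < 1 := by
  rw [norm_e, Real.exp_lt_one_iff]
  have := Real.pi_pos
  have : 0 < 2 * Real.pi * z.im := by positivity
  linarith

theorem differentiable_e : Differentiable ℂ e := by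
  unfold e; fun_prop

theorem hasDerivAt_e (z : ℂ) : HasDerivAt e (2 * Real.pi * I * e z) z := by
  have := ((hasDerivAt_id z).const_mul (2 * Real.pi * I)).cexp
  rw [mul_one] at this
  exact this.congr_deriv (mul_comm _ _)

/-- The Lambert series `∑ m ^ k x ^ m / (1 - y ^ m)`. -/
noncomputable def lam (k : ℕ) (x y : ℂ) : ℂ := ∑' m : ℕ, (m : ℂ) ^ k * x ^ m / (1 - y ^ m)

theorem summable_lam_aux (k : ℕ) {x : ℂ} {y : ℂ} (hx : ‖x‖ < 1) (hy : ‖y‖ < 1) :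
    Summable fun m : ℕ => ‖(m : ℂ) ^ k * x ^ m / (1 - y ^ m)‖ := by
  have hs := (summable_norm_pow_mul_geometric_of_norm_lt_one k hx).mul_right (1 - ‖y‖)⁻¹
  refine Summable.of_nonneg_of_le (fun _ => norm_nonneg _) (fun m => ?_) hs
  have h1 : 0 < 1 - ‖y‖ := by linarith
  rw [norm_div, div_eq_mul_inv]
  rcases Nat.eq_zero_or_pos m with rfl | hm
  · simp; positivity
  · gcongr
    calc 1 - ‖y‖ ≤ 1 - ‖y ^ m‖ := by
          rw [norm_pow]
          have := pow_le_of_le_one (norm_nonneg y) hy.le hm.ne'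
          linarith
      _ ≤ ‖1 - y ^ m‖ := by
          have := norm_sub_norm_le (1 : ℂ) (y ^ m)
          rwa [norm_one] at this

theorem hasSum_lam (k : ℕ) {x y : ℂ} (hx : ‖x‖ < 1) (hy : ‖y‖ < 1) :
    HasSum (fun m : ℕ => (m : ℂ) ^ k * x ^ m / (1 - y ^ m)) (lam k x y) :=
  (summable_lam_aux k hx hy).of_norm.hasSum

/-- A Lambert series, with the geometric series in the denominators expanded. -/
theorem hasSum_lam_rows {k : ℕ} (hk : k ≠ 0) {x y : ℂ} (hx : ‖x‖ < 1) (hy : ‖y‖ < 1) :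
    HasSum (fun n : ℕ => ∑' m : ℕ, (m : ℂ) ^ k * (x * y ^ n) ^ m) (lam k x y) := by
  have hs : Summable fun q : ℕ × ℕ => (q.1 : ℂ) ^ k * (x * y ^ q.2) ^ q.1 := by
    have h1 := (summable_norm_pow_mul_geometric_of_norm_lt_one k hx).mul_of_nonneg
      (summable_geometric_of_lt_one (norm_nonneg y) hy) (fun _ => norm_nonneg _)
      (fun _ => by positivity)
    refine Summable.of_norm_bounded h1 fun q => ?_
    rcases Nat.eq_zero_or_pos q.1 with h | h
    · simp [h, zero_pow hk]
    · rw [norm_mul, norm_mul, mul_pow, ← pow_mul, norm_mul, mul_assoc]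
      gcongr ‖_‖ * (‖_‖ * ?_)
      rw [norm_pow]
      exact pow_le_pow_of_le_one (norm_nonneg y) hy.le (Nat.le_mul_of_pos_right _ h)
  have h2 : HasSum (fun q : ℕ × ℕ => (q.1 : ℂ) ^ k * (x * y ^ q.2) ^ q.1) (lam k x y) := by
    have h3 := hs.hasSum.prod_fiberwise (g := fun m : ℕ => (m : ℂ) ^ k * x ^ m / (1 - y ^ m))
      fun m => ?_
    · rw [(hasSum_lam k hx hy).unique h3]; exact hs.hasSum
    · rcases Nat.eq_zero_or_pos m with rfl | h
      · simp [zero_pow hk]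
      · have hy' : ‖y ^ m‖ < 1 := by rw [norm_pow]; exact pow_lt_one₀ (norm_nonneg _) hy h.ne'
        have := (hasSum_geometric_of_norm_lt_one hy').mul_left ((m : ℂ) ^ k * x ^ m)
        rw [div_eq_mul_inv]
        refine this.congr_fun fun n => ?_
        rw [mul_pow, ← pow_mul, ← pow_mul, mul_comm n m, mul_assoc]
  have h3 := ((Equiv.prodComm ℕ ℕ).hasSum_iff.2 h2)
  exact h3.prod_fiberwise fun n => (h3.summable.prod_factor n).hasSum

/-- The sum of `(w + j)⁻ʳ` over a row of a lattice. -/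
noncomputable def row (r : ℕ) (w : ℂ) : ℂ := ∑' j : ℤ, 1 / (w + j) ^ r

theorem summable_row {r : ℕ} (hr : 2 ≤ r) (w : ℂ) : Summable fun j : ℤ => 1 / (w + j) ^ r := by
  have h := EisensteinSeries.linear_right_summable w 1 (k := r) (by exact_mod_cast hr)
  simpa using h

theorem row_neg (r : ℕ) (w : ℂ) : row r (-w) = (-1) ^ r * row r w := by
  unfold row
  rw [← tsum_mul_left, ← (Equiv.neg ℤ).tsum_eq]
  refine tsum_congr fun j => ?_
  have : -w + ((Equiv.neg ℤ j : ℤ) : ℂ) = -1 * (w + j) := by simp; ring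
  rw [this, mul_pow, one_div, mul_inv, one_div]
  congr 1
  rw [← inv_pow]; norm_num

/-- Lipschitz' formula. -/
theorem row_of_im_pos {r : ℕ} (hr : 2 ≤ r) {w : ℂ} (hw : 0 < w.im) :
    row r w = (-2 * Real.pi * I) ^ r / (r - 1).factorial * ∑' m : ℕ, (m : ℂ) ^ (r - 1) *
      e w ^ m := by
  obtain ⟨k, rfl⟩ : ∃ k, r = k + 1 := ⟨r - 1, by omega⟩
  exact EisensteinSeries.qExpansion_identity (by omega) ⟨w, hw⟩

/-- A sum over the lattice `ℤ + cℤ`, row by row. -/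
theorem hasSum_rows {c : ℂ} {hc : 0 < c.im} {f : ℂ → ℂ}
    (hf : Summable fun l : (unitPair c hc).lattice => f l) :
    HasSum (fun n : ℤ => ∑' j : ℤ, f (j + n * c)) (∑' l : (unitPair c hc).lattice, f l) := by
  have h1 : HasSum (fun x : ℤ × ℤ => f (x.1 + x.2 * c)) (∑' l : (unitPair c hc).lattice, f l) := by
    have := ((unitPair c hc).latticeEquivProd.symm.toEquiv.hasSum_iff).2 hf.hasSum
    refine this.congr_fun fun x => ?_
    have h2 := (unitPair c hc).latticeEquiv_symm_apply x
    have h3 : (x.1 : ℂ) + x.2 * c = ((unitPair c hc).latticeEquivProd.symm x : ℂ) := by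
      rw [h2]; simp [unitPair]
    rw [h3]; rfl
  have h3 := ((Equiv.prodComm ℤ ℤ).hasSum_iff.2 h1)
  exact h3.prod_fiberwise fun n => (h3.summable.prod_factor n).hasSum

/-- The constant in Lipschitz' formula. -/
noncomputable def lip (r : ℕ) : ℂ := (-2 * Real.pi * I) ^ r / (r - 1).factorial

/-- Lipschitz' formula, summed over the rows of a half lattice. -/
theorem hasSum_row_nat {r : ℕ} (hr : 2 ≤ r) {a σ : ℂ} (ha : 0 < a.im) (hσ : 0 < σ.im) :
    HasSum (fun n : ℕ => row r (a + n * σ)) (lip r * lam (r - 1) (e a) (e σ)) := by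
  have h := (hasSum_lam_rows (k := r - 1) (by omega) (norm_e_lt_one ha) (norm_e_lt_one hσ)).mul_left
    (lip r)
  refine h.congr_fun fun n => ?_
  have him : 0 < (a + n * σ).im := by
    have : (a + n * σ).im = a.im + n * σ.im := by simp
    rw [this]; positivity
  rw [row_of_im_pos hr him, lip]
  simp only [e_add, e_nat_mul]

/-- The Fourier expansion of `dfun` in the strip below the real axis. -/
theorem dfun_fourier {z : ℂ} (h1 : -(3 * τ.im) < z.im) (h2 : z.im < 0) :
    dfun τ hτ z = (2 * Real.pi * I) ^ 2 * (lam 1 (e (-z)) (e τ ^ 3) +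
      lam 1 (e τ ^ 3 * e z) (e τ ^ 3)
      - (lam 1 (e τ) (e τ ^ 3) + lam 1 (e τ ^ 2) (e τ ^ 3))) := by
  set L := L3 τ hτ
  have h0 : dfun τ hτ z = ∑' l : L.lattice, (1 / (z - l) ^ 2 - 1 / (-τ - l) ^ 2) := by
    have := ((L.hasSum_weierstrassP z).sub (L.hasSum_weierstrassP (-τ))).tsum_eq
    rw [dfun, ← L.weierstrassP_neg τ, ← this]
    exact tsum_congr fun l => by ring
  have hsum : Summable fun l : L.lattice => (1 / (z - l) ^ 2 - 1 / (-τ - l) ^ 2) := by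
    have := ((L.hasSum_weierstrassP z).sub (L.hasSum_weierstrassP (-τ))).summable
    exact this.congr fun l => by ring
  have hrow : ∀ w : ℂ, ∀ n : ℤ, HasSum (fun j : ℤ => 1 / (w - (j + n * (3 * τ))) ^ 2)
      (row 2 (n * (3 * τ) - w)) := by
    intro w n
    refine (summable_row le_rfl _).hasSum.congr_fun fun j => ?_
    congr 1; ring
  have key : HasSum (fun n : ℤ => row 2 (n * (3 * τ) - z) - row 2 (n * (3 * τ) - -τ))
      (dfun τ hτ z) := by
    rw [h0]
    refine (hasSum_rows (f := fun l => 1 / (z - l) ^ 2 - 1 / (-τ - l) ^ 2) hsum).congr_fun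
      fun n => ?_
    exact ((hrow z n).sub (hrow (-τ) n)).tsum_eq.symm
  have h3 : 0 < (3 * τ).im := three_mul_im_pos hτ
  have h3' : (3 * τ).im = 3 * τ.im := by simp
  have r1 := hasSum_row_nat (r := 2) le_rfl (a := -z) (σ := 3 * τ) (by simpa using h2) h3
  have r2 := hasSum_row_nat (r := 2) le_rfl (a := τ) (σ := 3 * τ) hτ h3
  have r3 := hasSum_row_nat (r := 2) le_rfl (a := 3 * τ + z) (σ := 3 * τ)
    (by rw [add_im, h3']; linarith) h3
  have r4 := hasSum_row_nat (r := 2) le_rfl (a := 2 * τ) (σ := 3 * τ)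
    (by have : (2 * τ).im = 2 * τ.im := by simp
        rw [this]; positivity) h3
  have e3 : e (3 * τ) = e τ ^ 3 := by exact_mod_cast e_nat_mul 3 τ
  have e2 : e (2 * τ) = e τ ^ 2 := by exact_mod_cast e_nat_mul 2 τ
  rw [e3] at r1 r2 r3 r4
  rw [e_add, e3] at r3
  rw [e2] at r4
  have hp := HasSum.of_nat_of_neg_add_one
    (f := fun n : ℤ => row 2 (n * (3 * τ) - z) - row 2 (n * (3 * τ) - -τ))
    ((r1.sub r2).congr_fun fun n => by
      simp only [Int.cast_natCast]; congr 2 <;> ring)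
    ((r3.sub r4).congr_fun fun n => by
      have a1 : ((-((n : ℤ) + 1) : ℤ) : ℂ) * (3 * τ) - z = -(3 * τ + z + n * (3 * τ)) := by
        push_cast; ring
      have a2 : ((-((n : ℤ) + 1) : ℤ) : ℂ) * (3 * τ) - -τ = -(2 * τ + n * (3 * τ)) := by
        push_cast; ring
      rw [a1, a2, row_neg, row_neg]; norm_num)
  rw [key.unique hp]
  simp only [lip]
  norm_num
  ring

/-- The Fourier expansion of the lattice sum `∑ (l - τ)⁻ʳ`: the rows above and below `τ` give one
Lambert series each. -/
theorem sumInvPow_eq {r : ℕ} (hr : 3 ≤ r) : (L3 τ hτ).sumInvPow τ r =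
    lip r * (lam (r - 1) (e τ ^ 2) (e τ ^ 3) + (-1) ^ r * lam (r - 1) (e τ) (e τ ^ 3)) := by
  set L := L3 τ hτ
  have hsum := (L.hasSum_sumInvPow τ (r := r) (by omega)).summable
  have key := hasSum_rows (f := fun l => ((l - τ) ^ r)⁻¹) hsum
  have h3 : 0 < (3 * τ).im := three_mul_im_pos hτ
  have r2 := (hasSum_row_nat (r := r) (by omega) (a := τ) (σ := 3 * τ) hτ h3).mul_left ((-1) ^ r)
  have r4 := hasSum_row_nat (r := r) (by omega) (a := 2 * τ) (σ := 3 * τ)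
    (by have : (2 * τ).im = 2 * τ.im := by simp
        rw [this]; positivity) h3
  have e3 : e (3 * τ) = e τ ^ 3 := by exact_mod_cast e_nat_mul 3 τ
  have e2 : e (2 * τ) = e τ ^ 2 := by exact_mod_cast e_nat_mul 2 τ
  rw [e3] at r2 r4
  rw [e2] at r4
  have hrow : ∀ n : ℤ, ∑' j : ℤ, ((j + n * (3 * τ) - τ) ^ r)⁻¹ = row r (n * (3 * τ) - τ) := by
    intro n
    refine tsum_congr fun j => ?_
    rw [one_div]; congr 2; ring
  simp only [hrow] at key
  have hp := HasSum.of_nat_of_neg_add_one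
    (f := fun n : ℤ => row r ((n + 1 : ℤ) * (3 * τ) - τ))
    (r4.congr_fun fun n => by
      push_cast; congr 1; ring)
    (r2.congr_fun fun n => by
      have a1 : ((-((n : ℤ) + 1) + 1 : ℤ) : ℂ) * (3 * τ) - τ = -(τ + n * (3 * τ)) := by
        push_cast; ring
      rw [a1, row_neg])
  have key' := (Equiv.addRight (1 : ℤ)).hasSum_iff.2 key
  have := key'.unique hp
  rw [PeriodPair.sumInvPow, this]
  ring

theorem s3_eq : s3 τ hτ = (-2 * Real.pi * I) ^ 3 / 2 *
    (lam 2 (e τ ^ 2) (e τ ^ 3) - lam 2 (e τ) (e τ ^ 3)) := by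
  rw [s3, sumInvPow_eq le_rfl, lip]
  norm_num
  ring

theorem s4_eq : s4 τ hτ = (2 * Real.pi * I) ^ 4 / 6 *
    (lam 3 (e τ ^ 2) (e τ ^ 3) + lam 3 (e τ) (e τ ^ 3)) := by
  rw [s4, sumInvPow_eq (by norm_num), lip]
  norm_num [Nat.factorial]

end

/-! ### Integrals over a horizontal period -/

section

/-- The integral of `g` over a horizontal unit segment at height `h`. -/
noncomputable def mean (h : ℝ) (g : ℂ → ℂ) : ℂ := ∫ x in (0 : ℝ)..1, g (x + h * I)

theorem periodic_line {g : ℂ → ℂ} (hg : Function.Periodic g 1) (w : ℂ) :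
    Function.Periodic (fun x : ℝ => g (x + w)) 1 := by
  intro x
  have : ((x + 1 : ℝ) : ℂ) + w = x + w + 1 := by push_cast; ring
  simp only [this, hg _]

theorem mean_eq_integral {g : ℂ → ℂ} (hg : Function.Periodic g 1) (h a : ℝ) :
    mean h g = ∫ x in a..a + 1, g (x + h * I) := by
  have := (periodic_line hg (h * I)).intervalIntegral_add_eq 0 a
  rw [zero_add] at this
  exact this

/-- **Cauchy's theorem** for a rectangle. -/
theorem integral_rect {F : ℂ → ℂ} {a b h₁ h₂ : ℝ}
    (hF : ∀ z : ℂ, z.re ∈ Set.uIcc a b → z.im ∈ Set.uIcc h₁ h₂ → DifferentiableAt ℂ F z) :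
    (∫ x in a..b, F (x + h₁ * I)) - (∫ x in a..b, F (x + h₂ * I)) +
      I * (∫ y in h₁..h₂, F (b + y * I)) - I * (∫ y in h₁..h₂, F (a + y * I)) = 0 := by
  have := integral_boundary_rect_eq_zero_of_differentiableOn F (a + h₁ * I) (b + h₂ * I) (by
    intro z hz
    rw [mem_reProdIm] at hz
    simp only [add_re, ofReal_re, mul_re, I_re, mul_zero, ofReal_im, I_im, mul_one, sub_self,
      add_zero, add_im, mul_im, zero_add] at hz
    exact (hF z hz.1 hz.2).differentiableWithinAt)
  simpa using this

/-- **Cauchy's theorem** in a horizontal strip, for a function of period `1`. -/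
theorem mean_eq_mean {g : ℂ → ℂ} (hg : Function.Periodic g 1) {h₁ h₂ : ℝ} (h : h₁ ≤ h₂)
    (hd : ∀ z : ℂ, h₁ ≤ z.im → z.im ≤ h₂ → DifferentiableAt ℂ g z) : mean h₁ g = mean h₂ g := by
  have := integral_rect (F := g) (a := 0) (b := 1) (h₁ := h₁) (h₂ := h₂) (by
    intro z _ hz
    rw [Set.uIcc_of_le h] at hz
    exact hd z hz.1 hz.2)
  have hv : ∀ y : ℝ, g ((1 : ℝ) + y * I) = g ((0 : ℝ) + y * I) := by
    intro y
    rw [← hg (((0 : ℝ) : ℂ) + y * I)]; congr 1; push_cast; ring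
  simp only [hv] at this
  rw [mean, mean]
  linear_combination this

theorem mean_shift {g : ℂ → ℂ} (hg : Function.Periodic g 1) (h : ℝ) (c : ℂ) :
    mean h (fun z => g (z + c)) = mean (h + c.im) g := by
  rw [mean_eq_integral hg (h + c.im) c.re, mean]
  have : ∀ x : ℝ, (x : ℂ) + h * I + c = ((x + c.re : ℝ) : ℂ) + ((h + c.im : ℝ) : ℂ) * I := by
    intro x
    apply Complex.ext <;> simp
  simp only [this]
  rw [intervalIntegral.integral_comp_add_right (fun x : ℝ => g (x + ((h + c.im : ℝ) : ℂ) * I)) c.re]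
  rw [zero_add, add_comm 1 c.re]

theorem mean_neg {g : ℂ → ℂ} (hg : Function.Periodic g 1) (h : ℝ) :
    mean h (fun z => g (-z)) = mean (-h) g := by
  rw [mean_eq_integral hg (-h) (-1), mean]
  have : ∀ x : ℝ, -((x : ℂ) + h * I) = ((-x : ℝ) : ℂ) + ((-h : ℝ) : ℂ) * I := by
    intro x
    push_cast; ring
  simp only [this]
  rw [intervalIntegral.integral_comp_neg (fun x : ℝ => g (x + ((-h : ℝ) : ℂ) * I))]
  simp

theorem norm_mean_le {g : ℂ → ℂ} {h K : ℝ} (hg : ∀ x : ℝ, ‖g (x + h * I)‖ ≤ K) :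
    ‖mean h g‖ ≤ K := by
  have := intervalIntegral.norm_integral_le_of_norm_le_const (a := 0) (b := 1) (C := K)
    (f := fun x : ℝ => g (x + h * I)) fun x _ => hg x
  simpa [mean] using this

theorem mean_congr {g g' : ℂ → ℂ} {h : ℝ} (H : ∀ z : ℂ, z.im = h → g z = g' z) :
    mean h g = mean h g' := by
  unfold mean
  congr 1
  funext x
  exact H _ (by simp)

theorem mean_const_mul (c : ℂ) (g : ℂ → ℂ) (h : ℝ) :
    mean h (fun z => c * g z) = c * mean h g := by
  unfold mean
  exact intervalIntegral.integral_const_mul _ _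

theorem continuous_line {g : ℂ → ℂ} {h : ℝ} (hd : ∀ z : ℂ, z.im = h → DifferentiableAt ℂ g z) :
    Continuous fun x : ℝ => g (x + h * I) := by
  rw [continuous_iff_continuousAt]
  intro x
  have h1 : ContinuousAt g (x + h * I) := (hd _ (by simp)).continuousAt
  have h2 : ContinuousAt (fun x : ℝ => (x : ℂ) + h * I) x := by fun_prop
  exact ContinuousAt.comp (f := fun x : ℝ => (x : ℂ) + h * I) h1 h2

theorem mean_sub {g g' : ℂ → ℂ} {h : ℝ} (hg : ∀ z : ℂ, z.im = h → DifferentiableAt ℂ g z)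
    (hg' : ∀ z : ℂ, z.im = h → DifferentiableAt ℂ g' z) :
    mean h (fun z => g z - g' z) = mean h g - mean h g' := by
  unfold mean
  exact intervalIntegral.integral_sub ((continuous_line hg).intervalIntegrable _ _)
    ((continuous_line hg').intervalIntegrable _ _)

theorem mean_add {g g' : ℂ → ℂ} {h : ℝ} (hg : ∀ z : ℂ, z.im = h → DifferentiableAt ℂ g z)
    (hg' : ∀ z : ℂ, z.im = h → DifferentiableAt ℂ g' z) :
    mean h (fun z => g z + g' z) = mean h g + mean h g' := by
  unfold mean
  exact intervalIntegral.integral_add ((continuous_line hg).intervalIntegrable _ _)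
    ((continuous_line hg').intervalIntegrable _ _)

theorem e_sub_one_ne_zero {z : ℂ} (hz : z.im ≠ 0) : e z - 1 ≠ 0 := by
  intro h
  have h1 : ‖e z‖ = 1 := by rw [sub_eq_zero.1 h, norm_one]
  rw [norm_e, Real.exp_eq_one_iff] at h1
  have := Real.pi_pos
  have : 2 * Real.pi * z.im = 0 := by linarith
  rcases mul_eq_zero.1 this with h | h
  · linarith
  · exact hz h

theorem eq_zero_of_e_eq_one {z : ℂ} (h : e z = 1) (hz : |z.re| < 1) : z = 0 := by
  rw [e, exp_eq_one_iff] at h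
  obtain ⟨n, hn⟩ := h
  have hpi : (2 * Real.pi * I : ℂ) ≠ 0 := two_pi_I_ne_zero
  have h1 : z = n := by
    apply mul_left_cancel₀ hpi
    linear_combination hn
  rw [h1] at hz ⊢
  simp only [intCast_re] at hz
  have : |n| < 1 := by exact_mod_cast hz
  rw [Int.abs_lt_one_iff.1 this]; simp

/-- Below the real axis `1 / (e z - 1)` tends to `0` for `Im z → -∞`. -/
theorem mean_cot_neg {h : ℝ} (hh : 0 < h) : mean (-h) (fun z => (e z - 1)⁻¹) = 0 := by
  have hp : Function.Periodic (fun z => (e z - 1)⁻¹) 1 := fun z => by simp only [e_add_one]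
  have hconst : ∀ H : ℝ, h ≤ H → mean (-H) (fun z => (e z - 1)⁻¹) =
      mean (-h) (fun z => (e z - 1)⁻¹) := by
    intro H hH
    refine mean_eq_mean hp (by linarith) fun z h1 h2 => ?_
    exact ((differentiable_e z).sub_const 1).inv (e_sub_one_ne_zero (by linarith))
  have hle : ∀ H : ℝ, h ≤ H → ‖mean (-h) (fun z => (e z - 1)⁻¹)‖ ≤
      (Real.exp (2 * Real.pi * H) - 1)⁻¹ := by
    intro H hH
    rw [← hconst H hH]
    refine norm_mean_le fun x => ?_
    rw [norm_inv]
    have h1 : 1 < Real.exp (2 * Real.pi * H) := by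
      have := Real.pi_pos; have : 0 < H := by linarith
      rw [Real.one_lt_exp_iff]; positivity
    refine inv_anti₀ (by linarith) ?_
    have := norm_sub_norm_le (e (x + (-H : ℝ) * I)) 1
    rw [norm_e, norm_one] at this
    simpa using this
  have hlim : Tendsto (fun H : ℝ => (Real.exp (2 * Real.pi * H) - 1)⁻¹) atTop (𝓝 0) := by
    refine Tendsto.inv_tendsto_atTop (tendsto_atTop_add_const_right _ (-1) ?_)
    refine Real.tendsto_exp_atTop.comp ?_
    exact tendsto_id.const_mul_atTop (by have := Real.pi_pos; positivity)
  have := ge_of_tendsto hlim (eventually_atTop.2 ⟨h, hle⟩)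
  exact norm_le_zero_iff.1 this

/-- Above the real axis `1 / (e z - 1)` tends to `-1` for `Im z → ∞`. -/
theorem mean_cot_pos {h : ℝ} (hh : 0 < h) : mean h (fun z => (e z - 1)⁻¹) = -1 := by
  have hp : Function.Periodic (fun z => (e z - 1)⁻¹) 1 := fun z => by simp only [e_add_one]
  have h1 : mean h (fun z => (e (-z) - 1)⁻¹) = 0 := by
    rw [mean_neg (g := fun z => (e z - 1)⁻¹) hp, mean_cot_neg hh]
  have h2 : mean h (fun z => (e z - 1)⁻¹) = mean h (fun z => -1 - (e (-z) - 1)⁻¹) := by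
    refine mean_congr fun z hz => ?_
    have a1 := e_sub_one_ne_zero (z := z) (by rw [hz]; exact hh.ne')
    have a2 : e (-z) - 1 ≠ 0 := e_sub_one_ne_zero (z := -z) (by simp [hz, hh.ne'])
    rw [e_neg] at a2 ⊢
    have a3 := e_ne_zero z
    have a4 : 1 - e z ≠ 0 := fun h => a1 (by linear_combination -h)
    have a5 : (e z)⁻¹ - 1 = (1 - e z) / e z := by field_simp
    rw [a5]
    field_simp
    ring
  have hconst : mean h (fun _ => -1) = -1 := by simp [mean]
  rw [h2, mean_sub (g := fun _ => -1) (fun z _ => by fun_prop), h1, hconst, sub_zero]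
  intro z hz
  have : DifferentiableAt ℂ (fun z => e (-z)) z :=
    (differentiable_e (-z)).comp z differentiableAt_id.neg
  exact (this.sub_const 1).inv (e_sub_one_ne_zero (z := -z) (by simp [hz, hh.ne']))

variable {τ : ℂ} {hτ : 0 < τ.im}

/-- The residue theorem for the double pole of `dfun` at `0`. -/
theorem mean_residue {g : ℂ → ℂ} {h h' : ℝ} (hh : 0 < h) (hh' : h < h') (hτ' : h' ≤ 3 * τ.im)
    (hg : ∀ z : ℂ, -h' < z.im → z.im < h' → DifferentiableAt ℂ g z)
    (hp : Function.Periodic g 1) (h0 : g 0 = 0) :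
    mean (-h) (fun z => dfun τ hτ z * g z) - mean h (fun z => dfun τ hτ z * g z) =
      2 * Real.pi * I * deriv g 0 := by
  set c : ℂ := 2 * Real.pi * I * deriv g 0 with hc
  set φ : ℂ → ℂ := fun z => dfun τ hτ z * g z - c * (e z - 1)⁻¹ with hφ
  have hφp : Function.Periodic φ 1 := by
    intro z
    simp only [hφ, dfun_add_one, hp z, e_add_one]
  set s : Set ℂ := {z | z.re ∈ Set.Ioo (-1) 1 ∧ z.im ∈ Set.Ioo (-h') h'} with hs
  have hso : IsOpen s := by
    have : s = re ⁻¹' Set.Ioo (-1) 1 ∩ im ⁻¹' Set.Ioo (-h') h' := rfl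
    rw [this]
    exact (isOpen_Ioo.preimage continuous_re).inter (isOpen_Ioo.preimage continuous_im)
  have h0s : s ∈ 𝓝 (0 : ℂ) := hso.mem_nhds ⟨by norm_num, by simp only [zero_im]; constructor <;> linarith⟩
  have hdφ : ∀ z : ℂ, z ∈ s → z ≠ 0 → DifferentiableAt ℂ φ z := by
    intro z hz hz0
    have h1 : z ∉ (L3 τ hτ).lattice := by
      intro hmem
      obtain ⟨m, n, hmn⟩ := mem_unitPair.1 hmem
      have him : z.im = n * (3 * τ.im) := by rw [← hmn]; simp
      have hn : n = 0 := by
        have h1 := hz.2.1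
        have h2 := hz.2.2
        rw [him] at h1 h2
        have h3 : (n : ℝ) < 1 := by nlinarith
        have h4 : (-1 : ℝ) < n := by nlinarith
        have h3' : n < 1 := by exact_mod_cast h3
        have h4' : -1 < n := by exact_mod_cast h4
        omega
      subst hn
      have hre : z = m := by rw [← hmn]; simp
      have h5 := hz.1
      rw [hre] at h5
      simp only [intCast_re] at h5
      have h6 : m < 1 := by exact_mod_cast h5.2
      have h7 : -1 < m := by exact_mod_cast h5.1
      have : m = 0 := by omega
      exact hz0 (by rw [hre, this]; simp)
    have h2 : e z - 1 ≠ 0 := fun h =>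
      hz0 (eq_zero_of_e_eq_one (sub_eq_zero.1 h) (abs_lt.2 hz.1))
    exact ((differentiableAt_dfun h1).mul (hg z hz.2.1 hz.2.2)).sub
      ((((differentiable_e z).sub_const 1).inv h2).const_mul c)
  have hlim : Tendsto (fun z => z * φ z) (𝓝[≠] 0) (𝓝 0) := by
    have hg0 : HasDerivAt g (deriv g 0) 0 :=
      (hg 0 (by simp; linarith) (by simp; linarith)).hasDerivAt
    have t1 := hasDerivAt_iff_tendsto_slope_zero.1 hg0
    simp only [zero_add, h0, sub_zero, smul_eq_mul] at t1
    have t2 := (sq_mul_dfun_tendsto (τ := τ) (hτ := hτ)).mul t1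
    have he0 : HasDerivAt e (2 * Real.pi * I) 0 := by
      have := hasDerivAt_e 0
      rwa [show e 0 = 1 by simp [e], mul_one] at this
    have t3 := hasDerivAt_iff_tendsto_slope_zero.1 he0
    simp only [zero_add, show e 0 = 1 by simp [e], smul_eq_mul] at t3
    have t4 := (t3.inv₀ two_pi_I_ne_zero).const_mul c
    have t5 := t2.sub t4
    have : (1 : ℂ) * deriv g 0 - c * (2 * Real.pi * I)⁻¹ = 0 := by
      rw [hc]; field_simp [two_pi_I_ne_zero]; ring
    rw [this] at t5
    refine t5.congr' ?_
    filter_upwards [self_mem_nhdsWithin] with z hz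
    have hz0 : z ≠ 0 := hz
    simp only [hφ, mul_inv, inv_inv]
    field_simp
  have ho : (fun z => φ z - φ 0) =o[𝓝[≠] 0] fun z => (z - 0)⁻¹ := by
    rw [Asymptotics.isLittleO_iff_tendsto' (by
      filter_upwards [self_mem_nhdsWithin] with z hz h
      have hz0 : z ≠ 0 := hz
      simp [hz0] at h)]
    have hid : Tendsto (fun w : ℂ => w * φ 0) (𝓝[≠] 0) (𝓝 0) := by
      have := (tendsto_id.mono_left nhdsWithin_le_nhds : Tendsto (fun w : ℂ => w) (𝓝[≠] 0) (𝓝 0))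
      simpa using this.mul_const (φ 0)
    have := hlim.sub hid
    rw [sub_zero] at this
    refine this.congr fun z => ?_
    rw [sub_zero, div_inv_eq_mul]; ring
  have hd := differentiableOn_update_limUnder_of_isLittleO h0s
    (fun z hz => (hdφ z hz.1 hz.2).differentiableWithinAt) ho
  set ψ := Function.update φ 0 (limUnder (𝓝[≠] 0) φ) with hψ
  have hψφ : ∀ z, z ≠ 0 → ψ z = φ z := fun z hz => Function.update_of_ne hz _ _
  have hrect := integral_rect (F := ψ) (a := -(1 / 2)) (b := 1 / 2) (h₁ := -h) (h₂ := h) (by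
    intro z h1 h2
    rw [Set.uIcc_of_le (by norm_num)] at h1
    rw [Set.uIcc_of_le (by linarith)] at h2
    have hz : z ∈ s := ⟨⟨by linarith [h1.1], by linarith [h1.2]⟩,
      ⟨by linarith [h2.1], by linarith [h2.2]⟩⟩
    exact hd.differentiableAt (hso.mem_nhds hz))
  have hv : ∀ y : ℝ, ψ (((1 / 2 : ℝ) : ℂ) + y * I) = ψ (((-(1 / 2) : ℝ) : ℂ) + y * I) := by
    intro y
    rw [hψφ, hψφ, ← hφp (((-(1 / 2) : ℝ) : ℂ) + y * I)]
    · congr 1; push_cast; ring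
    · intro h; have := congrArg re h; norm_num at this
    · intro h; have := congrArg re h; norm_num at this
  have hm : ∀ H : ℝ, H ≠ 0 → ∫ x in (-(1 / 2) : ℝ)..(1 / 2), ψ (x + H * I) = mean H φ := by
    intro H hH
    rw [mean_eq_integral hφp H (-(1 / 2))]
    norm_num
    congr 1
    funext x
    refine hψφ _ fun h => ?_
    have := congrArg im h
    simp at this
    exact hH this
  simp only [hv] at hrect
  rw [hm _ (by linarith), hm _ hh.ne'] at hrect
  have hdf : ∀ H : ℝ, H ≠ 0 → -h' < H → H < h' → ∀ z : ℂ, z.im = H →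
      DifferentiableAt ℂ (fun z => dfun τ hτ z * g z) z := by
    intro H hH h1 h2 z hz
    have hmem : z ∉ (L3 τ hτ).lattice := by
      rcases lt_or_gt_of_ne hH with h3 | h3
      · exact notMem_L3_of_im (k := -1) (by push_cast; linarith) (by push_cast; linarith)
      · exact notMem_L3_of_im (k := 0) (by push_cast; linarith) (by push_cast; linarith)
    exact (differentiableAt_dfun hmem).mul (hg z (by linarith) (by linarith))
  have hde : ∀ H : ℝ, H ≠ 0 → ∀ z : ℂ, z.im = H →
      DifferentiableAt ℂ (fun z => c * (e z - 1)⁻¹) z := by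
    intro H hH z hz
    exact (((differentiable_e z).sub_const 1).inv (e_sub_one_ne_zero (by rw [hz]; exact hH))).const_mul c
  have hsplit : ∀ H : ℝ, H ≠ 0 → -h' < H → H < h' →
      mean H φ = mean H (fun z => dfun τ hτ z * g z) - c * mean H (fun z => (e z - 1)⁻¹) := by
    intro H hH h1 h2
    rw [← mean_const_mul]
    exact mean_sub (hdf H hH h1 h2) (hde H hH)
  rw [hsplit (-h) (by linarith) (by linarith) (by linarith), hsplit h hh.ne' (by linarith) hh',
    mean_cot_neg hh, mean_cot_pos hh] at hrect
  linear_combination hrect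

end

/-! ### Solution of the recursion by contour integrals -/

section

/-- The function `κ (℘ - ℘(τ))` attached to the lattice `ℤ + 3τℤ`. -/
noncomputable def xi (τ : ℂ) (hτ : 0 < τ.im) (κ z : ℂ) : ℂ := κ * dfun τ hτ z

section Xi

variable {τ : ℂ} {hτ : 0 < τ.im} {κ : ℂ}

theorem xi_neg (z : ℂ) : xi τ hτ κ (-z) = xi τ hτ κ z := by rw [xi, xi, dfun_neg]

theorem xi_add_one (z : ℂ) : xi τ hτ κ (z + 1) = xi τ hτ κ z := by rw [xi, xi, dfun_add_one]

theorem xi_one_add (z w : ℂ) : xi τ hτ κ (z + 1 + w) = xi τ hτ κ (z + w) := by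
  rw [add_right_comm, xi_add_one]

theorem xi_one_sub (z w : ℂ) : xi τ hτ κ (z + 1 - w) = xi τ hτ κ (z - w) := by
  rw [sub_eq_add_neg, xi_one_add, ← sub_eq_add_neg]

theorem xi_add_three (z : ℂ) : xi τ hτ κ (z + 3 * τ) = xi τ hτ κ z := by
  rw [xi, xi, dfun_add_three]

theorem xi_sub_tau (z : ℂ) : xi τ hτ κ (z - τ) = xi τ hτ κ (z + 2 * τ) := by
  rw [xi, xi, dfun_sub_tau]

theorem differentiableAt_xi (k : ℤ) {z : ℂ} (h1 : 3 * k * τ.im < z.im)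
    (h2 : z.im < 3 * (k + 1) * τ.im) : DifferentiableAt ℂ (xi τ hτ κ) z :=
  (differentiableAt_dfun (notMem_L3_of_im h1 h2)).const_mul κ

theorem differentiableAt_xi_add (k : ℤ) {z w : ℂ} (h1 : 3 * k * τ.im < z.im + w.im)
    (h2 : z.im + w.im < 3 * (k + 1) * τ.im) :
    DifferentiableAt ℂ (fun z => xi τ hτ κ (z + w)) z := by
  have := differentiableAt_xi (τ := τ) (hτ := hτ) (κ := κ) k (z := z + w) (by simpa using h1)
    (by simpa using h2)
  exact DifferentiableAt.comp (f := fun z => z + w) z this (by fun_prop)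

theorem notMem_unitPair_of_im {z : ℂ} (k : ℤ) (h1 : k * τ.im < z.im)
    (h2 : z.im < (k + 1) * τ.im) : z ∉ (unitPair τ hτ).lattice := by
  intro hmem
  obtain ⟨m, n, hmn⟩ := mem_unitPair.1 hmem
  have him : z.im = n * τ.im := by rw [← hmn]; simp
  rw [him] at h1 h2
  have h3 : (k : ℝ) < n := lt_of_mul_lt_mul_right h1 hτ.le
  have h4 : (n : ℝ) < k + 1 := lt_of_mul_lt_mul_right h2 hτ.le
  have h3' : k < n := by exact_mod_cast h3
  have h4' : n < k + 1 := by exact_mod_cast h4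
  omega

end Xi

/-- The functional equation behind the solution of the recursion: `f` has period `1`, is
differentiable in the strip `|Im z| < 2 Im τ`, and its translate by `τ` differs from its
multiple by `s` through the function `xi`. The two last fields fix the scale `κ` and link it
to the variable `t` of the generating function. -/
structure Uniformizes (τ : ℂ) (hτ : 0 < τ.im) (s t κ : ℂ) (f : ℂ → ℂ) : Prop where
  s_ne : s ≠ 0
  t_ne : t ≠ 0
  periodic : Function.Periodic f 1
  diff : ∀ z : ℂ, -(2 * τ.im) < z.im → z.im < 2 * τ.im → DifferentiableAt ℂ f z
  shift : ∀ z : ℂ, -(2 * τ.im) < z.im → z.im < τ.im →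
    f z - s⁻¹ * f (z + τ) = -xi τ hτ κ (z - τ)
  prod : κ ^ 3 * (-4 * s3 τ hτ ^ 2) = 1
  pairs : κ ^ 2 * (6 * s4 τ hτ) = 1 / t

/-- The difference of the integrals of `g` along the lines at heights `-5/3 Im τ` and
`2/3 Im τ`. -/
noncomputable def jump (τ : ℂ) (g : ℂ → ℂ) : ℂ :=
  mean (-(5 / 3 * τ.im)) g - mean (2 / 3 * τ.im) g

/-- The solution of the recursion, as a contour integral. -/
noncomputable def sol (τ : ℂ) (hτ : 0 < τ.im) (t κ : ℂ) (f : ℂ → ℂ) (a b : ℤ) : ℂ :=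
  -(t * κ ^ 2 * (2 * Real.pi * I) * (2 * s3 τ hτ))⁻¹ *
    jump τ fun z => f z * xi τ hτ κ z ^ a * xi τ hτ κ (z + τ) ^ b

section Sol

variable {τ : ℂ} {hτ : 0 < τ.im} {s t κ : ℂ} {f : ℂ → ℂ}

theorem jump_const_mul (c : ℂ) (g : ℂ → ℂ) : jump τ (fun z => c * g z) = c * jump τ g := by
  rw [jump, jump, mean_const_mul, mean_const_mul, mul_sub]

theorem jump_congr {g g' : ℂ → ℂ}
    (h : ∀ z : ℂ, z.im = -(5 / 3 * τ.im) ∨ z.im = 2 / 3 * τ.im → g z = g' z) :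
    jump τ g = jump τ g' := by
  rw [jump, jump, mean_congr fun z hz => h z (Or.inl hz), mean_congr fun z hz => h z (Or.inr hz)]

theorem jump_add {g g' : ℂ → ℂ}
    (hg : ∀ z : ℂ, z.im = -(5 / 3 * τ.im) ∨ z.im = 2 / 3 * τ.im → DifferentiableAt ℂ g z)
    (hg' : ∀ z : ℂ, z.im = -(5 / 3 * τ.im) ∨ z.im = 2 / 3 * τ.im → DifferentiableAt ℂ g' z) :
    jump τ (fun z => g z + g' z) = jump τ g + jump τ g' := by
  rw [jump, jump, jump, mean_add (fun z hz => hg z (Or.inl hz)) fun z hz => hg' z (Or.inl hz),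
    mean_add (fun z hz => hg z (Or.inr hz)) fun z hz => hg' z (Or.inr hz)]
  ring

/-- After a translation by `τ` the two lines are the negatives of the original ones. -/
theorem jump_shift {g : ℂ → ℂ} (hg : Function.Periodic g 1) :
    jump τ (fun z => g (z + τ)) = mean (-(2 / 3 * τ.im)) g - mean (5 / 3 * τ.im) g := by
  rw [jump, mean_shift hg, mean_shift hg]
  congr 2 <;> ring

/-- The points of the two lines are off the lattice `ℤ + τℤ`. -/
theorem notMem_of_lines {z : ℂ} (hz : z.im = -(5 / 3 * τ.im) ∨ z.im = 2 / 3 * τ.im) :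
    z ∉ (unitPair τ hτ).lattice := by
  rcases hz with hz | hz
  · exact notMem_unitPair_of_im (-2) (by push_cast; linarith) (by push_cast; linarith)
  · exact notMem_unitPair_of_im 0 (by push_cast; linarith) (by push_cast; linarith)

theorem strip_of_lines (hτ : 0 < τ.im) {z : ℂ}
    (hz : z.im = -(5 / 3 * τ.im) ∨ z.im = 2 / 3 * τ.im) :
    -(2 * τ.im) < z.im ∧ z.im < τ.im := by
  rcases hz with hz | hz <;> constructor <;> linarith

theorem mean_zpow_eq (k : ℤ) (h : ℝ) :
    mean (-h) (fun z => xi τ hτ κ z ^ k) = mean h (fun z => xi τ hτ κ z ^ k) := by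
  rw [← mean_neg (g := fun z => xi τ hτ κ z ^ k) (fun z => by simp only [xi_add_one])]
  simp only [xi_neg]

/-- The residue at the double pole of `xi`, lowered to a simple pole by a zero of `g`. -/
theorem mean_simple_residue {g : ℂ → ℂ} (hg : ∀ z : ℂ, -τ.im < z.im → z.im < τ.im →
    DifferentiableAt ℂ g z) (hp : Function.Periodic g 1) (h0 : g 0 = 0) {h : ℝ} (hh : 0 < h)
    (hh' : h < τ.im) :
    mean (-h) (fun z => xi τ hτ κ z * g z) - mean h (fun z => xi τ hτ κ z * g z) =
      κ * (2 * Real.pi * I) * deriv g 0 := by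
  have := mean_residue (τ := τ) (hτ := hτ) hh hh' (by linarith) hg hp h0
  simp only [xi, mul_assoc]
  rw [mean_const_mul, mean_const_mul, ← mul_sub, this]
  ring

theorem xi_tau : xi τ hτ κ τ = 0 := by rw [xi, dfun_tau, mul_zero]

theorem hasDerivAt_xi_add : HasDerivAt (fun z => xi τ hτ κ (z + τ)) (κ * (2 * s3 τ hτ)) 0 := by
  have h : HasDerivAt (xi τ hτ κ) (κ * (2 * s3 τ hτ)) (0 + τ) := by
    rw [zero_add]; exact hasDerivAt_dfun_tau.const_mul κ
  exact h.comp_add_const 0 τ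

theorem hasDerivAt_xi_sub : HasDerivAt (fun z => xi τ hτ κ (z - τ)) (-(κ * (2 * s3 τ hτ))) 0 := by
  have h := hasDerivAt_xi_add (τ := τ) (hτ := hτ) (κ := κ)
  rw [← neg_zero] at h
  have h2 := h.comp (0 : ℂ) (hasDerivAt_neg (0 : ℂ))
  have : (fun z => xi τ hτ κ (z - τ)) = (fun z => xi τ hτ κ (z + τ)) ∘ fun z => -z := by
    funext z
    simp only [Function.comp]
    rw [← xi_neg]; congr 1; ring
  rw [this]
  rwa [mul_neg_one] at h2

namespace Uniformizes

theorem xi_prod (u : Uniformizes τ hτ s t κ f) {z : ℂ} (hz : z ∉ (unitPair τ hτ).lattice) :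
    xi τ hτ κ z * xi τ hτ κ (z + τ) * xi τ hτ κ (z - τ) = 1 := by
  rw [← u.prod, ← dfun_prod hz]; simp only [xi]; ring

theorem xi_pairs (u : Uniformizes τ hτ s t κ f) {z : ℂ} (hz : z ∉ (unitPair τ hτ).lattice) :
    xi τ hτ κ z * xi τ hτ κ (z + τ) + xi τ hτ κ (z + τ) * xi τ hτ κ (z - τ) +
      xi τ hτ κ (z - τ) * xi τ hτ κ z = 1 / t := by
  rw [← u.pairs, ← dfun_pairs hz]; simp only [xi]; ring

theorem xi_ne_zero (u : Uniformizes τ hτ s t κ f) {z : ℂ} (hz : z ∉ (unitPair τ hτ).lattice) :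
    xi τ hτ κ z ≠ 0 ∧ xi τ hτ κ (z + τ) ≠ 0 ∧ xi τ hτ κ (z - τ) ≠ 0 := by
  have := u.xi_prod hz
  refine ⟨fun h => ?_, fun h => ?_, fun h => ?_⟩ <;> rw [h] at this <;> simp at this

theorem sol_zero_zero (u : Uniformizes τ hτ s t κ f) : sol τ hτ t κ f 0 0 = 0 := by
  have : jump τ f = 0 := by
    rw [jump, sub_eq_zero]
    exact mean_eq_mean u.periodic (by linarith) fun z h1 h2 =>
      u.diff z (by linarith) (by linarith)
  simp [sol, this]

/-- Multiplying the second relation between the three translates of `xi` by `xi z` shows that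
the poles of `xi (z + τ)` and of `xi (z - τ)` compensate. -/
theorem pole_exchange (u : Uniformizes τ hτ s t κ f) {z : ℂ} (hz : z ∉ (unitPair τ hτ).lattice)
    (b : ℤ) :
    xi τ hτ κ z ^ b * xi τ hτ κ (z + τ) =
      1 / t * xi τ hτ κ z ^ (b - 1) - xi τ hτ κ z ^ (b - 2) -
        xi τ hτ κ z ^ b * xi τ hτ κ (z - τ) := by
  obtain ⟨h1, -, -⟩ := u.xi_ne_zero hz
  have e1 : xi τ hτ κ z ^ b = xi τ hτ κ z ^ (b - 2) * xi τ hτ κ z ^ 2 := by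
    rw [← zpow_natCast, ← zpow_add₀ h1]; congr 1; push_cast; ring
  have e2 : xi τ hτ κ z ^ (b - 1) = xi τ hτ κ z ^ (b - 2) * xi τ hτ κ z := by
    rw [← zpow_add_one₀ h1]; congr 1; ring
  rw [e1, e2, ← u.xi_pairs hz]
  linear_combination (-xi τ hτ κ z ^ (b - 2)) * u.xi_prod hz

/-- The difference of the two sides of the boundary condition at `(0, b)`. -/
theorem jump_left (u : Uniformizes τ hτ s t κ f) {b : ℤ} (hb : 1 ≤ b) :
    (jump τ fun z => f z * xi τ hτ κ (z + τ) ^ b) - s⁻¹ * (jump τ fun z => f z * xi τ hτ κ z ^ b) =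
      -(mean (-(2 / 3 * τ.im)) (fun z => xi τ hτ κ z ^ b * xi τ hτ κ (z + τ)) -
        mean (2 / 3 * τ.im) (fun z => xi τ hτ κ z ^ b * xi τ hτ κ (z + τ))) := by
  set H : ℂ → ℂ := fun z => f z * xi τ hτ κ z ^ b with hH
  set G : ℂ → ℂ := fun z => xi τ hτ κ z ^ b * xi τ hτ κ (z + τ) with hG
  have hHp : Function.Periodic H 1 := fun z => by simp only [hH, xi_add_one, u.periodic z]
  have hGp : Function.Periodic G 1 := fun z => by simp only [hG, xi_add_one, xi_one_add]
  have hdH : ∀ k : ℤ, ∀ z : ℂ, 3 * k * τ.im < z.im → z.im < 3 * (k + 1) * τ.im →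
      -(2 * τ.im) < z.im → z.im < 2 * τ.im → DifferentiableAt ℂ H z := fun k z h1 h2 h3 h4 =>
    (u.diff z h3 h4).mul ((differentiableAt_xi k h1 h2).zpow (Or.inr (by omega)))
  have hdG : ∀ z : ℂ, 0 < z.im → z.im < 2 * τ.im → DifferentiableAt ℂ G z := fun z h1 h2 =>
    ((differentiableAt_xi 0 (by push_cast; linarith) (by push_cast; linarith)).zpow
      (Or.inr (by omega))).mul
      (differentiableAt_xi_add 0 (by push_cast; linarith) (by push_cast; linarith))
  have hdG' : ∀ z : ℂ, -τ.im < z.im → z.im < 0 → DifferentiableAt ℂ G z := fun z h1 h2 =>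
    ((differentiableAt_xi (-1) (by push_cast; linarith) (by push_cast; linarith)).zpow
      (Or.inr (by omega))).mul
      (differentiableAt_xi_add 0 (by push_cast; linarith) (by push_cast; linarith))
  have e1 : (jump τ fun z => f z * xi τ hτ κ (z + τ) ^ b) =
      jump τ fun z => (fun z => s⁻¹ * H z - G z) (z + τ) := by
    refine jump_congr fun z hz => ?_
    obtain ⟨h1, h2⟩ := strip_of_lines hτ hz
    have := u.shift z h1 h2
    simp only [hH, hG]
    rw [show z + τ + τ = z + 2 * τ by ring, ← xi_sub_tau]
    linear_combination xi τ hτ κ (z + τ) ^ b * this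
  rw [e1, jump_shift (g := fun z => s⁻¹ * H z - G z) (fun z => by simp only [hHp z, hGp z])]
  rw [mean_sub (g := fun z => s⁻¹ * H z), mean_sub (g := fun z => s⁻¹ * H z), mean_const_mul,
    mean_const_mul, jump]
  · have m1 : mean (-(5 / 3 * τ.im)) H = mean (-(2 / 3 * τ.im)) H :=
      mean_eq_mean hHp (by linarith) fun z h1 h2 => hdH (-1) z (by push_cast; linarith)
        (by push_cast; linarith) (by linarith) (by linarith)
    have m2 : mean (2 / 3 * τ.im) H = mean (5 / 3 * τ.im) H :=
      mean_eq_mean hHp (by linarith) fun z h1 h2 => hdH 0 z (by push_cast; linarith)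
        (by push_cast; linarith) (by linarith) (by linarith)
    have m3 : mean (2 / 3 * τ.im) G = mean (5 / 3 * τ.im) G :=
      mean_eq_mean hGp (by linarith) fun z h1 h2 => hdG z (by linarith) (by linarith)
    rw [m1, m2, m3]; ring
  · exact fun z hz => (hdH 0 z (by push_cast; linarith) (by push_cast; linarith) (by linarith)
      (by linarith)).const_mul _
  · exact fun z hz => hdG z (by linarith) (by linarith)
  · exact fun z hz => (hdH (-1) z (by push_cast; linarith) (by push_cast; linarith) (by linarith)
      (by linarith)).const_mul _
  · exact fun z hz => hdG' z (by linarith) (by linarith)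

/-- The line at height `-2/3 Im τ` can be moved past the pole at `-τ`, of which `pole_exchange` rids
the integrand, to the height `-7/3 Im τ`, where the period `3τ` leads to `2/3 Im τ`. -/
theorem mean_pole_exchange (u : Uniformizes τ hτ s t κ f) {b : ℤ} (hb : 2 ≤ b) :
    mean (-(2 / 3 * τ.im)) (fun z => xi τ hτ κ z ^ b * xi τ hτ κ (z + τ)) =
      mean (2 / 3 * τ.im) (fun z => xi τ hτ κ z ^ b * xi τ hτ κ (z + τ)) := by
  set G : ℂ → ℂ := fun z => xi τ hτ κ z ^ b * xi τ hτ κ (z + τ) with hG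
  set Q : ℂ → ℂ := fun z => 1 / t * xi τ hτ κ z ^ (b - 1) - xi τ hτ κ z ^ (b - 2) -
        xi τ hτ κ z ^ b * xi τ hτ κ (z - τ) with hQ
  have hGp : Function.Periodic G 1 := fun z => by simp only [hG, xi_add_one, xi_one_add]
  have hQp : Function.Periodic Q 1 := fun z => by simp only [hQ, xi_add_one, xi_one_sub]
  have hdQ : ∀ z : ℂ, -(2 * τ.im) < z.im → z.im < 0 → DifferentiableAt ℂ Q z := by
    intro z h1 h2
    have hx : DifferentiableAt ℂ (xi τ hτ κ) z :=
      differentiableAt_xi (-1) (by push_cast; linarith) (by push_cast; linarith)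
    have hx' : DifferentiableAt ℂ (fun z => xi τ hτ κ (z - τ)) z :=
      differentiableAt_xi_add (w := -τ) (-1) (by push_cast; simp; linarith)
        (by push_cast; simp; linarith)
    exact (((hx.zpow (Or.inr (by omega))).const_mul _).sub (hx.zpow (Or.inr (by omega)))).sub
      ((hx.zpow (Or.inr (by omega))).mul hx')
  have hdG : ∀ z : ℂ, -(3 * τ.im) < z.im → z.im < -τ.im → DifferentiableAt ℂ G z := by
    intro z h1 h2
    have hx : DifferentiableAt ℂ (xi τ hτ κ) z :=
      differentiableAt_xi (-1) (by push_cast; linarith) (by push_cast; linarith)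
    have hx' : DifferentiableAt ℂ (fun z => xi τ hτ κ (z + τ)) z :=
      differentiableAt_xi_add (-1) (by push_cast; linarith) (by push_cast; linarith)
    exact (hx.zpow (Or.inr (by omega))).mul hx'
  calc mean (-(2 / 3 * τ.im)) G = mean (-(2 / 3 * τ.im)) Q := mean_congr fun z hz =>
        u.pole_exchange (notMem_unitPair_of_im (-1) (by push_cast; linarith)
          (by push_cast; linarith)) b
    _ = mean (-(3 / 2 * τ.im)) Q := (mean_eq_mean hQp (by linarith) fun z h1 h2 =>
        hdQ z (by linarith) (by linarith)).symm
    _ = mean (-(3 / 2 * τ.im)) G := mean_congr fun z hz =>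
        (u.pole_exchange (notMem_unitPair_of_im (-2) (by push_cast; linarith)
          (by push_cast; linarith)) b).symm
    _ = mean (-(7 / 3 * τ.im)) G := (mean_eq_mean hGp (by linarith) fun z h1 h2 =>
        hdG z (by linarith) (by linarith)).symm
    _ = mean (-(7 / 3 * τ.im)) (fun z => G (z + 3 * τ)) := mean_congr fun z _ => by
        simp only [hG, xi_add_three]
        rw [add_right_comm, xi_add_three]
    _ = mean (2 / 3 * τ.im) G := by
        rw [mean_shift hGp]; congr 1; simp; ring

/-- The normalising factor of `sol` is nonzero. -/
theorem const_ne (u : Uniformizes τ hτ s t κ f) : t * κ ^ 2 * (2 * Real.pi * I) *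
    (2 * s3 τ hτ) ≠ 0 := by
  have hκ : κ ≠ 0 := by
    intro h
    have := u.prod
    simp [h] at this
  have hpi : (2 * Real.pi * I : ℂ) ≠ 0 := two_pi_I_ne_zero
  exact mul_ne_zero (mul_ne_zero (mul_ne_zero u.t_ne (pow_ne_zero 2 hκ)) hpi)
    (mul_ne_zero two_ne_zero s3_ne_zero)

/-- The boundary condition that replaces `(0, b)` by `(b, 0)`; the extra term for `b = 1` produces the
initial condition of the recursion. -/
theorem sol_left (u : Uniformizes τ hτ s t κ f) {b : ℤ} (hb : 1 ≤ b) :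
    sol τ hτ t κ f 0 b = s⁻¹ * sol τ hτ t κ f b 0 + (if b = 1 then 1 / t else 0) := by
  have h1 := u.jump_left hb
  simp only [sol, zpow_zero, mul_one]
  have hne := u.const_ne
  split_ifs with hb1
  · subst hb1
    have h2 := mean_simple_residue (hτ := hτ) (κ := κ) (g := fun z => xi τ hτ κ (z + τ))
        (h := 2 / 3 * τ.im)
      (fun z h1 h2 => differentiableAt_xi_add 0 (by push_cast; linarith) (by push_cast; linarith))
      (fun z => xi_one_add _ _) (by simp [xi_tau]) (by linarith) (by linarith)
    rw [hasDerivAt_xi_add.deriv] at h2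
    simp only [zpow_one] at h1 ⊢
    rw [h2] at h1
    have ht := u.t_ne
    have h3 : (t * κ ^ 2 * (2 * Real.pi * I) * (2 * s3 τ hτ))⁻¹ *
        (κ * (2 * Real.pi * I) * (κ * (2 * s3 τ hτ))) = 1 / t := by
      rw [inv_mul_eq_div, div_eq_div_iff hne ht]; ring
    linear_combination (-(t * κ ^ 2 * (2 * Real.pi * I) * (2 * s3 τ hτ))⁻¹) * h1 + h3
  · rw [u.mean_pole_exchange (by omega), sub_self, neg_zero] at h1
    linear_combination (-(t * κ ^ 2 * (2 * Real.pi * I) * (2 * s3 τ hτ))⁻¹) * h1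

/-- The boundary condition that replaces `(a, -1)` by `(1, a + 1)`. -/
theorem sol_right (u : Uniformizes τ hτ s t κ f) {a : ℤ} (ha : 1 ≤ a) :
    sol τ hτ t κ f a (-1) = s * sol τ hτ t κ f 1 (a + 1) := by
  set b := a + 1 with hb
  set H : ℂ → ℂ := fun z => f z * (xi τ hτ κ z ^ b * xi τ hτ κ (z - τ)) with hH
  set X : ℂ → ℂ := fun z => xi τ hτ κ z ^ a with hX
  set Q : ℂ → ℂ := fun z => f z * (1 / t * xi τ hτ κ z ^ (b - 1) - xi τ hτ κ z ^ (b - 2) -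
        xi τ hτ κ z ^ b * xi τ hτ κ (z + τ)) with hQ
  have hHp : Function.Periodic H 1 := fun z => by
    simp only [hH, xi_add_one, xi_one_sub, u.periodic z]
  have hQp : Function.Periodic Q 1 := fun z => by
    simp only [hQ, xi_add_one, xi_one_add, u.periodic z]
  have hXp : Function.Periodic X 1 := fun z => by simp only [hX, xi_add_one]
  have hx : ∀ z : ℂ, 0 < z.im → z.im < 2 * τ.im → DifferentiableAt ℂ (xi τ hτ κ) z :=
    fun z h1 h2 => differentiableAt_xi 0 (by push_cast; linarith) (by push_cast; linarith)
  have hx' : ∀ z : ℂ, -(2 * τ.im) < z.im → z.im < 0 → DifferentiableAt ℂ (xi τ hτ κ) z :=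
    fun z h1 h2 => differentiableAt_xi (-1) (by push_cast; linarith) (by push_cast; linarith)
  have hdH : ∀ z : ℂ, -(2 * τ.im) < z.im → z.im < 0 → DifferentiableAt ℂ H z := fun z h1 h2 =>
    (u.diff z h1 (by linarith)).mul (((hx' z h1 h2).zpow (Or.inr (by omega))).mul
      (differentiableAt_xi_add (w := -τ) (-1) (by push_cast; simp; linarith)
        (by push_cast; simp; linarith)))
  have hdH' : ∀ z : ℂ, τ.im < z.im → z.im < 2 * τ.im → DifferentiableAt ℂ H z := fun z h1 h2 =>
    (u.diff z (by linarith) h2).mul (((hx z (by linarith) h2).zpow (Or.inr (by omega))).mul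
      (differentiableAt_xi_add (w := -τ) 0 (by push_cast; simp; linarith)
        (by push_cast; simp; linarith)))
  have hdQ : ∀ z : ℂ, 0 < z.im → z.im < 2 * τ.im → DifferentiableAt ℂ Q z := fun z h1 h2 =>
    (u.diff z (by linarith) h2).mul (((((hx z h1 h2).zpow (Or.inr (by omega))).const_mul _).sub
      ((hx z h1 h2).zpow (Or.inr (by omega)))).sub (((hx z h1 h2).zpow (Or.inr (by omega))).mul
      (differentiableAt_xi_add 0 (by push_cast; linarith) (by push_cast; linarith))))
  have hHQ : ∀ k : ℤ, ∀ z : ℂ, k * τ.im < z.im → z.im < (k + 1) * τ.im → H z = Q z := by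
    intro k z h1 h2
    have := u.pole_exchange (notMem_unitPair_of_im k h1 h2) b
    simp only [hH, hQ]
    linear_combination f z * this
  have e1 : (jump τ fun z => f z * xi τ hτ κ z ^ a * xi τ hτ κ (z + τ) ^ (-1 : ℤ)) = jump τ H := by
    refine jump_congr fun z hz => ?_
    obtain ⟨h1, h2, h3⟩ := u.xi_ne_zero (notMem_of_lines (hτ := hτ) hz)
    have h4 : xi τ hτ κ (z + τ) ^ (-1 : ℤ) = xi τ hτ κ z * xi τ hτ κ (z - τ) := by
      rw [zpow_neg_one]
      exact inv_eq_of_mul_eq_one_right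
        (by linear_combination u.xi_prod (notMem_of_lines (hτ := hτ) hz))
    simp only [hH]
    rw [h4, hb, zpow_add_one₀ h1]
    ring
  have e2 : (jump τ fun z => s * (f z * xi τ hτ κ z ^ (1 : ℤ) * xi τ hτ κ (z + τ) ^ b)) =
      jump τ fun z => (fun z => H z - s * X z) (z + τ) := by
    refine jump_congr fun z hz => ?_
    obtain ⟨h1, h2⟩ := strip_of_lines hτ hz
    obtain ⟨h3, h4, h5⟩ := u.xi_ne_zero (notMem_of_lines (hτ := hτ) hz)
    have h6 := u.shift z h1 h2
    have h7 : f (z + τ) = s * f z + s * xi τ hτ κ (z - τ) := by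
      have := u.s_ne
      field_simp at h6
      linear_combination -h6
    simp only [hH, hX, hb]
    rw [add_sub_cancel_right, h7, zpow_add_one₀ h4, zpow_one]
    linear_combination (-s * xi τ hτ κ (z + τ) ^ a) * u.xi_prod (notMem_of_lines (hτ := hτ) hz)
  have e3 : mean (-(5 / 3 * τ.im)) H = mean (-(2 / 3 * τ.im)) H :=
    mean_eq_mean hHp (by linarith) fun z h1 h2 => hdH z (by linarith) (by linarith)
  have e4 : mean (2 / 3 * τ.im) H = mean (5 / 3 * τ.im) H := by
    rw [mean_congr (g := H) (g' := Q) fun z hz => hHQ 0 z (by push_cast; linarith)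
        (by push_cast; linarith),
      mean_congr (h := 5 / 3 * τ.im) (g := H) (g' := Q) fun z hz => hHQ 1 z (by push_cast; linarith)
        (by push_cast; linarith)]
    exact mean_eq_mean hQp (by linarith) fun z h1 h2 => hdQ z (by linarith) (by linarith)
  have e5 : mean (-(2 / 3 * τ.im)) X = mean (5 / 3 * τ.im) X := by
    rw [mean_zpow_eq]
    exact mean_eq_mean hXp (by linarith) fun z h1 h2 =>
      (hx z (by linarith) (by linarith)).zpow (Or.inr (by omega))
  have e6 : jump τ H = jump τ fun z => s * (f z * xi τ hτ κ z ^ (1 : ℤ) *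
      xi τ hτ κ (z + τ) ^ b) := by
    rw [e2, jump_shift (g := fun z => H z - s * X z) (fun z => by simp only [hHp z, hXp z]),
      mean_sub, mean_sub, mean_const_mul, mean_const_mul, e5, jump, e3, e4]
    · ring
    · exact fun z hz => hdH' z (by linarith) (by linarith)
    · exact fun z hz => ((hx z (by linarith) (by linarith)).zpow (Or.inr (by omega))).const_mul _
    · exact fun z hz => hdH z (by linarith) (by linarith)
    · exact fun z hz => ((hx' z (by linarith) (by linarith)).zpow (Or.inr (by omega))).const_mul _
  simp only [sol]
  rw [e1, e6, jump_const_mul]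
  ring

/-- The interior recursion: the sum of `1/xi z`, `1/xi (z + τ)` and `xi z * xi (z + τ)` is the
constant `1/t`. -/
theorem sol_interior (u : Uniformizes τ hτ s t κ f) (a b : ℤ) :
    sol τ hτ t κ f a b = t * (sol τ hτ t κ f (a + 1) (b + 1) + sol τ hτ t κ f (a - 1) b +
      sol τ hτ t κ f a (b - 1)) := by
  set X : ℤ → ℤ → ℂ → ℂ := fun a b z => f z * xi τ hτ κ z ^ a * xi τ hτ κ (z + τ) ^ b with hX
  have hd : ∀ a b : ℤ, ∀ z : ℂ, z.im = -(5 / 3 * τ.im) ∨ z.im = 2 / 3 * τ.im →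
      DifferentiableAt ℂ (X a b) z := by
    intro a b z hz
    obtain ⟨h1, h2⟩ := strip_of_lines hτ hz
    obtain ⟨h3, h4, -⟩ := u.xi_ne_zero (notMem_of_lines (hτ := hτ) hz)
    have h5 : DifferentiableAt ℂ (xi τ hτ κ) z ∧
        DifferentiableAt ℂ (fun z => xi τ hτ κ (z + τ)) z := by
      rcases hz with hz | hz
      · exact ⟨differentiableAt_xi (-1) (by push_cast; linarith) (by push_cast; linarith),
          differentiableAt_xi_add (-1) (by push_cast; linarith) (by push_cast; linarith)⟩
      · exact ⟨differentiableAt_xi 0 (by push_cast; linarith) (by push_cast; linarith),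
          differentiableAt_xi_add 0 (by push_cast; linarith) (by push_cast; linarith)⟩
    exact ((u.diff z h1 (by linarith)).mul (h5.1.zpow (Or.inl h3))).mul (h5.2.zpow (Or.inl h4))
  have key : jump τ (X a b) =
      t * (jump τ (X (a + 1) (b + 1)) + jump τ (X (a - 1) b) + jump τ (X a (b - 1))) := by
    rw [← jump_add (hd _ _) (hd _ _),
      ← jump_add (g := fun z => X (a + 1) (b + 1) z + X (a - 1) b z)
        (fun z hz => (hd _ _ z hz).add (hd _ _ z hz)) (hd _ _), ← jump_const_mul]
    refine jump_congr fun z hz => ?_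
    have hz' := notMem_of_lines (hτ := hτ) hz
    obtain ⟨h3, h4, -⟩ := u.xi_ne_zero hz'
    have ht := u.t_ne
    have h1 := u.xi_prod hz'
    have h2 := u.xi_pairs hz'
    have h6 : t * (xi τ hτ κ z * xi τ hτ κ (z + τ) + (xi τ hτ κ z)⁻¹ + (xi τ hτ κ (z + τ))⁻¹) =
        1 := by
      have e1 : (xi τ hτ κ z)⁻¹ = xi τ hτ κ (z + τ) * xi τ hτ κ (z - τ) :=
        inv_eq_of_mul_eq_one_right (by linear_combination h1)
      have e2 : (xi τ hτ κ (z + τ))⁻¹ = xi τ hτ κ (z - τ) * xi τ hτ κ z :=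
        inv_eq_of_mul_eq_one_right (by linear_combination h1)
      rw [e1, e2, h2, mul_one_div_cancel ht]
    simp only [hX]
    rw [zpow_add_one₀ h3, zpow_add_one₀ h4, zpow_sub_one₀ h3, zpow_sub_one₀ h4]
    linear_combination (-f z * xi τ hτ κ z ^ a * xi τ hτ κ (z + τ) ^ b) * h6
  have h : ∀ a b, sol τ hτ t κ f a b =
    -(t * κ ^ 2 * (2 * Real.pi * I) * (2 * s3 τ hτ))⁻¹ * jump τ (X a b) := fun _ _ => rfl
  simp only [h]
  linear_combination (-(t * κ ^ 2 * (2 * Real.pi * I) * (2 * s3 τ hτ))⁻¹) * key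

/-- The contour integrals satisfy the recursion, with its initial condition, everywhere in the sector. -/
theorem sol_recursion (u : Uniformizes τ hτ s t κ f) {a b : ℤ} (ha : 1 ≤ a) (hb : 0 ≤ b) :
    sol τ hτ t κ f a b = (if a = 1 ∧ b = 1 then 1 else 0) +
      t * lastStep s (sol τ hτ t κ f) a b := by
  have ht := u.t_ne
  have hA : sol τ hτ t κ f (a - 1) b = (if a = 1 ∧ b = 1 then 1 / t else 0) +
      (if 2 ≤ a then sol τ hτ t κ f (a - 1) b else
        if 1 ≤ b then s⁻¹ * sol τ hτ t κ f b 0 else 0) := by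
    rcases ha.eq_or_lt with rfl | ha
    · rw [if_neg (by omega : ¬ (2 : ℤ) ≤ 1), sub_self]
      rcases hb.eq_or_lt with rfl | hb
      · simp [u.sol_zero_zero]
      · rw [if_pos (by omega : 1 ≤ b), u.sol_left (by omega)]
        simp only [true_and]
        ring
    · rw [if_pos (by omega : 2 ≤ a), if_neg (by omega), zero_add]
  have hB : sol τ hτ t κ f a (b - 1) =
      if 1 ≤ b then sol τ hτ t κ f a (b - 1) else s * sol τ hτ t κ f 1 (a + 1) := by
    rcases hb.eq_or_lt with rfl | hb
    · rw [if_neg (by omega), zero_sub, u.sol_right ha]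
    · rw [if_pos (by omega)]
  have hC : t * (if a = 1 ∧ b = 1 then 1 / t else 0) = if a = 1 ∧ b = 1 then 1 else 0 := by
    rw [mul_ite, mul_one_div_cancel ht, mul_zero]
  rw [u.sol_interior a b, lastStep]
  linear_combination t * hA + t * hB + hC

/-- Between the two lines the integrand has the poles `0` and `-τ`, and the functional equation
combines their residues. -/
theorem sol_one_one (u : Uniformizes τ hτ s t κ f) :
    sol τ hτ t κ f 1 1 = (s⁻¹ - 1) * f 0 / t := by
  set G : ℂ → ℂ := fun z => f z * xi τ hτ κ z * xi τ hτ κ (z + τ) with hG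
  have hGp : Function.Periodic G 1 := fun z => by
    simp only [hG, xi_add_one, xi_one_add, u.periodic z]
  have hd1 : ∀ z : ℂ, 0 < z.im → z.im < 2 * τ.im → DifferentiableAt ℂ G z := fun z h1 h2 =>
    ((u.diff z (by linarith) h2).mul (differentiableAt_xi 0 (by push_cast; linarith)
      (by push_cast; linarith))).mul
      (differentiableAt_xi_add 0 (by push_cast; linarith) (by push_cast; linarith))
  have hd2 : ∀ z : ℂ, -(2 * τ.im) < z.im → z.im < -τ.im → DifferentiableAt ℂ G z := fun z h1 h2 =>
    ((u.diff z h1 (by linarith)).mul (differentiableAt_xi (-1) (by push_cast; linarith)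
      (by push_cast; linarith))).mul
      (differentiableAt_xi_add (-1) (by push_cast; linarith) (by push_cast; linarith))
  have hf0 := u.diff 0 (by simpa using hτ) (by simpa using hτ)
  -- the pole at `0`
  have r1 : mean (-(1 / 2 * τ.im)) G - mean (1 / 2 * τ.im) G =
      κ * (2 * Real.pi * I) * (f 0 * (κ * (2 * s3 τ hτ))) := by
    have h := mean_simple_residue (hτ := hτ) (κ := κ) (g := fun z => f z * xi τ hτ κ (z + τ))
      (h := 1 / 2 * τ.im)
      (fun z h1 h2 => (u.diff z (by linarith) (by linarith)).mul
        (differentiableAt_xi_add 0 (by push_cast; linarith) (by push_cast; linarith)))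
      (fun z => by simp only [xi_one_add, u.periodic z]) (by simp [xi_tau]) (by linarith)
      (by linarith)
    rw [deriv_fun_mul hf0 hasDerivAt_xi_add.differentiableAt, hasDerivAt_xi_add.deriv, zero_add,
      xi_tau, mul_zero, zero_add] at h
    rw [← h]
    congr 2 <;> · funext z; simp only [hG]; ring
  -- the pole at `-τ`
  have hf1 : DifferentiableAt ℂ (fun z => f (z - τ)) 0 := by
    have : DifferentiableAt ℂ f (0 - τ) := u.diff _ (by simp; linarith) (by simp; linarith)
    exact DifferentiableAt.comp (f := fun z => z - τ) 0 this (by fun_prop)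
  have r2 : mean (-(3 / 2 * τ.im)) G - mean (-(1 / 2 * τ.im)) G =
      κ * (2 * Real.pi * I) * (f (-τ) * -(κ * (2 * s3 τ hτ))) := by
    have h := mean_simple_residue (hτ := hτ) (κ := κ)
      (g := fun z => f (z - τ) * xi τ hτ κ (z - τ)) (h := 1 / 2 * τ.im)
      (fun z h1 h2 => by
        have hfz : DifferentiableAt ℂ f (z - τ) :=
          u.diff _ (by simp; linarith) (by simp; linarith)
        exact (DifferentiableAt.comp (f := fun z => z - τ) z hfz (by fun_prop)).mul
          (differentiableAt_xi_add (w := -τ) (-1) (by push_cast; simp; linarith)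
            (by push_cast; simp; linarith)))
      (fun z => by
        have := u.periodic (z - τ)
        rw [show z - τ + 1 = z + 1 - τ by ring] at this
        simp only [xi_one_sub, this])
      (by rw [zero_sub, xi_neg, xi_tau, mul_zero]) (by linarith) (by linarith)
    rw [deriv_fun_mul hf1 hasDerivAt_xi_sub.differentiableAt, hasDerivAt_xi_sub.deriv, zero_sub,
      xi_neg, xi_tau, mul_zero,
      zero_add] at h
    rw [← h]
    have hs : ∀ x : ℝ, mean x (fun z => xi τ hτ κ z * (f (z - τ) * xi τ hτ κ (z - τ))) =
        mean (x - τ.im) G := by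
      intro x
      have := mean_shift hGp x (-τ)
      rw [neg_im, ← sub_eq_add_neg] at this
      rw [← this]
      congr 1
      funext z
      simp only [hG, ← sub_eq_add_neg, sub_add_cancel]
      ring
    rw [hs, hs]
    congr 2 <;> ring
  have hf2 : f (-τ) = s⁻¹ * f 0 := by
    have h := u.shift (-τ) (by simp; linarith) (by simp; linarith)
    rw [neg_add_cancel, show -τ - τ = τ + -(3 * τ) by ring,
      ← xi_add_three (τ + -(3 * τ)), neg_add_cancel_right, xi_tau] at h
    linear_combination h
  have hj : jump τ G = κ * (2 * Real.pi * I) * (κ * (2 * s3 τ hτ)) * (f 0 - f (-τ)) := by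
    have e1 : mean (-(5 / 3 * τ.im)) G = mean (-(3 / 2 * τ.im)) G :=
      mean_eq_mean hGp (by linarith) fun z h1 h2 => hd2 z (by linarith) (by linarith)
    have e2 : mean (1 / 2 * τ.im) G = mean (2 / 3 * τ.im) G :=
      mean_eq_mean hGp (by linarith) fun z h1 h2 => hd1 z (by linarith) (by linarith)
    rw [jump, e1, ← e2]
    linear_combination r1 + r2
  have hne := u.const_ne
  have ht := u.t_ne
  simp only [sol, zpow_one]
  rw [hj, hf2, neg_mul, inv_mul_eq_div, neg_eq_iff_eq_neg, ← neg_div, div_eq_div_iff hne ht]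
  ring

/-- The contour integrals grow at most geometrically, as required for uniqueness. -/
theorem norm_sol_le (u : Uniformizes τ hτ s t κ f) {R : ℝ}
    (hR : ∀ z : ℂ, z.im = -(5 / 3 * τ.im) ∨ z.im = 2 / 3 * τ.im →
      ‖xi τ hτ κ z‖ ≤ R ∧ ‖xi τ hτ κ (z + τ)‖ ≤ R) :
    ∃ K : ℝ, 0 ≤ K ∧ ∀ a b : ℤ, 1 ≤ a → 0 ≤ b → ‖sol τ hτ t κ f a b‖ ≤ K * R ^ (a + b) := by
  have hb : ∀ h : ℝ, h = -(5 / 3 * τ.im) ∨ h = 2 / 3 * τ.im → ∃ M : ℝ, 0 ≤ M ∧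
      ∀ a b : ℤ, 1 ≤ a → 0 ≤ b →
        ‖mean h fun z => f z * xi τ hτ κ z ^ a * xi τ hτ κ (z + τ) ^ b‖ ≤ M * R ^ (a + b) := by
    intro h hh
    have hc : Continuous fun x : ℝ => f (x + h * I) := continuous_line fun z hz => by
      obtain ⟨h1, h2⟩ := strip_of_lines hτ (z := z) (by rwa [hz])
      exact u.diff z h1 (by linarith)
    obtain ⟨M, hM⟩ := isCompact_Icc.exists_bound_of_continuousOn (s := Set.Icc (0 : ℝ) 1)
      hc.continuousOn
    have hM0 : 0 ≤ M := (norm_nonneg _).trans (hM 0 (by simp))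
    refine ⟨M, hM0, fun a b ha hb => ?_⟩
    obtain ⟨h3, h4⟩ := hR (h * I) (by simpa using hh)
    have hR0 : 0 ≤ R := (norm_nonneg _).trans h3
    have := intervalIntegral.norm_integral_le_of_norm_le_const (a := 0) (b := 1)
      (C := M * R ^ (a + b)) (f := fun x : ℝ => f (x + h * I) * xi τ hτ κ (x + h * I) ^ a *
        xi τ hτ κ (x + h * I + τ) ^ b) ?_
    · simpa [mean] using this
    · intro x hx
      rw [Set.uIoc_of_le zero_le_one] at hx
      obtain ⟨h3, h4⟩ := hR (x + h * I) (by simpa using hh)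
      lift a to ℕ using by omega
      lift b to ℕ using hb
      rw [norm_mul, norm_mul, mul_assoc, ← Nat.cast_add]
      simp only [zpow_natCast, norm_pow, pow_add]
      exact mul_le_mul (hM x ⟨hx.1.le, hx.2⟩) (mul_le_mul (pow_le_pow_left₀ (norm_nonneg _) h3 a)
        (pow_le_pow_left₀ (norm_nonneg _) h4 b) (by positivity) (by positivity)) (by positivity) hM0
  obtain ⟨M₁, h1, H1⟩ := hb _ (Or.inl rfl)
  obtain ⟨M₂, h2, H2⟩ := hb _ (Or.inr rfl)
  refine ⟨‖-(t * κ ^ 2 * (2 * Real.pi * I) * (2 * s3 τ hτ))⁻¹‖ * (M₁ + M₂), by positivity,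
    fun a b ha hb => ?_⟩
  rw [sol, norm_mul]
  refine (mul_le_mul_of_nonneg_left ?_ (norm_nonneg _)).trans (mul_assoc _ _ _).symm.le
  rw [add_mul]
  exact (norm_sub_le _ _).trans (add_le_add (H1 a b ha hb) (H2 a b ha hb))

/-- The generating function of the coefficients, in terms of a uniformizing function. -/
theorem hasSum_coef {α β : ℝ} (u : Uniformizes τ hτ (exp (α * I)) t κ f) {w₀ : ℤ × ℤ}
    (h₀ : w₀ ∈ nearOrigin) (hβ : β * (2 * Real.pi / 3) = α) {R : ℝ} (hR1 : 1 ≤ R)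
    (ht : 3 * R ^ 2 * ‖t‖ < 1)
    (hR : ∀ z : ℂ, z.im = -(5 / 3 * τ.im) ∨ z.im = 2 / 3 * τ.im →
      ‖xi τ hτ κ z‖ ≤ R ∧ ‖xi τ hτ κ (z + τ)‖ ≤ R) :
    HasSum (fun n => coef w₀ β n 1 1 * t ^ n) (((exp (α * I))⁻¹ - 1) * f 0 / t) := by
  obtain ⟨K, hK, hb⟩ := u.norm_sol_le hR
  rw [← u.sol_one_one]
  exact KrewerasWinding.hasSum_coef h₀ hβ hR1 hK ht hb (fun a b ha hb => u.sol_recursion ha hb)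
    le_rfl zero_le_one

end Uniformizes

end Sol

end

/-! ### The Laurent series that solves the functional equation -/

section

/-- The series `∑ m wᵐ / ((1 - p³ᵐ)(1 - s pᵐ))`. -/
noncomputable def ser (s p w : ℂ) : ℂ := ∑' m : ℕ, m * w ^ m / ((1 - p ^ (3 * m)) * (1 - s * p ^ m))

theorem one_sub_le_norm {s p : ℂ} (hs : ‖s‖ = 1) (hp : ‖p‖ < 1) {m : ℕ} (hm : m ≠ 0) :
    1 - ‖p‖ ≤ ‖1 - s * p ^ m‖ := by
  have h1 := norm_sub_norm_le 1 (s * p ^ m)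
  rw [norm_one, norm_mul, hs, one_mul, norm_pow] at h1
  have h2 : ‖p‖ ^ m ≤ ‖p‖ := pow_le_of_le_one (norm_nonneg p) hp.le hm
  linarith

theorem one_sub_ne_zero {s p : ℂ} (hs : ‖s‖ = 1) (hp : ‖p‖ < 1) {m : ℕ} (hm : m ≠ 0) :
    1 - s * p ^ m ≠ 0 := by
  have := one_sub_le_norm hs hp hm
  exact norm_pos_iff.1 (by linarith)

theorem one_sub_pow_ne_zero {p : ℂ} (hp : ‖p‖ < 1) {m : ℕ} (hm : m ≠ 0) : 1 - p ^ m ≠ 0 := by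
  simpa using one_sub_ne_zero (s := 1) (by simp) hp hm

theorem norm_ser_term_le {s p : ℂ} (hs : ‖s‖ = 1) (hp : ‖p‖ < 1) (w : ℂ) (m : ℕ) :
    ‖m * w ^ m / ((1 - p ^ (3 * m)) * (1 - s * p ^ m))‖ ≤
      m * ‖w‖ ^ m * ((1 - ‖p‖) * (1 - ‖p‖))⁻¹ := by
  have h0 : 0 < 1 - ‖p‖ := by linarith
  rw [norm_div, norm_mul, norm_pow, norm_natCast, div_eq_mul_inv]
  rcases Nat.eq_zero_or_pos m with rfl | hm
  · simp
  · refine mul_le_mul_of_nonneg_left (inv_anti₀ (by positivity) ?_) (by positivity)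
    rw [norm_mul]
    have h1 := one_sub_le_norm (s := 1) (by simp) hp (m := 3 * m) (by omega)
    rw [one_mul] at h1
    exact mul_le_mul h1 (one_sub_le_norm hs hp hm.ne') h0.le (norm_nonneg _)

theorem summable_ser_bound {r : ℝ} (h0 : 0 ≤ r) (hr : r < 1) (C : ℝ) :
    Summable fun m : ℕ => (m : ℝ) * r ^ m * C := by
  have := summable_pow_mul_geometric_of_norm_lt_one 1 (r := r) (by rwa [Real.norm_of_nonneg h0])
  simpa using this.mul_right C

theorem hasSum_ser {s p w : ℂ} (hs : ‖s‖ = 1) (hp : ‖p‖ < 1) (hw : ‖w‖ < 1) :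
    HasSum (fun m : ℕ => m * w ^ m / ((1 - p ^ (3 * m)) * (1 - s * p ^ m))) (ser s p w) :=
  (Summable.of_norm_bounded (summable_ser_bound (norm_nonneg w) hw _)
    fun m => norm_ser_term_le hs hp w m).hasSum

theorem differentiableAt_ser {s p w : ℂ} (hs : ‖s‖ = 1) (hp : ‖p‖ < 1) (hw : ‖w‖ < 1) :
    DifferentiableAt ℂ (ser s p) w := by
  obtain ⟨r, hr, hr1⟩ := exists_between hw
  have hr0 : 0 ≤ r := (norm_nonneg w).trans hr.le
  have h := differentiableOn_tsum_of_summable_norm (E := ℂ) (U := Metric.ball (0 : ℂ) r)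
    (F := fun (m : ℕ) w => m * w ^ m / ((1 - p ^ (3 * m)) * (1 - s * p ^ m)))
    (summable_ser_bound hr0 hr1 ((1 - ‖p‖) * (1 - ‖p‖))⁻¹)
    (fun m => by fun_prop) Metric.isOpen_ball (fun m w hw => by
      refine (norm_ser_term_le hs hp w m).trans ?_
      have h0 : 0 < 1 - ‖p‖ := by linarith
      have hw : ‖w‖ ≤ r := by simpa using (Metric.mem_ball.1 hw).le
      gcongr)
  exact h.differentiableAt (Metric.isOpen_ball.mem_nhds (by simpa using hr))

/-- The Laurent series in `e z` that solves the functional equation of `Uniformizes`. -/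
noncomputable def laurent (s p z : ℂ) : ℂ :=
  -(lam 1 p (p ^ 3) + lam 1 (p ^ 2) (p ^ 3)) / (1 - s⁻¹) - s * ser s p (p ^ 2 * e (-z)) +
    ser s⁻¹ p (p ^ 2 * e z)

section Laurent

variable {s τ : ℂ}

theorem laurent_periodic (s p : ℂ) : Function.Periodic (laurent s p) 1 := by
  intro z
  rw [laurent, laurent, e_add_one, show e (-(z + 1)) = e (-z) by rw [e_neg, e_neg, e_add_one]]

theorem norm_pow_mul_e_lt {z : ℂ} {k : ℕ} (h : -(k * τ.im) < z.im) :
    ‖e τ ^ k * e z‖ < 1 := by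
  rw [← e_nat_mul, ← e_add]
  exact norm_e_lt_one (by simp; linarith)

theorem differentiableAt_laurent (hs : ‖s‖ = 1) (hτ : 0 < τ.im) {z : ℂ}
    (h1 : -(2 * τ.im) < z.im) (h2 : z.im < 2 * τ.im) : DifferentiableAt ℂ (laurent s (e τ)) z := by
  have hp := norm_e_lt_one hτ
  have hs' : ‖s⁻¹‖ = 1 := by rw [norm_inv, hs, inv_one]
  have a1 := differentiableAt_ser hs hp
    (norm_pow_mul_e_lt (τ := τ) (k := 2) (z := -z) (by push_cast; simp; linarith))
  have a2 := differentiableAt_ser hs' hp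
    (norm_pow_mul_e_lt (τ := τ) (k := 2) (z := z) (by push_cast; linarith))
  have b1 : DifferentiableAt ℂ (fun z => e τ ^ 2 * e (-z)) z :=
    ((differentiable_e (-z)).comp z differentiableAt_id.neg).const_mul _
  have b2 : DifferentiableAt ℂ (fun z => e τ ^ 2 * e z) z := (differentiable_e z).const_mul _
  have c1 := DifferentiableAt.comp (f := fun z => e τ ^ 2 * e (-z)) z a1 b1
  have c2 := DifferentiableAt.comp (f := fun z => e τ ^ 2 * e z) z a2 b2
  exact ((differentiableAt_const _).sub (c1.const_mul s)).add c2

theorem ser_sub_ser_left (hs : ‖s‖ = 1) {p w : ℂ} (hp : ‖p‖ < 1) (hw : ‖w‖ < 1) :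
    ser s p (p * w) - s⁻¹ * ser s p w = -s⁻¹ * lam 1 w (p ^ 3) := by
  have hs0 : s ≠ 0 := norm_pos_iff.1 (by rw [hs]; exact one_pos)
  have hp3 : ‖p ^ 3‖ < 1 := by rw [norm_pow]; exact pow_lt_one₀ (norm_nonneg _) hp (by norm_num)
  have hpw : ‖p * w‖ < 1 := by
    rw [norm_mul]; exact mul_lt_one_of_nonneg_of_lt_one_left (norm_nonneg _) hp hw.le
  refine ((hasSum_ser hs hp hpw).sub ((hasSum_ser hs hp hw).mul_left _)).unique
    (((hasSum_lam 1 hw hp3).mul_left (-s⁻¹)).congr_fun fun m => ?_)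
  rcases Nat.eq_zero_or_pos m with rfl | hm
  · simp
  have h1 := one_sub_ne_zero hs hp hm.ne'
  have h2 := one_sub_pow_ne_zero hp (m := 3 * m) (by omega)
  rw [← pow_mul, mul_pow, pow_one]
  generalize p ^ m = q at *
  generalize p ^ (3 * m) = u at *
  rw [← mul_div_mul_right _ (1 - u) h1, ← mul_div_assoc, ← mul_div_assoc, ← sub_div]
  congr 1
  linear_combination (-(m * w ^ m * q)) * inv_mul_cancel₀ hs0

theorem ser_sub_ser_right (hs : ‖s‖ = 1) {p w : ℂ} (hp : ‖p‖ < 1) (hw : ‖w‖ < 1) :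
    ser s p w - s * ser s p (p * w) = lam 1 w (p ^ 3) := by
  have hs0 : s ≠ 0 := norm_pos_iff.1 (by rw [hs]; exact one_pos)
  linear_combination (-s) * ser_sub_ser_left hs hp hw + 
    (lam 1 w (p ^ 3) - ser s p w) * mul_inv_cancel₀ hs0

/-- The functional equation of `Uniformizes`, up to the scale: the translation by `τ` multiplies
`e z` by `e τ`, and the Fourier expansion of `dfun` is recovered term by term. -/
theorem laurent_shift {hτ : 0 < τ.im} (hs : ‖s‖ = 1) (hs1 : s ≠ 1) {z : ℂ}
    (h1 : -(2 * τ.im) < z.im) (h2 : z.im < τ.im) :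
    (2 * Real.pi * I) ^ 2 * (laurent s (e τ) z - s⁻¹ * laurent s (e τ) (z + τ)) =
      dfun τ hτ (z - τ) := by
  have hs0 : s ≠ 0 := norm_pos_iff.1 (by rw [hs]; exact one_pos)
  have hs' : ‖s⁻¹‖ = 1 := by rw [norm_inv, hs, inv_one]
  have hp := norm_e_lt_one hτ
  have hs2 : 1 - s⁻¹ ≠ 0 := by
    rw [sub_ne_zero]; intro h; exact hs1 (by rw [← inv_inv s, ← h, inv_one])
  have w1 := norm_pow_mul_e_lt (τ := τ) (k := 1) (z := -z) (by push_cast; simp; linarith)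
  have w2 := norm_pow_mul_e_lt (τ := τ) (k := 2) (z := z) (by push_cast; linarith)
  have r1 := ser_sub_ser_left hs hp w1
  have r2 := ser_sub_ser_right hs' hp w2
  have hτ0 := e_ne_zero τ
  rw [dfun_fourier (by simp; linarith) (by simp; linarith)]
  have x1 : e (-(z - τ)) = e τ ^ 1 * e (-z) := by
    rw [pow_one, ← e_add]; congr 1; ring
  have x2 : e τ ^ 3 * e (z - τ) = e τ ^ 2 * e z := by
    rw [sub_eq_add_neg, e_add, e_neg]; field_simp
  have x3 : e τ ^ 2 * e (-(z + τ)) = e τ ^ 1 * e (-z) := by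
    rw [neg_add, e_add, e_neg τ]; field_simp
  have x4 : e τ ^ 2 * e (z + τ) = e τ * (e τ ^ 2 * e z) := by rw [e_add]; ring
  have x5 : e τ ^ 2 * e (-z) = e τ * (e τ ^ 1 * e (-z)) := by ring
  rw [x1, x2, laurent, laurent, x3, x4, x5]
  set L := lam 1 (e τ) (e τ ^ 3) + lam 1 (e τ ^ 2) (e τ ^ 3)
  have h3 : -L / (1 - s⁻¹) - s⁻¹ * (-L / (1 - s⁻¹)) = -L := by
    rw [← one_sub_mul, mul_div_cancel₀ _ hs2]
  linear_combination (2 * Real.pi * I) ^ 2 * (h3 - s * r1 + r2 +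
    lam 1 (e τ ^ 1 * e (-z)) (e τ ^ 3) * mul_inv_cancel₀ hs0)

end Laurent

/-- The series `∑ m (pᵐ / (s - pᵐ) + s pᵐ / (1 - s pᵐ))`. -/
noncomputable def sig (s p : ℂ) : ℂ := ∑' m : ℕ, m *
  (p ^ m / (s - p ^ m) + s * p ^ m / (1 - s * p ^ m))

theorem sig_term {s p : ℂ} (hs : ‖s‖ = 1) (m : ℕ) :
    p ^ m / (s - p ^ m) = s⁻¹ * p ^ m / (1 - s⁻¹ * p ^ m) := by
  have hs0 : s ≠ 0 := norm_pos_iff.1 (by rw [hs]; exact one_pos)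
  have : s - p ^ m = s * (1 - s⁻¹ * p ^ m) := by rw [mul_sub, mul_inv_cancel_left₀ hs0, mul_one]
  rw [this, ← div_div, mul_comm s⁻¹, div_eq_mul_inv (p ^ m)]

theorem norm_sig_term_le {s p : ℂ} (hs : ‖s‖ = 1) (hp : ‖p‖ < 1) (m : ℕ) :
    ‖m * (p ^ m / (s - p ^ m) + s * p ^ m / (1 - s * p ^ m))‖ ≤ m * ‖p‖ ^ m * (2 * (1 - ‖p‖)⁻¹) :=
      by
  have h0 : 0 < 1 - ‖p‖ := by linarith
  rcases Nat.eq_zero_or_pos m with rfl | hm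
  · simp
  have key : ∀ σ : ℂ, ‖σ‖ = 1 → ‖σ * p ^ m / (1 - σ * p ^ m)‖ ≤ ‖p‖ ^ m * (1 - ‖p‖)⁻¹ := by
    intro σ hσ
    rw [norm_div, norm_mul, hσ, one_mul, norm_pow, div_eq_mul_inv]
    gcongr
    exact one_sub_le_norm hσ hp hm.ne'
  rw [sig_term hs, norm_mul, norm_natCast, mul_assoc]
  gcongr
  refine (norm_add_le _ _).trans ((add_le_add (key _ (by rw [norm_inv, hs, inv_one]))
    (key s hs)).trans (le_of_eq (by ring)))

theorem hasSum_sig {s p : ℂ} (hs : ‖s‖ = 1) (hp : ‖p‖ < 1) :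
    HasSum (fun m : ℕ => m * (p ^ m / (s - p ^ m) + s * p ^ m / (1 - s * p ^ m))) (sig s p) :=
  (Summable.of_norm_bounded (summable_ser_bound (norm_nonneg p) hp _)
    fun m => norm_sig_term_le hs hp m).hasSum

theorem cube_root_facts : ‖exp (2 * Real.pi * I / 3)‖ = 1 ∧
    exp (2 * Real.pi * I / 3) ^ 2 + exp (2 * Real.pi * I / 3) + 1 = 0 := by
  constructor
  · rw [show (2 * Real.pi * I / 3 : ℂ) = ((2 * Real.pi / 3 : ℝ) : ℂ) * I by push_cast; ring,
      norm_exp_ofReal_mul_I]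
  · have := exp_two_pi_div_three_sq
    rw [this]; ring

/-- The value at `0` of the Laurent series. -/
theorem laurent_zero {s p : ℂ} (hs : ‖s‖ = 1) (hs1 : s ≠ 1) (hs3 : 1 + s + s ^ 2 ≠ 0)
    (hp : ‖p‖ < 1) :
    (1 - s⁻¹) * laurent s p 0 =
      -(s / (1 + s + s ^ 2)) * (sig s p - sig (exp (2 * Real.pi * I / 3)) p) := by
  obtain ⟨hω, hω2⟩ := cube_root_facts
  set ω := exp (2 * Real.pi * I / 3)
  have hs0 : s ≠ 0 := norm_pos_iff.1 (by rw [hs]; exact one_pos)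
  have hs' : ‖s⁻¹‖ = 1 := by rw [norm_inv, hs, inv_one]
  have hs2 : 1 - s⁻¹ ≠ 0 := by
    rw [sub_ne_zero]; intro h; exact hs1 (by rw [← inv_inv s, ← h, inv_one])
  have hp2 : ‖p ^ 2‖ < 1 := by rw [norm_pow]; exact pow_lt_one₀ (norm_nonneg _) hp (by norm_num)
  have hp3 : ‖p ^ 3‖ < 1 := by rw [norm_pow]; exact pow_lt_one₀ (norm_nonneg _) hp (by norm_num)
  have e1 : (1 - s⁻¹) * laurent s p 0 = -(lam 1 p (p ^ 3) + lam 1 (p ^ 2) (p ^ 3)) +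
      (1 - s⁻¹) * (ser s⁻¹ p (p ^ 2) - s * ser s p (p ^ 2)) := by
    rw [laurent, neg_zero, show e 0 = 1 by simp [e], mul_one]
    field_simp
    ring
  rw [e1]
  refine HasSum.unique ((((hasSum_lam 1 hp hp3).add (hasSum_lam 1 hp2 hp3)).neg).add
    (((hasSum_ser hs' hp hp2).sub ((hasSum_ser hs hp hp2).mul_left s)).mul_left _))
    ((((hasSum_sig hs hp).sub (hasSum_sig hω hp)).mul_left _).congr_fun fun m => ?_)
  rcases Nat.eq_zero_or_pos m with rfl | hm
  · simp
  have hq : ∀ k : ℕ, p ^ (k * m) = (p ^ m) ^ k := fun k => by rw [mul_comm, pow_mul]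
  have n1 := one_sub_ne_zero hs hp hm.ne'
  have n2 := one_sub_ne_zero hs' hp hm.ne'
  have n3 := one_sub_ne_zero hω hp hm.ne'
  have n5 := one_sub_pow_ne_zero hp (m := 3 * m) (by omega)
  have n6 : s - p ^ m ≠ 0 := by
    intro h; apply n2; rw [← sub_eq_zero.1 h, inv_mul_cancel₀ hs0, sub_self]
  have n7 : ω - p ^ m ≠ 0 := by
    have hω0 : ω ≠ 0 := exp_ne_zero _
    have := one_sub_ne_zero (s := ω⁻¹) (by rw [norm_inv, hω, inv_one]) hp hm.ne'
    intro h; apply this; rw [← sub_eq_zero.1 h, inv_mul_cancel₀ hω0, sub_self]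
  rw [← pow_mul, ← pow_mul, hq 3, hq 2]
  rw [hq 3] at n5
  set q := p ^ m
  have n8 : 1 - q ≠ 0 := one_sub_pow_ne_zero hp hm.ne'
  have f5 : 1 - q ^ 3 = (1 - q) * (1 + q + q ^ 2) := by ring
  have n9 : 1 + q + q ^ 2 ≠ 0 := fun h => n5 (by rw [f5, h, mul_zero])
  have e2 : q / (ω - q) + ω * q / (1 - ω * q) = -(q + 2 * q ^ 2) / (1 + q + q ^ 2) := by
    rw [div_add_div _ _ n7 n3, div_eq_div_iff (mul_ne_zero n7 n3) n9]
    linear_combination q * (1 - q ^ 2) * hω2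
  have e3 : 1 - s⁻¹ * q = (s - q) / s := by field_simp
  have n1' : 1 - q * s ≠ 0 := by rwa [mul_comm]
  rw [e2, e3, f5]
  field_simp
  ring

end

/-! ### Parametrization of the generating function -/

/-- The Lambert series of the lattice sum `s3`. -/
noncomputable def eis3 (p : ℂ) : ℂ := lam 2 p (p ^ 3) - lam 2 (p ^ 2) (p ^ 3)

/-- The Lambert series of the lattice sum `s4`. -/
noncomputable def eis4 (p : ℂ) : ℂ := lam 3 p (p ^ 3) + lam 3 (p ^ 2) (p ^ 3)

theorem s3_eq_eis3 {τ : ℂ} {hτ : 0 < τ.im} : s3 τ hτ = -4 * Real.pi ^ 3 * I * eis3 (e τ) := by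
  rw [s3_eq, eis3]
  linear_combination (-4 * Real.pi ^ 3 * (lam 2 (e τ ^ 2) (e τ ^ 3) - lam 2 (e τ) (e τ ^ 3))) *
    I * I_sq

theorem s4_eq_eis4 {τ : ℂ} {hτ : 0 < τ.im} : s4 τ hτ = 8 / 3 * Real.pi ^ 4 * eis4 (e τ) := by
  rw [s4_eq, eis4, mul_pow, I_pow_four]
  ring

/-- A Lambert series is close to its first term near `0`. -/
theorem exists_norm_lam_sub_le (k : ℕ) : ∃ A : ℝ, 0 ≤ A ∧ ∀ x y : ℂ, ‖x‖ ≤ 1 / 2 → ‖y‖ ≤ ‖x‖ →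
    ‖lam k x y - x‖ ≤ A * ‖x‖ ^ 2 := by
  have hs : Summable fun m : ℕ => ((m + 2 : ℕ) : ℝ) ^ k * (1 / 2) ^ m * 2 := by
    have := (summable_nat_add_iff 2).2
      (summable_pow_mul_geometric_of_norm_lt_one k (r := (1 / 2 : ℝ)) (by norm_num))
    refine ((this.mul_right 4).mul_right 2).congr fun m => ?_
    rw [pow_add]; ring
  refine ⟨2 + ∑' m : ℕ, ((m + 2 : ℕ) : ℝ) ^ k * (1 / 2) ^ m * 2,
    add_nonneg (by norm_num) (tsum_nonneg fun m => by positivity), fun x y hx hy => ?_⟩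
  have hy2 : ‖y‖ ≤ 1 / 2 := hy.trans hx
  have hden : ∀ m : ℕ, m ≠ 0 → (1 : ℝ) / 2 ≤ ‖1 - y ^ m‖ := fun m hm => by
    have := one_sub_le_norm (s := 1) (by simp) (p := y) (by linarith) hm
    rw [one_mul] at this
    linarith
  have h := hasSum_lam k (x := x) (y := y) (by linarith) (by linarith)
  have h2 := (hasSum_nat_add_iff' 2).2 h
  simp only [Finset.sum_range_succ, Finset.sum_range_zero] at h2
  have hb : ‖lam k x y - (0 + (((0 : ℕ) : ℂ) ^ k * x ^ 0 / (1 - y ^ 0)) +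
      (((1 : ℕ) : ℂ) ^ k * x ^ 1 / (1 - y ^ 1)))‖ ≤
      (∑' m : ℕ, ((m + 2 : ℕ) : ℝ) ^ k * (1 / 2) ^ m * 2) * ‖x‖ ^ 2 := by
    rw [← h2.tsum_eq]
    refine tsum_of_norm_bounded (hs.hasSum.mul_right (‖x‖ ^ 2)) fun m => ?_
    rw [norm_div, norm_mul, norm_pow, norm_natCast, norm_pow, pow_add ‖x‖, div_eq_mul_inv]
    have h3 : ‖1 - y ^ (m + 2)‖⁻¹ ≤ 2 := by
      have := inv_anti₀ (by norm_num) (hden (m + 2) (by omega))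
      simpa using this
    calc ((m + 2 : ℕ) : ℝ) ^ k * (‖x‖ ^ m * ‖x‖ ^ 2) * ‖1 - y ^ (m + 2)‖⁻¹
        ≤ ((m + 2 : ℕ) : ℝ) ^ k * ((1 / 2) ^ m * ‖x‖ ^ 2) * 2 := by gcongr
      _ = _ := by ring
  have h1 : ‖x / (1 - y) - x‖ ≤ 2 * ‖x‖ ^ 2 := by
    have hd := hden 1 one_ne_zero
    rw [pow_one] at hd
    have hne : 1 - y ≠ 0 := norm_pos_iff.1 (by linarith)
    have : x / (1 - y) - x = x * y / (1 - y) := by field_simp; ring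
    rw [this, norm_div, norm_mul, div_le_iff₀ (by linarith)]
    nlinarith [norm_nonneg x, norm_nonneg y, mul_le_mul_of_nonneg_left hy (norm_nonneg x)]
  simp only [pow_zero, sub_self, div_zero, Nat.cast_one, one_pow, one_mul, pow_one, add_zero,
    zero_add] at hb
  calc ‖lam k x y - x‖ = ‖(lam k x y - x / (1 - y)) + (x / (1 - y) - x)‖ := by congr 1; ring
    _ ≤ _ := (norm_add_le _ _).trans (by linarith)

theorem exists_norm_lam_le (k : ℕ) : ∃ A : ℝ, 0 ≤ A ∧ ∀ x y : ℂ, ‖x‖ ≤ 1 / 2 → ‖y‖ ≤ ‖x‖ →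
    ‖lam k x y‖ ≤ A * ‖x‖ := by
  obtain ⟨A, hA, h⟩ := exists_norm_lam_sub_le k
  refine ⟨A + 1, by linarith, fun x y hx hy => ?_⟩
  calc ‖lam k x y‖ = ‖(lam k x y - x) + x‖ := by rw [sub_add_cancel]
    _ ≤ A * ‖x‖ ^ 2 + ‖x‖ := (norm_add_le _ _).trans (add_le_add_left (h x y hx hy) _)
    _ ≤ (A + 1) * ‖x‖ := by
      have h1 : ‖x‖ ^ 2 ≤ ‖x‖ := by nlinarith [norm_nonneg x]
      nlinarith [mul_le_mul_of_nonneg_left h1 hA]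

/-- Near `0` the two Lambert series behave like `p`. -/
theorem exists_norm_eis_sub_le : ∃ A : ℝ, 0 ≤ A ∧ ∀ p : ℂ, ‖p‖ ≤ 1 / 2 →
    ‖eis3 p - p‖ ≤ A * ‖p‖ ^ 2 ∧ ‖eis4 p - p‖ ≤ A * ‖p‖ ^ 2 := by
  obtain ⟨A, hA, h2⟩ := exists_norm_lam_sub_le 2
  obtain ⟨A', hA', h2'⟩ := exists_norm_lam_le 2
  obtain ⟨B, hB, h3⟩ := exists_norm_lam_sub_le 3
  obtain ⟨B', hB', h3'⟩ := exists_norm_lam_le 3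
  refine ⟨A + A' + B + B', by positivity, fun p hp => ?_⟩
  have hp1 : ‖p‖ ≤ 1 := by linarith
  have n2 : ‖p ^ 2‖ = ‖p‖ ^ 2 := norm_pow _ _
  have n3 : ‖p ^ 3‖ = ‖p‖ ^ 3 := norm_pow _ _
  have a1 : ‖p ^ 3‖ ≤ ‖p‖ := by rw [n3]; exact pow_le_of_le_one (norm_nonneg p) hp1 (by norm_num)
  have a2 : ‖p ^ 3‖ ≤ ‖p ^ 2‖ := by
    rw [n3, n2]; exact pow_le_pow_of_le_one (norm_nonneg p) hp1 (by norm_num)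
  have a3 : ‖p ^ 2‖ ≤ 1 / 2 := by
    rw [n2]; nlinarith [norm_nonneg p]
  have b1 := h2 p _ hp a1
  have b2 := h2' _ _ a3 a2
  have b3 := h3 p _ hp a1
  have b4 := h3' _ _ a3 a2
  rw [n2] at b2 b4
  have hp2 : 0 ≤ ‖p‖ ^ 2 := by positivity
  constructor
  · calc ‖eis3 p - p‖ = ‖(lam 2 p (p ^ 3) - p) - lam 2 (p ^ 2) (p ^ 3)‖ :=
        by rw [eis3]; congr 1; ring
      _ ≤ A * ‖p‖ ^ 2 + A' * ‖p‖ ^ 2 := (norm_sub_le _ _).trans (add_le_add b1 b2)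
      _ ≤ _ := by nlinarith
  · calc ‖eis4 p - p‖ = ‖(lam 3 p (p ^ 3) - p) + lam 3 (p ^ 2) (p ^ 3)‖ :=
        by rw [eis4]; congr 1; ring
      _ ≤ B * ‖p‖ ^ 2 + B' * ‖p‖ ^ 2 := (norm_add_le _ _).trans (add_le_add b3 b4)
      _ ≤ _ := by nlinarith

/-- The function `dfun` is small between the two lines of integration. -/
theorem exists_norm_dfun_le : ∃ A : ℝ, 0 ≤ A ∧ ∀ (τ : ℂ) (hτ : 0 < τ.im) (ρ : ℝ),
    ρ = Real.exp (-(2 * Real.pi * τ.im / 3)) → ρ ≤ 1 / 2 →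
    ∀ z : ℂ, -(5 / 3 * τ.im) ≤ z.im → z.im ≤ -(2 / 3 * τ.im) → ‖dfun τ hτ z‖ ≤
      4 * Real.pi ^ 2 * (A * ρ ^ 2) := by
  obtain ⟨A, hA, h⟩ := exists_norm_lam_le 1
  refine ⟨4 * A, by positivity, fun τ hτ ρ hρ hρ2 z h1 h2 => ?_⟩
  have hpi := Real.pi_pos
  have hρ0 : 0 < ρ := by rw [hρ]; exact Real.exp_pos _
  have hρp : ∀ n : ℕ, ρ ^ n = Real.exp (-(2 * Real.pi * (n * τ.im / 3))) := fun n => by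
    rw [hρ, ← Real.exp_nat_mul]; congr 1; ring
  have hle : ∀ (w : ℂ) (n : ℕ), n * τ.im / 3 ≤ w.im → ‖e w‖ ≤ ρ ^ n := fun w n hw => by
    rw [hρp, norm_e, Real.exp_le_exp]
    nlinarith
  have hle' : ∀ n m : ℕ, m ≤ n → ρ ^ n ≤ ρ ^ m := fun n m hnm =>
    pow_le_pow_of_le_one hρ0.le (by linarith) hnm
  have hhalf : ∀ n : ℕ, n ≠ 0 → ρ ^ n ≤ 1 / 2 := fun n hn =>
    (pow_le_of_le_one hρ0.le (by linarith) hn).trans hρ2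
  have q3 : e τ ^ 3 = e (3 * τ) := by rw [← e_nat_mul]; norm_num
  have q2 : e τ ^ 2 = e (2 * τ) := by rw [← e_nat_mul]; norm_num
  have mono : ∀ w w' : ℂ, w'.im ≤ w.im → ‖e w‖ ≤ ‖e w'‖ := fun w w' hw => by
    rw [norm_e, norm_e, Real.exp_le_exp]; nlinarith
  have key : ∀ w : ℂ, 2 * τ.im / 3 ≤ w.im → w.im ≤ 3 * τ.im → ‖lam 1 (e w) (e (3 * τ))‖ ≤ A *
      ρ ^ 2 := by
    intro w hw hw'
    have e1 := hle w 2 (by push_cast; linarith)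
    refine (h _ _ (e1.trans (hhalf 2 (by norm_num))) (mono _ _ (by simp; linarith))).trans ?_
    gcongr
  have k1 := key (-z) (by simp; linarith) (by simp; linarith)
  have k3 := key τ (by linarith) (by linarith)
  have k4 := key (2 * τ) (by simp; linarith) (by simp; linarith)
  have k2 := key (3 * τ + z) (by simp; linarith) (by simp; linarith)
  rw [dfun_fourier (by linarith) (by linarith), norm_mul, q3, q2, ← e_add]
  have hn : ‖(2 * Real.pi * I : ℂ) ^ 2‖ = 4 * Real.pi ^ 2 := by
    rw [mul_pow, I_sq]
    simp [abs_of_pos hpi]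
    ring
  rw [hn]
  refine mul_le_mul_of_nonneg_left ?_ (by positivity)
  refine (norm_sub_le _ _).trans ?_
  have n1 := norm_add_le (lam 1 (e (-z)) (e (3 * τ))) (lam 1 (e (3 * τ + z)) (e (3 * τ)))
  have n2 := norm_add_le (lam 1 (e τ) (e (3 * τ))) (lam 1 (e (2 * τ)) (e (3 * τ)))
  linarith

set_option maxHeartbeats 1000000 in
/-- For `τ` high up in the upper half plane, the generating function of the numbers of walks in
the variable `t³` is uniformized by `t³ = eis3⁴ / eis4³`. -/
theorem exists_hasSum_coef {w₀ : ℤ × ℤ} (h₀ : w₀ ∈ nearOrigin) {α β : ℝ}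
    (hβ : β * (2 * Real.pi / 3) = α) (hs1 : exp (α * I) ≠ 1)
    (hs3 : 1 + exp (α * I) + exp (α * I) ^ 2 ≠ 0) :
    ∃ Y : ℝ, 0 < Y ∧ ∀ τ : ℂ, Y ≤ τ.im → eis3 (e τ) ≠ 0 ∧ eis4 (e τ) ≠ 0 ∧
      HasSum (fun m : ℕ => coef w₀ β (3 * m) 1 1 * (eis3 (e τ) ^ 4 / eis4 (e τ) ^ 3) ^ m)
        (exp (α * I) / (1 + exp (α * I) + exp (α * I) ^ 2) * (eis4 (e τ) / eis3 (e τ) ^ 2) *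
          (sig (exp (α * I)) (e τ) - sig (exp (2 * Real.pi * I / 3)) (e τ))) := by
  obtain ⟨A, hA, hD⟩ := exists_norm_dfun_le
  obtain ⟨B, hB, hE⟩ := exists_norm_eis_sub_le
  set s := exp (α * I) with hs
  have hsn : ‖s‖ = 1 := norm_exp_ofReal_mul_I _
  have hpi := Real.pi_pos
  set R : ℝ := max 1 (2 * A) with hR
  have hR1 : 1 ≤ R := le_max_left _ _
  -- `ρ` is small in terms of the constants
  have hlim : Tendsto (fun y : ℝ => Real.exp (-(2 * Real.pi * y / 3))) atTop (𝓝 0) := by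
    refine Real.tendsto_exp_neg_atTop_nhds_zero.comp ?_
    have : Tendsto (fun y : ℝ => (2 * Real.pi / 3) * y) atTop atTop :=
      tendsto_id.const_mul_atTop (by positivity)
    exact this.congr fun y => by ring
  have hev := (hlim.eventually_lt_const (u := 1 / 2) (by norm_num)).and
    ((hlim.eventually_lt_const (u := 1 / (2 * (B + 1))) (by positivity)).and
    ((hlim.eventually_lt_const (u := 1 / (18 * R ^ 2))
      (by positivity)).and (eventually_gt_atTop 0)))
  obtain ⟨Y, hY⟩ := eventually_atTop.1 hev
  refine ⟨max Y 1, by positivity, fun τ hτY => ?_⟩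
  obtain ⟨g1, g2, g3, hτ⟩ := hY τ.im ((le_max_left _ _).trans hτY)
  set ρ := Real.exp (-(2 * Real.pi * τ.im / 3)) with hρ
  have hρ0 : 0 < ρ := Real.exp_pos _
  set p := e τ with hp
  have hpn : ‖p‖ = ρ ^ 3 := by
    rw [hp, norm_e, hρ, ← Real.exp_nat_mul]; congr 1; push_cast; ring
  have hp1 : ‖p‖ < 1 := norm_e_lt_one hτ
  have hpρ : ‖p‖ ≤ ρ := by rw [hpn]; exact pow_le_of_le_one hρ0.le (by linarith) (by norm_num)
  have hp0 : 0 < ‖p‖ := by rw [hpn]; positivity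
  obtain ⟨E3, E4⟩ := hE p (by linarith)
  have hBp : B * ‖p‖ ^ 2 ≤ ‖p‖ / 2 := by
    have h1 : ρ * (2 * (B + 1)) < 1 := by rwa [lt_div_iff₀ (by positivity)] at g2
    have h2 : B * ‖p‖ ≤ 1 / 2 := by nlinarith
    nlinarith
  have l3 : ‖p‖ / 2 ≤ ‖eis3 p‖ := by
    have := norm_sub_norm_le p (p - eis3 p)
    rw [sub_sub_cancel, norm_sub_rev] at this
    linarith
  have l4 : ‖p‖ / 2 ≤ ‖eis4 p‖ := by
    have := norm_sub_norm_le p (p - eis4 p)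
    rw [sub_sub_cancel, norm_sub_rev] at this
    linarith
  have u3 : ‖eis3 p‖ ≤ 2 * ‖p‖ := by
    have := norm_add_le (eis3 p - p) p
    rw [sub_add_cancel] at this
    linarith
  have n3 : eis3 p ≠ 0 := norm_pos_iff.1 (by linarith)
  have n4 : eis4 p ≠ 0 := norm_pos_iff.1 (by linarith)
  refine ⟨n3, n4, ?_⟩
  obtain ⟨t, ht⟩ := IsAlgClosed.exists_pow_nat_eq (eis3 p ^ 4 / eis4 p ^ 3) (n := 3) (by norm_num)
  have ht0 : t ≠ 0 := by
    rintro rfl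
    have : eis3 p ^ 4 / eis4 p ^ 3 ≠ 0 := div_ne_zero (pow_ne_zero _ n3) (pow_ne_zero _ n4)
    exact this (by rw [← ht]; simp)
  have hpiC : (Real.pi : ℂ) ≠ 0 := by exact_mod_cast hpi.ne'
  -- the scale `κ = t U / T`
  set κ : ℂ := t * eis4 p / (4 * Real.pi ^ 2 * eis3 p ^ 2) with hκ
  have ht' : t ^ 3 * eis4 p ^ 3 = eis3 p ^ 4 := by rw [ht]; field_simp
  have hprod : κ ^ 3 * (-4 * s3 τ hτ ^ 2) = 1 := by
    have h1 : -4 * s3 τ hτ ^ 2 = (4 * Real.pi ^ 2) ^ 3 * eis3 p ^ 2 := by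
      rw [s3_eq_eis3, mul_pow, mul_pow, I_sq]; ring
    rw [h1, hκ, div_pow, mul_pow, ht']
    field_simp
  have hpairs : κ ^ 2 * (6 * s4 τ hτ) = 1 / t := by
    rw [s4_eq_eis4, hκ, div_pow, eq_div_iff ht0]
    field_simp
    linear_combination 48 * ht'
  have u : Uniformizes τ hτ s t κ (fun z => -(κ * (2 * Real.pi * I) ^ 2) * laurent s p z) :=
    { s_ne := exp_ne_zero _
      t_ne := ht0
      periodic := fun z => by simp only [laurent_periodic s p z]
      diff := fun z h1 h2 => (differentiableAt_laurent hsn hτ h1 h2).const_mul _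
      shift := fun z h1 h2 => by
        rw [xi, ← laurent_shift hsn hs1 h1 h2]; ring
      prod := hprod
      pairs := hpairs }
  have hκn : ‖κ‖ * (2 * Real.pi ^ 2 * ρ ^ 2) ≤ 1 := by
    have h1 : ‖κ‖ ^ 3 * (4 * ‖s3 τ hτ‖ ^ 2) = 1 := by
      have := congrArg norm hprod
      simpa using this
    have h2 : ‖s3 τ hτ‖ = 4 * Real.pi ^ 3 * ‖eis3 p‖ := by
      rw [s3_eq_eis3]; simp [abs_of_pos hpi, hp]
    have h3 : (2 * Real.pi ^ 2 * ρ ^ 2) ^ 3 ≤ 4 * ‖s3 τ hτ‖ ^ 2 := by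
      rw [h2]
      have : (ρ ^ 3 / 2) ^ 2 ≤ ‖eis3 p‖ ^ 2 := by
        rw [← hpn]; exact pow_le_pow_left₀ (by positivity) l3 2
      have h6 : 0 ≤ Real.pi ^ 6 := by positivity
      have h7 : Real.pi ^ 6 * (ρ ^ 3 / 2) ^ 2 ≤ Real.pi ^ 6 * ‖eis3 p‖ ^ 2 := by gcongr
      have h8 : 0 ≤ Real.pi ^ 6 * (ρ ^ 3 / 2) ^ 2 := by positivity
      nlinarith
    have h4 : (‖κ‖ * (2 * Real.pi ^ 2 * ρ ^ 2)) ^ 3 ≤ 1 ^ 3 := by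
      rw [mul_pow, one_pow, ← h1]
      gcongr
    exact le_of_pow_le_pow_left₀ (by norm_num) zero_le_one h4
  have hbd : ∀ z : ℂ, -(5 / 3 * τ.im) ≤ z.im → z.im ≤ -(2 / 3 * τ.im) → ‖xi τ hτ κ z‖ ≤ R := by
    intro z h1 h2
    have h3 := hD τ hτ ρ hρ g1.le z h1 h2
    rw [xi, norm_mul]
    calc ‖κ‖ * ‖dfun τ hτ z‖ ≤ ‖κ‖ * (4 * Real.pi ^ 2 * (A * ρ ^ 2)) := by gcongr
      _ = ‖κ‖ * (2 * Real.pi ^ 2 * ρ ^ 2) * (2 * A) := by ring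
      _ ≤ 1 * (2 * A) := by gcongr
      _ ≤ R := by rw [one_mul]; exact le_max_right _ _
  have hbd' : ∀ z : ℂ, 2 / 3 * τ.im ≤ z.im → z.im ≤ 5 / 3 * τ.im → ‖xi τ hτ κ z‖ ≤ R := by
    intro z h1 h2
    rw [← xi_neg]
    exact hbd (-z) (by simp; linarith) (by simp; linarith)
  have htn : 3 * R ^ 2 * ‖t‖ < 1 := by
    have h1 : ‖t‖ ^ 3 * ‖eis4 p‖ ^ 3 = ‖eis3 p‖ ^ 4 := by
      have := congrArg norm ht'
      simpa using this
    have h2 : ‖t‖ ^ 3 * (ρ ^ 3 / 2) ^ 3 ≤ (2 * ρ ^ 3) ^ 4 := by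
      calc ‖t‖ ^ 3 * (ρ ^ 3 / 2) ^ 3 ≤ ‖t‖ ^ 3 * ‖eis4 p‖ ^ 3 := by rw [← hpn]; gcongr
        _ = ‖eis3 p‖ ^ 4 := h1
        _ ≤ _ := by rw [← hpn]; gcongr
    have h3 : ‖t‖ ^ 3 ≤ (6 * ρ) ^ 3 := by
      have h4 : 0 < ρ ^ 9 := by positivity
      have h5 : ‖t‖ ^ 3 * ρ ^ 9 ≤ 128 * ρ ^ 3 * ρ ^ 9 := by nlinarith
      have h6 := le_of_mul_le_mul_right h5 h4
      have h7 : 0 < ρ ^ 3 := by positivity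
      nlinarith
    have h4 : ‖t‖ ≤ 6 * ρ := le_of_pow_le_pow_left₀ (by norm_num) (by positivity) h3
    have h5 : ρ * (18 * R ^ 2) < 1 := by rwa [lt_div_iff₀ (by positivity)] at g3
    have h6 : 0 < R ^ 2 := by positivity
    nlinarith
  have h := u.hasSum_coef h₀ hβ hR1 htn (fun z hz => by
    rcases hz with hz | hz
    · exact ⟨hbd z (by linarith) (by linarith), hbd _ (by simp; linarith) (by simp; linarith)⟩
    · exact ⟨hbd' z (by linarith) (by linarith), hbd' _ (by simp; linarith) (by simp; linarith)⟩)
  -- only the powers of `t³` occur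
  have hinj : Function.Injective fun m : ℕ => 3 * m := fun a b hab => by
    simpa using hab
  rw [← hinj.hasSum_iff (fun n hn => by
    rw [coef_eq_zero h₀ hβ n le_rfl zero_le_one, zero_mul]
    intro hdvd
    apply hn
    have h1 : (3 : ℤ) ∣ n := by
      have := hdvd; omega
    obtain ⟨m, hm⟩ := Int.natCast_dvd_natCast.1 (by exact_mod_cast h1 : ((3 : ℕ) : ℤ) ∣ (n : ℤ))
    exact ⟨m, hm.symm⟩)] at h
  have hval : (s⁻¹ - 1) * (-(κ * (2 * Real.pi * I) ^ 2) * laurent s p 0) / t =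
      s / (1 + s + s ^ 2) * (eis4 p / eis3 p ^ 2) *
        (sig s p - sig (exp (2 * Real.pi * I / 3)) p) := by
    have h1 := laurent_zero hsn hs1 hs3 hp1
    have h2 : (s⁻¹ - 1) * (-(κ * (2 * Real.pi * I) ^ 2) * laurent s p 0) / t =
        ((1 - s⁻¹) * laurent s p 0) * (κ * (2 * Real.pi * I) ^ 2 / t) := by ring
    have h3 : κ * (2 * Real.pi * I) ^ 2 / t = -(eis4 p / eis3 p ^ 2) := by
      rw [hκ, mul_pow, I_sq]; field_simp; norm_num
    rw [h2, h1, h3]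
    ring
  rw [hval] at h
  refine h.congr_fun fun m => ?_
  simp only [Function.comp]
  rw [pow_mul, ht]

/-! ### Coefficients as integrals in the upper half plane -/

/-- A Lambert series with a twist `u` of absolute value `1` is differentiable in the unit disc. -/
theorem differentiableAt_lam_mul (k : ℕ) {u : ℂ} (hu : ‖u‖ = 1) {j l : ℕ} (hj : j ≠ 0) (hl : l ≠ 0)
    {p : ℂ} (hp : ‖p‖ < 1) : DifferentiableAt ℂ (fun p => lam k (u * p ^ j) (p ^ l)) p := by
  obtain ⟨r, hr, hr1⟩ := exists_between hp
  have hr0 : 0 ≤ r := (norm_nonneg p).trans hr.le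
  have h3 : 0 < 1 - r := by linarith
  have hr2 : ‖r‖ < 1 := by rwa [Real.norm_of_nonneg hr0]
  have hsum : Summable fun m : ℕ => (m : ℝ) ^ k * r ^ m * (1 - r)⁻¹ :=
    Summable.mul_right _ (summable_pow_mul_geometric_of_norm_lt_one k hr2)
  have hne : ∀ w ∈ Metric.ball (0 : ℂ) r, ∀ m : ℕ, m ≠ 0 → 1 - r ≤ ‖1 - (w ^ l) ^ m‖ := by
    intro w hw m hm
    have hw : ‖w‖ < r := by simpa using Metric.mem_ball.1 hw
    have h1 := one_sub_le_norm (s := 1) (by simp) (p := w) (by linarith) (m := l * m)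
      (mul_ne_zero hl hm)
    rw [one_mul, pow_mul] at h1
    linarith
  set F : ℕ → ℂ → ℂ := fun m p => (m : ℂ) ^ k * (u * p ^ j) ^ m / (1 - (p ^ l) ^ m) with hF
  have hF0 : F 0 = fun _ => 0 := by funext w; simp [hF]
  have hdiff : ∀ m, DifferentiableOn ℂ (F m) (Metric.ball 0 r) := by
    intro m w hw
    rcases Nat.eq_zero_or_pos m with rfl | hm
    · rw [hF0]; exact differentiableWithinAt_const _
    · have h1 := hne w hw m hm.ne'
      have h2 : 1 - (w ^ l) ^ m ≠ 0 := norm_pos_iff.1 (by linarith)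
      have h3 : DifferentiableAt ℂ (fun p : ℂ => (m : ℂ) ^ k * (u * p ^ j) ^ m) w :=
        (((differentiableAt_id.fun_pow j).const_mul u).fun_pow m).const_mul _
      have h4 : DifferentiableAt ℂ (fun p : ℂ => 1 - (p ^ l) ^ m) w :=
        ((differentiableAt_id.fun_pow l).fun_pow m).const_sub _
      exact (h3.fun_div h4 h2).differentiableWithinAt
  have hbound : ∀ m, ∀ w ∈ Metric.ball (0 : ℂ) r, ‖F m w‖ ≤ (m : ℝ) ^ k * r ^ m * (1 - r)⁻¹ := by
    intro m w hw
    rcases Nat.eq_zero_or_pos m with rfl | hm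
    · rw [hF0, norm_zero]; positivity
    have h1 := hne w hw m hm.ne'
    have hw : ‖w‖ ≤ r := by simpa using (Metric.mem_ball.1 hw).le
    have h2 : (‖w‖ ^ j) ^ m ≤ r ^ m :=
      pow_le_pow_left₀ (by positivity) ((pow_le_of_le_one (norm_nonneg w) (by linarith) hj).trans hw) m
    rw [hF, norm_div, norm_mul, norm_pow, norm_natCast, norm_pow, norm_mul, hu, one_mul, norm_pow,
      div_eq_mul_inv]
    gcongr
  have h := differentiableOn_tsum_of_summable_norm hsum hdiff Metric.isOpen_ball hbound
  have heq : (fun p => lam k (u * p ^ j) (p ^ l)) = fun w => ∑' m, F m w := by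
    funext w; simp only [lam, hF]
  rw [heq]
  exact h.differentiableAt (Metric.isOpen_ball.mem_nhds (by simpa using hr))

theorem differentiableAt_lam (k : ℕ) {j : ℕ} (hj : j ≠ 0) {p : ℂ} (hp : ‖p‖ < 1) :
    DifferentiableAt ℂ (fun p => lam k (p ^ j) (p ^ 3)) p := by
  simpa only [one_mul] using
    differentiableAt_lam_mul k (norm_one (α := ℂ)) hj (l := 3) (by norm_num) hp

theorem differentiableAt_sig {s p : ℂ} (hs : ‖s‖ = 1) (hp : ‖p‖ < 1) :
    DifferentiableAt ℂ (sig s) p := by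
  obtain ⟨r, hr, hr1⟩ := exists_between hp
  have hr0 : 0 ≤ r := (norm_nonneg p).trans hr.le
  have h3 : 0 < 1 - r := by linarith
  have hs0 : s ≠ 0 := norm_pos_iff.1 (by rw [hs]; exact one_pos)
  have h := differentiableOn_tsum_of_summable_norm (E := ℂ) (U := Metric.ball (0 : ℂ) r)
    (F := fun (m : ℕ) p => m * (p ^ m / (s - p ^ m) + s * p ^ m / (1 - s * p ^ m)))
    (summable_ser_bound hr0 hr1 (2 * (1 - r)⁻¹))
    (fun m w hw => by
      have hw : ‖w‖ < 1 := by have := Metric.mem_ball.1 hw; rw [dist_zero_right] at this; linarith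
      rcases Nat.eq_zero_or_pos m with rfl | hm
      · simp only [Nat.cast_zero, zero_mul]; exact differentiableWithinAt_const _
      have h1 := one_sub_ne_zero hs hw hm.ne'
      have h2 : s - w ^ m ≠ 0 := by
        have h2 := one_sub_ne_zero (s := s⁻¹) (by rw [norm_inv, hs, inv_one]) hw hm.ne'
        intro h; apply h2; rw [← sub_eq_zero.1 h, inv_mul_cancel₀ hs0, sub_self]
      have h5 : DifferentiableAt ℂ (fun p : ℂ => p ^ m / (s - p ^ m)) w :=
        DifferentiableAt.fun_div (by fun_prop) (by fun_prop) h2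
      have h6 : DifferentiableAt ℂ (fun p : ℂ => s * p ^ m / (1 - s * p ^ m)) w :=
        DifferentiableAt.fun_div (by fun_prop) (by fun_prop) h1
      exact ((h5.add h6).const_mul _).differentiableWithinAt)
    Metric.isOpen_ball (fun m w hw => by
      have hw : ‖w‖ ≤ r := by simpa using (Metric.mem_ball.1 hw).le
      have h4 : 0 < 1 - ‖w‖ := by linarith
      refine (norm_sig_term_le hs (by linarith) m).trans ?_
      gcongr)
  exact h.differentiableAt (Metric.isOpen_ball.mem_nhds (by simpa using hr))

theorem differentiableAt_eis3 {p : ℂ} (hp : ‖p‖ < 1) : DifferentiableAt ℂ eis3 p := by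
  have := (differentiableAt_lam 2 one_ne_zero hp).sub (differentiableAt_lam 2 two_ne_zero hp)
  simp only [pow_one] at this
  exact this

theorem differentiableAt_eis4 {p : ℂ} (hp : ‖p‖ < 1) : DifferentiableAt ℂ eis4 p := by
  have := (differentiableAt_lam 3 one_ne_zero hp).add (differentiableAt_lam 3 two_ne_zero hp)
  simp only [pow_one] at this
  exact this

/-- Otherwise `dfun` would have a double zero at `τ`. -/
theorem eis3_ne_zero {τ : ℂ} (hτ : 0 < τ.im) : eis3 (e τ) ≠ 0 := by
  intro h
  have := s3_ne_zero (τ := τ) (hτ := hτ)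
  rw [s3_eq_eis3, h, mul_zero] at this
  exact this rfl

/-- The reciprocal of the uniformizing function, `eis4³ / eis3⁴`, as a function of `τ`. -/
noncomputable def gam (τ : ℂ) : ℂ := eis4 (e τ) ^ 3 / eis3 (e τ) ^ 4

theorem differentiableAt_comp_e {F : ℂ → ℂ} (hF : ∀ p : ℂ, ‖p‖ < 1 → DifferentiableAt ℂ F p)
    {τ : ℂ} (hτ : 0 < τ.im) : DifferentiableAt ℂ (fun τ => F (e τ)) τ :=
  (hF _ (norm_e_lt_one hτ)).comp τ (differentiable_e τ)

theorem differentiableAt_gam {τ : ℂ} (hτ : 0 < τ.im) : DifferentiableAt ℂ gam τ :=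
  ((differentiableAt_comp_e (fun _ => differentiableAt_eis4) hτ).fun_pow 3).fun_div
    ((differentiableAt_comp_e (fun _ => differentiableAt_eis3) hτ).fun_pow 4)
    (pow_ne_zero 4 (eis3_ne_zero hτ))

theorem isOpen_upper : IsOpen {τ : ℂ | 0 < τ.im} := isOpen_lt continuous_const continuous_im

theorem differentiableAt_deriv_of_upper {F : ℂ → ℂ}
    (hF : ∀ τ : ℂ, 0 < τ.im → DifferentiableAt ℂ F τ) {τ : ℂ} (hτ : 0 < τ.im) :
    DifferentiableAt ℂ (deriv F) τ := by
  have h : DifferentiableOn ℂ F {τ : ℂ | 0 < τ.im} := fun τ hτ => (hF τ hτ).differentiableWithinAt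
  exact (h.deriv isOpen_upper).differentiableAt (isOpen_upper.mem_nhds hτ)

theorem periodic_deriv {F : ℂ → ℂ} (hF : Function.Periodic F 1) : Function.Periodic (deriv F) 1 :=
    by
  intro z
  rw [← deriv_comp_add_const]
  congr 1
  funext w
  exact hF w

theorem gam_periodic : Function.Periodic gam 1 := fun z => by simp only [gam, e_add_one]

/-- The derivative of a function of period `1` has mean value `0`. -/
theorem mean_deriv_eq_zero {F F' : ℂ → ℂ} {h : ℝ} (hp : Function.Periodic F 1)
    (hF : ∀ z : ℂ, z.im = h → HasDerivAt F (F' z) z)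
    (hF' : ∀ z : ℂ, z.im = h → DifferentiableAt ℂ F' z) : mean h F' = 0 := by
  have h1 : ∀ x : ℝ, HasDerivAt (fun x : ℝ => F (x + h * I)) (F' (x + h * I)) x := by
    intro x
    have := (hF (x + h * I) (by simp)).comp_add_const (x : ℂ) (h * I)
    exact this.comp_ofReal
  rw [mean, intervalIntegral.integral_eq_sub_of_hasDerivAt (fun x _ => h1 x)
    ((continuous_line hF').intervalIntegrable _ _)]
  have := hp ((0 : ℝ) + h * I)
  rw [sub_eq_zero, ← this]
  congr 1
  push_cast; ring

theorem tendsto_div_one {F : ℂ → ℂ} {A : ℝ} (hF : ∀ p : ℂ, ‖p‖ ≤ 1 / 2 → ‖F p - p‖ ≤ A * ‖p‖ ^ 2) :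
    Tendsto (fun p => F p / p) (𝓝[≠] 0) (𝓝 1) := by
  rw [tendsto_iff_norm_sub_tendsto_zero]
  have hn : Tendsto (fun p : ℂ => A * ‖p‖) (𝓝[≠] 0) (𝓝 0) := by
    have : Tendsto (fun p : ℂ => A * ‖p‖) (𝓝 0) (𝓝 (A * ‖(0 : ℂ)‖)) := by
      apply Continuous.tendsto; fun_prop
    rw [norm_zero, mul_zero] at this
    exact this.mono_left nhdsWithin_le_nhds
  refine squeeze_zero' (Eventually.of_forall fun _ => norm_nonneg _) ?_ hn
  filter_upwards [self_mem_nhdsWithin, mem_nhdsWithin_of_mem_nhds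
    (Metric.closedBall_mem_nhds (0 : ℂ) (by norm_num : (0 : ℝ) < 1 / 2))] with p hp hp2
  have hp0 : p ≠ 0 := hp
  have hp1 : 0 < ‖p‖ := norm_pos_iff.2 hp0
  have : F p / p - 1 = (F p - p) / p := by field_simp
  rw [this, norm_div, div_le_iff₀ hp1]
  have := hF p (by simpa using hp2)
  nlinarith

/-- The behaviour of `gam` at the cusp. -/
theorem exists_gam_bounds : ∃ Y : ℝ, 0 < Y ∧ ∀ τ : ℂ, Y ≤ τ.im →
    ‖gam τ * e τ - 1‖ < 1 ∧ ‖(gam τ)⁻¹‖ ≤ 1 / 54 := by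
  obtain ⟨A, hA, h⟩ := exists_norm_eis_sub_le
  have t3 := tendsto_div_one fun p hp => (h p hp).1
  have t4 := tendsto_div_one fun p hp => (h p hp).2
  have tid : Tendsto (fun p : ℂ => p) (𝓝[≠] 0) (𝓝 0) := tendsto_id.mono_left nhdsWithin_le_nhds
  have l1 := (((t4.pow 3).div (t3.pow 4) (by norm_num)).sub_const 1).norm
  have l2 := (tid.mul ((t3.pow 4).div (t4.pow 3) (by norm_num))).norm
  simp only [one_pow, div_one, sub_self, norm_zero, mul_one] at l1 l2
  have hev := (l1.eventually_lt_const (u := 1) one_pos).and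
    (l2.eventually_lt_const (u := 1 / 54) (by norm_num))
  rw [eventually_nhdsWithin_iff, Metric.eventually_nhds_iff] at hev
  obtain ⟨δ, hδ, H⟩ := hev
  have hpi := Real.pi_pos
  have hlim : Tendsto (fun y : ℝ => Real.exp (-(2 * Real.pi * y))) atTop (𝓝 0) := by
    refine Real.tendsto_exp_neg_atTop_nhds_zero.comp ?_
    exact tendsto_id.const_mul_atTop (by positivity)
  obtain ⟨Y, hY⟩ := eventually_atTop.1 (hlim.eventually_lt_const hδ)
  refine ⟨max Y 1, by positivity, fun τ hτ => ?_⟩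
  have h1 := hY τ.im ((le_max_left _ _).trans hτ)
  obtain ⟨h2, h3⟩ := H (y := e τ) (by rwa [dist_zero_right, norm_e]) (e_ne_zero τ)
  have he := e_ne_zero τ
  constructor
  · refine lt_of_eq_of_lt ?_ h2
    congr 2
    simp only [Pi.div_apply]
    rw [gam, div_pow, div_pow]
    field_simp
  · refine le_of_eq_of_le ?_ h3.le
    congr 1
    simp only [Pi.div_apply]
    rw [gam, div_pow, div_pow]
    field_simp

theorem gam_ne_zero_of_bound {τ : ℂ} (h : ‖gam τ * e τ - 1‖ < 1) : gam τ ≠ 0 := by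
  rintro h0
  rw [h0, zero_mul, zero_sub, norm_neg, norm_one] at h
  exact lt_irrefl _ h

/-- `gam` winds once, clockwise, around the origin along a horizontal period high up in the upper
half plane. -/
theorem mean_logDeriv_gam {Y : ℝ} (hY0 : 0 < Y) (hY : ∀ τ : ℂ, Y ≤ τ.im → ‖gam τ * e τ - 1‖ < 1) :
    mean Y (fun τ => deriv gam τ / gam τ) = -(2 * Real.pi * I) := by
  have hd : ∀ z : ℂ, z.im = Y → HasDerivAt gam (deriv gam z) z := fun z hz =>
    (differentiableAt_gam (by linarith)).hasDerivAt
  have hsl : ∀ z : ℂ, z.im = Y → gam z * e z ∈ slitPlane := fun z hz => by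
    have := mem_slitPlane_of_norm_lt_one (hY z hz.ge)
    rwa [add_sub_cancel] at this
  have h := mean_deriv_eq_zero (h := Y) (F := fun z => log (gam z * e z))
    (F' := fun z => deriv gam z / gam z - -(2 * Real.pi * I))
    (fun z => by simp only [gam_periodic z, e_add_one])
    (fun z hz => by
      have h1 := ((hd z hz).fun_mul (hasDerivAt_e z)).clog (hsl z hz)
      convert h1 using 1
      have := gam_ne_zero_of_bound (hY z hz.ge)
      have := e_ne_zero z
      field_simp
      ring)
    (fun z hz => ((differentiableAt_deriv_of_upper (fun _ => differentiableAt_gam)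
      (by linarith)).fun_div (differentiableAt_gam (by linarith))
      (gam_ne_zero_of_bound (hY z hz.ge))).sub_const _)
  rw [mean_sub (g := fun z => deriv gam z / gam z)] at h
  · rw [sub_eq_zero] at h
    rw [h, mean]
    simp
  · exact fun z hz => (differentiableAt_deriv_of_upper (fun _ => differentiableAt_gam)
      (by linarith)).fun_div (differentiableAt_gam (by linarith))
      (gam_ne_zero_of_bound (hY z hz.ge))
  · exact fun z _ => differentiableAt_const _

/-- The coefficients of a power series in `1 / gam`, as integrals over a horizontal period. -/
theorem coef_eq_mean {c : ℕ → ℂ} {G : ℂ → ℂ} {Y₀ : ℝ} (hc : ∀ k, ‖c k‖ ≤ 27 ^ k)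
    (hG : ∀ τ : ℂ, Y₀ ≤ τ.im → HasSum (fun k => c k * ((gam τ)⁻¹) ^ k) (G τ))
    (hGd : ∀ τ : ℂ, 0 < τ.im → DifferentiableAt ℂ G τ) (hGp : Function.Periodic G 1)
    {Y : ℝ} (hY : 0 < Y) (m : ℕ) :
    c (m + 1) = -(2 * Real.pi * I)⁻¹ * mean Y fun τ => G τ * gam τ ^ m * deriv gam τ := by
  obtain ⟨Y₁, hY₁, hb⟩ := exists_gam_bounds
  set H := max Y (max Y₀ Y₁) with hH
  have hH1 : Y₁ ≤ H := (le_max_right _ _).trans (le_max_right _ _)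
  have hH2 : Y₀ ≤ H := (le_max_left _ _).trans (le_max_right _ _)
  have hH0 : 0 < H := lt_of_lt_of_le hY (le_max_left _ _)
  have hd' : ∀ τ : ℂ, 0 < τ.im → DifferentiableAt ℂ (deriv gam) τ := fun τ hτ =>
    differentiableAt_deriv_of_upper (fun _ => differentiableAt_gam) hτ
  -- at a large height the power series converges on the whole line
  have hmove : mean Y (fun τ => G τ * gam τ ^ m * deriv gam τ) =
      mean H fun τ => G τ * gam τ ^ m * deriv gam τ := by
    refine mean_eq_mean (fun z => ?_) (le_max_left _ _) fun z h1 _ => ?_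
    · simp only [hGp z, gam_periodic z, periodic_deriv gam_periodic z]
    · have hz : 0 < z.im := by linarith
      exact ((hGd z hz).fun_mul ((differentiableAt_gam hz).fun_pow m)).fun_mul (hd' z hz)
  have hgne : ∀ z : ℂ, z.im = H → gam z ≠ 0 := fun z hz =>
    gam_ne_zero_of_bound (hb z (by linarith)).1
  have hterm : ∀ k : ℕ, mean H (fun τ => ((gam τ)⁻¹) ^ k * gam τ ^ m * deriv gam τ) =
      if k = m + 1 then -(2 * Real.pi * I) else 0 := by
    intro k
    have hrew : mean H (fun τ => ((gam τ)⁻¹) ^ k * gam τ ^ m * deriv gam τ) =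
        mean H (fun τ => gam τ ^ ((m : ℤ) - k) * deriv gam τ) := mean_congr fun z hz => by
      rw [zpow_sub₀ (hgne z hz), zpow_natCast, zpow_natCast, inv_pow]
      field_simp
    rw [hrew]
    split_ifs with hk
    · rw [← mean_logDeriv_gam hH0 fun τ hτ => (hb τ (by linarith)).1]
      refine mean_congr fun z _ => ?_
      rw [hk, show ((m : ℤ) - (m + 1 : ℕ)) = -1 by push_cast; ring, zpow_neg_one]
      ring
    · set n : ℤ := (m : ℤ) + 1 - k with hn
      have hn0 : (n : ℂ) ≠ 0 := by
        have : n ≠ 0 := by omega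
        exact_mod_cast this
      have h := mean_deriv_eq_zero (h := H) (F := fun z => gam z ^ n)
        (F' := fun z => n * (gam z ^ (n - 1) * deriv gam z))
        (fun z => by simp only [gam_periodic z])
        (fun z hz => by
          have h1 : HasDerivAt gam (deriv gam z) z :=
              (differentiableAt_gam (by linarith)).hasDerivAt
          have := (hasDerivAt_zpow n (gam z) (Or.inl (hgne z hz))).comp z h1
          rw [mul_assoc] at this
          exact this)
        (fun z hz => (((differentiableAt_gam (by linarith)).zpow (Or.inl (hgne z hz))).fun_mul
          (hd' z (by linarith))).const_mul _)
      rw [mean_const_mul] at h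
      have h2 := (mul_eq_zero.1 h).resolve_left hn0
      rw [← h2]
      refine mean_congr fun z _ => ?_
      rw [show n - 1 = (m : ℤ) - k by omega]
  have hline : ∀ k : ℕ, Continuous fun x : ℝ => ((gam (x + H * I))⁻¹) ^ k * gam (x + H * I) ^ m *
      deriv gam (x + H * I) := fun k =>
    continuous_line (g := fun z => ((gam z)⁻¹) ^ k * gam z ^ m * deriv gam z) fun z hz =>
      ((((differentiableAt_gam (by linarith)).fun_inv (hgne z hz)).fun_pow k).fun_mul
        ((differentiableAt_gam (by linarith)).fun_pow m)).fun_mul (hd' z (by linarith))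
  obtain ⟨M, hM⟩ := isCompact_Icc.exists_bound_of_continuousOn (s := Set.Icc (0 : ℝ) 1)
    (hline 0).continuousOn
  have hsum : HasSum (fun k => c k * mean H (fun τ => ((gam τ)⁻¹) ^ k * gam τ ^ m * deriv gam τ))
      (mean H fun τ => G τ * gam τ ^ m * deriv gam τ) := by
    simp only [← mean_const_mul]
    refine intervalIntegral.hasSum_integral_of_dominated_convergence
      (fun k _ => (1 / 2) ^ k * M) (fun k => ?_) (fun k => ?_) ?_ ?_ ?_
    · exact ((hline k).const_mul (c k)).aestronglyMeasurable
    · refine Eventually.of_forall fun x hx => ?_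
      rw [Set.uIoc_of_le zero_le_one] at hx
      have h1 := hM x ⟨hx.1.le, hx.2⟩
      rw [pow_zero, one_mul] at h1
      beta_reduce
      rw [mul_assoc, ← mul_assoc, norm_mul, norm_mul, norm_pow]
      have h2 := (hb (x + H * I) (by simpa using hH1)).2
      have h3 : ‖c k‖ * ‖(gam (x + H * I))⁻¹‖ ^ k ≤ (1 / 2) ^ k := by
        calc ‖c k‖ * ‖(gam (x + H * I))⁻¹‖ ^ k ≤ 27 ^ k * (1 / 54) ^ k := by
              gcongr; exact hc k
          _ = (1 / 2) ^ k := by rw [← mul_pow]; norm_num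
      exact mul_le_mul h3 h1 (norm_nonneg _) (by positivity)
    · refine Eventually.of_forall fun x _ => ?_
      exact (summable_geometric_of_lt_one (by norm_num) (by norm_num)).mul_right M
    · exact intervalIntegrable_const
    · refine Eventually.of_forall fun x _ => ?_
      have := (hG (x + H * I) (by simpa using hH2)).mul_right
        (gam (x + H * I) ^ m * deriv gam (x + H * I))
      rw [← mul_assoc] at this
      exact this.congr_fun fun k => by ring
  have h2 : HasSum (fun k => c k * (if k = m + 1 then -(2 * Real.pi * I) else 0))
      (c (m + 1) * -(2 * Real.pi * I)) := by
    have := hasSum_single (f := fun k => c k * (if k = m + 1 then -(2 * Real.pi * I) else 0))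
        (m + 1)
      (fun k hk => by simp [hk])
    simpa using this
  simp only [hterm] at hsum
  rw [hmove, ← h2.unique hsum]
  have := two_pi_I_ne_zero
  field_simp

/-! ### The lattice sums at the other cusp -/

section

/-- A sum over the lattice `ℤ + cℤ`, column by column. -/
theorem hasSum_columns {c : ℂ} {hc : 0 < c.im} {f : ℂ → ℂ}
    (hf : Summable fun l : (unitPair c hc).lattice => f l) :
    HasSum (fun j : ℤ => ∑' n : ℤ, f (j + n * c)) (∑' l : (unitPair c hc).lattice, f l) := by
  have h1 : HasSum (fun x : ℤ × ℤ => f (x.1 + x.2 * c)) (∑' l : (unitPair c hc).lattice, f l) := by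
    have := ((unitPair c hc).latticeEquivProd.symm.toEquiv.hasSum_iff).2 hf.hasSum
    refine this.congr_fun fun x => ?_
    have h2 := (unitPair c hc).latticeEquiv_symm_apply x
    have h3 : (x.1 : ℂ) + x.2 * c = ((unitPair c hc).latticeEquivProd.symm x : ℂ) := by
      rw [h2]; simp [unitPair]
    rw [h3]; rfl
  exact h1.prod_fiberwise fun n => (h1.summable.prod_factor n).hasSum

/-- The sum of `(1/3 + l)⁻ʳ` over the lattice `ℤ + σℤ`, as a function of `q = e σ`. -/
noncomputable def cusp (r : ℕ) (q : ℂ) : ℂ :=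
  row r (1 / 3) + lip r * (lam (r - 1) (e (1 / 3) * q) q + (-1) ^ r *
    lam (r - 1) (e (-(1 / 3)) * q) q)

/-- The behaviour of the lattice sums under `τ ↦ -1 / (3τ)`. -/
theorem sumInvPow_eq_cusp {r : ℕ} (hr : 3 ≤ r) {τ σ : ℂ} {hτ : 0 < τ.im} (hσ : 0 < σ.im)
    (h : 3 * τ * σ = -1) : (L3 τ hτ).sumInvPow τ r = σ ^ r * cusp r (e σ) := by
  set L := L3 τ hτ
  have hsum := (L.hasSum_sumInvPow τ (r := r) (by omega)).summable
  have key := (hasSum_columns (f := fun l => ((l - τ) ^ r)⁻¹) hsum)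
  have hσ0 : σ ≠ 0 := by rintro rfl; simp at hσ
  have hrow : ∀ j : ℤ, ∑' n : ℤ, ((j + n * (3 * τ) - τ) ^ r)⁻¹ = σ ^ r * row r (1 / 3 + j * σ) := by
    intro j
    rw [row, ← tsum_mul_left, ← (Equiv.neg ℤ).tsum_eq]
    refine tsum_congr fun n => ?_
    have h1 : (j : ℂ) + ((Equiv.neg ℤ n : ℤ) : ℂ) * (3 * τ) - τ = σ⁻¹ * (1 / 3 + j * σ + n) := by
      have h2 : σ⁻¹ = -(3 * τ) := inv_eq_of_mul_eq_one_left (by linear_combination -h)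
      have h3 : σ⁻¹ * (1 / 3 + j * σ + n) = σ⁻¹ * (1 / 3 + n) + j * (σ⁻¹ * σ) := by ring
      rw [h3, inv_mul_cancel₀ hσ0, h2]
      simp
      ring
    rw [h1, mul_pow, mul_inv, inv_pow, inv_inv, one_div (_ ^ r)]
  simp only [hrow] at key
  have e1 : (1 / 3 + σ).im = σ.im := by simp
  have e2 : (-(1 / 3) + σ).im = σ.im := by simp
  have r1 := hasSum_row_nat (r := r) (by omega) (a := 1 / 3 + σ) (σ := σ) (by rwa [e1]) hσ
  have r2 := (hasSum_row_nat (r := r) (by omega) (a := -(1 / 3) + σ) (σ := σ) (by rwa [e2]) hσ).mul_left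
    ((-1) ^ r)
  have r3 : HasSum (fun n : ℕ => row r (1 / 3 + ((n : ℤ) : ℂ) * σ))
      (lip r * lam (r - 1) (e (1 / 3 + σ)) (e σ) + row r (1 / 3)) := by
    have := (hasSum_nat_add_iff (f := fun n : ℕ => row r (1 / 3 + ((n : ℤ) : ℂ) * σ)) 1).1
      (r1.congr_fun fun n => by push_cast; congr 1; ring)
    simpa using this
  have hp := HasSum.of_nat_of_neg_add_one (f := fun n : ℤ => row r (1 / 3 + n * σ)) r3
    (r2.congr_fun fun n => by
      have a1 : (1 / 3 : ℂ) + ((-((n : ℤ) + 1) : ℤ) : ℂ) * σ = -(-(1 / 3) + σ + n * σ) := by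
        push_cast; ring
      rw [a1, row_neg])
  rw [PeriodPair.sumInvPow, key.unique (hp.mul_left (σ ^ r)), cusp, e_add, e_add]
  ring

/-- A row through `1/3` is a sum over the residue classes `1` and `2` modulo `3`. -/
theorem row_one_third {r : ℕ} (hr : 2 ≤ r) : row r (1 / 3) =
    3 ^ r * ((∑' k : ℕ, 1 / ((1 + 3 * k : ℕ) : ℂ) ^ r) +
      (-1) ^ r * ∑' k : ℕ, 1 / ((2 + 3 * k : ℕ) : ℂ) ^ r) := by
  have h := summable_row hr (1 / 3)
  have h1 := (h.comp_injective (i := fun n : ℕ => (n : ℤ)) Nat.cast_injective)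
  have h2 := (h.comp_injective (i := fun n : ℕ => -((n : ℤ) + 1))
      (fun a b hab => by simpa using hab))
  have h3 := HasSum.of_nat_of_neg_add_one (f := fun j : ℤ => 1 / ((1 / 3 : ℂ) + j) ^ r) h1.hasSum
    h2.hasSum
  rw [row, h3.tsum_eq, mul_add, ← tsum_mul_left,
    ← tsum_mul_left, ← tsum_mul_left]
  congr 1
  · refine tsum_congr fun k => ?_
    have : (1 / 3 : ℂ) + ((k : ℤ) : ℂ) = ((1 + 3 * k : ℕ) : ℂ) / 3 := by push_cast; ring
    simp only [Function.comp]
    rw [this, div_pow, one_div_div]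
    ring
  · refine tsum_congr fun k => ?_
    have : (1 / 3 : ℂ) + ((-((k : ℤ) + 1) : ℤ) : ℂ) = (-1) * (((2 + 3 * k : ℕ) : ℂ) / 3) := by
      push_cast; ring
    simp only [Function.comp]
    rw [this, mul_pow, div_pow]
    have h3 : ((-1 : ℂ) ^ r)⁻¹ = (-1) ^ r := by rw [← inv_pow]; norm_num
    rw [one_div, mul_inv, h3, inv_div]
    ring

theorem tsum_residues {f : ℕ → ℝ} (hf : Summable f) :
    ∑' n, f n = ∑' k, f (0 + 3 * k) + ∑' k, f (1 + 3 * k) + ∑' k, f (2 + 3 * k) := by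
  rw [Nat.sumByResidueClasses hf 3]
  exact Fin.sum_univ_three _

/-- The value follows from the Fourier series of a Bernoulli polynomial at `1/3`. -/
theorem row_three_one_third : row 3 (1 / 3) = 4 * Real.pi ^ 3 / (3 * Real.sqrt 3) := by
  have h := hasSum_one_div_nat_pow_mul_sin (k := 1) one_ne_zero (x := 1 / 3) (by norm_num)
  have hB : (Polynomial.map (algebraMap ℚ ℝ) (Polynomial.bernoulli (2 * 1 + 1))).eval (1 / 3) =
      1 / 27 := by
    have : (1 / 3 : ℝ) = (algebraMap ℚ ℝ) (1 / 3 : ℚ) := by simp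
    rw [this, Polynomial.eval_map, Polynomial.eval₂_at_apply]
    have h2 : (Polynomial.bernoulli 3).eval (1 / 3 : ℚ) = 1 / 27 := by
      simp [Polynomial.bernoulli_def, Finset.sum_range_succ, bernoulli_two, bernoulli_one,
        Polynomial.eval_add, Nat.choose]
      norm_num
    rw [show 2 * 1 + 1 = 3 from rfl, h2]
    simp
  rw [hB] at h
  have s0 : ∀ k : ℕ, Real.sin (2 * Real.pi * ((3 * k : ℕ) : ℝ) * (1 / 3)) = 0 := fun k => by
    have : 2 * Real.pi * ((3 * k : ℕ) : ℝ) * (1 / 3) = 0 + k * (2 * Real.pi) := by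
      push_cast; ring
    rw [this, Real.sin_add_nat_mul_two_pi, Real.sin_zero]
  have s1 : ∀ k : ℕ, Real.sin (2 * Real.pi * ((1 + 3 * k : ℕ) : ℝ) * (1 / 3)) = Real.sqrt 3 / 2 :=
    fun k => by
    have : 2 * Real.pi * ((1 + 3 * k : ℕ) : ℝ) * (1 / 3) = (Real.pi - Real.pi / 3) + k *
        (2 * Real.pi) := by
      push_cast; ring
    rw [this, Real.sin_add_nat_mul_two_pi, Real.sin_pi_sub, Real.sin_pi_div_three]
  have s2 : ∀ k : ℕ, Real.sin (2 * Real.pi * ((2 + 3 * k : ℕ) : ℝ) * (1 / 3)) =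
      -(Real.sqrt 3 / 2) :=
    fun k => by
    have : 2 * Real.pi * ((2 + 3 * k : ℕ) : ℝ) * (1 / 3) = (Real.pi / 3 + Real.pi) + k *
        (2 * Real.pi) := by
      push_cast; ring
    rw [this, Real.sin_add_nat_mul_two_pi, Real.sin_add_pi, Real.sin_pi_div_three]
  have h1 := tsum_residues h.summable
  simp only [s0, s1, s2, mul_zero, tsum_zero, zero_add, tsum_mul_right] at h1
  rw [h.tsum_eq] at h1
  have h3 : (0 : ℝ) < Real.sqrt 3 := by positivity
  have h4 : Real.sqrt 3 ^ 2 = 3 := Real.sq_sqrt (by norm_num)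
  set A := ∑' k : ℕ, 1 / (((1 + 3 * k : ℕ)) : ℝ) ^ (2 * 1 + 1) with hA
  set B := ∑' k : ℕ, 1 / (((2 + 3 * k : ℕ)) : ℝ) ^ (2 * 1 + 1) with hB
  have h5 : 27 * (A - B) = 4 * Real.pi ^ 3 / (3 * Real.sqrt 3) := by
    rw [eq_div_iff (by positivity)]
    norm_num [Nat.factorial] at h1
    linear_combination (-162) * h1
  rw [row_one_third (by norm_num)]
  have hA' : (∑' k : ℕ, 1 / ((1 + 3 * k : ℕ) : ℂ) ^ 3) = (A : ℂ) := by
    rw [hA, ofReal_tsum]; exact tsum_congr fun k => by push_cast; ring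
  have hB' : (∑' k : ℕ, 1 / ((2 + 3 * k : ℕ) : ℂ) ^ 3) = (B : ℂ) := by
    rw [hB, ofReal_tsum]; exact tsum_congr fun k => by push_cast; ring
  rw [hA', hB']
  have := congrArg (fun x : ℝ => (x : ℂ)) h5
  push_cast at this
  rw [← this]
  ring

theorem row_four_one_third : row 4 (1 / 3) = 8 * Real.pi ^ 4 / 9 := by
  have h := hasSum_zeta_four
  have h1 := tsum_residues h.summable
  rw [h.tsum_eq] at h1
  have h0 : ∑' k : ℕ, (1 : ℝ) / ((0 + 3 * k : ℕ) : ℝ) ^ 4 = 1 / 81 * (Real.pi ^ 4 / 90) := by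
    rw [← h.tsum_eq, ← tsum_mul_left]
    exact tsum_congr fun k => by push_cast; rw [zero_add, mul_pow, one_div_mul_one_div]; norm_num
  set A := ∑' k : ℕ, 1 / (((1 + 3 * k : ℕ)) : ℝ) ^ 4 with hA
  set B := ∑' k : ℕ, 1 / (((2 + 3 * k : ℕ)) : ℝ) ^ 4 with hB
  rw [row_one_third (by norm_num)]
  have hA' : (∑' k : ℕ, 1 / ((1 + 3 * k : ℕ) : ℂ) ^ 4) = (A : ℂ) := by
    rw [hA, ofReal_tsum]; exact tsum_congr fun k => by push_cast; ring
  have hB' : (∑' k : ℕ, 1 / ((2 + 3 * k : ℕ) : ℂ) ^ 4) = (B : ℂ) := by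
    rw [hB, ofReal_tsum]; exact tsum_congr fun k => by push_cast; ring
  rw [hA', hB']
  have h5 : 81 * (A + B) = 8 * Real.pi ^ 4 / 9 := by linarith
  have := congrArg (fun x : ℝ => (x : ℂ)) h5
  push_cast at this
  rw [← this]
  ring

section Transform

variable {τ σ : ℂ}

theorem im_pos_of_mul_eq (hσ : 0 < σ.im) (h : 3 * τ * σ = -1) : 0 < τ.im := by
  have hσ0 : σ ≠ 0 := by rintro rfl; simp at hσ
  have h1 : τ = -1 / (3 * σ) := by field_simp; linear_combination h
  have h2 : (τ * (3 * normSq σ : ℝ)) = -(starRingEnd ℂ σ) := by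
    rw [h1]; push_cast; rw [normSq_eq_conj_mul_self]; field_simp
  have h3 := congrArg im h2
  rw [im_mul_ofReal, neg_im, conj_im, neg_neg] at h3
  have h4 := normSq_pos.2 hσ0
  by_contra hcon
  nlinarith

theorem eis3_transform (hσ : 0 < σ.im) (h : 3 * τ * σ = -1) :
    -4 * Real.pi ^ 3 * I * eis3 (e τ) = σ ^ 3 * cusp 3 (e σ) := by
  rw [← s3_eq_eis3 (hτ := im_pos_of_mul_eq hσ h), s3, sumInvPow_eq_cusp le_rfl hσ h]

theorem eis4_transform (hσ : 0 < σ.im) (h : 3 * τ * σ = -1) :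
    8 / 3 * Real.pi ^ 4 * eis4 (e τ) = σ ^ 4 * cusp 4 (e σ) := by
  rw [← s4_eq_eis4 (hτ := im_pos_of_mul_eq hσ h), s4, sumInvPow_eq_cusp (by norm_num) hσ h]

theorem cusp_three_ne_zero (hσ : 0 < σ.im) : cusp 3 (e σ) ≠ 0 := by
  intro h0
  have hσ0 : σ ≠ 0 := by rintro rfl; simp at hσ
  have h : 3 * (-1 / (3 * σ)) * σ = -1 := by field_simp
  have h1 := eis3_transform hσ h
  rw [h0, mul_zero] at h1
  have hpi : (Real.pi : ℂ) ≠ 0 := by exact_mod_cast Real.pi_ne_zero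
  have := eis3_ne_zero (im_pos_of_mul_eq hσ h)
  simp [this, hpi, I_ne_zero] at h1

/-- As a quotient of forms of weight `12`, the function `gam` transforms without an automorphy factor. -/
theorem gam_transform (hσ : 0 < σ.im) (h : 3 * τ * σ = -1) :
    gam τ = 27 / 2 * cusp 4 (e σ) ^ 3 / cusp 3 (e σ) ^ 4 := by
  have hσ0 : σ ≠ 0 := by rintro rfl; simp at hσ
  have hpi : (Real.pi : ℂ) ≠ 0 := by exact_mod_cast Real.pi_ne_zero
  have h3 := eis3_ne_zero (im_pos_of_mul_eq hσ h)
  have hc := cusp_three_ne_zero hσ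
  have t3 : cusp 3 (e σ) = -4 * Real.pi ^ 3 * I * eis3 (e τ) / σ ^ 3 := by
    rw [eis3_transform hσ h]; field_simp
  have t4 : cusp 4 (e σ) = 8 / 3 * Real.pi ^ 4 * eis4 (e τ) / σ ^ 4 := by
    rw [eis4_transform hσ h]; field_simp
  have h4 : (-4 * Real.pi ^ 3 * I * eis3 (e τ)) ^ 4 = 256 * Real.pi ^ 12 * eis3 (e τ) ^ 4 := by
    rw [mul_pow, mul_pow, I_pow_four]; ring
  rw [gam, t3, t4, div_pow, div_pow, h4]
  field_simp
  ring

/-- A quotient of weights `4` and `6` transforms with the factor `σ⁻²`, which cancels against the factor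
of `sig_transform`. -/
theorem quotient_transform (hσ : 0 < σ.im) (h : 3 * τ * σ = -1) :
    eis4 (e τ) / eis3 (e τ) ^ 2 = -6 * Real.pi ^ 2 / σ ^ 2 * (cusp 4 (e σ) / cusp 3 (e σ) ^ 2) := by
  have hσ0 : σ ≠ 0 := by rintro rfl; simp at hσ
  have hpi : (Real.pi : ℂ) ≠ 0 := by exact_mod_cast Real.pi_ne_zero
  have h3 := eis3_ne_zero (im_pos_of_mul_eq hσ h)
  have t3 : cusp 3 (e σ) = -4 * Real.pi ^ 3 * I * eis3 (e τ) / σ ^ 3 := by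
    rw [eis3_transform hσ h]; field_simp
  have t4 : cusp 4 (e σ) = 8 / 3 * Real.pi ^ 4 * eis4 (e τ) / σ ^ 4 := by
    rw [eis4_transform hσ h]; field_simp
  rw [t3, t4, div_pow, mul_pow, mul_pow, mul_pow, I_sq]
  field_simp
  ring

end Transform

end

/-! ### Lipschitz' formula with a character -/

open MeasureTheory in
/-- The Fourier integral behind Lipschitz' formula of weight `2`. -/
theorem integral_mul_exp_neg {r : ℂ} (hr : 0 < r.re) :
    ∫ v in Set.Ioi (0 : ℝ), (v : ℂ) * exp (-(r * v)) = 1 / r ^ 2 := by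
  have hr0 : r ≠ 0 := by rintro rfl; simp at hr
  have hn : ∀ v : ℝ, ‖exp (-(r * v))‖ = Real.exp (-r.re * v) := by
    intro v; rw [norm_exp]; congr 1; simp
  have hd : ∀ v : ℝ, HasDerivAt (fun v : ℝ => -((v / r + 1 / r ^ 2) * exp (-(r * v))))
      ((v : ℂ) * exp (-(r * v))) v := by
    intro v
    have h0 : HasDerivAt (fun v : ℝ => (v : ℂ)) 1 v := ofRealCLM.hasDerivAt
    have h1 : HasDerivAt (fun v : ℝ => -(r * (v : ℂ))) (-(r * 1)) v := (h0.const_mul r).neg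
    have h2 := (((h0.div_const r).add_const (1 / r ^ 2)).mul h1.cexp).neg
    refine h2.congr_deriv ?_
    field_simp; ring
  have ht1 : Tendsto (fun v : ℝ => v * Real.exp (-r.re * v)) atTop (𝓝 0) := by
    have := tendsto_rpow_mul_exp_neg_mul_atTop_nhds_zero 1 r.re hr
    simpa using this
  have ht0 : Tendsto (fun v : ℝ => Real.exp (-r.re * v)) atTop (𝓝 0) := by
    have := tendsto_rpow_mul_exp_neg_mul_atTop_nhds_zero 0 r.re hr
    simpa using this
  have hlim : Tendsto (fun v : ℝ => -((v / r + 1 / r ^ 2) * exp (-(r * v)))) atTop (𝓝 0) := by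
    have h3 : Tendsto (fun v : ℝ => (v : ℂ) * exp (-(r * v))) atTop (𝓝 0) := by
      rw [tendsto_zero_iff_norm_tendsto_zero]
      refine (tendsto_zero_iff_norm_tendsto_zero.1 ht1).congr fun v => ?_
      rw [norm_mul, norm_mul, hn, norm_real, Real.norm_of_nonneg (Real.exp_pos _).le]
    have h4 : Tendsto (fun v : ℝ => exp (-(r * v))) atTop (𝓝 0) := by
      rw [tendsto_zero_iff_norm_tendsto_zero]
      exact ht0.congr fun v => (hn v).symm
    have := ((h3.mul_const (1 / r)).add (h4.mul_const (1 / r ^ 2))).neg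
    simp only [zero_mul, add_zero, neg_zero] at this
    refine this.congr fun v => ?_
    ring
  have hint : IntegrableOn (fun v : ℝ => (v : ℂ) * exp (-(r * v))) (Set.Ioi 0) := by
    have h5 := integrableOn_rpow_mul_exp_neg_mul_rpow (s := 1) (p := 1) (b := r.re) (by norm_num)
      one_pos hr
    refine h5.mono' (by fun_prop) ((ae_restrict_iff' measurableSet_Ioi).2
      (Eventually.of_forall fun v hv => ?_))
    rw [norm_mul, hn, norm_real, Real.norm_of_nonneg (Set.mem_Ioi.1 hv).le]
    simp
  rw [integral_Ioi_of_hasDerivAt_of_tendsto' (fun v _ => hd v) hint hlim]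
  simp

open MeasureTheory FourierTransform in
/-- **Lipschitz' formula** with a character, from Poisson summation. -/
theorem lipschitz_character {a : ℝ} (ha : 0 < a) (ha1 : a < 1) {z : ℂ} (hz : 0 < z.im) :
    ∑' k : ℤ, e (k * a) / (z - k) ^ 2 =
      -4 * Real.pi ^ 2 * ∑' n : ℕ, (n + a) * e ((n + a) * z) := by
  have hpi := Real.pi_pos
  set f : ℝ → ℂ := fun x => (max x 0 : ℝ) * e (x * z) with hf
  have hc : Continuous f := by
    have h1 : Continuous fun x : ℝ => ((max x 0 : ℝ) : ℂ) :=
      continuous_ofReal.comp (continuous_id.max continuous_const)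
    have h2 : Continuous fun x : ℝ => e (x * z) :=
      differentiable_e.continuous.comp (continuous_ofReal.mul continuous_const)
    exact h1.mul h2
  have hdecay : f =O[cocompact ℝ] fun x : ℝ => |x| ^ (-(2 : ℝ)) := by
    refine Asymptotics.IsBigO.of_bound (6 / (2 * Real.pi * z.im) ^ 3)
      (Eventually.of_forall fun x => ?_)
    rcases le_or_gt x 0 with hx | hx
    · rw [hf]; simp only [max_eq_right hx, ofReal_zero, zero_mul, norm_zero]; positivity
    · have h1 : ‖f x‖ = x * Real.exp (-(2 * Real.pi * z.im * x)) := by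
        rw [hf]; simp only [max_eq_left hx.le, norm_mul, norm_real, Real.norm_of_nonneg hx.le,
          norm_e]
        congr 2; simp; ring
      have h2 := Real.pow_div_factorial_le_exp (2 * Real.pi * z.im * x) (by positivity) 3
      rw [h1, abs_of_pos hx, Real.rpow_neg hx.le, Real.norm_of_nonneg (by positivity), Real.exp_neg]
      have h3 : (3 : ℕ).factorial = 6 := rfl
      rw [h3] at h2
      have h4 := Real.exp_pos (2 * Real.pi * z.im * x)
      have h5 : x ^ (2 : ℝ) = x ^ 2 := by exact_mod_cast Real.rpow_natCast x 2
      rw [h5, ← div_eq_mul_inv, ← div_eq_mul_inv, div_div, div_le_div_iff₀ h4 (by positivity)]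
      push_cast at h2
      rw [mul_pow, div_le_iff₀ (by norm_num)] at h2
      calc x * ((2 * Real.pi * z.im) ^ 3 * x ^ 2) = (2 * Real.pi * z.im) ^ 3 * x ^ 3 := by ring
        _ ≤ _ := by linarith
  have hF : ∀ w : ℝ, 𝓕 f w = -1 / (4 * Real.pi ^ 2 * (z - w) ^ 2) := by
    intro w
    rw [Real.fourier_real_eq_integral_exp_smul]
    have hre : 0 < (-(2 * Real.pi * I * (z - w))).re := by
      simp; positivity
    have h2 : ∫ v : ℝ, exp (((-2 * Real.pi * v * w : ℝ) : ℂ) * I) • f v =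
        ∫ v in Set.Ioi (0 : ℝ), (v : ℂ) * exp (-(-(2 * Real.pi * I * (z - w)) * v)) := by
      rw [← integral_indicator measurableSet_Ioi]
      refine integral_congr_ae (Eventually.of_forall fun v => ?_)
      beta_reduce
      rcases le_or_gt v 0 with hv | hv
      · rw [Set.indicator_of_notMem (by simpa using hv), hf]
        simp [max_eq_right hv]
      · rw [Set.indicator_of_mem (by simpa using hv), hf]
        simp only [max_eq_left hv.le, smul_eq_mul]
        rw [e, mul_left_comm, ← exp_add]
        congr 2
        push_cast; ring
    rw [h2, integral_mul_exp_neg hre, neg_sq, mul_pow, mul_pow, mul_pow, I_sq,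
      neg_div, ← div_neg]
    congr 1; ring
  have hsumF : Summable fun n : ℤ => 𝓕 f n := by
    have h1 := (EisensteinSeries.linear_right_summable (-z) 1 (k := 2) le_rfl).mul_left
      (-1 / (4 * Real.pi ^ 2 : ℂ))
    refine h1.congr fun n => ?_
    have h2 := hF n
    push_cast at h2 ⊢
    rw [h2]
    have : (1 * -z + (n : ℂ)) ^ (2 : ℤ) = (z - n) ^ 2 := by rw [zpow_ofNat]; ring
    rw [this]
    generalize ((z - n) ^ 2 : ℂ) = w
    ring
  have key := Real.tsum_eq_tsum_fourier_of_rpow_decay_of_summable hc one_lt_two hdecay hsumF a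
  have hR : ∀ n : ℤ, 𝓕 f n * fourier n (a : UnitAddCircle) =
      -1 / (4 * Real.pi ^ 2) * (e (n * a) / (z - n) ^ 2) := by
    intro n
    have h2 := hF n
    rw [h2, fourier_coe_apply, e]
    have : 2 * Real.pi * I * n * a / (1 : ℝ) = 2 * Real.pi * I * (n * a) := by push_cast; ring
    rw [this]
    push_cast
    rw [div_mul_eq_div_div]
    generalize ((z - n) ^ 2 : ℂ) = w
    ring
  have hL : ∑' n : ℤ, f (a + n) = ∑' n : ℕ, (n + a) * e ((n + a) * z) := by
    have hinj : Function.Injective fun n : ℕ => (n : ℤ) := Nat.cast_injective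
    rw [← hinj.tsum_eq (f := fun n : ℤ => f (a + n))]
    · refine tsum_congr fun n => ?_
      have h1 : 0 ≤ a + ((n : ℤ) : ℝ) := by push_cast; positivity
      simp only [hf, max_eq_left h1]
      push_cast
      rw [add_comm (a : ℂ)]
    · intro n hn
      rw [Function.mem_support] at hn
      by_contra hcon
      apply hn
      have hn0 : n < 0 := by
        by_contra h
        exact hcon ⟨n.toNat, Int.toNat_of_nonneg (by omega)⟩
      have : (n : ℝ) ≤ -1 := by exact_mod_cast (by omega : n ≤ -1)
      simp only [hf]
      rw [max_eq_right (by linarith)]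
      simp
  simp only [hR] at key
  rw [hL, tsum_mul_left] at key
  have hpiC : (Real.pi : ℂ) ≠ 0 := by exact_mod_cast hpi.ne'
  rw [key, ← mul_assoc]
  have : (-4 * Real.pi ^ 2 * (-1 / (4 * Real.pi ^ 2)) : ℂ) = 1 := by field_simp
  rw [this, one_mul]

/-- The series `∑ (n + a) X / (1 - X)` with `X = e (3 (n + a) σ)`. -/
noncomputable def psi (a : ℝ) (σ : ℂ) : ℂ :=
  ∑' n : ℕ, (n + a) * e (3 * (n + a) * σ) / (1 - e (3 * (n + a) * σ))

theorem norm_e_psi (a : ℝ) (σ : ℂ) (n : ℕ) :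
    ‖e (3 * (n + a) * σ)‖ = Real.exp (-(6 * Real.pi * a * σ.im)) *
      Real.exp (-(6 * Real.pi * σ.im)) ^ n := by
  rw [norm_e, ← Real.exp_nat_mul, ← Real.exp_add]
  congr 1
  have : (3 * (n + a) * σ).im = 3 * (n + a) * σ.im := by
    have : (3 * (n + a) : ℂ) = ((3 * (n + a) : ℝ) : ℂ) := by push_cast; ring
    rw [this, im_ofReal_mul]
  rw [this]; ring

theorem exp_neg_lt_one {x : ℝ} (hx : 0 < x) : Real.exp (-x) < 1 := by
  rw [Real.exp_lt_one_iff]; linarith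

theorem norm_e_psi_lt_one {a : ℝ} (ha : 0 < a) {σ : ℂ} (hσ : 0 < σ.im) (n : ℕ) :
    ‖e (3 * (n + a) * σ)‖ < 1 := by
  rw [norm_e_psi]
  have hpi := Real.pi_pos
  have h1 := exp_neg_lt_one (x := 6 * Real.pi * a * σ.im) (by positivity)
  have h2 := exp_neg_lt_one (x := 6 * Real.pi * σ.im) (by positivity)
  exact mul_lt_one_of_nonneg_of_lt_one_left (Real.exp_pos _).le h1
    (pow_le_one₀ (Real.exp_pos _).le h2.le)

theorem summable_add_mul_pow {r : ℝ} (h0 : 0 ≤ r) (hr : r < 1) (a : ℝ) :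
    Summable fun n : ℕ => ((n : ℝ) + a) * r ^ n := by
  have h1 := summable_pow_mul_geometric_of_norm_lt_one 1 (r := r) (by rwa [Real.norm_of_nonneg h0])
  have h2 := (summable_geometric_of_lt_one h0 hr).mul_left a
  refine (h1.add h2).congr fun n => ?_
  rw [pow_one]; ring

/-- The series `psi`, with its geometric series expanded. -/
theorem hasSum_psi_rows {a : ℝ} (ha : 0 < a) {σ : ℂ} (hσ : 0 < σ.im) :
    HasSum (fun j : ℕ => ∑' n : ℕ, (n + a) * e ((n + a) * (3 * (j + 1) * σ))) (psi a σ) := by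
  have hpi := Real.pi_pos
  set ρ := Real.exp (-(6 * Real.pi * σ.im)) with hρ
  set x := Real.exp (-(6 * Real.pi * a * σ.im)) with hx
  have hρ0 : 0 < ρ := Real.exp_pos _
  have hx0 : 0 < x := Real.exp_pos _
  have hρ1 : ρ < 1 := exp_neg_lt_one (by positivity)
  have hx1 : x < 1 := exp_neg_lt_one (by positivity)
  have hpow : ∀ (j n : ℕ), e ((n + a) * (3 * (j + 1) * σ)) = e (3 * (n + a) * σ) ^ (j + 1) := by
    intro j n
    rw [← e_nat_mul]; congr 1; push_cast; ring
  have hs : Summable fun q : ℕ × ℕ => (q.1 + a) * e (3 * (q.1 + a) * σ) ^ (q.2 + 1) := by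
    have h1 := (summable_add_mul_pow hρ0.le hρ1 a).mul_of_nonneg
      (summable_geometric_of_lt_one hx0.le hx1) (fun n => by positivity)
      (fun _ => by positivity)
    refine Summable.of_norm_bounded h1 fun q => ?_
    have h2 : ‖((q.1 : ℂ) + a)‖ = q.1 + a := by
      have : ((q.1 : ℂ) + a) = ((q.1 + a : ℝ) : ℂ) := by push_cast; ring
      rw [this, norm_real, Real.norm_of_nonneg (by positivity)]
    rw [norm_mul, h2, norm_pow, norm_e_psi, ← hx, ← hρ, mul_pow, mul_assoc]
    have h3 : x ^ (q.2 + 1) ≤ x ^ q.2 := pow_le_pow_of_le_one hx0.le hx1.le (Nat.le_succ _)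
    have h4 : (ρ ^ q.1) ^ (q.2 + 1) ≤ ρ ^ q.1 := pow_le_of_le_one (by positivity)
      (pow_le_one₀ hρ0.le hρ1.le) (by omega)
    rw [mul_comm (ρ ^ q.1)]
    gcongr
  have h2 : HasSum (fun q : ℕ × ℕ => (q.1 + a) * e (3 * (q.1 + a) * σ) ^ (q.2 + 1)) (psi a σ) := by
    have h3 := hs.hasSum.prod_fiberwise
      (g := fun n : ℕ => (n + a) * e (3 * (n + a) * σ) / (1 - e (3 * (n + a) * σ))) fun n => ?_
    · rw [psi, h3.tsum_eq]; exact hs.hasSum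
    · have := (hasSum_geometric_of_norm_lt_one (norm_e_psi_lt_one ha hσ n)).mul_left
        ((n + a) * e (3 * (n + a) * σ))
      rw [div_eq_mul_inv]
      refine this.congr_fun fun j => ?_
      rw [pow_succ]; ring
  have h3 := ((Equiv.prodComm ℕ ℕ).hasSum_iff.2 h2)
  have h4 := h3.prod_fiberwise fun n => (h3.summable.prod_factor n).hasSum
  refine h4.congr_fun fun j => tsum_congr fun n => ?_
  rw [hpow]; rfl

/-! ### The transformation law of the twisted series -/

theorem lip_two : lip 2 = -4 * Real.pi ^ 2 := by
  rw [lip, mul_pow, mul_pow, I_sq]; norm_num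

theorem norm_e_int_mul (k : ℤ) (a : ℝ) : ‖e (k * a)‖ = 1 := by
  rw [norm_e]
  have : ((k : ℂ) * a).im = 0 := by simp
  rw [this]; simp

theorem hasSum_twisted_nat {u τ : ℂ} (hu : ‖u‖ = 1) (hτ : 0 < τ.im) :
    HasSum (fun k : ℕ => u ^ (k + 1) * row 2 ((k + 1) * τ))
      (lip 2 * ∑' m : ℕ, m * (u * e τ ^ m / (1 - u * e τ ^ m))) := by
  set p := e τ with hp'
  have hp : ‖p‖ < 1 := norm_e_lt_one hτ
  have hs : Summable fun q : ℕ × ℕ => (q.1 : ℂ) * (u * p ^ q.1) ^ (q.2 + 1) := by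
    have h1 := (summable_norm_pow_mul_geometric_of_norm_lt_one 1 hp).mul_of_nonneg
      (summable_geometric_of_lt_one (norm_nonneg p) hp) (fun _ => norm_nonneg _)
      (fun _ => by positivity)
    refine Summable.of_norm_bounded h1 fun q => ?_
    rcases Nat.eq_zero_or_pos q.1 with h | h
    · simp [h]
    · rw [norm_mul, norm_mul, pow_one, norm_pow, norm_mul, hu, one_mul, mul_assoc]
      gcongr ‖_‖ * ?_
      rw [← norm_pow, ← norm_pow, ← norm_mul, ← pow_mul, ← pow_add, norm_pow, norm_pow]
      refine pow_le_pow_of_le_one (norm_nonneg p) hp.le ?_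
      nlinarith
  have h2 : HasSum (fun q : ℕ × ℕ => (q.1 : ℂ) * (u * p ^ q.1) ^ (q.2 + 1))
      (∑' m : ℕ, m * (u * p ^ m / (1 - u * p ^ m))) := by
    have h3 := hs.hasSum.prod_fiberwise (g := fun m : ℕ => (m : ℂ) * (u * p ^ m / (1 - u * p ^ m)))
      fun m => ?_
    · rw [h3.tsum_eq]; exact hs.hasSum
    · rcases Nat.eq_zero_or_pos m with rfl | h
      · simp
      · have hy' : ‖u * p ^ m‖ < 1 := by
          rw [norm_mul, hu, one_mul, norm_pow]; exact pow_lt_one₀ (norm_nonneg _) hp h.ne'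
        have := (hasSum_geometric_of_norm_lt_one hy').mul_left (m * (u * p ^ m))
        rw [← mul_div_assoc, div_eq_mul_inv]
        refine this.congr_fun fun n => ?_
        rw [pow_succ]; ring
  have h3 := ((Equiv.prodComm ℕ ℕ).hasSum_iff.2 h2)
  have h4 := (h3.prod_fiberwise fun n => (h3.summable.prod_factor n).hasSum).mul_left (lip 2)
  refine h4.congr_fun fun k => ?_
  have him : 0 < ((k + 1) * τ).im := by
    have : ((k + 1) * τ).im = (k + 1) * τ.im := by simp
    rw [this]; positivity
  rw [row_of_im_pos le_rfl him, ← lip, mul_left_comm, ← tsum_mul_left]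
  congr 1
  refine tsum_congr fun m => ?_
  have h5 : e ((k + 1) * τ) = p ^ (k + 1) := by rw [hp', ← e_nat_mul]; push_cast; rfl
  simp only [Function.comp, Equiv.prodComm_apply, Prod.swap]
  rw [h5, mul_pow, ← pow_mul, ← pow_mul, mul_comm (k + 1) m]
  ring

/-- The twisted lattice sum of weight `2`, row by row, is `sig` up to constants. The row through the
origin, whose term at `0` is a junk value `0`, contributes `row 2 0`. -/
theorem hasSum_twisted_rows (a : ℝ) {τ : ℂ} (hτ : 0 < τ.im) :
    HasSum (fun k : ℤ => e (k * a) * row 2 (k * τ)) (lip 2 * sig (e a) (e τ) + row 2 0) := by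
  have hu : ‖e a‖ = 1 := by simpa using norm_e_int_mul 1 a
  have hu' : ‖(e a)⁻¹‖ = 1 := by rw [norm_inv, hu, inv_one]
  have h1 := hasSum_twisted_nat hu hτ
  have h2 := hasSum_twisted_nat hu' hτ
  have hpow : ∀ k : ℕ, e (((k : ℤ) : ℂ) * a) = e a ^ k := fun k =>
      by rw [← e_nat_mul]; push_cast; rfl
  have h3 : HasSum (fun k : ℕ => e (((k : ℤ) : ℂ) * a) * row 2 (((k : ℤ) : ℂ) * τ))
      (lip 2 * (∑' m : ℕ, m * (e a * e τ ^ m / (1 - e a * e τ ^ m))) + row 2 0) := by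
    have := (hasSum_nat_add_iff
      (f := fun k : ℕ => e (((k : ℤ) : ℂ) * a) * row 2 (((k : ℤ) : ℂ) * τ)) 1).1
      (h1.congr_fun fun n => by rw [hpow]; push_cast; rfl)
    simpa [e] using this
  have h4 := HasSum.of_nat_of_neg_add_one (f := fun k : ℤ => e (k * a) * row 2 (k * τ)) h3
    (h2.congr_fun fun n => by
      have a1 : (((-((n : ℤ) + 1) : ℤ) : ℂ)) * τ = -((n + 1) * τ) := by push_cast; ring
      have a2 : (((-((n : ℤ) + 1) : ℤ) : ℂ)) * a = -((((n + 1 : ℕ) : ℤ) : ℂ) * a) :=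
          by push_cast; ring
      rw [a1, row_neg, a2, e_neg, hpow, inv_pow]
      simp)
  have hsplit : ∀ (v : ℂ), ‖v‖ = 1 → Summable fun m : ℕ => (m : ℂ) *
      (v * e τ ^ m / (1 - v * e τ ^ m)) := by
    intro v hv
    have hp : ‖e τ‖ < 1 := norm_e_lt_one hτ
    have h0 : 0 < 1 - ‖e τ‖ := by linarith
    refine Summable.of_norm_bounded (summable_ser_bound (norm_nonneg (e τ)) hp (1 - ‖e τ‖)⁻¹) fun m => ?_
    rcases Nat.eq_zero_or_pos m with rfl | hm
    · simp
    rw [norm_mul, norm_div, norm_mul, hv, one_mul, norm_natCast, norm_pow, div_eq_mul_inv,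
      ← mul_assoc]
    gcongr
    exact one_sub_le_norm hv hp hm.ne'
  have h5 : sig (e a) (e τ) = (∑' m : ℕ, m * ((e a)⁻¹ * e τ ^ m / (1 - (e a)⁻¹ * e τ ^ m))) +
      ∑' m : ℕ, m * (e a * e τ ^ m / (1 - e a * e τ ^ m)) := by
    rw [← (hsplit _ hu').tsum_add (hsplit _ hu), sig]
    refine tsum_congr fun m => ?_
    rw [sig_term hu, mul_add]
  rw [show lip 2 * sig (e a) (e τ) + row 2 0 =
    _ by rw [h5, mul_add, add_comm (lip 2 * _), add_right_comm]]
  exact h4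

/-- Differences of consecutive terms are of the order of the cubes, over which the lattice sum is
absolutely convergent. -/
theorem norm_inv_sq_sub_le (A τ : ℂ) :
    ‖1 / A ^ 2 - 1 / (A - τ) ^ 2‖ ≤ 2 * ‖τ‖ * (‖(A ^ 3)⁻¹‖ + ‖((A - τ) ^ 3)⁻¹‖) := by
  have key : ∀ x y : ℝ, 0 ≤ x → 0 ≤ y → x * y ^ 2 + x ^ 2 * y ≤ 2 * (x ^ 3 + y ^ 3) := by
    intro x y hx hy
    have : x ^ 3 + y ^ 3 - (x * y ^ 2 + x ^ 2 * y) = (x + y) * (x - y) ^ 2 := by ring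
    have h2 : 0 ≤ (x + y) * (x - y) ^ 2 := by positivity
    have h3 : 0 ≤ x ^ 3 + y ^ 3 := by positivity
    linarith
  rcases eq_or_ne τ 0 with rfl | hτ
  · simp
  rcases eq_or_ne A 0 with rfl | hA
  · have := norm_pos_iff.2 hτ
    simp only [zero_sub, norm_inv, norm_pow, norm_neg, norm_zero]
    norm_num
    rw [mul_assoc]
    have h1 : ‖τ‖ * (‖τ‖ ^ 3)⁻¹ = (‖τ‖ ^ 2)⁻¹ := by field_simp
    have h2 : 0 ≤ (‖τ‖ ^ 2)⁻¹ := by positivity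
    rw [h1]; linarith
  rcases eq_or_ne (A - τ) 0 with hB | hB
  · have hA' : A = τ := sub_eq_zero.1 hB
    rw [hB, hA']
    have := norm_pos_iff.2 hτ
    simp only [norm_inv, norm_pow]
    norm_num
    rw [mul_assoc]
    have h1 : ‖τ‖ * (‖τ‖ ^ 3)⁻¹ = (‖τ‖ ^ 2)⁻¹ := by field_simp
    have h2 : 0 ≤ (‖τ‖ ^ 2)⁻¹ := by positivity
    rw [h1]; linarith
  · have h1 : 1 / A ^ 2 - 1 / (A - τ) ^ 2 =
        -τ * (A⁻¹ * ((A - τ)⁻¹) ^ 2 + (A⁻¹) ^ 2 * (A - τ)⁻¹) := by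
      field_simp
      ring
    rw [h1, norm_mul, norm_neg, mul_comm 2, mul_assoc]
    refine mul_le_mul_of_nonneg_left ?_ (norm_nonneg _)
    refine (norm_add_le _ _).trans ?_
    have := key ‖A⁻¹‖ ‖(A - τ)⁻¹‖ (norm_nonneg _) (norm_nonneg _)
    simpa only [norm_mul, norm_pow, norm_inv, inv_pow] using this

theorem summable_lattice_cube {τ : ℂ} (hτ : 0 < τ.im) :
    Summable fun q : ℤ × ℤ => ‖(((q.1 : ℂ) * τ + q.2) ^ 3)⁻¹‖ := by
  have h1 := ((unitPair τ hτ).hasSum_sumInvPow 0 (r := 3) (by norm_num)).summable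
  have h2 := ((unitPair τ hτ).latticeEquivProd.symm.toEquiv.summable_iff).2 h1
  have h3 := ((Equiv.prodComm ℤ ℤ).summable_iff).2 h2
  refine h3.norm.congr fun q => ?_
  have h2 := (unitPair τ hτ).latticeEquiv_symm_apply (q.2, q.1)
  have h4 : (q.1 : ℂ) * τ + q.2 = ((unitPair τ hτ).latticeEquivProd.symm (q.2, q.1) : ℂ) := by
    rw [h2]; simp [unitPair]; ring
  rw [h4]
  simp [Function.comp, Prod.swap]

/-- The conditionally convergent sum of `e (k a) / (kτ + j)²` may be taken in either order: partial
summation against the character makes it absolutely convergent. -/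
theorem hasSum_twisted_columns {a : ℝ} (ha : e a ≠ 1) {τ : ℂ} (hτ : 0 < τ.im) :
    HasSum (fun j : ℤ => ∑' k : ℤ, e (k * a) / (k * τ + j) ^ 2)
      (lip 2 * sig (e a) (e τ) + row 2 0) := by
  set S := lip 2 * sig (e a) (e τ) + row 2 0
  have hrows := hasSum_twisted_rows a hτ
  set W : ℤ × ℤ → ℂ := fun q => e (q.1 * a) * (1 / (q.1 * τ + q.2) ^ 2 - 1 / (q.1 * τ +
      q.2 - τ) ^ 2)
    with hWdef
  have hshift : ∀ k : ℤ, e (k * a) = e a * e (((k - 1 : ℤ) : ℂ) * a) := by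
    intro k; rw [← e_add]; congr 1; push_cast; ring
  have hsub : ∀ k j : ℤ, (k : ℂ) * τ + j - τ = ((k - 1 : ℤ) : ℂ) * τ + j := by
    intro k j; push_cast; ring
  -- `W` is the twisted lattice sum multiplied by `1 - e a`, termwise
  have hW : Summable W := by
    have h1 := summable_lattice_cube hτ
    have h2 : Summable fun q : ℤ × ℤ => ‖(((q.1 : ℂ) * τ + q.2 - τ) ^ 3)⁻¹‖ := by
      have := (((Equiv.subRight (1 : ℤ)).prodCongr (Equiv.refl ℤ)).summable_iff).2 h1
      refine this.congr fun q => ?_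
      simp only [Function.comp, Equiv.prodCongr_apply, Prod.map, Equiv.subRight_apply,
        Equiv.refl_apply]
      rw [hsub]
    refine Summable.of_norm_bounded ((h1.add h2).mul_left (2 * ‖τ‖)) fun q => ?_
    rw [hWdef, norm_mul, norm_e_int_mul, one_mul]
    exact norm_inv_sq_sub_le _ _
  have htot : HasSum W ((1 - e a) * S) := by
    have h1 : HasSum (fun k : ℤ => e (k * a) * row 2 (k * τ) - e (k * a) * row 2 (k * τ - τ))
        ((1 - e a) * S) := by
      have h2 := ((Equiv.subRight (1 : ℤ)).hasSum_iff.2 hrows).mul_left (e a)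
      have h3 := hrows.sub h2
      rw [one_sub_mul]
      refine h3.congr_fun fun k => ?_
      simp only [Function.comp, Equiv.subRight_apply]
      rw [← mul_assoc, ← hshift]
      congr 3
      push_cast; ring
    have h4 := hW.hasSum.prod_fiberwise
      (g := fun k : ℤ => e (k * a) * row 2 (k * τ) - e (k * a) * row 2 (k * τ - τ)) fun k => ?_
    · rw [h1.unique h4]; exact hW.hasSum
    · have h5 := ((summable_row le_rfl (k * τ)).hasSum.sub
        (summable_row le_rfl (k * τ - τ)).hasSum).mul_left (e (k * a))
      rw [← mul_sub]
      refine h5.congr_fun fun j => ?_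
      simp only [hWdef]
      congr 4
      ring
  have hτ0 : τ ≠ 0 := by rintro rfl; simp at hτ
  have hcol : ∀ j : ℤ, Summable fun k : ℤ => e (k * a) / (k * τ + j) ^ 2 := by
    intro j
    have h1 := (EisensteinSeries.linear_left_summable hτ0 j (k := 2) le_rfl).norm
    refine Summable.of_norm_bounded h1 fun k => ?_
    rw [norm_div, norm_e_int_mul, norm_inv, one_div, zpow_ofNat]
  have h3 := ((Equiv.prodComm ℤ ℤ).hasSum_iff.2 htot)
  have h4 := h3.prod_fiberwise (g := fun j : ℤ => (1 - e a) * ∑' k : ℤ, e (k * a) / (k * τ + j) ^ 2)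
    fun j => by
      have h5 := (hcol j).hasSum
      have h6 := h5.sub (((Equiv.subRight (1 : ℤ)).hasSum_iff.2 h5).mul_left (e a))
      rw [one_sub_mul]
      refine h6.congr_fun fun k => ?_
      simp only [Function.comp, Equiv.prodComm_apply, Prod.swap, Equiv.subRight_apply, hWdef]
      rw [← mul_div_assoc, ← hshift, hsub]
      ring
  have h0 : 1 - e a ≠ 0 := sub_ne_zero.2 (Ne.symm ha)
  have h7 := h4.mul_left (1 - e a)⁻¹
  simpa only [inv_mul_cancel_left₀ h0] using h7

theorem e_eq_one_sub (a : ℝ) (k : ℤ) : e (k * ((1 - a : ℝ) : ℂ)) = e (((-k : ℤ) : ℂ) * a) := by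
  have : (k : ℂ) * ((1 - a : ℝ) : ℂ) = ((-k : ℤ) : ℂ) * a + k := by push_cast; ring
  rw [this, e_add, e_int, mul_one]

/-- The behaviour of `sig` under `τ ↦ -1 / (3τ)`. -/
theorem sig_transform {a : ℝ} (ha : 0 < a) (ha1 : a < 1) (h1 : e a ≠ 1) {τ σ : ℂ} (hσ : 0 < σ.im)
    (h : 3 * τ * σ = -1) : lip 2 * sig (e a) (e τ) + row 2 0 =
      9 * σ ^ 2 * ((∑' k : ℤ, e (k * a) / k ^ 2) - 4 * Real.pi ^ 2 * (psi a σ + psi (1 - a) σ)) :=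
        by
  have hτ := im_pos_of_mul_eq hσ h
  have key := hasSum_twisted_columns h1 hτ
  have hσ0 : σ ≠ 0 := by rintro rfl; simp at hσ
  have hτσ : τ = -(3 * σ)⁻¹ := by
    field_simp; linear_combination h
  have hterm : ∀ k j : ℤ, e (k * a) / (k * τ + j) ^ 2 = 9 * σ ^ 2 *
      (e (k * a) / (j * (3 * σ) - k) ^ 2) := by
    intro k j
    have h2 : (k : ℂ) * τ + j = (3 * σ)⁻¹ * (j * (3 * σ) - k) := by
      rw [hτσ]; field_simp; ring
    rw [h2, mul_pow, inv_pow, div_eq_mul_inv, mul_inv, inv_inv]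
    ring
  simp only [hterm, tsum_mul_left] at key
  have him : ∀ j : ℕ, 0 < (3 * ((j : ℂ) + 1) * σ).im := by
    intro j
    have : (3 * ((j : ℂ) + 1) * σ).im = 3 * (j + 1) * σ.im := by
      have : (3 * ((j : ℂ) + 1)) = ((3 * (j + 1) : ℝ) : ℂ) := by push_cast; ring
      rw [this, im_ofReal_mul]
    rw [this]; positivity
  have p1 := (hasSum_psi_rows ha hσ).mul_left (9 * σ ^ 2 * (-4 * Real.pi ^ 2))
  have p2 := (hasSum_psi_rows (sub_pos.2 ha1) hσ).mul_left (9 * σ ^ 2 * (-4 * Real.pi ^ 2))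
  set F : ℤ → ℂ := fun j => 9 * σ ^ 2 * ∑' k : ℤ, e (k * a) / (j * (3 * σ) - k) ^ 2 with hF
  have r1 : HasSum (fun j : ℕ => F ((j : ℤ) + 1)) (9 * σ ^ 2 * (-4 * Real.pi ^ 2) * psi a σ) := by
    refine p1.congr_fun fun j => ?_
    rw [mul_assoc (9 * σ ^ 2), ← lipschitz_character ha ha1 (him j)]
    refine congrArg (9 * σ ^ 2 * ·) ?_
    refine tsum_congr fun k => ?_
    push_cast
    rw [show ((j : ℂ) + 1) * (3 * σ) = 3 * (j + 1) * σ by ring]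
  have r2 : HasSum (fun j : ℕ => F (-((j : ℤ) + 1)))
      (9 * σ ^ 2 * (-4 * Real.pi ^ 2) * psi (1 - a) σ) := by
    refine p2.congr_fun fun j => ?_
    have h5 := lipschitz_character (sub_pos.2 ha1) (by linarith) (him j)
    rw [mul_assoc (9 * σ ^ 2), ← h5]
    refine congrArg (9 * σ ^ 2 * ·) ?_
    rw [← (Equiv.neg ℤ).tsum_eq]
    refine tsum_congr fun k => ?_
    rw [e_eq_one_sub]
    simp only [Equiv.neg_apply]
    congr 1
    push_cast
    ring
  have r3 : HasSum (fun j : ℕ => F (j : ℤ)) (9 * σ ^ 2 * (-4 * Real.pi ^ 2) * psi a σ + F 0) := by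
    have := (hasSum_nat_add_iff (f := fun j : ℕ => F (j : ℤ)) 1).1
      (r1.congr_fun fun n => by push_cast; rfl)
    simpa using this
  have hp := HasSum.of_nat_of_neg_add_one (f := F) r3 r2
  rw [key.unique hp, hF]
  simp only [Int.cast_zero, zero_mul, zero_sub, neg_sq]
  ring

/-- The constants `row 2 0` of `sig_transform` cancel in a difference. -/
theorem sig_sub_transform {a b : ℝ} (ha : 0 < a) (ha1 : a < 1) (ha' : e a ≠ 1) (hb : 0 < b)
    (hb1 : b < 1) (hb' : e b ≠ 1) : ∃ C : ℂ, ∀ τ σ : ℂ, 0 < σ.im → 3 * τ * σ = -1 →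
      sig (e a) (e τ) - sig (e b) (e τ) = 9 * σ ^ 2 *
        (C + (psi a σ + psi (1 - a) σ) - (psi b σ + psi (1 - b) σ)) := by
  refine ⟨-((∑' k : ℤ, e (k * a) / k ^ 2) - ∑' k : ℤ, e (k * b) / k ^ 2) / (4 * Real.pi ^ 2),
    fun τ σ hσ h => ?_⟩
  have h1 := sig_transform ha ha1 ha' hσ h
  have h2 := sig_transform hb hb1 hb' hσ h
  rw [lip_two] at h1 h2
  have hpi : (Real.pi : ℂ) ≠ 0 := by exact_mod_cast Real.pi_ne_zero
  have h3 : (-4 * Real.pi ^ 2 : ℂ) ≠ 0 := by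
    simp [hpi]
  apply mul_left_cancel₀ h3
  field_simp
  linear_combination h1 - h2

/-! ### Expansions at the cusp -/

theorem norm_e_one_third : ‖e (1 / 3)‖ = 1 := by
  have := norm_e_int_mul 1 (1 / 3)
  push_cast at this
  simpa using this

theorem norm_e_neg_one_third : ‖e (-(1 / 3))‖ = 1 := by
  rw [e_neg, norm_inv, norm_e_one_third, inv_one]

theorem e_one_third : e (1 / 3) = -1 / 2 + Real.sqrt 3 / 2 * I := by
  rw [e, show 2 * Real.pi * I * (1 / 3) = 2 * Real.pi * I / 3 by ring, exp_two_pi_div_three]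
  push_cast; ring

theorem e_neg_one_third : e (-(1 / 3)) = -1 / 2 - Real.sqrt 3 / 2 * I := by
  have h : (Real.sqrt 3 : ℂ) ^ 2 = 3 := by exact_mod_cast Real.sq_sqrt (by norm_num : (0 : ℝ) ≤ 3)
  rw [e_neg, e_one_third, inv_eq_iff_eq_inv]
  refine eq_inv_of_mul_eq_one_left ?_
  linear_combination (-1 / 4) * h * I ^ 2 - 3 / 4 * I_sq

theorem differentiableAt_cusp (r : ℕ) {q : ℂ} (hq : ‖q‖ < 1) : DifferentiableAt ℂ (cusp r) q := by
  have h1 := differentiableAt_lam_mul (r - 1) norm_e_one_third one_ne_zero one_ne_zero hq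
  have h2 := differentiableAt_lam_mul (r - 1) norm_e_neg_one_third one_ne_zero one_ne_zero hq
  simp only [pow_one] at h1 h2
  exact ((h1.fun_add (h2.const_mul _)).const_mul _).const_add _

theorem hasDerivAt_lam_zero (k : ℕ) {u : ℂ} (hu : ‖u‖ = 1) :
    HasDerivAt (fun q => lam k (u * q) q) u 0 := by
  obtain ⟨A, hA, h⟩ := exists_norm_lam_sub_le k
  have h0 : lam k (u * 0) 0 = 0 := by
    have := h 0 0 (by simp) (by simp)
    simpa using this
  rw [hasDerivAt_iff_isLittleO]
  have h1 : (fun q : ℂ => lam k (u * q) q - lam k (u * 0) 0 - (q - 0) • u) =O[𝓝 0]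
      fun q => q ^ 2 := by
    refine Asymptotics.IsBigO.of_bound A ?_
    filter_upwards [Metric.closedBall_mem_nhds (0 : ℂ) (by norm_num : (0 : ℝ) < 1 / 2)] with q hq
    have hq : ‖q‖ ≤ 1 / 2 := by simpa using hq
    have hn : ‖u * q‖ = ‖q‖ := by rw [norm_mul, hu, one_mul]
    have := h (u * q) q (by rwa [hn]) hn.ge
    rw [hn] at this
    rw [h0, sub_zero, sub_zero, smul_eq_mul, mul_comm q, norm_pow]
    exact this
  refine h1.trans_isLittleO ?_
  simp only [sub_zero]
  exact Asymptotics.isLittleO_pow_id one_lt_two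

theorem cusp_zero (r : ℕ) : cusp r 0 = row r (1 / 3) := by
  have h0 : lam (r - 1) 0 0 = 0 := by
    obtain ⟨A, hA, h⟩ := exists_norm_lam_sub_le (r - 1)
    have := h 0 0 (by simp) (by simp)
    simpa using this
  rw [cusp, mul_zero, mul_zero, h0]; ring

theorem hasDerivAt_cusp_zero (r : ℕ) :
    HasDerivAt (cusp r) (lip r * (e (1 / 3) + (-1) ^ r * e (-(1 / 3)))) 0 := by
  have h1 := hasDerivAt_lam_zero (r - 1) norm_e_one_third
  have h2 := hasDerivAt_lam_zero (r - 1) norm_e_neg_one_third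
  exact ((h1.fun_add (h2.const_mul _)).const_mul _).const_add _

theorem sqrt_three_sq : (Real.sqrt 3 : ℂ) ^ 2 = 3 := by
  exact_mod_cast Real.sq_sqrt (by norm_num : (0 : ℝ) ≤ 3)

theorem sqrt_three_ne_zero : (Real.sqrt 3 : ℂ) ≠ 0 := by
  intro h; have := sqrt_three_sq; rw [h] at this; norm_num at this

theorem pi_ne_zero' : (Real.pi : ℂ) ≠ 0 := by exact_mod_cast Real.pi_ne_zero

theorem lip_three : lip 3 = 4 * Real.pi ^ 3 * I := by
  have : (3 - 1).factorial = 2 := rfl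
  rw [lip, this, mul_pow, mul_pow, I_pow_three]; push_cast; ring

theorem lip_four : lip 4 = 8 / 3 * Real.pi ^ 4 := by
  have : (4 - 1).factorial = 6 := rfl
  rw [lip, this, mul_pow, mul_pow, I_pow_four]; push_cast; ring

/-- The normalized function `cusp 3 q / cusp 3 0` as a Lambert series. -/
theorem cusp_three_eq (q : ℂ) : cusp 3 q = 4 * Real.pi ^ 3 / (3 * Real.sqrt 3) *
    (1 + 3 * Real.sqrt 3 * I * (lam 2 (e (1 / 3) * q) q - lam 2 (e (-(1 / 3)) * q) q)) := by
  rw [cusp, row_three_one_third, lip_three]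
  have := sqrt_three_ne_zero
  field_simp
  ring

theorem cusp_four_eq (q : ℂ) : cusp 4 q = 8 * Real.pi ^ 4 / 9 *
    (1 + 3 * (lam 3 (e (1 / 3) * q) q + lam 3 (e (-(1 / 3)) * q) q)) := by
  rw [cusp, row_four_one_third, lip_four]
  ring

/-- Every nonzero point of the unit disc is in the image of the upper half plane under `e`. -/
theorem exists_e_eq {q : ℂ} (h0 : q ≠ 0) (hq : ‖q‖ < 1) : ∃ σ : ℂ, 0 < σ.im ∧ e σ = q := by
  have h1 : (2 * Real.pi * I : ℂ) ≠ 0 := by simp [Real.pi_ne_zero]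
  have h2 : e (log q / (2 * Real.pi * I)) = q := by
    rw [e, mul_div_cancel₀ _ h1, exp_log h0]
  refine ⟨_, ?_, h2⟩
  by_contra hcon
  rw [← h2, norm_e] at hq
  have := Real.pi_pos
  have h3 : 0 ≤ -(2 * Real.pi * (log q / (2 * Real.pi * I)).im) := by
    rw [neg_nonneg]; exact mul_nonpos_of_nonneg_of_nonpos (by positivity) (not_lt.1 hcon)
  have := Real.one_le_exp h3
  linarith

theorem cusp_three_ne_zero' {q : ℂ} (hq : ‖q‖ < 1) : cusp 3 q ≠ 0 := by
  rcases eq_or_ne q 0 with rfl | h0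
  · rw [cusp_zero, row_three_one_third]
    have := sqrt_three_ne_zero
    have := pi_ne_zero'
    exact div_ne_zero (mul_ne_zero (by norm_num) (pow_ne_zero 3 this)) (mul_ne_zero (by norm_num) ‹_›)
  · obtain ⟨σ, hσ, rfl⟩ := exists_e_eq h0 hq
    exact cusp_three_ne_zero hσ

/-- The function `gam` at `-1 / (3σ)`, as a function of `q = e σ`. -/
noncomputable def cgam (q : ℂ) : ℂ := 27 / 2 * cusp 4 q ^ 3 / cusp 3 q ^ 4

/-- The quotient `eis4 / eis3²` at `-1 / (3σ)`, as a function of `q = e σ`, without the automorphy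
factor. -/
noncomputable def cquot (q : ℂ) : ℂ := -54 * Real.pi ^ 2 * (cusp 4 q / cusp 3 q ^ 2)

theorem differentiableAt_cgam {q : ℂ} (hq : ‖q‖ < 1) : DifferentiableAt ℂ cgam q :=
  (((differentiableAt_cusp 4 hq).fun_pow 3).const_mul _).fun_div ((differentiableAt_cusp 3 hq).fun_pow 4)
    (pow_ne_zero 4 (cusp_three_ne_zero' hq))

theorem differentiableAt_cquot {q : ℂ} (hq : ‖q‖ < 1) : DifferentiableAt ℂ cquot q :=
  ((differentiableAt_cusp 4 hq).fun_div ((differentiableAt_cusp 3 hq).fun_pow 2)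
    (pow_ne_zero 2 (cusp_three_ne_zero' hq))).const_mul _

theorem cquot_zero : cquot 0 = -81 := by
  rw [cquot, cusp_zero, cusp_zero, row_three_one_third, row_four_one_third]
  have := sqrt_three_ne_zero
  have := pi_ne_zero'
  field_simp
  rw [sqrt_three_sq]; norm_num

theorem cgam_zero : cgam 0 = 27 := by
  rw [cgam, cusp_zero, cusp_zero, row_three_one_third, row_four_one_third]
  have := sqrt_three_ne_zero
  have := pi_ne_zero'
  have h4 : (Real.sqrt 3 : ℂ) ^ 4 = 9 := by
    rw [show (Real.sqrt 3 : ℂ) ^ 4 = ((Real.sqrt 3 : ℂ) ^ 2) ^ 2 by ring, sqrt_three_sq]; norm_num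
  rw [div_pow (4 * _ : ℂ), mul_pow (3 : ℂ), h4]
  field_simp
  norm_num

/-- The expansion `27 + 729 q + …` at the cusp. -/
theorem hasDerivAt_cgam_zero : HasDerivAt cgam 729 0 := by
  have h3 := hasDerivAt_cusp_zero 3
  have h4 := hasDerivAt_cusp_zero 4
  have hq : ‖(0 : ℂ)‖ < 1 := by simp
  have := ((h4.fun_pow 3).const_mul (27 / 2)).fun_div (h3.fun_pow 4)
    (pow_ne_zero 4 (cusp_three_ne_zero' hq))
  refine this.congr_deriv ?_
  have hs := sqrt_three_ne_zero
  have hp := pi_ne_zero'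
  set w : ℂ := (Real.sqrt 3 : ℂ)
  have hw : w ^ 2 = 3 := sqrt_three_sq
  have e1 : lip 3 * (e (1 / 3) + (-1) ^ 3 * e (-(1 / 3))) = -9 * cusp 3 0 := by
    rw [cusp_zero, row_three_one_third, lip_three, e_one_third, e_neg_one_third]
    field_simp
    linear_combination (w ^ 2 * 6) * I_sq - 6 * hw
  have e2 : lip 4 * (e (1 / 3) + (-1) ^ 4 * e (-(1 / 3))) = -3 * cusp 4 0 := by
    rw [cusp_zero, row_four_one_third, lip_four, e_one_third, e_neg_one_third]
    ring
  have hc := cusp_three_ne_zero' hq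
  have hg := cgam_zero
  rw [cgam] at hg
  rw [e1, e2]
  have : (729 : ℂ) = 27 * (27 / 2 * cusp 4 0 ^ 3 / cusp 3 0 ^ 4) := by rw [hg]; norm_num
  rw [this]
  field_simp
  ring

/-! ### The size of the parameter on the line of integration -/

/-- The first terms of a Lambert series on the negative real axis. -/
theorem norm_lam_sub_head_le {k : ℕ} (hk : ∀ m : ℕ, ((m : ℝ) + 4) ^ k ≤ 4 ^ k * 2 ^ m) (hk0 : k ≠ 0)
    {u : ℂ} (hu : ‖u‖ = 1) {x : ℝ} (h0 : 0 ≤ x) (h1 : x ≤ 1 / 6) :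
    ‖lam k (u * -x) (-x) -
      (-u * (x / (1 + x) : ℝ) + 2 ^ k * u ^ 2 * (x ^ 2 / (1 - x ^ 2) : ℝ) -
        3 ^ k * u ^ 3 * (x ^ 3 / (1 + x ^ 3) : ℝ))‖ ≤ 4 ^ k * (9 / 5) * x ^ 4 := by
  have hn : ‖(-x : ℂ)‖ = x := by rw [norm_neg, norm_real, Real.norm_of_nonneg h0]
  have hy : ‖(-x : ℂ)‖ < 1 := by rw [hn]; linarith
  have hx : ‖u * -x‖ < 1 := by rw [norm_mul, hu, one_mul]; exact hy
  have hs := hasSum_lam k hx hy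
  have h2 := (hasSum_nat_add_iff' 4).2 hs
  have h3 : (∑ i ∈ Finset.range 4, ((i : ℂ) ^ k * (u * -x) ^ i / (1 - (-x) ^ i))) =
      -u * (x / (1 + x) : ℝ) + 2 ^ k * u ^ 2 * (x ^ 2 / (1 - x ^ 2) : ℝ) -
        3 ^ k * u ^ 3 * (x ^ 3 / (1 + x ^ 3) : ℝ) := by
    rw [Finset.sum_range_succ, Finset.sum_range_succ, Finset.sum_range_succ, Finset.sum_range_one]
    have a3 : (-(x : ℂ)) ^ 3 = -(x ^ 3) := by ring
    rw [mul_pow u _ 3, a3]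
    push_cast
    rw [zero_pow hk0, pow_one, pow_one, one_pow, neg_sq, sub_neg_eq_add, sub_neg_eq_add]
    ring
  rw [h3] at h2
  rw [← h2.tsum_eq]
  have hg := ((hasSum_geometric_of_lt_one (r := 2 * x) (by positivity) (by linarith)).mul_left
    (4 ^ k * (6 / 5) * x ^ 4))
  refine (tsum_of_norm_bounded hg fun m => ?_).trans ?_
  · rw [norm_div, norm_mul, norm_pow, norm_pow, norm_mul, hu, one_mul, norm_natCast, hn]
    have hd : 5 / 6 ≤ ‖1 - (-x : ℂ) ^ (m + 4)‖ := by
      have a1 := norm_sub_norm_le (1 : ℂ) ((-x) ^ (m + 4))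
      rw [norm_one, norm_pow, hn] at a1
      have a2 : x ^ (m + 4) ≤ x := pow_le_of_le_one h0 (by linarith) (by omega)
      linarith
    rw [div_le_iff₀ (by linarith)]
    have a3 := hk m
    push_cast
    calc ((m : ℝ) + 4) ^ k * x ^ (m + 4) ≤ (4 ^ k * 2 ^ m) * x ^ (m + 4) := by gcongr
      _ = (4 ^ k * (6 / 5) * x ^ 4 * (2 * x) ^ m) * (5 / 6) := by rw [mul_pow, pow_add]; ring
      _ ≤ _ := by gcongr
  · have : (1 - 2 * x)⁻¹ ≤ 3 / 2 := by
      rw [inv_le_comm₀ (by linarith) (by norm_num)]; linarith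
    calc 4 ^ k * (6 / 5) * x ^ 4 * (1 - 2 * x)⁻¹ ≤ 4 ^ k * (6 / 5) * x ^ 4 * (3 / 2) := by gcongr
      _ = _ := by ring

theorem add_four_sq_le (m : ℕ) : ((m : ℝ) + 4) ^ 2 ≤ 4 ^ 2 * 2 ^ m := by
  induction m with
  | zero => norm_num
  | succ m ih =>
    push_cast
    have hm : (0 : ℝ) ≤ m := m.cast_nonneg
    rw [pow_succ (2 : ℝ)]
    have : ((m : ℝ) + 1 + 4) ^ 2 ≤ 2 * ((m : ℝ) + 4) ^ 2 := by nlinarith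
    linarith

theorem add_four_cube_le (m : ℕ) : ((m : ℝ) + 4) ^ 3 ≤ 4 ^ 3 * 2 ^ m := by
  induction m with
  | zero => norm_num
  | succ m ih =>
    push_cast
    have hm : (0 : ℝ) ≤ m := m.cast_nonneg
    rw [pow_succ (2 : ℝ)]
    have : ((m : ℝ) + 1 + 4) ^ 3 ≤ 2 * ((m : ℝ) + 4) ^ 3 := by
      have h : 2 * ((m : ℝ) + 4) ^ 3 - (m + 1 + 4) ^ 3 = m ^ 3 + 9 * m ^ 2 + 21 * m + 3 := by ring
      have : 0 ≤ (m : ℝ) ^ 3 + 9 * m ^ 2 + 21 * m + 3 := by positivity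
      linarith
    linarith

theorem e_one_third_sq : e (1 / 3) ^ 2 = e (-(1 / 3)) := by
  rw [← e_nat_mul, ← e_add_one (-(1 / 3))]; congr 1; push_cast; ring

theorem e_neg_one_third_sq : e (-(1 / 3)) ^ 2 = e (1 / 3) := by
  rw [e_neg, inv_pow, e_one_third_sq, e_neg, inv_inv]

theorem e_one_third_cube : e (1 / 3) ^ 3 = 1 := by
  rw [← e_nat_mul, show ((3 : ℕ) : ℂ) * (1 / 3) = 1 by norm_num, e_one]

theorem e_neg_one_third_cube : e (-(1 / 3)) ^ 3 = 1 := by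
  rw [e_neg, inv_pow, e_one_third_cube, inv_one]

/-- A lower bound for `cusp 3 (-x) / cusp 3 0`, the exact expansion of which starts with `1 + 9x`. -/
theorem le_norm_cusp_three {x : ℝ} (h0 : 0 ≤ x) (h1 : x ≤ 1 / 6) :
    1 + 6 * x ≤ ‖1 + 3 * Real.sqrt 3 * I *
      (lam 2 (e (1 / 3) * -x) (-x) - lam 2 (e (-(1 / 3)) * -x) (-x))‖ := by
  have b1 := norm_lam_sub_head_le add_four_sq_le two_ne_zero norm_e_one_third h0 h1
  have b2 := norm_lam_sub_head_le add_four_sq_le two_ne_zero norm_e_neg_one_third h0 h1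
  set L1 := lam 2 (e (1 / 3) * -x) (-x)
  set L2 := lam 2 (e (-(1 / 3)) * -x) (-x)
  set A := x / (1 + x)
  set B := x ^ 2 / (1 - x ^ 2)
  set C := x ^ 3 / (1 + x ^ 3)
  rw [e_one_third_sq, e_one_third_cube] at b1
  rw [e_neg_one_third_sq, e_neg_one_third_cube] at b2
  set D1 := -e (1 / 3) * A + 2 ^ 2 * e (-(1 / 3)) * B - 3 ^ 2 * 1 * C
  set D2 := -e (-(1 / 3)) * A + 2 ^ 2 * e (1 / 3) * B - 3 ^ 2 * 1 * C
  have hs3 : Real.sqrt 3 ≤ 26 / 15 := by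
    rw [Real.sqrt_le_left (by norm_num)]; norm_num
  have hD : (1 : ℂ) + 3 * Real.sqrt 3 * I * (D1 - D2) = ((1 + 9 * A + 36 * B : ℝ) : ℂ) := by
    simp only [D1, D2, e_one_third, e_neg_one_third]
    push_cast
    linear_combination (-3 * A - 12 * B) * (sqrt_three_sq * I ^ 2 + 3 * I_sq)
  have key : ((1 + 9 * A + 36 * B : ℝ) : ℂ) = (1 + 3 * Real.sqrt 3 * I * (L1 - L2)) -
      3 * Real.sqrt 3 * I * ((L1 - D1) - (L2 - D2)) := by rw [← hD]; ring
  have hA : x - x ^ 2 ≤ A := by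
    rw [le_div_iff₀ (by linarith)]; nlinarith [pow_nonneg h0 3]
  have hx2 : x ^ 2 ≤ 1 / 36 := by nlinarith
  have hB : x ^ 2 ≤ B := by
    rw [le_div_iff₀ (by nlinarith)]; nlinarith [sq_nonneg (x ^ 2)]
  have n1 : ‖3 * Real.sqrt 3 * I * ((L1 - D1) - (L2 - D2))‖ ≤ 300 * x ^ 4 := by
    have a1 := norm_sub_le (L1 - D1) (L2 - D2)
    have a2 : ‖(3 * Real.sqrt 3 * I : ℂ)‖ = 3 * Real.sqrt 3 := by
      simp
    rw [norm_mul, a2]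
    calc 3 * Real.sqrt 3 * ‖L1 - D1 - (L2 - D2)‖ ≤ 3 * (26 / 15) * (4 ^ 2 * (9 / 5) * x ^ 4 +
          4 ^ 2 * (9 / 5) * x ^ 4) := by
          gcongr
          linarith
      _ ≤ 300 * x ^ 4 := by
          have := pow_nonneg h0 4
          linarith
  have n2 := norm_sub_le (1 + 3 * Real.sqrt 3 * I * (L1 - L2))
      (3 * Real.sqrt 3 * I * ((L1 - D1) - (L2 - D2)))
  rw [← key, norm_real] at n2
  have n3 := Real.le_norm_self (1 + 9 * A + 36 * B)
  -- the error is compensated by the second-order terms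
  have n4 : 300 * x ^ 4 ≤ 9 * x ^ 2 := by nlinarith [sq_nonneg x]
  nlinarith

/-- An upper bound for `cusp 4 (-x) / cusp 4 0`, the exact expansion of which starts with `1 + 3x`. -/
theorem norm_cusp_four_le {x : ℝ} (h0 : 0 ≤ x) (h1 : x ≤ 1 / 6) :
    ‖1 + 3 * (lam 3 (e (1 / 3) * -x) (-x) + lam 3 (e (-(1 / 3)) * -x) (-x))‖ ≤ 1 + 6 * x := by
  have b1 := norm_lam_sub_head_le add_four_cube_le three_ne_zero norm_e_one_third h0 h1
  have b2 := norm_lam_sub_head_le add_four_cube_le three_ne_zero norm_e_neg_one_third h0 h1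
  set L1 := lam 3 (e (1 / 3) * -x) (-x)
  set L2 := lam 3 (e (-(1 / 3)) * -x) (-x)
  set A := x / (1 + x)
  set B := x ^ 2 / (1 - x ^ 2)
  set C := x ^ 3 / (1 + x ^ 3)
  rw [e_one_third_sq, e_one_third_cube] at b1
  rw [e_neg_one_third_sq, e_neg_one_third_cube] at b2
  set D1 := -e (1 / 3) * A + 2 ^ 3 * e (-(1 / 3)) * B - 3 ^ 3 * 1 * C
  set D2 := -e (-(1 / 3)) * A + 2 ^ 3 * e (1 / 3) * B - 3 ^ 3 * 1 * C
  have hD : (1 : ℂ) + 3 * (D1 + D2) = ((1 + 3 * A - 24 * B - 162 * C : ℝ) : ℂ) := by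
    simp only [D1, D2, e_one_third, e_neg_one_third]
    push_cast
    ring
  have key : (1 + 3 * (L1 + L2)) = ((1 + 3 * A - 24 * B - 162 * C : ℝ) : ℂ) +
      3 * ((L1 - D1) + (L2 - D2)) := by rw [← hD]; ring
  have hx2 : x ^ 2 ≤ 1 / 36 := by nlinarith
  have hx3 : 0 ≤ x ^ 3 := by positivity
  have hA : A ≤ x := by
    rw [div_le_iff₀ (by linarith)]; nlinarith
  have hA0 : 0 ≤ A := by positivity
  have hB : x ^ 2 ≤ B := by
    rw [le_div_iff₀ (by nlinarith)]; nlinarith [sq_nonneg (x ^ 2)]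
  have hB' : B ≤ 36 / 35 * x ^ 2 := by
    rw [div_le_iff₀ (by nlinarith)]; nlinarith [sq_nonneg (x ^ 2)]
  have hC : C ≤ x ^ 3 := by
    rw [div_le_iff₀ (by positivity)]; nlinarith [sq_nonneg (x ^ 3)]
  have hC0 : 0 ≤ C := by positivity
  have n1 : ‖3 * ((L1 - D1) + (L2 - D2))‖ ≤ 692 * x ^ 4 := by
    have a1 := norm_add_le (L1 - D1) (L2 - D2)
    have a2 : ‖(3 : ℂ)‖ = 3 := by simp
    rw [norm_mul, a2]
    have := pow_nonneg h0 4
    linarith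
  have n2 := norm_add_le ((1 + 3 * A - 24 * B - 162 * C : ℝ) : ℂ) (3 * ((L1 - D1) + (L2 - D2)))
  rw [← key, norm_real] at n2
  have n4 : 692 * x ^ 4 ≤ 20 * x ^ 2 := by nlinarith [sq_nonneg x]
  have n5 : |1 + 3 * A - 24 * B - 162 * C| ≤ 1 + 6 * x - 20 * x ^ 2 := by
    rw [abs_le]
    constructor <;> nlinarith
  rw [Real.norm_eq_abs] at n2
  linarith

/-- On the interval of integration `cgam (-x)` has its maximal absolute value at `x = 0` only. By the two
preceding bounds `|cgam (-x)| / 27` is at most `1 / (1 + 6x)`. -/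
theorem norm_cgam_le {x : ℝ} (h0 : 0 ≤ x) (h1 : x ≤ 1 / 6) :
    ‖cgam (-x)‖ ≤ 27 * Real.exp (-(3 * x)) := by
  have h3 := le_norm_cusp_three h0 h1
  have h4 := norm_cusp_four_le h0 h1
  have c3 := cusp_three_eq (-x)
  have c4 := cusp_four_eq (-x)
  set M := 1 + 3 * Real.sqrt 3 * I *
      (lam 2 (e (1 / 3) * -x) (-x) - lam 2 (e (-(1 / 3)) * -x) (-x))
  set N := 1 + 3 * (lam 3 (e (1 / 3) * -x) (-x) + lam 3 (e (-(1 / 3)) * -x) (-x))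
  have hM0 : 0 < ‖M‖ := by linarith
  have hM : M ≠ 0 := norm_pos_iff.1 hM0
  have hg : cgam (-x) = 27 * (N ^ 3 / M ^ 4) := by
    rw [cgam, c3, c4]
    have := sqrt_three_ne_zero
    have := pi_ne_zero'
    have h4 : (Real.sqrt 3 : ℂ) ^ 4 = 9 := by
      rw [show (Real.sqrt 3 : ℂ) ^ 4 = ((Real.sqrt 3 : ℂ) ^ 2) ^ 2 by ring, sqrt_three_sq]; norm_num
    rw [mul_pow _ M, div_pow (4 * _ : ℂ), mul_pow (3 : ℂ), h4]
    field_simp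
    ring
  rw [hg, norm_mul, norm_div, norm_pow, norm_pow]
  have h27 : ‖(27 : ℂ)‖ = 27 := by simp
  rw [h27]
  refine mul_le_mul_of_nonneg_left ?_ (by norm_num)
  have h5 : ‖N‖ ^ 3 / ‖M‖ ^ 4 ≤ 1 / (1 + 6 * x) := by
    rw [div_le_div_iff₀ (by positivity) (by linarith), one_mul]
    calc ‖N‖ ^ 3 * (1 + 6 * x) ≤ ‖M‖ ^ 3 * ‖M‖ := by
          have := h4.trans h3
          gcongr
      _ = ‖M‖ ^ 4 := by ring
  refine h5.trans ?_
  have h6 := Real.add_one_le_exp (-(3 * x))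
  rw [div_le_iff₀ (by linarith)]
  nlinarith

/-! ### Watson's lemma -/

open MeasureTheory in
/-- **Watson's lemma**: the asymptotic behaviour of `∫ f gᵐ` over an interval at whose left end `0`
the function `g` takes its maximal absolute value `1`. -/
theorem tendsto_laplace {f g : ℝ → ℂ} {A : ℂ} {x₀ B κ β γ : ℝ} (hx₀ : 0 < x₀) (hβ : 0 < β)
    (hκ : 0 < κ)
    (hγ : 0 < γ) (hf : ContinuousOn f (Set.Ioc 0 x₀)) (hg : ContinuousOn g (Set.Ioc 0 x₀))
    (hfb : ∀ x ∈ Set.Ioc 0 x₀, ‖f x‖ ≤ B * x ^ β)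
    (hgb : ∀ x ∈ Set.Ioc 0 x₀, ‖g x‖ ≤ Real.exp (-(κ * x)))
    (hfl : Tendsto (fun x : ℝ => f x / ((x ^ β : ℝ) : ℂ)) (𝓝[>] 0) (𝓝 A))
    (hgl : Tendsto (fun x : ℝ => (g x - 1) / x) (𝓝[>] 0) (𝓝 (-γ))) :
    Tendsto (fun m : ℕ => (((m : ℝ) ^ (β + 1) : ℝ) : ℂ) * ∫ x in (0 : ℝ)..x₀, f x * g x ^ m) atTop
      (𝓝 (A * ((γ ^ (-(β + 1)) * Real.Gamma (β + 1) : ℝ) : ℂ))) := by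
  set F : ℕ → ℝ → ℂ := fun m => (Set.Ioc 0 (m * x₀)).indicator
    fun t => (((m : ℝ) ^ β : ℝ) : ℂ) * (f (t / m) * g (t / m) ^ m) with hF
  have hB : 0 ≤ B := by
    have h := (norm_nonneg _).trans (hfb x₀ ⟨hx₀, le_rfl⟩)
    exact nonneg_of_mul_nonneg_left h (Real.rpow_pos_of_pos hx₀ β)
  have hmem : ∀ {m : ℕ} {t : ℝ}, 0 < m → t ∈ Set.Ioc 0 (m * x₀) → t / m ∈ Set.Ioc 0 x₀ := by
    intro m t hm ht
    have hm' : (0 : ℝ) < m := by exact_mod_cast hm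
    exact ⟨div_pos ht.1 hm', by rw [div_le_iff₀ hm']; linarith [ht.2]⟩
  have hI : ∀ᶠ m : ℕ in atTop, ∫ t in Set.Ioi (0 : ℝ), F m t =
      (((m : ℝ) ^ (β + 1) : ℝ) : ℂ) * ∫ x in (0 : ℝ)..x₀, f x * g x ^ m := by
    filter_upwards [eventually_gt_atTop 0] with m hm
    have hm' : (0 : ℝ) < m := by exact_mod_cast hm
    have hle : 0 ≤ (m : ℝ) * x₀ := by positivity
    rw [hF, setIntegral_indicator measurableSet_Ioc,
      Set.inter_eq_right.2 Set.Ioc_subset_Ioi_self, integral_const_mul,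
      ← intervalIntegral.integral_of_le hle]
    have := intervalIntegral.integral_comp_div (a := 0) (b := m * x₀)
        (fun x => f x * g x ^ m) hm'.ne'
    rw [this, zero_div, mul_div_cancel_left₀ _ hm'.ne', Real.rpow_add_one hm'.ne', real_smul]
    push_cast; ring
  refine Tendsto.congr' hI ?_
  have hlim : ∫ t in Set.Ioi (0 : ℝ), A * ((t ^ β * Real.exp (-(γ * t)) : ℝ) : ℂ) =
      A * ((γ ^ (-(β + 1)) * Real.Gamma (β + 1) : ℝ) : ℂ) := by
    rw [integral_const_mul, integral_complex_ofReal]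
    have := Real.integral_rpow_mul_exp_neg_mul_Ioi (a := β + 1) (by linarith) hγ
    rw [add_sub_cancel_right] at this
    rw [this, one_div, Real.inv_rpow hγ.le, Real.rpow_neg hγ.le]
  rw [← hlim]
  refine tendsto_integral_of_dominated_convergence (fun t => B * (t ^ β * Real.exp (-κ * t)))
    (fun m => ?_) ?_ (fun m => ?_) ?_
  · rcases Nat.eq_zero_or_pos m with rfl | hm
    · simp only [hF]
      simpa using aestronglyMeasurable_const
    have hm' : (0 : ℝ) < m := by exact_mod_cast hm
    rw [hF, aestronglyMeasurable_indicator_iff measurableSet_Ioc,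
      Measure.restrict_restrict_of_subset Set.Ioc_subset_Ioi_self]
    refine ContinuousOn.aestronglyMeasurable ?_ measurableSet_Ioc
    have hdiv : ContinuousOn (fun t : ℝ => t / m) (Set.Ioc 0 (m * x₀)) :=
      (continuous_id.div_const _).continuousOn
    have hmaps : Set.MapsTo (fun t : ℝ => t / m) (Set.Ioc 0 (m * x₀)) (Set.Ioc 0 x₀) :=
      fun t ht => hmem hm ht
    exact continuousOn_const.mul ((hf.comp hdiv hmaps).mul ((hg.comp hdiv hmaps).pow m))
  · have := integrableOn_rpow_mul_exp_neg_mul_rpow (s := β) (p := 1) (b := κ)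
        (by linarith) one_pos hκ
    simp only [Real.rpow_one] at this
    exact this.const_mul B
  · refine (ae_restrict_iff' measurableSet_Ioi).2 (Eventually.of_forall fun t ht => ?_)
    have ht : 0 < t := ht
    have hbd : 0 ≤ B * (t ^ β * Real.exp (-κ * t)) := by positivity
    by_cases hmt : t ∈ Set.Ioc 0 (m * x₀)
    · have hm : 0 < m := by
        rcases Nat.eq_zero_or_pos m with rfl | hm
        · simp at hmt
        · exact hm
      have hm' : (0 : ℝ) < m := by exact_mod_cast hm
      have h1 := hmem hm hmt
      simp only [hF]
      rw [Set.indicator_of_mem hmt, norm_mul, norm_mul, norm_pow, norm_real,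
        Real.norm_of_nonneg (by positivity)]
      calc (m : ℝ) ^ β * (‖f (t / m)‖ * ‖g (t / m)‖ ^ m) ≤
            (m : ℝ) ^ β * ((B * (t / m) ^ β) * Real.exp (-(κ * (t / m))) ^ m) := by
              gcongr
              · exact hfb _ h1
              · exact hgb _ h1
        _ = B * (t ^ β * Real.exp (-κ * t)) := by
          rw [← Real.exp_nat_mul, Real.div_rpow ht.le hm'.le]
          have : (m : ℝ) * -(κ * (t / m)) = -κ * t := by field_simp
          rw [this]
          have := (Real.rpow_pos_of_pos hm' β).ne'
          field_simp
    · simp only [hF]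
      rw [Set.indicator_of_notMem hmt, norm_zero]; exact hbd
  · refine (ae_restrict_iff' measurableSet_Ioi).2 (Eventually.of_forall fun t ht => ?_)
    have ht : 0 < t := ht
    have htm : Tendsto (fun m : ℕ => t / m) atTop (𝓝[>] 0) := by
      refine tendsto_nhdsWithin_iff.2 ⟨tendsto_const_div_atTop_nhds_zero_nat t, ?_⟩
      filter_upwards [eventually_gt_atTop 0] with m hm
      exact div_pos ht (by exact_mod_cast hm)
    have h1 := (hfl.comp htm).const_mul (((t ^ β : ℝ)) : ℂ)
    have h2 : Tendsto (fun m : ℕ => (m : ℂ) * (g (t / m) - 1)) atTop (𝓝 (((-(γ * t) : ℝ)) : ℂ)) :=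
        by
      have := (hgl.comp htm).mul_const (t : ℂ)
      push_cast
      rw [← neg_mul]
      refine this.congr' ?_
      filter_upwards [eventually_gt_atTop 0] with m hm
      have hm' : (m : ℂ) ≠ 0 := by exact_mod_cast hm.ne'
      have ht' : (t : ℂ) ≠ 0 := by exact_mod_cast ht.ne'
      simp only [Function.comp]
      push_cast
      field_simp
    have h3 := tendsto_one_add_pow_exp_of_tendsto h2
    have h4 := h1.mul h3
    have h5 : ((t ^ β : ℝ) : ℂ) * A * exp ((-(γ * t) : ℝ) : ℂ) =
        A * ((t ^ β * Real.exp (-(γ * t)) : ℝ) : ℂ) := by push_cast; ring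
    rw [h5] at h4
    refine h4.congr' ?_
    filter_upwards [eventually_gt_atTop 0, eventually_ge_atTop ⌈t / x₀⌉₊] with m hm hm2
    have hm' : (0 : ℝ) < m := by exact_mod_cast hm
    have hmt : t ∈ Set.Ioc 0 (m * x₀) := by
      refine ⟨ht, ?_⟩
      rw [← div_le_iff₀ hx₀]
      exact Nat.ceil_le.1 hm2
    simp only [hF]
    rw [Set.indicator_of_mem hmt]
    simp only [Function.comp]
    rw [Real.div_rpow ht.le hm'.le, add_sub_cancel]
    have a1 : ((t ^ β : ℝ) : ℂ) ≠ 0 := by exact_mod_cast (Real.rpow_pos_of_pos ht β).ne'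
    have a2 : (((m : ℝ) ^ β : ℝ) : ℂ) ≠ 0 := by exact_mod_cast (Real.rpow_pos_of_pos hm' β).ne'
    rw [ofReal_div]
    field_simp

/-! ### The transformation of the contour -/

section

section Psi

variable {a : ℝ} {σ : ℂ} {h : ℝ}

theorem norm_e_psi_le (ha : 0 < a) (hσ : h ≤ σ.im) (n : ℕ) :
    ‖e (3 * (n + a) * σ)‖ ≤ Real.exp (-(6 * Real.pi * a * h)) *
      Real.exp (-(6 * Real.pi * h)) ^ n := by
  rw [norm_e_psi]
  have := Real.pi_pos
  gcongr

theorem one_sub_le_norm_psi (ha : 0 < a) (h0 : 0 < h) (hσ : h ≤ σ.im) (n : ℕ) :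
    1 - Real.exp (-(6 * Real.pi * a * h)) ≤ ‖1 - e (3 * (n + a) * σ)‖ := by
  have h1 := norm_sub_norm_le 1 (e (3 * (n + a) * σ))
  have h2 := norm_e_psi_le ha hσ n
  have hpi := Real.pi_pos
  have h3 : Real.exp (-(6 * Real.pi * h)) ^ n ≤ 1 :=
    pow_le_one₀ (Real.exp_pos _).le (exp_neg_lt_one (by positivity)).le
  have h4 := mul_le_mul_of_nonneg_left h3 (Real.exp_pos (-(6 * Real.pi * a * h))).le
  rw [norm_one] at h1
  linarith

theorem norm_add_ofReal (ha : 0 < a) (n : ℕ) : ‖((n : ℂ) + a)‖ = n + a := by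
  have : ((n : ℂ) + a) = ((n + a : ℝ) : ℂ) := by push_cast; ring
  rw [this, norm_real, Real.norm_of_nonneg (by positivity)]

theorem norm_psi_term_le (ha : 0 < a) (h0 : 0 < h) (hσ : h ≤ σ.im) (n : ℕ) :
    ‖(n + a) * e (3 * (n + a) * σ) / (1 - e (3 * (n + a) * σ))‖ ≤
      (n + a) * Real.exp (-(6 * Real.pi * h)) ^ n *
        (Real.exp (-(6 * Real.pi * a * h)) * (1 - Real.exp (-(6 * Real.pi * a * h)))⁻¹) := by
  have hpi := Real.pi_pos
  have h1 : 0 < 1 - Real.exp (-(6 * Real.pi * a * h)) := sub_pos.2 (exp_neg_lt_one (by positivity))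
  rw [norm_div, norm_mul, norm_add_ofReal ha, div_eq_mul_inv]
  calc (n + a) * ‖e (3 * (n + a) * σ)‖ * ‖1 - e (3 * (n + a) * σ)‖⁻¹ ≤
      (n + a) * (Real.exp (-(6 * Real.pi * a * h)) * Real.exp (-(6 * Real.pi * h)) ^ n) *
        (1 - Real.exp (-(6 * Real.pi * a * h)))⁻¹ := by
        gcongr
        · exact norm_e_psi_le ha hσ n
        · exact one_sub_le_norm_psi ha h0 hσ n
    _ = _ := by ring

theorem hasSum_psi (ha : 0 < a) (hσ : 0 < σ.im) :
    HasSum (fun n : ℕ => (n + a) * e (3 * (n + a) * σ) / (1 - e (3 * (n + a) * σ))) (psi a σ) :=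
  (Summable.of_norm_bounded ((summable_add_mul_pow (Real.exp_pos _).le
    (exp_neg_lt_one (by have := Real.pi_pos; positivity)) a).mul_right _)
    (norm_psi_term_le ha hσ le_rfl)).hasSum

theorem differentiableAt_psi (ha : 0 < a) (hσ : 0 < σ.im) : DifferentiableAt ℂ (psi a) σ := by
  have hpi := Real.pi_pos
  obtain ⟨h, h0, hh⟩ := exists_between hσ
  have hU : IsOpen {σ : ℂ | h < σ.im} := isOpen_lt continuous_const continuous_im
  have := differentiableOn_tsum_of_summable_norm (E := ℂ) (U := {σ : ℂ | h < σ.im})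
    (F := fun (n : ℕ) σ => (n + a) * e (3 * (n + a) * σ) / (1 - e (3 * (n + a) * σ)))
    ((summable_add_mul_pow (Real.exp_pos (-(6 * Real.pi * h))).le
      (exp_neg_lt_one (by positivity)) a).mul_right
      (Real.exp (-(6 * Real.pi * a * h)) * (1 - Real.exp (-(6 * Real.pi * a * h)))⁻¹))
    (fun n w hw => by
      have hd : DifferentiableAt ℂ (fun σ => e (3 * (n + a) * σ)) w :=
        (differentiable_e _).comp w (differentiableAt_id.const_mul _)
      have hw0 : 0 < w.im := h0.trans hw
      have hne : 1 - e (3 * (n + a) * w) ≠ 0 := by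
        have h1 := norm_e_psi_lt_one ha hw0 n
        intro h2
        rw [← sub_eq_zero.1 h2, norm_one] at h1
        exact lt_irrefl _ h1
      exact ((hd.const_mul _).fun_div (hd.const_sub 1) hne).differentiableWithinAt)
    hU (fun n w hw => norm_psi_term_le ha h0 (le_of_lt hw) n)
  exact this.differentiableAt (hU.mem_nhds hh)

/-- High up in the upper half plane, `psi` is close to the leading part of its first term. -/
theorem exists_norm_psi_sub_le (ha : 0 < a) (h0 : 0 < h) : ∃ C : ℝ, 0 ≤ C ∧ ∀ σ : ℂ, h ≤ σ.im →
    ‖psi a σ - a * e (3 * a * σ)‖ ≤ C * (Real.exp (-(12 * Real.pi * a * σ.im)) +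
      Real.exp (-(6 * Real.pi * (1 + a) * σ.im))) := by
  have hpi := Real.pi_pos
  set x := Real.exp (-(6 * Real.pi * a * h)) with hx
  set ρ := Real.exp (-(6 * Real.pi * h)) with hρ
  have hx1 : 0 < 1 - x := sub_pos.2 (exp_neg_lt_one (by positivity))
  have hρ0 : 0 < ρ := Real.exp_pos _
  have hρ1 : ρ < 1 := exp_neg_lt_one (by positivity)
  set B := ∑' n : ℕ, ((n : ℝ) + (1 + a)) * ρ ^ n with hB
  have hsB := summable_add_mul_pow hρ0.le hρ1 (1 + a)
  have hB0 : 0 ≤ B := tsum_nonneg fun n => by positivity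
  refine ⟨(a + B) * (1 - x)⁻¹, by positivity, fun σ hσ => ?_⟩
  have hσ0 : 0 < σ.im := h0.trans_le hσ
  have hs := (hasSum_nat_add_iff' 1).2 (hasSum_psi ha hσ0)
  rw [Finset.sum_range_one, Nat.cast_zero, zero_add] at hs
  set E := e (3 * a * σ) with hE
  have hE1 : ‖E‖ = Real.exp (-(6 * Real.pi * a * σ.im)) := by
    have := norm_e_psi a σ 0
    simpa using this
  have hden := one_sub_le_norm_psi ha h0 hσ 0
  rw [Nat.cast_zero, zero_add, ← hx, ← hE] at hden
  have hne : 1 - E ≠ 0 := norm_pos_iff.1 (by linarith)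
  have hfirst : ‖a * E / (1 - E) - a * E‖ ≤ a * Real.exp (-(12 * Real.pi * a * σ.im)) *
      (1 - x)⁻¹ := by
    have : a * E / (1 - E) - a * E = a * E ^ 2 / (1 - E) := by field_simp; ring
    rw [this, norm_div, norm_mul, norm_real, Real.norm_of_nonneg ha.le, norm_pow, hE1,
      div_eq_mul_inv,
      ← Real.exp_nat_mul]
    have h2 : ((2 : ℕ) : ℝ) * -(6 * Real.pi * a * σ.im) = -(12 * Real.pi * a * σ.im) := by
      push_cast; ring
    rw [h2]
    gcongr
  have hrest : ‖psi a σ - a * E / (1 - E)‖ ≤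
      B * (Real.exp (-(6 * Real.pi * (1 + a) * σ.im)) * (1 - x)⁻¹) := by
    rw [← hs.tsum_eq]
    refine tsum_of_norm_bounded (hsB.hasSum.mul_right _) fun n => ?_
    rw [norm_div, norm_mul, norm_add_ofReal ha, div_eq_mul_inv]
    have h3 : ‖e (3 * ((n + 1 : ℕ) + a) * σ)‖ ≤ ρ ^ n *
        Real.exp (-(6 * Real.pi * (1 + a) * σ.im)) := by
      rw [norm_e_psi, pow_succ, mul_comm, mul_assoc, ← Real.exp_add]
      have : -(6 * Real.pi * σ.im) + -(6 * Real.pi * a * σ.im) =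
          -(6 * Real.pi * (1 + a) * σ.im) := by
        ring
      rw [this, hρ]
      gcongr
    have h4 := one_sub_le_norm_psi ha h0 hσ (n + 1)
    have h5 : (((n + 1 : ℕ) : ℝ) + a) = n + (1 + a) := by push_cast; ring
    rw [h5]
    calc (n + (1 + a)) * ‖e (3 * ((n + 1 : ℕ) + a) * σ)‖ * ‖1 - e (3 * ((n + 1 : ℕ) + a) * σ)‖⁻¹ ≤
        (n + (1 + a)) * (ρ ^ n * Real.exp (-(6 * Real.pi * (1 + a) * σ.im))) * (1 - x)⁻¹ := by
          gcongr
      _ = _ := by ring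
  have := norm_add_le (psi a σ - a * E / (1 - E)) (a * E / (1 - E) - a * E)
  rw [sub_add_sub_cancel] at this
  have hi : 0 ≤ (1 - x)⁻¹ := by positivity
  have e1 := Real.exp_pos (-(12 * Real.pi * a * σ.im))
  have e2 := Real.exp_pos (-(6 * Real.pi * (1 + a) * σ.im))
  have p1 : 0 ≤ B * (1 - x)⁻¹ * Real.exp (-(12 * Real.pi * a * σ.im)) := by positivity
  have p2 : 0 ≤ a * (1 - x)⁻¹ * Real.exp (-(6 * Real.pi * (1 + a) * σ.im)) := by positivity
  nlinarith

/-- If `3a` is an integer, the exponents of `psi` are integers. -/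
theorem psi_add_one (h3 : ∃ k : ℕ, 3 * a = k) (σ : ℂ) : psi a (σ + 1) = psi a σ := by
  obtain ⟨k, hk⟩ := h3
  have hk' : (3 * a : ℂ) = k := by exact_mod_cast congrArg ((↑) : ℝ → ℂ) hk
  unfold psi
  refine tsum_congr fun n => ?_
  have : 3 * (n + a) * (σ + 1) = 3 * (n + a) * σ + ((3 * n + k : ℤ) : ℂ) := by
    push_cast; rw [← hk']; ring
  rw [this, e_add, e_int, mul_one]

end Psi

/-- The disc with centre `2i` and radius `2` is tangent to the real line at `0`, and is mapped by
`σ ↦ -1 / (3σ)` onto the half plane `Im > 1/12`. -/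
theorem mem_ball_two {z : ℂ} : z ∈ Metric.ball (2 * I) 2 ↔ normSq z < 4 * z.im := by
  rw [Metric.mem_ball, dist_eq, ← sq_lt_sq₀ (norm_nonneg _) (by norm_num), ← normSq_eq_norm_sq,
    normSq_apply, normSq_apply]
  simp
  constructor <;> intro h <;> nlinarith

/-- The map `σ ↦ -1 / (3σ)` exchanges the end points of the segment from `-1/2 + √3/6 i` to
`1/2 + √3/6 i`, which turns an integral along this segment into minus the transformed integral. -/
theorem mean_eq_neg_integral {F : ℂ → ℂ} (hd : ∀ τ : ℂ, 0 < τ.im → DifferentiableAt ℂ F τ)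
    (hp : Function.Periodic F 1) : mean (Real.sqrt 3 / 6) F =
      -∫ x in (-1 / 2 : ℝ)..1 / 2, F (-1 / (3 * (x + (Real.sqrt 3 / 6 : ℝ) * I))) *
        (1 / (3 * (x + (Real.sqrt 3 / 6 : ℝ) * I) ^ 2)) := by
  set h := Real.sqrt 3 / 6 with hh
  have hs := Real.sq_sqrt (show (0 : ℝ) ≤ 3 by norm_num)
  have hs1 : 1 < Real.sqrt 3 := by
    rw [Real.lt_sqrt (by norm_num)]; norm_num
  have hh2 : h ^ 2 = 1 / 12 := by rw [hh, div_pow, hs]; norm_num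
  -- a primitive in a disc that contains the segment and its image
  have hball : ∀ z ∈ Metric.ball (2 * I) 2, 0 < z.im := by
    intro z hz
    have := mem_ball_two.1 hz
    have := normSq_nonneg z
    linarith
  obtain ⟨Φ, hΦ⟩ := DifferentiableOn.isExactOn_ball (f := F) (c := 2 * I) (r := 2)
    fun z hz => (hd z (hball z hz)).differentiableWithinAt
  set z : ℝ → ℂ := fun x => x + (h : ℂ) * I with hz
  have hre : ∀ x, (z x).re = x := fun x => by simp [hz]
  have him : ∀ x, (z x).im = h := fun x => by simp [hz]
  have hzc : Continuous z := by fun_prop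
  have hz0 : ∀ x, z x ≠ 0 := by
    intro x h0
    have := him x
    rw [h0, zero_im] at this
    linarith
  have hsq : ∀ x, normSq (z x) = x ^ 2 + h ^ 2 := fun x => by rw [normSq_apply, hre, him]; ring
  have hzb : ∀ x ∈ Set.uIcc (-1 / 2 : ℝ) (1 / 2), z x ∈ Metric.ball (2 * I) 2 := by
    intro x hx
    rw [Set.uIcc_of_le (by norm_num)] at hx
    rw [mem_ball_two, hsq, him]
    nlinarith [hx.1, hx.2]
  have hSz : ∀ x, -1 / (3 * z x) ∈ Metric.ball (2 * I) 2 := by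
    intro x
    have h1 : 0 < normSq (z x) := normSq_pos.2 (hz0 x)
    have h2 : -1 / (3 * z x) = ((1 / (3 * normSq (z x)) : ℝ) : ℂ) * -(starRingEnd ℂ (z x)) := by
      have hc : (starRingEnd ℂ) (z x) ≠ 0 := by simpa using hz0 x
      have := hz0 x
      push_cast
      rw [normSq_eq_conj_mul_self]
      field_simp
    rw [mem_ball_two, h2, normSq_mul, normSq_neg, normSq_conj, im_ofReal_mul, neg_im, conj_im,
      neg_neg,
      normSq_ofReal, him]
    have h3 : 1 / (3 * normSq (z x)) * (1 / (3 * normSq (z x))) * normSq (z x) =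
      1 / (3 * normSq (z x)) * (1 / 3) := by field_simp
    rw [h3]
    have h4 : 0 < 1 / (3 * normSq (z x)) := by positivity
    nlinarith
  have hI1 : ∫ x in (-1 / 2 : ℝ)..1 / 2, F (z x) = Φ (z (1 / 2)) - Φ (z (-1 / 2)) := by
    refine intervalIntegral.integral_eq_sub_of_hasDerivAt (f := fun x => Φ (z x))
      (fun x hx => ?_) ?_
    · have h1 : HasDerivAt (fun w : ℂ => Φ (w + h * I)) (F (z x)) (x : ℂ) :=
        HasDerivAt.comp_add_const _ _ (hΦ _ (hzb x hx))
      exact h1.comp_ofReal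
    · refine ContinuousOn.intervalIntegrable fun x hx => ?_
      exact ((hd _ (hball _ (hzb x hx))).continuousAt.comp hzc.continuousAt).continuousWithinAt
  -- the image of the segment is an arc between the same end points, traversed backwards
  have hI2 : ∫ x in (-1 / 2 : ℝ)..1 / 2, F (-1 / (3 * z x)) * (1 / (3 * z x ^ 2)) =
      Φ (-1 / (3 * z (1 / 2))) - Φ (-1 / (3 * z (-1 / 2))) := by
    refine intervalIntegral.integral_eq_sub_of_hasDerivAt (f := fun x => Φ (-1 / (3 * z x)))
      (fun x _ => ?_) ?_
    · have h0 : HasDerivAt (fun w : ℂ => w + h * I) 1 (x : ℂ) := (hasDerivAt_id _).add_const _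
      have h1 : HasDerivAt (fun w : ℂ => -1 / (3 * (w + h * I))) (1 / (3 * z x ^ 2)) (x : ℂ) := by
        have hne : 3 * ((x : ℂ) + h * I) ≠ 0 := mul_ne_zero (by norm_num) (hz0 x)
        have := (hasDerivAt_const (x : ℂ) (-1 : ℂ)).fun_div (h0.const_mul 3) hne
        refine this.congr_deriv ?_
        have := hz0 x
        simp only [hz] at this ⊢
        field_simp
        ring
      have h2 := HasDerivAt.comp (x : ℂ) (hΦ _ (hSz x)) h1
      exact h2.comp_ofReal
    · refine Continuous.intervalIntegrable ?_ _ _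
      have c1 : Continuous fun x => -1 / (3 * z x) :=
        continuous_const.div (continuous_const.mul hzc) fun x => mul_ne_zero (by norm_num) (hz0 x)
      refine (continuous_iff_continuousAt.2 fun x => ?_).mul
        (continuous_const.div (continuous_const.mul (hzc.pow 2))
          fun x => mul_ne_zero (by norm_num) (pow_ne_zero 2 (hz0 x)))
      exact (hd _ (hball _ (hSz x))).continuousAt.comp (f := fun x =>
        -1 / (3 * z x)) c1.continuousAt
  have hsC : (h : ℂ) ^ 2 = 1 / 12 := by rw [← ofReal_pow, hh2]; push_cast; rfl
  have hw : ((h : ℂ) * I) ^ 2 = -1 / 12 := by rw [mul_pow, hsC, I_sq]; norm_num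
  have s1 : -1 / (3 * z (1 / 2)) = z (-1 / 2) := by
    rw [div_eq_iff (mul_ne_zero (by norm_num) (hz0 _))]
    simp only [hz]; push_cast
    linear_combination -3 * hw
  have s2 : -1 / (3 * z (-1 / 2)) = z (1 / 2) := by
    rw [div_eq_iff (mul_ne_zero (by norm_num) (hz0 _))]
    simp only [hz]; push_cast
    linear_combination -3 * hw
  rw [s1, s2] at hI2
  have hm := mean_eq_integral hp h (-1 / 2)
  rw [show (-1 / 2 : ℝ) + 1 = 1 / 2 by norm_num] at hm
  rw [hm]
  change (∫ x in (-1 / 2 : ℝ)..1 / 2, F (z x)) =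
    -∫ x in (-1 / 2 : ℝ)..1 / 2, F (-1 / (3 * z x)) * (1 / (3 * z x ^ 2))
  rw [hI1, hI2]; ring

end

/-- The symmetrized series in the transformation law of `sig`. -/
noncomputable def psiSym (a : ℝ) (σ : ℂ) : ℂ := psi a σ + psi (1 - a) σ

/-- The integrand for the coefficients after `τ ↦ -1 / (3τ)`. -/
noncomputable def integrand (a : ℝ) (C : ℂ) (m : ℕ) (σ : ℂ) : ℂ :=
  cquot (e σ) * (C + psiSym a σ - psiSym (1 / 3) σ) * cgam (e σ) ^ m *
    (deriv cgam (e σ) * (2 * Real.pi * I * e σ))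

theorem differentiableAt_psiSym {a : ℝ} (ha : 0 < a) (ha1 : a < 1) {σ : ℂ} (hσ : 0 < σ.im) :
    DifferentiableAt ℂ (psiSym a) σ :=
  (differentiableAt_psi ha hσ).add (differentiableAt_psi (sub_pos.2 ha1) hσ)

theorem deriv_gam_transform {τ σ : ℂ} (hσ : 0 < σ.im) (h : 3 * τ * σ = -1) :
    deriv gam τ * (1 / (3 * σ ^ 2)) = deriv cgam (e σ) * (2 * Real.pi * I * e σ) := by
  have hσ0 : σ ≠ 0 := by rintro rfl; simp at hσ
  have hτ : τ = -1 / (3 * σ) := by field_simp; linear_combination h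
  have hne : 3 * σ ≠ 0 := mul_ne_zero (by norm_num) hσ0
  have h1 : HasDerivAt (fun w : ℂ => -1 / (3 * w)) (1 / (3 * σ ^ 2)) σ := by
    have := (hasDerivAt_const σ (-1 : ℂ)).fun_div ((hasDerivAt_id σ).const_mul 3) hne
    refine this.congr_deriv ?_
    simp only [id]
    field_simp
    ring
  have h2 : HasDerivAt (fun w : ℂ => gam (-1 / (3 * w))) (deriv gam τ * (1 / (3 * σ ^ 2))) σ := by
    have h3 := (differentiableAt_gam (im_pos_of_mul_eq hσ h)).hasDerivAt
    rw [hτ] at h3 ⊢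
    exact h3.comp σ h1
  have h3 : HasDerivAt (fun w : ℂ => cgam (e w)) (deriv cgam (e σ) * (2 * Real.pi * I * e σ)) σ :=
    (differentiableAt_cgam (norm_e_lt_one hσ)).hasDerivAt.comp σ (hasDerivAt_e σ)
  refine h2.unique (h3.congr_of_eventuallyEq ?_)
  filter_upwards [isOpen_upper.mem_nhds hσ] with w hw
  have hw : 0 < w.im := hw
  have hw0 : w ≠ 0 := by rintro rfl; simp at hw
  rw [gam_transform hw (by field_simp), cgam]

theorem e_ofReal_eq (a : ℝ) : e a = exp ((2 * Real.pi * a : ℝ) * I) := by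
  rw [e]; congr 1; push_cast; ring

theorem e_one_third_eq : e ((1 / 3 : ℝ) : ℂ) = exp (2 * Real.pi * I / 3) := by
  rw [e]; congr 1; push_cast; ring

theorem e_one_third_ne_one : e ((1 / 3 : ℝ) : ℂ) ≠ 1 := by
  rw [e_one_third_eq, exp_two_pi_div_three]
  intro h
  have := congrArg re h
  simp at this
  norm_num at this

/-- The numbers of walks as integrals along the segment from `-1/2 + √3/6 i` to `1/2 + √3/6 i`. -/
theorem exists_coef_eq_integral {w₀ : ℤ × ℤ} (h₀ : w₀ ∈ nearOrigin) {a : ℝ} (ha : 0 < a)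
    (ha1 : a < 1)
    (hs1 : e a ≠ 1) (hs3 : 1 + e a + e a ^ 2 ≠ 0) : ∃ C : ℂ, ∀ m : ℕ,
      coef w₀ (3 * a) (3 * (m + 1)) 1 1 = e a / (1 + e a + e a ^ 2) * (2 * Real.pi * I)⁻¹ *
        ∫ x in (-1 / 2 : ℝ)..1 / 2, integrand a C m (x + (Real.sqrt 3 / 6 : ℝ) * I) := by
  obtain ⟨C, hC⟩ := sig_sub_transform ha ha1 hs1 (b := 1 / 3) (by norm_num) (by norm_num)
    e_one_third_ne_one
  refine ⟨C, fun m => ?_⟩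
  have hβ : 3 * a * (2 * Real.pi / 3) = 2 * Real.pi * a := by ring
  have hn : ‖e a‖ = 1 := by simpa using norm_e_int_mul 1 a
  have hω : ‖e ((1 / 3 : ℝ) : ℂ)‖ = 1 := by simpa using norm_e_int_mul 1 (1 / 3)
  obtain ⟨Y, hY, hsum⟩ := exists_hasSum_coef h₀ hβ (by rwa [← e_ofReal_eq]) (by rwa [← e_ofReal_eq])
  rw [← e_ofReal_eq, ← e_one_third_eq] at hsum
  set c := e a / (1 + e a + e a ^ 2) with hc
  set G : ℂ → ℂ := fun τ => c * (eis4 (e τ) / eis3 (e τ) ^ 2) *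
    (sig (e a) (e τ) - sig (e ((1 / 3 : ℝ) : ℂ)) (e τ)) with hG
  have hGd : ∀ τ : ℂ, 0 < τ.im → DifferentiableAt ℂ G τ := by
    intro τ hτ
    have d4 := differentiableAt_comp_e (fun _ => differentiableAt_eis4) hτ
    have d3 := differentiableAt_comp_e (fun _ => differentiableAt_eis3) hτ
    have s1 := differentiableAt_comp_e (fun _ => differentiableAt_sig hn) hτ
    have s2 := differentiableAt_comp_e (fun _ => differentiableAt_sig hω) hτ
    exact ((d4.fun_div (d3.fun_pow 2) (pow_ne_zero 2 (eis3_ne_zero hτ))).const_mul c).mul (s1.sub s2)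
  have hGp : Function.Periodic G 1 := fun z => by simp only [hG, e_add_one]
  have hgd : ∀ τ : ℂ, 0 < τ.im → DifferentiableAt ℂ gam τ := fun _ => differentiableAt_gam
  have hcoef := coef_eq_mean (c := fun m => coef w₀ (3 * a) (3 * m) 1 1) (G := G) (Y₀ := Y)
    (Y := Real.sqrt 3 / 6) (fun k => by
      have := norm_coef_le h₀ hβ (3 * k) (le_refl 1) zero_le_one
      rw [pow_mul] at this
      norm_num at this
      exact this) (fun τ hτ => by
      have := (hsum τ hτ).2.2
      refine this.congr_fun fun k => ?_
      rw [gam, inv_div]) hGd hGp (by positivity) m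
  rw [hcoef, mean_eq_neg_integral (F := fun τ => G τ * gam τ ^ m * deriv gam τ)
    (fun τ hτ => ((hGd τ hτ).mul ((hgd τ hτ).pow m)).mul
    (differentiableAt_deriv_of_upper hgd hτ)) (fun z => by
      beta_reduce
      rw [hGp, gam_periodic, periodic_deriv gam_periodic])]
  rw [mul_neg, neg_mul, neg_neg, mul_comm c, mul_assoc _ c, ← intervalIntegral.integral_const_mul c]
  refine congrArg ((2 * Real.pi * I : ℂ)⁻¹ * ·) ?_
  refine intervalIntegral.integral_congr fun x _ => ?_
  set σ : ℂ := x + (Real.sqrt 3 / 6 : ℝ) * I with hσ'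
  have hσ : 0 < σ.im := by
    rw [hσ']; simp
  have hσ0 : σ ≠ 0 := by rintro h; rw [h] at hσ; simp at hσ
  have h3 : 3 * (-1 / (3 * σ)) * σ = -1 := by field_simp
  rw [integrand, ← deriv_gam_transform hσ h3]
  simp only [hG]
  rw [hC _ _ hσ h3, quotient_transform hσ h3, gam_transform hσ h3, cgam, cquot, psiSym, psiSym]
  field_simp
  ring

/-! ### The jump across the vertical lines -/

section

/-- The difference of the values of `psiSym a` on the lines `re = ∓1/2`, as a function of the
variable `x = exp (-2πy)`, where `y` is the height. -/
noncomputable def psiJump (a x : ℝ) : ℂ :=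
  psiSym a (-1 / 2 + ((-Real.log x / (2 * Real.pi) : ℝ) : ℂ) * I) -
    psiSym a (1 / 2 + ((-Real.log x / (2 * Real.pi) : ℝ) : ℂ) * I)

theorem height_pos {x : ℝ} (h0 : 0 < x) (h1 : x < 1) : 0 < -Real.log x / (2 * Real.pi) := by
  have := Real.log_neg h0 h1
  have := Real.pi_pos
  apply div_pos <;> linarith

theorem im_line (r y : ℝ) : ((r : ℂ) + (y : ℂ) * I).im = y := by simp

theorem continuousOn_psiJump {a : ℝ} (ha : 0 < a) (ha1 : a < 1) :
    ContinuousOn (psiJump a) (Set.Ioo 0 1) := by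
  intro x hx
  have hy := height_pos hx.1 hx.2
  have hY : ContinuousAt (fun x : ℝ => ((-Real.log x / (2 * Real.pi) : ℝ) : ℂ)) x :=
    continuous_ofReal.continuousAt.comp
      (f := fun x : ℝ => -Real.log x / (2 * Real.pi))
        ((Real.continuousAt_log hx.1.ne').neg.div_const _)
  have key : ∀ r : ℝ, ContinuousAt (fun x : ℝ =>
      psiSym a (r + ((-Real.log x / (2 * Real.pi) : ℝ) : ℂ) * I)) x := by
    intro r
    have hd := (differentiableAt_psiSym ha ha1 (σ := r + ((-Real.log x / (2 * Real.pi) : ℝ) : ℂ) *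
        I)
      (by rwa [im_line])).continuousAt
    exact hd.comp (f := fun x : ℝ => (r : ℂ) + ((-Real.log x / (2 * Real.pi) : ℝ) : ℂ) * I)
      (continuousAt_const.add (hY.mul continuousAt_const))
  have k1 := key (-1 / 2)
  have k2 := key (1 / 2)
  push_cast at k1 k2
  have := (k1.sub k2).continuousWithinAt (s := Set.Ioo 0 1)
  refine this.congr (fun y _ => ?_) ?_ <;> simp [psiJump]

theorem exp_eq_rpow {x c y : ℝ} (hx : 0 < x) (hy : y = -Real.log x / (2 * Real.pi)) {d : ℝ}
    (hd : d = 2 * Real.pi * c) : Real.exp (-(d * y)) = x ^ c := by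
  rw [Real.rpow_def_of_pos hx, hy, hd]
  congr 1
  have := Real.pi_ne_zero
  field_simp

/-- The leading term of `psiJump a x` as `x` tends to `0`. -/
theorem exists_norm_psiJump_sub_le {a x₀ : ℝ} (ha : 0 < a) (ha2 : a < 1 / 2) (h0 : 0 < x₀)
    (h1 : x₀ < 1) : ∃ K δ : ℝ, 0 ≤ K ∧ 0 < δ ∧ ∀ x ∈ Set.Ioc 0 x₀,
      ‖psiJump a x - a * (e (-(3 * a / 2)) - e (3 * a / 2)) * ((x ^ (3 * a) : ℝ) : ℂ)‖ ≤
        K * x ^ (3 * a + δ) := by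
  have hpi := Real.pi_pos
  have hh := height_pos h0 h1
  set h := -Real.log x₀ / (2 * Real.pi) with hhdef
  obtain ⟨C, hC0, hC⟩ := exists_norm_psi_sub_le ha hh
  obtain ⟨C', hC0', hC'⟩ := exists_norm_psi_sub_le (a := 1 - a) (by linarith) hh
  -- `δ` is the gap between `3a` and the next exponents `6a` and `3 (1 - a)`
  refine ⟨2 * (2 * C + 1 + 2 * C'), min (3 * a) (3 - 6 * a), by positivity,
    lt_min (by linarith) (by linarith), fun x hx => ?_⟩
  set δ := min (3 * a) (3 - 6 * a) with hδ
  have hδ1 : δ ≤ 3 * a := min_le_left _ _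
  have hδ2 : δ ≤ 3 - 6 * a := min_le_right _ _
  have hx0 : 0 < x := hx.1
  have hx1 : x ≤ 1 := hx.2.trans h1.le
  set y := -Real.log x / (2 * Real.pi) with hy
  have hhy : h ≤ y := by
    rw [hhdef, hy]
    gcongr
    exact hx.2
  set P := x ^ (3 * a + δ) with hP
  have hpow : ∀ c : ℝ, 3 * a + δ ≤ c → x ^ c ≤ P := fun c hc =>
    Real.rpow_le_rpow_of_exponent_ge hx0 hx1 hc
  have hP0 : 0 ≤ P := by positivity
  -- the main term on a vertical line
  have hmain : ∀ r b : ℝ, e (3 * b * ((r : ℂ) + y * I)) = e (3 * b * r) *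
      ((x ^ (3 * b) : ℝ) : ℂ) := by
    intro r b
    rw [mul_add, e_add]
    congr 1
    rw [← exp_eq_rpow (c := 3 * b) hx0 hy rfl, e, ofReal_exp]
    congr 1
    push_cast
    linear_combination (2 * Real.pi * 3 * b * y : ℂ) * I_sq
  have hline : ∀ r : ℝ, ‖psiSym a ((r : ℂ) + y * I) - a * e (3 * a * r) * ((x ^ (3 * a) : ℝ) : ℂ)‖ ≤
      (2 * C + 1 + 2 * C') * P := by
    intro r
    have b1 := hC ((r : ℂ) + y * I) (by rwa [im_line])
    have b2 := hC' ((r : ℂ) + y * I) (by rwa [im_line])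
    rw [im_line, hmain] at b1 b2
    rw [exp_eq_rpow (c := 6 * a) hx0 hy (by ring), exp_eq_rpow (c := 3 * (1 + a)) hx0 hy (by ring)] at b1
    rw [exp_eq_rpow (c := 6 * (1 - a)) hx0 hy (by ring),
      exp_eq_rpow (c := 3 * (1 + (1 - a))) hx0 hy (by ring)] at b2
    have p1 := hpow (6 * a) (by linarith)
    have p2 := hpow (3 * (1 + a)) (by linarith)
    have p3 := hpow (6 * (1 - a)) (by linarith)
    have p4 := hpow (3 * (1 + (1 - a))) (by linarith)
    have p5 := hpow (3 * (1 - a)) (by linarith)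
    have n1 : ‖((1 - a : ℝ) : ℂ) * (e (3 * (1 - a : ℝ) * r) * ((x ^ (3 * (1 - a)) : ℝ) : ℂ))‖ ≤
        P := by
      have : ‖e (3 * (1 - a : ℝ) * r)‖ = 1 := by
        have := norm_e_int_mul 1 (3 * (1 - a) * r)
        push_cast at this ⊢
        rwa [one_mul] at this
      rw [norm_mul, norm_mul, this, one_mul, norm_real, norm_real,
        Real.norm_of_nonneg (by linarith), Real.norm_of_nonneg (by positivity)]
      have q0 : 0 ≤ x ^ (3 * (1 - a)) := by positivity
      nlinarith
    have n2 : psiSym a ((r : ℂ) + y * I) - a * e (3 * a * r) * ((x ^ (3 * a) : ℝ) : ℂ) =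
        (psi a ((r : ℂ) + y * I) - a * (e (3 * a * r) * ((x ^ (3 * a) : ℝ) : ℂ))) +
        (psi (1 - a) ((r : ℂ) + y * I) -
          ((1 - a : ℝ) : ℂ) * (e (3 * (1 - a : ℝ) * r) * ((x ^ (3 * (1 - a)) : ℝ) : ℂ))) +
        ((1 - a : ℝ) : ℂ) * (e (3 * (1 - a : ℝ) * r) * ((x ^ (3 * (1 - a)) : ℝ) : ℂ)) := by
      rw [psiSym]; ring
    rw [n2]
    refine (norm_add₃_le).trans ?_
    have m1 : C * (x ^ (6 * a) + x ^ (3 * (1 + a))) ≤ C * (P + P) := by gcongr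
    have m2 : C' * (x ^ (6 * (1 - a)) + x ^ (3 * (1 + (1 - a)))) ≤ C' * (P + P) := by gcongr
    linarith
  have l1 := hline (-1 / 2)
  have l2 := hline (1 / 2)
  have e1 : (3 * a * ((-1 / 2 : ℝ) : ℂ)) = -(3 * a / 2) := by push_cast; ring
  have e2 : (3 * a * ((1 / 2 : ℝ) : ℂ)) = 3 * a / 2 := by push_cast; ring
  rw [e1] at l1
  rw [e2] at l2
  push_cast at l1 l2
  have := norm_sub_le _ _ |>.trans (add_le_add l1 l2)
  calc _ = _ := by
        congr 1
        rw [psiJump, ← hy]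
        ring
    _ ≤ _ := this
    _ = _ := by ring

theorem continuousOn_deriv_cgam : ContinuousOn (deriv cgam) (Metric.ball 0 1) := by
  have h : DifferentiableOn ℂ cgam (Metric.ball 0 1) := fun q hq =>
    (differentiableAt_cgam (by simpa using hq)).differentiableWithinAt
  exact (h.deriv Metric.isOpen_ball).continuousOn

theorem tendsto_e_comap : Tendsto e (comap im atTop) (𝓝 0) := by
  rw [tendsto_zero_iff_norm_tendsto_zero]
  have h1 : Tendsto (fun y : ℝ => Real.exp (-(2 * Real.pi * y))) atTop (𝓝 0) :=
    Real.tendsto_exp_neg_atTop_nhds_zero.comp (tendsto_id.const_mul_atTop (by have := Real.pi_pos; positivity))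
  exact (h1.comp tendsto_comap).congr fun z => (norm_e z).symm

theorem tendsto_psi_comap {a : ℝ} (ha : 0 < a) : Tendsto (psi a) (comap im atTop) (𝓝 0) := by
  have hpi := Real.pi_pos
  obtain ⟨C, hC0, hC⟩ := exists_norm_psi_sub_le ha one_pos
  have hexp : ∀ c : ℝ, 0 < c → Tendsto (fun σ : ℂ => Real.exp (-(c * σ.im))) (comap im atTop)
      (𝓝 0) :=
    fun c hc => (Real.tendsto_exp_neg_atTop_nhds_zero.comp (tendsto_id.const_mul_atTop hc)).comp
      tendsto_comap
  have h1 : Tendsto (fun σ => psi a σ - a * e (3 * a * σ)) (comap im atTop) (𝓝 0) := by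
    have := ((hexp (12 * Real.pi * a) (by positivity)).add
      (hexp (6 * Real.pi * (1 + a)) (by positivity))).const_mul C
    rw [add_zero, mul_zero] at this
    refine squeeze_zero_norm' ?_ this
    filter_upwards [tendsto_comap.eventually (eventually_ge_atTop (1 : ℝ))] with σ hσ
    exact hC σ hσ
  have h2 : Tendsto (fun σ => (a : ℂ) * e (3 * a * σ)) (comap im atTop) (𝓝 0) := by
    rw [tendsto_zero_iff_norm_tendsto_zero]
    have := (hexp (6 * Real.pi * a) (by positivity)).const_mul a
    rw [mul_zero] at this
    refine this.congr fun σ => ?_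
    have h3 := norm_e_psi a σ 0
    rw [Nat.cast_zero, zero_add, pow_zero, mul_one] at h3
    rw [norm_mul, h3, norm_real, Real.norm_of_nonneg ha.le]
  have := h1.add h2
  simpa using this

/-- The factor `e σ`, from the chain rule, makes the integrand tend to `0` at the cusp. -/
theorem tendsto_integrand {a : ℝ} (ha : 0 < a) (ha1 : a < 1) (C : ℂ) (m : ℕ) :
    Tendsto (integrand a C m) (comap im atTop) (𝓝 0) := by
  have z : ‖(0 : ℂ)‖ < 1 := by simp
  have h1 := (differentiableAt_cquot z).continuousAt.tendsto.comp tendsto_e_comap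
  have h2 := (differentiableAt_cgam z).continuousAt.tendsto.comp tendsto_e_comap
  have h3 := (continuousOn_deriv_cgam.continuousAt (Metric.ball_mem_nhds 0 one_pos)).tendsto.comp
    tendsto_e_comap
  have h4 : ∀ b : ℝ, 0 < b → b < 1 → Tendsto (psiSym b) (comap im atTop) (𝓝 (0 + 0)) :=
    fun b hb hb1 => (tendsto_psi_comap hb).add (tendsto_psi_comap (sub_pos.2 hb1))
  have := ((h1.mul ((tendsto_const_nhds (x := C)).add (h4 a ha ha1) |>.sub
    (h4 (1 / 3) (by norm_num) (by norm_num)))).mul (h2.pow m)).mul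
    (h3.mul (tendsto_e_comap.const_mul (2 * Real.pi * I)))
  simp only [mul_zero] at this
  exact this

theorem differentiableAt_integrand {a : ℝ} (ha : 0 < a) (ha1 : a < 1) (C : ℂ) (m : ℕ) {σ : ℂ}
    (hσ : 0 < σ.im) : DifferentiableAt ℂ (integrand a C m) σ := by
  have hd : ∀ p : ℂ, ‖p‖ < 1 → DifferentiableAt ℂ (deriv cgam) p := by
    intro p hp
    have h : DifferentiableOn ℂ cgam (Metric.ball 0 1) := fun q hq =>
      (differentiableAt_cgam (by simpa using hq)).differentiableWithinAt
    exact (h.deriv Metric.isOpen_ball).differentiableAt (Metric.isOpen_ball.mem_nhds (by simpa using hp))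
  have h1 := differentiableAt_comp_e (fun _ => differentiableAt_cquot) hσ
  have h2 := differentiableAt_comp_e (fun _ => differentiableAt_cgam) hσ
  have h3 := differentiableAt_comp_e hd hσ
  have h4 := differentiableAt_psiSym ha ha1 hσ
  have h5 := differentiableAt_psiSym (a := 1 / 3) (by norm_num) (by norm_num) hσ
  exact ((h1.mul ((h4.const_add C).sub h5)).mul (h2.pow m)).mul
    (h3.mul ((differentiable_e σ).const_mul _))

/-- The series that belongs to the cube root of unity has no jump. -/
theorem psiSym_one_third_periodic (σ : ℂ) : psiSym (1 / 3) (σ + 1) = psiSym (1 / 3) σ := by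
  rw [psiSym, psiSym, psi_add_one ⟨1, by norm_num⟩, psi_add_one ⟨2, by norm_num⟩]

end

/-! ### Reduction to a real integral -/

section

/-- The amplitude of the integrand on the vertical line, in the variable `x = exp (-2πy)`. -/
noncomputable def amplitude (a x : ℝ) : ℂ := cquot (-x) * psiJump a x * deriv cgam (-x)

theorem norm_neg_ofReal_lt {x : ℝ} (h0 : 0 ≤ x) (h1 : x < 1) : ‖(-x : ℂ)‖ < 1 := by
  rwa [norm_neg, norm_real, Real.norm_of_nonneg h0]

theorem continuousOn_comp_neg {F : ℂ → ℂ} (hF : ContinuousOn F (Metric.ball 0 1)) :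
    ContinuousOn (fun x : ℝ => F (-x)) (Set.Ico 0 1) :=
  hF.comp (by fun_prop) fun x hx => by simpa using norm_neg_ofReal_lt hx.1 hx.2

theorem continuousOn_cgam : ContinuousOn cgam (Metric.ball 0 1) := fun q hq =>
  (differentiableAt_cgam (by simpa using hq)).continuousAt.continuousWithinAt

theorem continuousOn_cquot : ContinuousOn cquot (Metric.ball 0 1) := fun q hq =>
  (differentiableAt_cquot (by simpa using hq)).continuousAt.continuousWithinAt

section Amplitude

variable {a x₀ : ℝ}

theorem continuousOn_amplitude (ha : 0 < a) (ha1 : a < 1) (h1 : x₀ < 1) :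
    ContinuousOn (amplitude a) (Set.Ioc 0 x₀) := by
  have s1 : Set.Ioc 0 x₀ ⊆ Set.Ico 0 1 := fun x hx => ⟨hx.1.le, hx.2.trans_lt h1⟩
  have s2 : Set.Ioc 0 x₀ ⊆ Set.Ioo 0 1 := fun x hx => ⟨hx.1, hx.2.trans_lt h1⟩
  exact (((continuousOn_comp_neg continuousOn_cquot).mono s1).mul
    ((continuousOn_psiJump ha ha1).mono s2)).mul
    ((continuousOn_comp_neg continuousOn_deriv_cgam).mono s1)

theorem exists_norm_amplitude_le (ha : 0 < a) (ha2 : a < 1 / 2) (h0 : 0 < x₀) (h1 : x₀ < 1) :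
    ∃ B : ℝ, ∀ x ∈ Set.Ioc 0 x₀, ‖amplitude a x‖ ≤ B * x ^ (3 * a) := by
  obtain ⟨K, δ, hK, hδ, hJ⟩ := exists_norm_psiJump_sub_le ha ha2 h0 h1
  set L := (a : ℂ) * (e (-(3 * a / 2)) - e (3 * a / 2))
  have s1 : Set.Icc 0 x₀ ⊆ Set.Ico 0 1 := fun x hx => ⟨hx.1, hx.2.trans_lt h1⟩
  obtain ⟨M, hM⟩ := isCompact_Icc.exists_bound_of_continuousOn
    (((continuousOn_comp_neg continuousOn_cquot).mul
      (continuousOn_comp_neg continuousOn_deriv_cgam)).mono s1)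
  refine ⟨M * (K + ‖L‖), fun x hx => ?_⟩
  have h2 := hM x ⟨hx.1.le, hx.2⟩
  have h3 : ‖psiJump a x‖ ≤ (K + ‖L‖) * x ^ (3 * a) := by
    have h4 := norm_add_le (psiJump a x - L * ((x ^ (3 * a) : ℝ) : ℂ)) (L * ((x ^ (3 * a) : ℝ) : ℂ))
    have hp : 0 ≤ x ^ (3 * a) := Real.rpow_nonneg hx.1.le _
    rw [sub_add_cancel, norm_mul L, norm_real, Real.norm_of_nonneg hp] at h4
    have h5 : x ^ (3 * a + δ) ≤ x ^ (3 * a) :=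
      Real.rpow_le_rpow_of_exponent_ge hx.1 (hx.2.trans h1.le) (by linarith)
    have h6 := mul_le_mul_of_nonneg_left h5 hK
    have := hJ x hx
    linarith
  have h7 : amplitude a x = (cquot (-x) * deriv cgam (-x)) * psiJump a x := by
    rw [amplitude]; ring
  rw [h7, norm_mul, mul_assoc]
  exact mul_le_mul h2 h3 (norm_nonneg _) ((norm_nonneg _).trans h2)

/-- The leading coefficient of the amplitude: `-81` and `729` are the values at `0` of `cquot` and of the
derivative of `cgam`, the rest comes from `psiJump`. -/
theorem tendsto_amplitude (ha : 0 < a) (ha2 : a < 1 / 2) :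
    Tendsto (fun x : ℝ => amplitude a x / ((x ^ (3 * a) : ℝ) : ℂ)) (𝓝[>] 0)
      (𝓝 (-81 * (a * (e (-(3 * a / 2)) - e (3 * a / 2))) * 729)) := by
  obtain ⟨K, δ, hK, hδ, hJ⟩ := exists_norm_psiJump_sub_le ha ha2 (x₀ := 1 / 2) (by norm_num)
    (by norm_num)
  set L := (a : ℂ) * (e (-(3 * a / 2)) - e (3 * a / 2))
  have hmem : Set.Ioc (0 : ℝ) (1 / 2) ∈ 𝓝[>] 0 := Ioc_mem_nhdsGT (by norm_num)
  have hj : Tendsto (fun x : ℝ => psiJump a x / ((x ^ (3 * a) : ℝ) : ℂ)) (𝓝[>] 0) (𝓝 L) := by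
    rw [tendsto_iff_norm_sub_tendsto_zero]
    have hx : Tendsto (fun x : ℝ => K * x ^ δ) (𝓝[>] 0) (𝓝 0) := by
      have := ((Real.continuousAt_rpow_const 0 δ (Or.inr hδ.le)).tendsto.const_mul K).mono_left
        (nhdsWithin_le_nhds (s := Set.Ioi 0))
      rwa [Real.zero_rpow hδ.ne', mul_zero] at this
    refine squeeze_zero' (Eventually.of_forall fun _ => norm_nonneg _) ?_ hx
    filter_upwards [hmem] with x hx
    have hp : 0 < x ^ (3 * a) := Real.rpow_pos_of_pos hx.1 _
    have hpC : ((x ^ (3 * a) : ℝ) : ℂ) ≠ 0 := by exact_mod_cast hp.ne'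
    have h1 : psiJump a x / ((x ^ (3 * a) : ℝ) : ℂ) - L =
        (psiJump a x - L * ((x ^ (3 * a) : ℝ) : ℂ)) / ((x ^ (3 * a) : ℝ) : ℂ) := by
      field_simp
    rw [h1, norm_div, norm_real, Real.norm_of_nonneg hp.le, div_le_iff₀ hp]
    have := hJ x hx
    rw [Real.rpow_add hx.1] at this
    linarith
  have hneg : Tendsto (fun x : ℝ => (-x : ℂ)) (𝓝[>] 0) (𝓝 0) := by
    have : Tendsto (fun x : ℝ => (-x : ℂ)) (𝓝 0) (𝓝 (-((0 : ℝ) : ℂ))) := by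
      apply Continuous.tendsto; fun_prop
    rw [ofReal_zero, neg_zero] at this
    exact this.mono_left nhdsWithin_le_nhds
  have h1 := (continuousOn_cquot.continuousAt (Metric.ball_mem_nhds 0 one_pos)).tendsto.comp hneg
  have h2 := (continuousOn_deriv_cgam.continuousAt (Metric.ball_mem_nhds 0 one_pos)).tendsto.comp hneg
  rw [cquot_zero] at h1
  rw [hasDerivAt_cgam_zero.deriv] at h2
  refine ((h1.mul hj).mul h2).congr fun x => ?_
  simp only [Function.comp, amplitude]
  ring

end Amplitude

open MeasureTheory in
/-- The integral along the horizontal segment becomes a real integral, once the contour is replaced by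
the two vertical half lines. -/
theorem integral_integrand_eq {a : ℝ} (ha : 0 < a) (ha2 : a < 1 / 2) (C : ℂ) (m : ℕ) {h : ℝ}
    (hh : 0 < h) : ∫ x in (-1 / 2 : ℝ)..1 / 2, integrand a C m (x + h * I) =
      ∫ x in (0 : ℝ)..Real.exp (-(2 * Real.pi * h)), amplitude a x * cgam (-x) ^ m := by
  have hpi := Real.pi_pos
  set φ : ℝ → ℝ := fun y => Real.exp (-(2 * Real.pi * y)) with hφ
  change _ = ∫ x in (0 : ℝ)..φ h, _
  set g : ℝ → ℂ := fun x => amplitude a x * cgam (-x) ^ m with hg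
  have hφ0 : ∀ y, 0 < φ y := fun y => Real.exp_pos _
  have hφ1 : ∀ y, 0 < y → φ y < 1 := fun y hy => exp_neg_lt_one (by positivity)
  have hgc : ContinuousOn g (Set.Ioc 0 (φ h)) := by
    have s1 : Set.Ioc 0 (φ h) ⊆ Set.Ico 0 1 := fun x hx => ⟨hx.1.le, hx.2.trans_lt (hφ1 h hh)⟩
    exact (continuousOn_amplitude ha (by linarith) (hφ1 h hh)).mul
      (((continuousOn_comp_neg continuousOn_cgam).mono s1).pow m)
  have hgi : IntegrableOn g (Set.uIcc 0 (φ h)) := by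
    rw [Set.uIcc_of_le (hφ0 h).le, integrableOn_Icc_iff_integrableOn_Ioc]
    obtain ⟨B, hB⟩ := exists_norm_amplitude_le ha ha2 (hφ0 h) (hφ1 h hh)
    have s1 : Set.Icc 0 (φ h) ⊆ Set.Ico 0 1 := fun x hx => ⟨hx.1, hx.2.trans_lt (hφ1 h hh)⟩
    obtain ⟨M, hM⟩ := isCompact_Icc.exists_bound_of_continuousOn
      ((continuousOn_comp_neg continuousOn_cgam).mono s1)
    refine IntegrableOn.of_bound (by simp) (hgc.aestronglyMeasurable measurableSet_Ioc) (|B| * M ^ m)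
      ((ae_restrict_iff' measurableSet_Ioc).2 (Eventually.of_forall fun x hx => ?_))
    rw [hg, norm_mul, norm_pow]
    have h1 : x ^ (3 * a) ≤ 1 := Real.rpow_le_one hx.1.le (hx.2.trans (hφ1 h hh).le) (by linarith)
    have h2 : 0 ≤ x ^ (3 * a) := Real.rpow_nonneg hx.1.le _
    have h3 : ‖amplitude a x‖ ≤ |B| := by
      refine (hB x hx).trans ?_
      calc B * x ^ (3 * a) ≤ |B| * 1 := by
            gcongr
            exact le_abs_self B
        _ = |B| := mul_one _
    have h4 := hM x ⟨hx.1.le, hx.2⟩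
    gcongr
  have hrect : ∀ H, h ≤ H → ∫ x in (-1 / 2 : ℝ)..1 / 2, integrand a C m (x + h * I) =
      (∫ x in (-1 / 2 : ℝ)..1 / 2, integrand a C m (x + H * I)) + ∫ x in φ H..φ h, g x := by
    intro H hH
    have hpos : ∀ y ∈ Set.uIcc h H, 0 < y := by
      intro y hy
      rw [Set.uIcc_of_le hH] at hy
      exact hh.trans_le hy.1
    have h1 := integral_rect (F := integrand a C m) (a := -1 / 2) (b := 1 / 2) (h₁ := h) (h₂ := H)
      fun z _ hz => differentiableAt_integrand ha (by linarith) C m (hpos _ hz)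
    have hcont : ∀ r : ℝ, IntervalIntegrable (fun y : ℝ =>
        integrand a C m (r + y * I)) volume h H := by
      intro r
      refine ContinuousOn.intervalIntegrable fun y hy => ContinuousAt.continuousWithinAt ?_
      have hd := (differentiableAt_integrand ha (by linarith) C m (σ := r + y * I)
        (by rw [im_line]; exact hpos y hy)).continuousAt
      exact hd.comp (f := fun y : ℝ => (r : ℂ) + y * I) (by fun_prop)
    have h2 : ∀ y ∈ Set.uIcc h H, I * (integrand a C m (((1 / 2 : ℝ) : ℂ) + y * I) -
        integrand a C m (((-1 / 2 : ℝ) : ℂ) + y * I)) = (-(2 * Real.pi) * φ y) • (g ∘ φ) y := by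
      intro y hy
      have hy0 := hpos y hy
      have q1 : e (((1 / 2 : ℝ) : ℂ) + y * I) = -(φ y) := by
        rw [e_add]
        have t1 : e ((1 / 2 : ℝ) : ℂ) = -1 := by
          rw [e, show 2 * Real.pi * I * ((1 / 2 : ℝ) : ℂ) = Real.pi *
            I by push_cast; ring, exp_pi_mul_I]
        have t2 : e (y * I) = φ y := by
          rw [e, hφ, ofReal_exp]; congr 1; push_cast
          linear_combination (2 * Real.pi * y : ℂ) * I_sq
        rw [t1, t2]; ring
      have hshift : ((1 / 2 : ℝ) : ℂ) + y * I = ((-1 / 2 : ℝ) : ℂ) + y * I + 1 := by push_cast; ring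
      have q2 : e (((-1 / 2 : ℝ) : ℂ) + y * I) = -(φ y) := by rw [← q1, hshift, e_add_one]
      have q3 : psiSym (1 / 3) (((1 / 2 : ℝ) : ℂ) + y * I) =
          psiSym (1 / 3) (((-1 / 2 : ℝ) : ℂ) + y * I) := by
        rw [hshift, psiSym_one_third_periodic]
      have q4 : -Real.log (φ y) / (2 * Real.pi) = y := by
        rw [hφ, Real.log_exp]; field_simp
      have q5 : psiJump a (φ y) = psiSym a (((-1 / 2 : ℝ) : ℂ) + y * I) -
          psiSym a (((1 / 2 : ℝ) : ℂ) + y * I) := by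
        rw [psiJump, q4]; push_cast; rfl
      rw [integrand, integrand, q1, q2, q3, real_smul]
      simp only [Function.comp, hg, amplitude]
      rw [q5]
      generalize psiSym a (((1 / 2 : ℝ) : ℂ) + y * I) = u
      generalize psiSym a (((-1 / 2 : ℝ) : ℂ) + y * I) = w
      push_cast
      linear_combination (-(cquot (-(φ y)) * cgam (-(φ y)) ^ m * deriv cgam (-(φ y)) * 2 *
        Real.pi * φ y) *
        (u - w)) * I_sq
    have hφd : ∀ y : ℝ, HasDerivAt φ (-(2 * Real.pi) * φ y) y := by
      intro y
      have := (((hasDerivAt_id y).const_mul (2 * Real.pi)).neg).exp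
      refine this.congr_deriv ?_
      simp [hφ]; ring
    have h3 : ∫ y in h..H, (-(2 * Real.pi) * φ y) • (g ∘ φ) y = ∫ x in φ h..φ H, g x := by
      have hφc : Continuous φ := by fun_prop
      refine intervalIntegral.integral_deriv_smul_comp' (fun y _ => hφd y)
        (by fun_prop) (hgc.mono ?_)
      rintro _ ⟨y, hy, rfl⟩
      rw [Set.uIcc_of_le hH] at hy
      refine ⟨hφ0 y, Real.exp_le_exp.2 ?_⟩
      have := hy.1
      gcongr
    have h4 : ∫ y in h..H, (-(2 * Real.pi) * φ y) • (g ∘ φ) y =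
        I * ((∫ y in h..H, integrand a C m (((1 / 2 : ℝ) : ℂ) + y * I)) -
          ∫ y in h..H, integrand a C m (((-1 / 2 : ℝ) : ℂ) + y * I)) := by
      rw [← intervalIntegral.integral_sub (hcont _) (hcont _),
        ← intervalIntegral.integral_const_mul]
      exact (intervalIntegral.integral_congr h2).symm
    rw [intervalIntegral.integral_symm (φ h), ← h3, h4]
    linear_combination h1
  have htop : Tendsto (fun H : ℝ => ∫ x in (-1 / 2 : ℝ)..1 / 2, integrand a C m (x + H * I)) atTop
      (𝓝 0) := by
    rw [Metric.tendsto_nhds]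
    intro ε hε
    have h1 := (Metric.tendsto_nhds.1 (tendsto_integrand ha (by linarith) C m)) (ε / 2) (by positivity)
    rw [eventually_comap] at h1
    filter_upwards [h1] with H hH
    rw [dist_zero_right]
    have h2 : ‖∫ x in (-1 / 2 : ℝ)..1 / 2, integrand a C m (x + H * I)‖ ≤
        ε / 2 * |1 / 2 - -1 / 2| := by
      refine intervalIntegral.norm_integral_le_of_norm_le_const fun x _ => ?_
      have := hH (x + H * I) (im_line x H)
      rw [dist_zero_right] at this
      exact this.le
    norm_num at h2
    linarith
  have hφt : Tendsto φ atTop (𝓝[Set.uIcc 0 (φ h)] 0) := by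
    refine tendsto_nhdsWithin_iff.2 ⟨Real.tendsto_exp_neg_atTop_nhds_zero.comp
      (tendsto_id.const_mul_atTop (by positivity)), ?_⟩
    filter_upwards [eventually_ge_atTop h] with H hH
    rw [Set.uIcc_of_le (hφ0 h).le]
    refine ⟨(hφ0 H).le, Real.exp_le_exp.2 ?_⟩
    gcongr
  have hprim := ((intervalIntegral.continuousOn_primitive_interval_left hgi) 0
    Set.left_mem_uIcc).tendsto.comp hφt
  have hlim := htop.add hprim
  rw [zero_add] at hlim
  refine tendsto_nhds_unique (tendsto_const_nhds.congr' ?_) hlim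
  filter_upwards [eventually_ge_atTop h] with H hH
  exact hrect H hH

end

/-! ### Asymptotics -/

/-- The end point of the interval of integration, in the variable `x = exp (-2πy)` with `y = √3/6`. -/
theorem exp_neg_le_one_sixth : Real.exp (-(2 * Real.pi * (Real.sqrt 3 / 6))) ≤ 1 / 6 := by
  have h3 : Real.sqrt 3 * Real.sqrt 3 = 3 := Real.mul_self_sqrt (by norm_num)
  have hs : 1.732 ≤ Real.sqrt 3 := by rw [Real.le_sqrt' (by norm_num)]; norm_num
  have hpi := Real.pi_gt_d2
  have h1 : 9 / 5 ≤ 2 * Real.pi * (Real.sqrt 3 / 6) := by nlinarith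
  have h2 : (6 : ℝ) ≤ Real.exp (9 / 5) := by
    have he := Real.exp_one_gt_d9
    have h4 : Real.exp (9 / 5) ^ 5 = Real.exp 1 ^ 9 := by
      rw [← Real.exp_nat_mul, ← Real.exp_nat_mul]; norm_num
    by_contra hcon
    have h5 : Real.exp (9 / 5) ^ 5 < 6 ^ 5 :=
      pow_lt_pow_left₀ (not_le.1 hcon) (Real.exp_pos _).le (by norm_num)
    have h6 : (2.718 : ℝ) ^ 9 ≤ Real.exp 1 ^ 9 := by
      gcongr
      linarith
    rw [h4] at h5
    norm_num at h5 h6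
    linarith
  rw [Real.exp_neg, inv_le_comm₀ (Real.exp_pos _) (by norm_num)]
  have := Real.exp_le_exp.2 h1
  norm_num
  linarith

/-- Watson's lemma for the amplitude, with `cgam (-x) / 27 = 1 - 27x + …`. -/
theorem tendsto_integral_amplitude {a : ℝ} (ha : 0 < a) (ha2 : a < 1 / 2) {x₀ : ℝ} (h0 : 0 < x₀)
    (h1 : x₀ ≤ 1 / 6) : Tendsto (fun m : ℕ => (((m : ℝ) ^ (3 * a + 1) : ℝ) : ℂ) *
      ((∫ x in (0 : ℝ)..x₀, amplitude a x * cgam (-x) ^ m) / 27 ^ m)) atTop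
      (𝓝 (-81 * (a * (e (-(3 * a / 2)) - e (3 * a / 2))) * 729 *
        (((27 : ℝ) ^ (-(3 * a + 1)) * Real.Gamma (3 * a + 1) : ℝ) : ℂ))) := by
  obtain ⟨B, hB⟩ := exists_norm_amplitude_le ha ha2 h0 (by linarith)
  have s1 : Set.Ioc 0 x₀ ⊆ Set.Ico 0 1 := fun x hx => ⟨hx.1.le, by linarith [hx.2]⟩
  have hneg : Tendsto (fun x : ℝ => (-x : ℂ)) (𝓝[>] 0) (𝓝[≠] 0) := by
    refine tendsto_nhdsWithin_iff.2 ⟨?_, ?_⟩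
    · have : Tendsto (fun x : ℝ => (-x : ℂ)) (𝓝 0) (𝓝 (-((0 : ℝ) : ℂ))) := by
        apply Continuous.tendsto; fun_prop
      rw [ofReal_zero, neg_zero] at this
      exact this.mono_left nhdsWithin_le_nhds
    · filter_upwards [self_mem_nhdsWithin] with x hx
      have : x ≠ 0 := ne_of_gt hx
      simpa using this
  have hslope := ((hasDerivAt_iff_tendsto_slope.1 hasDerivAt_cgam_zero).comp hneg).const_mul (-1 / 27)
  have key := tendsto_laplace (f := amplitude a) (g := fun x => cgam (-x) / 27) (κ := 3)
      (β := 3 * a)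
    (γ := 27) h0 (by positivity) (by norm_num) (by norm_num)
    (continuousOn_amplitude ha (by linarith) (by linarith))
    (((continuousOn_comp_neg continuousOn_cgam).mono s1).div_const 27) hB (fun x hx => by
      rw [norm_div, show ‖(27 : ℂ)‖ = 27 by simp, div_le_iff₀ (by norm_num), mul_comm]
      exact norm_cgam_le hx.1.le (hx.2.trans h1)) (tendsto_amplitude ha ha2) (by
      have : (-1 / 27 * 729 : ℂ) = -((27 : ℝ) : ℂ) := by push_cast; norm_num
      rw [this] at hslope
      refine hslope.congr' ?_
      filter_upwards [self_mem_nhdsWithin] with x hx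
      have hx : (x : ℂ) ≠ 0 := by exact_mod_cast ne_of_gt hx
      simp only [Function.comp, slope_def_field, cgam_zero, sub_zero]
      field_simp)
  refine key.congr fun m => ?_
  rw [← intervalIntegral.integral_div]
  congr 1
  refine intervalIntegral.integral_congr fun x _ => ?_
  rw [div_pow, mul_div_assoc]

theorem e_ofReal_ne_one {a : ℝ} (h0 : 0 < a) (h1 : a < 1) : e a ≠ 1 := by
  intro h
  have := eq_zero_of_e_eq_one h (by rw [ofReal_re, abs_lt]; constructor <;> linarith)
  have : a = 0 := by exact_mod_cast this
  linarith

theorem one_add_e_add_sq_ne_zero {a : ℝ} (h0 : 0 < a) (h1 : a < 1 / 2) (h3 : a ≠ 1 / 3) :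
    1 + e a + e a ^ 2 ≠ 0 := by
  intro h
  have h2 : e (((3 * a - 1 : ℝ)) : ℂ) = 1 := by
    have t1 : e a ^ 3 = 1 := by linear_combination (e a - 1) * h
    have t2 : e (((3 * a - 1 : ℝ) : ℂ) + 1) = e a ^ 3 := by
      rw [← e_nat_mul]; congr 1; push_cast; ring
    rw [← e_add_one, t2, t1]
  have := eq_zero_of_e_eq_one h2 (by rw [ofReal_re, abs_lt]; constructor <;> linarith)
  have : 3 * a - 1 = 0 := by exact_mod_cast this
  exact h3 (by linarith)

theorem sin_pi_mul_ne_zero {a : ℝ} (h0 : 0 < a) (h1 : a < 1 / 2) (h3 : a ≠ 1 / 3) :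
    Real.sin (Real.pi * (3 * a)) ≠ 0 := by
  intro h
  obtain ⟨n, hn⟩ := Real.sin_eq_zero_iff.1 h
  have h2 : (n : ℝ) = 3 * a := by
    have := Real.pi_ne_zero
    field_simp at hn
    linarith
  have h4 : 0 < n := by exact_mod_cast (show (0 : ℝ) < n by linarith)
  have h5 : n < 2 := by exact_mod_cast (show (n : ℝ) < 2 by linarith)
  have h6 : n = 1 := by omega
  rw [h6] at h2
  push_cast at h2
  exact h3 (by linarith)

theorem gamma_neg_ne_zero {a : ℝ} (h0 : 0 < a) (h1 : a < 1 / 2) (h3 : a ≠ 1 / 3) :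
    Real.Gamma (-(3 * a)) ≠ 0 := by
  intro h
  have hrefl := Real.Gamma_mul_Gamma_one_sub (-(3 * a))
  rw [h, zero_mul, mul_neg, Real.sin_neg] at hrefl
  exact div_ne_zero Real.pi_ne_zero (neg_ne_zero.2 (sin_pi_mul_ne_zero h0 h1 h3)) hrefl.symm

theorem e_sub_e (b : ℝ) : e (-(b / 2)) - e (b / 2) = -2 * I * (Real.sin (Real.pi * b) : ℂ) := by
  have h1 : e (b / 2) = exp ((Real.pi * b : ℝ) * I) := by rw [e]; congr 1; push_cast; ring
  have h2 : e (-(b / 2)) = exp (-((Real.pi * b : ℝ) : ℂ) * I) := by rw [e]; congr 1; push_cast; ring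
  rw [h1, h2, ofReal_sin, sin]
  linear_combination (exp (-((Real.pi * b : ℝ) : ℂ) * I) - exp ((Real.pi * b : ℝ) * I)) * I_sq

/-- The asymptotic behaviour of the numbers of walks. -/
theorem tendsto_coef {w₀ : ℤ × ℤ} (h₀ : w₀ ∈ nearOrigin) {a : ℝ} (ha : 0 < a) (ha2 : a < 1 / 2)
    (ha3 : a ≠ 1 / 3) : Tendsto (fun m : ℕ => (((m : ℝ) ^ (3 * a + 1) : ℝ) : ℂ) *
      (coef w₀ (3 * a) (3 * (m + 1)) 1 1 / 27 ^ m)) atTop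
      (𝓝 (-(e a / (1 + e a + e a ^ 2) * a * (((3 : ℝ) ^ (7 - 9 * a) / Real.Gamma (-(3 * a)) : ℝ) :
        ℂ)))) := by
  obtain ⟨C, hC⟩ := exists_coef_eq_integral h₀ ha (by linarith) (e_ofReal_ne_one ha (by linarith))
    (one_add_e_add_sq_ne_zero ha ha2 ha3)
  set c := e a / (1 + e a + e a ^ 2)
  have hlim := (tendsto_integral_amplitude ha ha2 (Real.exp_pos _) exp_neg_le_one_sixth).const_mul
    (c * (2 * Real.pi * I)⁻¹)
  have hpi := Real.pi_pos
  have hpiC := pi_ne_zero'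
  have hsin := sin_pi_mul_ne_zero ha ha2 ha3
  have hrefl := Real.Gamma_mul_Gamma_one_sub (-(3 * a))
  rw [sub_neg_eq_add, add_comm 1, mul_neg, Real.sin_neg] at hrefl
  have hG := gamma_neg_ne_zero ha ha2 ha3
  have hval : Real.Gamma (3 * a + 1) * Real.sin (Real.pi * (3 * a)) / Real.pi =
      -1 / Real.Gamma (-(3 * a)) := by
    rw [eq_div_iff (neg_ne_zero.2 hsin)] at hrefl
    rw [div_eq_div_iff hpi.ne' hG]
    linear_combination -hrefl
  have h27 : (27 : ℝ) ^ (-(3 * a + 1)) * 3 ^ 10 = 3 ^ (7 - 9 * a) := by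
    have e1 : (27 : ℝ) = 3 ^ (3 : ℝ) := by norm_num
    have e2 : (3 : ℝ) ^ 10 = 3 ^ (10 : ℝ) := by norm_num
    rw [e1, e2, ← Real.rpow_mul (by norm_num), ← Real.rpow_add (by norm_num)]
    congr 1; ring
  have hconst : c * (2 * Real.pi * I)⁻¹ * (-81 * (a * (e (-(3 * a / 2)) - e (3 * a / 2))) * 729 *
        (((27 : ℝ) ^ (-(3 * a + 1)) * Real.Gamma (3 * a + 1) : ℝ) : ℂ)) =
      -(c * a * (((3 : ℝ) ^ (7 - 9 * a) / Real.Gamma (-(3 * a)) : ℝ) : ℂ)) := by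
    have h1 : (3 : ℝ) ^ (7 - 9 * a) / Real.Gamma (-(3 * a)) = -((27 : ℝ) ^ (-(3 * a + 1)) * 3 ^ 10 *
        (Real.Gamma (3 * a + 1) * Real.sin (Real.pi * (3 * a)) / Real.pi)) := by
      rw [hval, h27]; ring
    have h2 := e_sub_e (3 * a)
    push_cast at h2
    rw [h1, h2]
    push_cast
    field_simp
    ring
  rw [hconst] at hlim
  refine hlim.congr fun m => ?_
  rw [hC, integral_integrand_eq ha ha2 C m (by positivity)]
  ring

/-- A limit along the multiples of `3`. -/
theorem tendsto_multiples_of_three {X : Type*} {F : ℕ → X} {l : Filter X}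
    (h : Tendsto (fun m : ℕ => F (3 * (m + 1))) atTop l) :
    Tendsto F (atTop ⊓ 𝓟 {n : ℕ | 3 ∣ n}) l := by
  have h1 : Tendsto (fun n : ℕ => n / 3 - 1) (atTop ⊓ 𝓟 {n : ℕ | 3 ∣ n}) atTop := by
    refine Tendsto.mono_left (tendsto_atTop.2 fun b => ?_) inf_le_left
    filter_upwards [eventually_ge_atTop (3 * (b + 1))] with n hn
    omega
  refine (h.comp h1).congr' ?_
  rw [EventuallyEq, eventually_inf_principal]
  filter_upwards [eventually_ge_atTop 3] with n hn hn3
  have hn3 : 3 ∣ n := hn3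
  simp only [Function.comp]
  congr 1
  omega

end KrewerasWinding


theorem corollary4 (w₀ : ℤ × ℤ) (hw₀ : w₀ ∈ KrewerasWinding.nearOrigin)
    (α : ℝ) (hα : α ∈ Set.Ioo 0 Real.pi \ {2 * Real.pi / 3}) (v : ℕ → ℂ)
    (hv : ∀ n, v n = PowerSeries.coeff n
      (KrewerasWinding.genFun w₀ (Complex.exp (α * Complex.I)))) :
    Asymptotics.IsEquivalent (Filter.atTop ⊓ Filter.principal {n : ℕ | 3 ∣ n}) v
      (fun n : ℕ =>
        -(((3 : ℝ) ^ (5 - 3 * α / Real.pi) : ℝ) * Complex.exp (α * Complex.I) * α /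
          (2 * Real.pi *
            (1 + Complex.exp (α * Complex.I) + Complex.exp (2 * α * Complex.I)) *
            Real.Gamma (-(3 * α / (2 * Real.pi))))) *
        ((n : ℝ) ^ (-(3 * α / (2 * Real.pi)) - 1) : ℝ) * 3 ^ n) ∧
    ∀ n : ℕ, ¬ 3 ∣ n → v n = 0 := by
  open KrewerasWinding in
  have hpi := Real.pi_pos
  obtain ⟨⟨hα0, hα1⟩, hα2⟩ := hα
  obtain ⟨a, rfl⟩ : ∃ a : ℝ, α = 2 * Real.pi * a := ⟨α / (2 * Real.pi), by field_simp⟩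
  have ha : 0 < a := by
    by_contra h
    have : 2 * Real.pi * a ≤ 0 := mul_nonpos_of_nonneg_of_nonpos (by positivity) (not_lt.1 h)
    linarith
  have ha2 : a < 1 / 2 := by nlinarith
  have ha3 : a ≠ 1 / 3 := by
    rintro rfl
    exact hα2 (by rw [Set.mem_singleton_iff]; ring)
  have hβ : 3 * a * (2 * Real.pi / 3) = 2 * Real.pi * a := by ring
  have hvc : ∀ n, v n = coef w₀ (3 * a) n 1 1 := fun n => by rw [hv, coeff_genFun hw₀ hβ]
  refine ⟨?_, fun n hn => ?_⟩
  · have hsq : Complex.exp (2 * (2 * Real.pi * a : ℝ) * Complex.I) = e a ^ 2 := by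
      rw [e_ofReal_eq, ← Complex.exp_nat_mul]; congr 1; push_cast; ring
    have x1 : 3 * (2 * Real.pi * a) / Real.pi = 6 * a := by field_simp; norm_num
    have x2 : 3 * (2 * Real.pi * a) / (2 * Real.pi) = 3 * a := by field_simp
    rw [← e_ofReal_eq, hsq, x1, x2]
    have hs3 := one_add_e_add_sq_ne_zero ha ha2 ha3
    have hlim := tendsto_coef hw₀ ha ha2 ha3
    set c := e a / (1 + e a + e a ^ 2) with hc
    have hc0 : c ≠ 0 := div_ne_zero (e_ne_zero _) hs3
    have hΓ := gamma_neg_ne_zero ha ha2 ha3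
    have hΓC : (Real.Gamma (-(3 * a)) : ℂ) ≠ 0 := by exact_mod_cast hΓ
    have hpiC := pi_ne_zero'
    have haC : (a : ℂ) ≠ 0 := by exact_mod_cast ha.ne'
    set K : ℂ := -(c * a * (((3 : ℝ) ^ (5 - 6 * a) / Real.Gamma (-(3 * a)) : ℝ) : ℂ)) with hK
    have hKeq : -(((3 : ℝ) ^ (5 - 6 * a) : ℝ) * e a * (2 * Real.pi * a : ℝ) /
          (2 * Real.pi * (1 + e a + e a ^ 2) * Real.Gamma (-(3 * a)))) = K := by
      rw [hK, hc]
      push_cast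
      field_simp
    have hK0 : K ≠ 0 := by
      have h3 : (3 : ℝ) ^ (5 - 6 * a) / Real.Gamma (-(3 * a)) ≠ 0 :=
        div_ne_zero (Real.rpow_pos_of_pos (by norm_num) _).ne' hΓ
      exact neg_ne_zero.2 (mul_ne_zero (mul_ne_zero hc0 haC) (by exact_mod_cast h3))
    rw [hKeq]
    refine Asymptotics.isEquivalent_of_tendsto_one (tendsto_multiples_of_three ?_)
    have hfrac : Filter.Tendsto (fun m : ℕ => ((((m : ℝ) / (3 * (m + 1))) ^ (3 * a + 1) : ℝ) : ℂ))
        Filter.atTop (nhds ((((1 / 3 : ℝ)) ^ (3 * a + 1) : ℝ) : ℂ)) := by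
      have h1 : Filter.Tendsto (fun m : ℕ => (m : ℝ) / (3 *
          (m + 1))) Filter.atTop (nhds (1 / 3)) := by
        have := (tendsto_natCast_div_add_atTop (1 : ℝ)).div_const 3
        refine this.congr fun m => ?_
        rw [div_div, mul_comm]
      exact (Complex.continuous_ofReal.tendsto _).comp
        (((Real.continuousAt_rpow_const (1 / 3) _ (Or.inl (by norm_num))).tendsto).comp h1)
    have hden := hfrac.const_mul (K * 27)
    have hfrac0 : ((((1 / 3 : ℝ)) ^ (3 * a + 1) : ℝ) : ℂ) ≠ 0 := by
      exact_mod_cast (Real.rpow_pos_of_pos (by norm_num) _).ne'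
    have hratio := hlim.div hden (mul_ne_zero (mul_ne_zero hK0 (by norm_num)) hfrac0)
    have hone : -(c * a * (((3 : ℝ) ^ (7 - 9 * a) / Real.Gamma (-(3 * a)) : ℝ) : ℂ)) /
        (K * 27 * ((((1 / 3 : ℝ)) ^ (3 * a + 1) : ℝ) : ℂ)) = 1 := by
      rw [div_eq_one_iff_eq (mul_ne_zero (mul_ne_zero hK0 (by norm_num)) hfrac0)]
      have h3 : (3 : ℝ) ^ (7 - 9 * a) = 3 ^ (5 - 6 * a) * 27 * (1 / 3) ^ (3 * a + 1) := by
        have e1 : (27 : ℝ) = 3 ^ (3 : ℝ) := by norm_num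
        have e2 : (1 / 3 : ℝ) = 3 ^ (-1 : ℝ) := by rw [Real.rpow_neg_one]; norm_num
        rw [e1, e2, ← Real.rpow_mul (by norm_num), ← Real.rpow_add (by norm_num),
          ← Real.rpow_add (by norm_num)]
        congr 1; ring
      rw [hK, h3]
      push_cast
      ring
    rw [hone] at hratio
    refine hratio.congr' ?_
    filter_upwards [Filter.eventually_gt_atTop 0] with m hm
    have hm' : (0 : ℝ) < m := by exact_mod_cast hm
    have hm1 : (0 : ℝ) < 3 * (m + 1) := by positivity
    have hp1 : ((((m : ℝ) ^ (3 * a + 1)) : ℝ) : ℂ) ≠ 0 := by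
      exact_mod_cast (Real.rpow_pos_of_pos hm' _).ne'
    have hp2 : ((((3 * ((m : ℝ) + 1)) ^ (3 * a + 1)) : ℝ) : ℂ) ≠ 0 := by
      exact_mod_cast (Real.rpow_pos_of_pos hm1 _).ne'
    have hexp : -(3 * a) - 1 = -(3 * a + 1) := by ring
    have hcast : (((3 * (m + 1) : ℕ)) : ℝ) = 3 * ((m : ℝ) + 1) := by push_cast; ring
    simp only [Pi.div_apply]
    rw [hvc, hexp, hcast, Real.div_rpow hm'.le hm1.le, Real.rpow_neg hm1.le, pow_mul, pow_succ,
      Complex.ofReal_div, Complex.ofReal_inv]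
    norm_num only
    field_simp
  · rw [hvc]
    refine coef_eq_zero hw₀ hβ n le_rfl zero_le_one ?_
    intro h
    omega
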